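/- Let $m\ge 3$ and let $W=I_2(m)$ be the dihedral group of order $2m$, with reflection representation $V$, $\dim V=2$, Poincaré polynomial $P_W(q)=\frac{(q^2-1)(q^m-1)}{(q-1)^2}$ and $N^*=m$ reflections. Its irreducible characters are $\chi_i$ for $0\le i<m/2$, the sign character $\epsilon$ and, if $m=2r$, also $\chi_r,\chi_r'$. Here $\chi_0$ is trivial, $\chi_i$ ($0<i<m/2$) has degree $2$ and takes the value $2\cos(2\pi ik/m)$ on the $k$-th power of the basic rotation, and $\chi_r,\chi_r'$ are the two linear characters other than $\chi_0,\epsilon$ (either may be called $\chi_r$). For a class function $f$ put $R(f)=\frac{(q-1)^2P_W(q)}{|W|}\sum_{w}\frac{\det_V(w)f(w)}{\det_V(q-w)}$. Let $b_\chi$ be the largest power of $q$ dividing $R(\chi)$, and let $\omega_{\chi,\chi'}=q^{N^*}R(\chi\otimes\chi'\otimes\overline{\det}_V)$, $\Omega=(\omega_{\chi,\chi'})$. Special characters are those $\chi$ for which $b_\chi$ is the largest power of $q$ dividing the generic degree of $\chi$, and families are Rouquier blocks, both with respect to the one-parameter Iwahori–Hecke algebra of $W$ with parameter $q$ and its canonical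 symmetrizing trace. A Lusztig–Shoji datum is a triple $(X,<,a)$, where $X$ is a partition of $\mathrm{Irr}(W)$ into nonempty sets (classes), $<$ is a strict total order on $X$, and $a:X\to\mathbb N$ is weakly order reversing. Write $\mathrm{supp}\,\chi$ for the class containing $\chi$. A system of Green functions is a pair of matrices $P,\Lambda$ of rational functions in $q$, indexed by $\mathrm{Irr}(W)$, with $P\Lambda P^t=\Omega$, with $P_{\chi,\chi'}=0$ if $\mathrm{supp}\,\chi<\mathrm{supp}\,\chi'$, $P_{\chi,\chi'}=\delta_{\chi,\chi'}q^{a_C}$ if $\mathrm{supp}\,\chi=\mathrm{supp}\,\chi'=C$, and $\Lambda_{\chi,\chi'}=0$ if $\mathrm{supp}\,\chi\ne\mathrm{supp}\,\chi'$. The datum is a Springer correspondence if: 1. each class $C$ has a unique member with minimal $b$ (its Springer representation), and $a_C$ is this minimum; 2. every special character is a Springer representation; 3. if $\chi'$ is nonspecial and in the same family as the special character $\chi$, then $\mathrm{supp}\,\chi'\le\mathrm{supp}\,\chi$; 4. there is a system of Green functions such that $\Lambda$ has entries in $\mathbb Z[q]$ and $P$ has entries in $\mathbb N[q]$; 5.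 for this system, $P_{\chi,\chi'}$ is divisible by $q^{a_C}$ whenever $\chi\in C$. **Theorem.** Let $S\subseteq\mathrm{Irr}(W)$ contain $\chi_0,\chi_1,\epsilon$. If $m=2r$ and $S$ contains exactly one of $\chi_r,\chi_r'$, choose the names so that it contains $\chi_r'$. Let $0=d_0<1=d_1<\dots<d_N<m/2$ be the indices $i<m/2$ with $\chi_i\in S$. Then $W$ has a Springer correspondence whose set of Springer representations is exactly $S$. For every such Springer correspondence there are integers $f_1\ge\dots\ge f_N$ such that the classes $C_k$, $C_{\chi_r}$, $C_{\chi_r'}$, $C_\epsilon$ with Springer representations $\chi_{d_k},\chi_r,\chi_r',\epsilon$ are $$C_0=\{\chi_0\},\qquad C_k=\{\chi_{d_k},\dots,\chi_{d_{k+1}-1}\}\cup\{\chi_{f_{k+1}+1},\dots,\chi_{f_k}\}\quad(1\le k\le N-1),$$ $$C_N=\begin{cases}\{\chi_{d_N},\dots,\chi_{\lfloor (m-1)/2\rfloor}\}&\text{if } m \text{ is odd, or } m \text{ is even and } \chi_r,\chi_r'\in S,\\ \{\chi_{d_N},\dots,\chi_{f_N}\}&\text{if } m \text{ is even},\ \chi_r\notin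 S,\ \chi_r'\in S,\\ \{\chi_{d_N},\dots,\chi_r,\chi_r'\}&\text{if } m \text{ is even and } \chi_r,\chi_r'\notin S,\end{cases}$$ $C_{\chi_r}=\{\chi_r\}$ if $m$ is even and $\chi_r\in S$, $C_{\chi_r'}=\{\chi_r'\}$ if $m$ is even and $\chi_r'\in S$, and $C_\epsilon=\{\epsilon\}$. (a) Unless $m$ is even and $S$ contains exactly one of $\chi_r,\chi_r'$, one has $f_k=\lfloor (m-1)/2\rfloor$ for all $k$, and the Springer correspondence for $S$ is unique. More precisely, $X$ and $a$ are unique, and so is $<$, except possibly for the relative order of $\{\chi_r\}$ and $\{\chi_r'\}$ when both are classes. (b) If $m=2r$, $\chi_r'\in S$ and $\chi_r\notin S$, then the sequence of any such Springer correspondence can be taken with $r=f_1\ge\dots\ge f_N\ge d_N$. Conversely, for all integers $r=f_1\ge\dots\ge f_N\ge d_N$ with $f_k-f_{k+1}\le d_{k+1}-d_k$ for $1\le k<N$ there is a Springer correspondence for $S$ of the above form. More precisely, a sequence $r=f_1\ge\dots\ge f_N\ge d_N$ occurs if and only if $f_k-f_l\le d_l-d_k$ for all $1\le k<l\le N$ such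 that $l=N$ or $f_l>f_{l+1}$. -/

import Mathlib

/-! # Springer correspondences for the dihedral groups

`DihedralGroup m` is the group `I₂(m)` of order `2m`, with rotations `r k` and reflections `sr k`. -/

namespace LusztigShoji

noncomputable section

open scoped Classical

/-! ## Irreducible characters -/

/-- The irreducible complex characters of `I₂(m)`, as functions on the group. -/
def irrChars (m : ℕ) : Set (DihedralGroup m → ℂ) :=
  {χ | ∃ (n : ℕ) (ρ : Representation ℂ (DihedralGroup m) (Fin n → ℂ)),
    ρ.IsIrreducible ∧ ρ.character = χ}

/-- The index set `Irr(I₂(m))`. -/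
abbrev Irr (m : ℕ) : Type := irrChars m

/-- Irreducible characters are orthonormal, hence linearly independent, hence finite in number. -/
theorem finite_irrChars (m : ℕ) [NeZero m] : (irrChars m).Finite := by
  have key : ∀ χ ∈ irrChars m, ∀ χ' ∈ irrChars m,
      (∑ g, χ g * χ' g⁻¹ = 0 ↔ χ ≠ χ') := by
    rintro χ ⟨n, ρ, hρ, rfl⟩ χ' ⟨n', σ, hσ, rfl⟩
    have hc : (Nat.card (DihedralGroup m) : ℂ) ≠ 0 := Nat.cast_ne_zero.2 Nat.card_pos.ne'
    let _ : Invertible (Nat.card (DihedralGroup m) : ℂ) := invertibleOfNonzero hc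
    have h := Representation.char_orthonormal ρ σ
    have h' := Representation.char_orthonormal ρ ρ
    rw [if_pos ⟨Representation.Equiv.refl ρ⟩] at h'
    constructor
    · intro h0 he
      rw [← he] at h0
      simp [h0] at h'
    · intro hne
      rw [if_neg] at h
      · exact (mul_eq_zero.1 h).resolve_left (inv_ne_zero hc)
      · rintro ⟨e⟩
        exact hne (Representation.char_iso e).symm
  have hli : LinearIndependent ℂ ((↑) : irrChars m → DihedralGroup m → ℂ) := by
    rw [linearIndependent_iff']
    intro t c hc i hi
    have h1 : ∑ j ∈ t, c j * ∑ g, j.1 g * i.1 g⁻¹ = 0 := by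
      have : ∑ g, (∑ j ∈ t, c j • j.1) g * i.1 g⁻¹ = 0 := by rw [hc]; simp
      rw [← this]
      simp only [Finset.sum_apply, Pi.smul_apply, smul_eq_mul, Finset.sum_mul, Finset.mul_sum]
      rw [Finset.sum_comm]
      simp only [mul_assoc]
    rw [Finset.sum_eq_single_of_mem i hi] at h1
    · refine (mul_eq_zero.1 h1).resolve_right fun h2 => ?_
      exact (key i.1 i.2 i.1 i.2).1 h2 rfl
    · intro j _ hj
      rw [(key j.1 j.2 i.1 i.2).2 (fun h => hj (Subtype.ext h)), mul_zero]
  exact hli.setFinite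

instance (m : ℕ) [NeZero m] : Finite (Irr m) := (finite_irrChars m).to_subtype

instance (m : ℕ) [NeZero m] : Fintype (Irr m) := Fintype.ofFinite _

/-- The characters `χ_j`, `0 ≤ j ≤ m/2`. If `m = 2r` there are two linear characters other than the
trivial and the sign character, with values `± (-1)^k` at `sr k`; the sign `s` selects which of
them is called `χ_r`. -/
def chi (m : ℕ) (s : ℤˣ) (j : ℕ) : DihedralGroup m → ℂ
  | .r k => if j = 0 then 1 else if 2 * j = m then (-1) ^ k.val
      else 2 * (Real.cos (2 * Real.pi * j * k.val / m) : ℂ)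
  | .sr k => if j = 0 then 1 else if 2 * j = m then ((s : ℤ) : ℂ) * (-1) ^ k.val
      else 0

/-- The other linear character `χ_r'` (`m = 2r`). -/
def chi' (m : ℕ) (s : ℤˣ) : DihedralGroup m → ℂ
  | .r k => (-1) ^ k.val
  | .sr k => -((s : ℤ) : ℂ) * (-1) ^ k.val

/-- The sign character `ε`. -/
def sgn (m : ℕ) : DihedralGroup m → ℂ
  | .r _ => 1
  | .sr _ => -1

/-! ## Fake degrees and the matrix `Ω` -/

/-- The field `ℂ(q)`. -/
abbrev F : Type := RatFunc ℂ

/-- The indeterminate. -/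
abbrev q : F := RatFunc.X

/-- Order of vanishing at `q = 0`: for a nonzero polynomial, the largest power of `q` dividing
it. -/
def ordZero (f : F) : ℤ := (f.num.natTrailingDegree : ℤ) - (f.denom.natTrailingDegree : ℤ)

/-- Rotation by `2πk/m`. -/
def rot (m : ℕ) (k : ZMod m) : Matrix (Fin 2) (Fin 2) ℂ :=
  !![(Real.cos (2 * Real.pi * k.val / m) : ℂ), -(Real.sin (2 * Real.pi * k.val / m) : ℂ);
     (Real.sin (2 * Real.pi * k.val / m) : ℂ), (Real.cos (2 * Real.pi * k.val / m) : ℂ)]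

/-- The reflection representation `V = ℂ²` of `I₂(m)`. -/
def reflRep (m : ℕ) : DihedralGroup m → Matrix (Fin 2) (Fin 2) ℂ
  | .r k => rot m k
  | .sr k => !![1, 0; 0, -1] * rot m k

/-- The Poincaré polynomial of `I₂(m)`, whose degrees are `2` and `m`. -/
def poincare (m : ℕ) : F := (q ^ 2 - 1) / (q - 1) * ((q ^ m - 1) / (q - 1))

/-- `R(f) = (q-1)^{dim V} P_W(q) / |W| * ∑_w det_V(w) f(w) / det_V(q - w)`. -/
def fakeDegree (m : ℕ) [NeZero m] (f : DihedralGroup m → ℂ) : F :=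
  (q - 1) ^ 2 * poincare m / (Nat.card (DihedralGroup m) : F) *
    ∑ w : DihedralGroup m,
      RatFunc.C ((reflRep m w).det * f w) / algebraMap (Polynomial ℂ) F (reflRep m w).charpoly

/-- The `b`-invariant: the largest power of `q` dividing the fake degree. -/
def bInv (m : ℕ) [NeZero m] (χ : Irr m) : ℤ := ordZero (fakeDegree m χ.1)

/-- `ω_{χ,χ'} = q^{N*} R(χ ⊗ χ' ⊗ conj det_V)`, where `N* = m` is the number of reflections. -/
def Omega (m : ℕ) [NeZero m] : Matrix (Irr m) (Irr m) F :=
  fun χ χ' => q ^ m * fakeDegree m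
    (fun w => χ.1 w * χ'.1 w * (starRingEnd ℂ) (reflRep m w).det)

/-! ## The Iwahori–Hecke algebra, special characters, families -/

/-- The two simple reflections; their product has order `m`. -/
def simpleRefl (m : ℕ) (i : Bool) : DihedralGroup m := if i then .sr 1 else .sr 0

/-- The alternating word `i, i', i, …` of length `n`. -/
def altWord : Bool → ℕ → List Bool
  | _, 0 => []
  | i, n + 1 => i :: altWord (!i) n

/-- The quadratic relations with parameter `q` and the braid relation of length `m`. -/
inductive HeckeRel (m : ℕ) : FreeAlgebra F Bool → FreeAlgebra F Bool → Prop
  | quadratic (i : Bool) :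
      HeckeRel m ((FreeAlgebra.ι F i - algebraMap F (FreeAlgebra F Bool) q) *
        (FreeAlgebra.ι F i + 1)) 0
  | braid : HeckeRel m ((altWord false m).map (FreeAlgebra.ι F)).prod
      ((altWord true m).map (FreeAlgebra.ι F)).prod

/-- The one-parameter Iwahori–Hecke algebra of `I₂(m)` over `ℂ(q)`. -/
abbrev Hecke (m : ℕ) : Type := RingQuot (HeckeRel m)

/-- The generators of the Hecke algebra. -/
def heckeT (m : ℕ) (i : Bool) : Hecke m :=
  RingQuot.mkAlgHom F (HeckeRel m) (FreeAlgebra.ι F i)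

/-- The product of generators along a word. It is the standard basis element `T_w` if the word is a
reduced expression of `w`. -/
def heckeWord (m : ℕ) (l : List Bool) : Hecke m := (l.map (heckeT m)).prod

/-- Reduced words. -/
def IsReducedWord (m : ℕ) (l : List Bool) : Prop :=
  ∀ l' : List Bool, (l'.map (simpleRefl m)).prod = (l.map (simpleRefl m)).prod →
    l.length ≤ l'.length

/-- An irreducible representation of the Hecke algebra that corresponds to the character `χ` under
the specialization `q = 1` (Tits' deformation theorem). -/
structure HeckeLift (m : ℕ) (χ : DihedralGroup m → ℂ) where
  /-- The dimension. -/
  n : ℕ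
  /-- The representation. -/
  rep : Hecke m →ₐ[F] Matrix (Fin n) (Fin n) F
  pos : 0 < n
  irreducible : ∀ U : Submodule F (Fin n → F),
    (∀ h : Hecke m, ∀ u ∈ U, (rep h).mulVec u ∈ U) → U = ⊥ ∨ U = ⊤
  regular : ∀ l : List Bool, (rep (heckeWord m l)).trace.denom.eval 1 ≠ 0
  specializes : ∀ l : List Bool, RatFunc.eval (RingHom.id ℂ) 1 (rep (heckeWord m l)).trace =
    χ ((l.map (simpleRefl m)).prod)

/-- `D` is the family of generic degrees, for the irreducible representations `L`: the canonical
symmetrizing trace `τ` (given by `τ(T_w) = 1` if `w = 1` and `0` otherwise) is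
`τ = ∑_χ (D_χ / P_W) χ_q`. The generic degree `D_χ` is thus `P_W` divided by the Schur element
of `χ`. -/
def IsGenericDegrees (m : ℕ) [NeZero m] (L : ∀ χ : Irr m, HeckeLift m χ.1) (D : Irr m → F) :
    Prop :=
  ∀ l : List Bool, IsReducedWord m l →
    ∑ χ : Irr m, D χ / poincare m * ((L χ).rep (heckeWord m l)).trace = if l = [] then 1 else 0

/-- A character is special if its `b`-invariant is the largest power of `q` dividing its generic
degree. -/
def IsSpecial (m : ℕ) [NeZero m] (χ : Irr m) : Prop :=
  ∃ (L : ∀ χ : Irr m, HeckeLift m χ.1) (D : Irr m → F),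
    IsGenericDegrees m L D ∧ ordZero (D χ) = bInv m χ

/-- The Rouquier ring `ℤ_K[q, q⁻¹, (q^n - 1)⁻¹ (n ≥ 1)]`, with `ℤ_K` the ring of integers of the
field of definition `K = ℚ(2 cos(2π/m))` of `I₂(m)`. -/
def rouquierRing (m : ℕ) : Subring F :=
  Subring.closure
    ({x | ∃ z : ℂ, IsIntegral ℤ z ∧
        z ∈ IntermediateField.adjoin ℚ {(2 * (Real.cos (2 * Real.pi / m) : ℂ))} ∧
        x = RatFunc.C z} ∪
      {q, q⁻¹} ∪ {x | ∃ n : ℕ, 1 ≤ n ∧ x = (q ^ n - 1)⁻¹})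

/-- The Hecke algebra over the Rouquier ring. -/
def heckeOrder (m : ℕ) : Subring (Hecke m) :=
  Subring.closure (algebraMap F (Hecke m) '' (rouquierRing m : Set F) ∪ Set.range (heckeT m))

/-- Two characters lie in the same family (Rouquier block) if they lie in the same block of the
Hecke algebra over the Rouquier ring: no central idempotent separates them. -/
def SameFamily (m : ℕ) (χ χ' : Irr m) : Prop :=
  ∃ (L : HeckeLift m χ.1) (L' : HeckeLift m χ'.1), ∀ e ∈ heckeOrder m, e * e = e →
    (∀ x ∈ heckeOrder m, e * x = x * e) → (L.rep e = 0 ↔ L'.rep e = 0)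

/-! ## Lusztig–Shoji data, Green functions, Springer correspondences -/

/-- A Lusztig–Shoji datum `(X, <, a)`: a partition of the irreducible characters, a total order on
its members and an order reversing function, in the weak sense (two classes may have the same
value). -/
structure Datum (m : ℕ) where
  /-- The partition. -/
  X : Set (Set (Irr m))
  isPartition : Setoid.IsPartition X
  /-- The strict total order. -/
  lt : X → X → Prop
  isStrictTotalOrder : IsStrictTotalOrder X lt
  /-- The order reversing function. -/
  a : X → ℕ
  a_anti : ∀ C C' : X, lt C C' → a C' ≤ a C

/-- A system of Green functions `P`, `Λ` for a Lusztig–Shoji datum. -/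
structure IsGreenSystem (m : ℕ) [NeZero m] (D : Datum m) (P Λ : Matrix (Irr m) (Irr m) F) :
    Prop where
  equation : P * Λ * P.transpose = Omega m
  P_lt : ∀ C C' : D.X, D.lt C C' → ∀ χ ∈ C.1, ∀ χ' ∈ C'.1, P χ χ' = 0
  P_diag : ∀ C : D.X, ∀ χ ∈ C.1, P χ χ = q ^ D.a C
  P_block : ∀ C : D.X, ∀ χ ∈ C.1, ∀ χ' ∈ C.1, χ ≠ χ' → P χ χ' = 0
  Λ_block : ∀ C C' : D.X, C ≠ C' → ∀ χ ∈ C.1, ∀ χ' ∈ C'.1, Λ χ χ' = 0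

/-- `χ` is the Springer representation of `C`: the unique member with the smallest
`b`-invariant. -/
def IsSpringerRep (m : ℕ) [NeZero m] (C : Set (Irr m)) (χ : Irr m) : Prop :=
  χ ∈ C ∧ ∀ χ' ∈ C, χ' ≠ χ → bInv m χ < bInv m χ'

/-- A Lusztig–Shoji datum is a Springer correspondence. -/
structure IsSpringer (m : ℕ) [NeZero m] (D : Datum m) : Prop where
  springer_rep : ∀ C : D.X, ∃ χ, IsSpringerRep m C.1 χ ∧ (D.a C : ℤ) = bInv m χ
  special : ∀ χ : Irr m, IsSpecial m χ → ∃ C ∈ D.X, IsSpringerRep m C χ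
  family : ∀ χ χ' : Irr m, IsSpecial m χ → ¬ IsSpecial m χ' → SameFamily m χ χ' →
    ∀ C C' : D.X, χ ∈ C.1 → χ' ∈ C'.1 → C' = C ∨ D.lt C' C
  green : ∃ P Λ : Matrix (Irr m) (Irr m) F, IsGreenSystem m D P Λ ∧
    (∀ χ χ', ∃ p : Polynomial ℤ,
      Λ χ χ' = algebraMap (Polynomial ℂ) F (p.map (Int.castRingHom ℂ))) ∧
    (∀ χ χ', ∃ p : Polynomial ℕ,
      P χ χ' = algebraMap (Polynomial ℂ) F (p.map (Nat.castRingHom ℂ))) ∧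
    (∀ C : D.X, ∀ χ ∈ C.1, ∀ χ', ∃ p : Polynomial ℤ,
      P χ χ' = q ^ D.a C * algebraMap (Polynomial ℂ) F (p.map (Int.castRingHom ℂ)))

/-- `D` is a Springer correspondence whose set of Springer representations is `S`. -/
def IsSpringerFor (m : ℕ) [NeZero m] (S : Set (DihedralGroup m → ℂ)) (D : Datum m) : Prop :=
  IsSpringer m D ∧ {φ | ∃ C ∈ D.X, ∃ χ : Irr m, χ.1 = φ ∧ IsSpringerRep m C χ} = S

/-! ## The explicit form -/

/-- The class of `D` with Springer representation `φ` exists and is equal to `A`. -/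
def ClassIs (m : ℕ) [NeZero m] (D : Datum m) (φ : DihedralGroup m → ℂ)
    (A : Set (DihedralGroup m → ℂ)) : Prop :=
  ∃ C ∈ D.X, (∃ χ : Irr m, χ.1 = φ ∧ IsSpringerRep m C χ) ∧ Subtype.val '' C = A

/-- The set `C_k`, `0 ≤ k ≤ N`, of characters, for the sequences `d_0, …, d_N`
and `f_1, …, f_N`. -/
def classSet (m : ℕ) (s : ℤˣ) (S : Set (DihedralGroup m → ℂ)) (N : ℕ) (d f : ℕ → ℕ) (k : ℕ) :
    Set (DihedralGroup m → ℂ) :=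
  if k = 0 then {chi m s 0}
  else if k < N then
    chi m s '' Set.Ico (d k) (d (k + 1)) ∪ chi m s '' Set.Ioc (f (k + 1)) (f k)
  else if Odd m ∨ (chi m s (m / 2) ∈ S ∧ chi' m s ∈ S) then
    chi m s '' Set.Icc (d N) ((m - 1) / 2)
  else if chi m s (m / 2) ∉ S ∧ chi' m s ∈ S then
    chi m s '' Set.Icc (d N) (f N)
  else chi m s '' Set.Icc (d N) (m / 2) ∪ {chi' m s}

/-- The classes of `D` are the `C_k`, the singleton classes of those of `χ_r`, `χ_r'` that belong
to `S` (for `m = 2r`), and the singleton class of `ε`. -/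
structure HasForm (m : ℕ) [NeZero m] (s : ℤˣ) (S : Set (DihedralGroup m → ℂ)) (N : ℕ)
    (d f : ℕ → ℕ) (D : Datum m) : Prop where
  main : ∀ k ≤ N, ClassIs m D (chi m s (d k)) (classSet m s S N d f k)
  chi_r : Even m → chi m s (m / 2) ∈ S → ClassIs m D (chi m s (m / 2)) {chi m s (m / 2)}
  chi_r' : Even m → chi' m s ∈ S → ClassIs m D (chi' m s) {chi' m s}
  sign : ClassIs m D (sgn m) {sgn m}

end

end LusztigShoji

/-! For every Lusztig–Shoji datum a system of Green functions exists and `P` is determined by the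
datum: at `q = ∞` the diagonal of `Ω` dominates, so all principal blocks of `Ω` are nonsingular
(`exists_vecMul_Omega_eq`, `exists_isBlockDecomp`). The question is when the entries are
polynomials, nonnegative, and divisible by the prescribed power of `q`. An entry `P i j` can be
computed without solving the whole system: if row `i` of `Ω` agrees, on the columns of classes at
most that of `j`, with a combination of rows of such classes, then `P i j` is the coefficient of row
`j` times a power of `q` (`IsBlockDecomp.apply_eq`).

Molien's formula gives `Ω` explicitly. The sign character forms the smallest class, and eliminating
it leaves `redOmega`, whose entry at `χ_i`, `χ_j` for `i ≤ j < m/2` is `q^i (q^j + q^(m-j))`: a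
function of the smaller index times a function of the larger one. Hence the row of `χ_i`, on columns
outside an open interval `(j, l)` containing `i`, is a combination of the rows of `χ_j` and `χ_l`,
with coefficients that interpolate `q^n` and `q^(-n)` (`row_between`). For even `m` the chain of
indices forks at its end into `χ_r` and `χ_r'` (`row_fork`).

Necessity. The two-sided interpolation coefficients contain `(q^(2a) - 1)/(q^(2b) - 1)` with `0 < a
< b` and are not polynomials, so no index has smaller classes on both sides (`between`,
`between_half`). Similar arguments apply at the end of the chain (`beyond`, `half_half`). Since the
order of the Springer representations is forced by their `b`-invariants (`supp_lt`), the indices in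
`[d_k, d_(k+1))` lie in `C_k`, and everything from `d_N` on lies in `C_N`. The exception is the case
where `χ_r'` alone of the two is in `S`. Then one side of the fork lies below and the other need
not, and the relevant relation `row_beyond` has the monomial coefficient `q^(t-i)`. The classes may
therefore grow beyond `d_N`, which is recorded by the sequence `f`. Divisibility of the entry
`q^(f_l + d_l - f_k)` by `q^(d_k)` is the inequality `f_k - f_l ≤ d_l - d_k` (`sub_le_sub`).

Sufficiency. For the datum defined by an admissible `f`, the same relations show that the entries of
`P` outside the column of `ε` are zero or powers of `q`, divisible as required (`natDiv_levDatum`).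
Integrality of `Λ` then follows by induction over the classes (`lambda_mem`).

Three facts about the Hecke algebra enter. The special characters are `χ_0`, `χ_1`, `ε`
(`isSpecial_iff`): the generic degrees are found by Fourier inversion on the powers of the Coxeter
element, and those of the `χ_i`, `χ_r`, `χ_r'` with positive index vanish to order one at `q = 0`.
The sign character is alone in its family (`eq_of_sameFamily_sgn`), as its central idempotent is
defined over the Rouquier ring. For even `m`, `χ_r` lies in the family of `χ_1` (`sameFamily_half`),
by congruences modulo `ω - 1` for roots of unity `ω` of prime power order; this gives `f_1 = r`. -/

namespace LusztigShoji

noncomputable section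

open scoped Classical

set_option linter.unusedSectionVars false

section

/-! ## Block triangular decompositions -/

section Green

variable {I α K : Type*} [Fintype I] [DecidableEq I] [LinearOrder α] [WellFoundedLT α] [Field K]

/-- A block triangular decomposition `P Λ Pᵗ = Ω` for the level function `κ`, where the diagonal
blocks of `P` are the scalars `p`. -/
structure IsBlockDecomp (κ : I → α) (p : α → K) (Ω P Λ : Matrix I I K) : Prop where
  equation : P * Λ * P.transpose = Ω
  lt : ∀ i j, κ i < κ j → P i j = 0
  diag : ∀ i, P i i = p (κ i)
  block : ∀ i j, κ i = κ j → i ≠ j → P i j = 0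
  block_diag : ∀ i j, κ i ≠ κ j → Λ i j = 0

open Matrix

/-- With `y = e_i - x`, the vector `y P Λ Pᵗ` vanishes on all levels at most `c`. Block
triangularity allows `Pᵗ`, and then `Λ`, to be cancelled on these levels, so `y P` vanishes there.
Its entry at `j` is `P i j - x j * p c`. -/
theorem IsBlockDecomp.apply_eq {κ : I → α} {p : α → K} {Ω P Λ : Matrix I I K}
    (h : IsBlockDecomp κ p Ω P Λ) (hp : ∀ c, p c ≠ 0) (hΩ : IsUnit Ω.det)
    {i : I} {c : α} {x : I → K} (hx : ∀ z, c < κ z → x z = 0)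
    (hxΩ : ∀ w, κ w ≤ c → (x ᵥ* Ω) w = Ω i w) {j : I} (hj : κ j = c) :
    P i j = x j * p c := by
  set y : I → K := Pi.single i 1 - x with hy
  set t := y ᵥ* P with ht
  set s := t ᵥ* Λ with hs
  have h1 : ∀ w, κ w ≤ c → (s ᵥ* P.transpose) w = 0 := by
    intro w hw
    rw [hs, ht, vecMul_vecMul, vecMul_vecMul, ← Matrix.mul_assoc, h.equation, hy, sub_vecMul, Pi.sub_apply, hxΩ w hw,
      single_one_vecMul, row_apply, sub_self]
  have h2 : ∀ w, κ w ≤ c → s w = 0 := by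
    intro w
    induction hw : κ w using WellFoundedLT.induction generalizing w with
    | ind d ih =>
      intro hd
      have h3 := h1 w (hw ▸ hd)
      rw [vecMul, dotProduct, Finset.sum_eq_single w] at h3
      · rw [transpose_apply, h.diag] at h3
        exact (mul_eq_zero.1 h3).resolve_right (hp _)
      · intro z _ hz
        rw [transpose_apply]
        rcases lt_trichotomy (κ w) (κ z) with h4 | h4 | h4
        · rw [h.lt _ _ h4, mul_zero]
        · rw [h.block _ _ h4 hz.symm, mul_zero]
        · rw [ih (κ z) (hw ▸ h4) z rfl (h4.le.trans (hw ▸ hd)), zero_mul]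
      · simp
  -- Truncation to levels at most `c` commutes with the block diagonal `Λ`, so the truncated vector
  -- is in the kernel of the invertible `Λ`.
  set t' : I → K := fun z => if κ z ≤ c then t z else 0 with ht'
  have h3 : t' ᵥ* Λ = 0 := by
    ext w
    by_cases hw : κ w ≤ c
    · rw [Pi.zero_apply, ← h2 w hw]
      refine Finset.sum_congr rfl fun z _ => ?_
      change t' z * Λ z w = t z * Λ z w
      by_cases hz : κ z = κ w
      · simp [ht', hz, hw]
      · rw [h.block_diag _ _ hz, mul_zero, mul_zero]
    · refine Finset.sum_eq_zero fun z _ => ?_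
      change t' z * Λ z w = 0
      by_cases hz : κ z = κ w
      · simp [ht', hz, hw]
      · rw [h.block_diag _ _ hz, mul_zero]
  have hΛ : IsUnit Λ := by
    rw [Matrix.isUnit_iff_isUnit_det]
    rw [← h.equation, det_mul, det_mul] at hΩ
    exact isUnit_of_mul_isUnit_right (isUnit_of_mul_isUnit_left hΩ)
  have h4 : t' = 0 := by
    have := (Matrix.vecMul_injective_iff_isUnit.2 hΛ)
    exact this (by simpa using h3)
  have h5 : t j = 0 := by
    have := congrFun h4 j
    simpa [ht', hj] using this
  rw [ht, hy, sub_vecMul, Pi.sub_apply, single_one_vecMul, row_apply, sub_eq_zero] at h5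
  rw [h5, vecMul, dotProduct, Finset.sum_eq_single j]
  · rw [h.diag, hj]
  · intro z _ hz
    rcases lt_trichotomy (κ z) (κ j) with h6 | h6 | h6
    · rw [h.lt _ _ h6, mul_zero]
    · rw [h.block _ _ h6 hz, mul_zero]
    · rw [hx z (hj ▸ h6), zero_mul]
  · simp

/-- Block decompositions exist if all principal blocks are nonsingular. -/
theorem exists_isBlockDecomp (κ : I → α) (p : α → K) (hp : ∀ c, p c ≠ 0) (Ω : Matrix I I K)
    (hsymm : ∀ i j, Ω i j = Ω j i)
    (hΩ : ∀ (Z : Set I) (v : I → K), ∃ x : I → K, (∀ z ∉ Z, x z = 0) ∧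
      ∀ w ∈ Z, (x ᵥ* Ω) w = v w) :
    ∃ P Λ, IsBlockDecomp κ p Ω P Λ := by
  -- Gram–Schmidt: `g i` is the combination of rows of strictly smaller level that agrees with row
  -- `i` on the columns of strictly smaller level. The matrix `1 - g` becomes the inverse of the
  -- unipotent factor.
  choose g hg hgΩ using fun i => hΩ {z | κ z < κ i} (Ω i)
  set Q : Matrix I I K := 1 - Matrix.of g with hQ
  have hQ0 : ∀ i j, κ i ≤ κ j → i ≠ j → Q i j = 0 := by
    intro i j hij hne
    rw [hQ, Matrix.sub_apply, one_apply_ne hne, of_apply, hg i j (by simpa using hij), sub_zero]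
  have hQ1 : ∀ i, Q i i = 1 := by
    intro i
    rw [hQ, Matrix.sub_apply, one_apply_eq, of_apply, hg i i (by simp), sub_zero]
  have hQΩ : ∀ i j, κ j < κ i → (Q * Ω) i j = 0 := by
    intro i j hij
    rw [hQ, Matrix.sub_mul, Matrix.sub_apply, Matrix.one_mul, mul_apply, sub_eq_zero]
    exact (hgΩ i j hij).symm
  have hQu : IsUnit Q := by
    rw [← Matrix.mulVec_injective_iff_isUnit]
    refine (injective_iff_map_eq_zero Q.mulVecLin).2 fun v hv => ?_
    ext i
    induction hi : κ i using WellFoundedLT.induction generalizing i with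
    | ind d ih =>
      have h1 := congrFun hv i
      rw [mulVecLin_apply, mulVec, dotProduct, Finset.sum_eq_single i, hQ1, one_mul] at h1
      · exact h1
      · intro z _ hz
        rcases le_or_gt (κ i) (κ z) with h2 | h2
        · rw [hQ0 _ _ h2 hz.symm, zero_mul]
        · rw [ih (κ z) (hi ▸ h2) z rfl, Pi.zero_apply, mul_zero]
      · simp
  have hQd : IsUnit Q.det := (Matrix.isUnit_iff_isUnit_det _).1 hQu
  have hQb : BlockTriangular Q (OrderDual.toDual ∘ κ) := by
    intro i j hij
    have hij' : κ i < κ j := hij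
    exact hQ0 i j hij'.le (fun h => hij'.ne (by rw [h]))
  let _ : Invertible Q := hQu.invertible
  have hU : ∀ i j, κ i < κ j → Q⁻¹ i j = 0 := by
    intro i j hij
    exact blockTriangular_inv_of_blockTriangular hQb hij
  have hU1 : ∀ i j, κ i = κ j → Q⁻¹ i j = (1 : Matrix I I K) i j := by
    intro i j hij
    rw [← mul_nonsing_inv Q hQd, mul_apply, Finset.sum_eq_single i, hQ1, one_mul]
    · intro z _ hz
      rcases le_or_gt (κ i) (κ z) with h2 | h2
      · rw [hQ0 _ _ h2 hz.symm, zero_mul]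
      · rw [hU z j (hij ▸ h2), mul_zero]
    · simp
  have hΛ0 : ∀ i j, κ j < κ i → (Q * Ω * Q.transpose) i j = 0 := by
    intro i j hij
    rw [mul_apply]
    refine Finset.sum_eq_zero fun z _ => ?_
    by_cases hz : κ z < κ i
    · rw [hQΩ i z hz, zero_mul]
    · rw [transpose_apply, hQ0 j z (hij.le.trans (not_lt.1 hz)), mul_zero]
      rintro rfl
      exact hz hij
  have hΛsymm : ∀ i j, (Q * Ω * Q.transpose) i j = (Q * Ω * Q.transpose) j i := by
    intro i j
    have : (Q * Ω * Q.transpose).transpose = Q * Ω * Q.transpose := by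
      rw [transpose_mul, transpose_mul, transpose_transpose, Matrix.mul_assoc,
        show Ω.transpose = Ω from by ext i j; exact hsymm j i]
    exact congrFun (congrFun this j) i
  -- The scalars `p` are moved from the block diagonal factor into the triangular one.
  set δ : Matrix I I K := diagonal fun i => p (κ i) with hδ
  set δ' : Matrix I I K := diagonal fun i => (p (κ i))⁻¹ with hδ'
  have hδδ : δ * δ' = 1 := by
    rw [hδ, hδ', diagonal_mul_diagonal, ← diagonal_one]
    congr 1
    ext i
    exact mul_inv_cancel₀ (hp _)
  have hδδ' : δ' * δ = 1 := by
    rw [hδ, hδ', diagonal_mul_diagonal, ← diagonal_one]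
    congr 1
    ext i
    exact inv_mul_cancel₀ (hp _)
  refine ⟨Q⁻¹ * δ, δ' * (Q * Ω * Q.transpose) * δ', ?_, ?_, ?_, ?_, ?_⟩
  · have e1 : Q⁻¹ * Q = 1 := nonsing_inv_mul Q hQd
    have e2 : Q.transpose * Q⁻¹.transpose = 1 := by
      rw [← transpose_mul, e1, transpose_one]
    have e3 : δ.transpose = δ := diagonal_transpose _
    rw [transpose_mul, e3]
    calc Q⁻¹ * δ * (δ' * (Q * Ω * Q.transpose) * δ') * (δ * Q⁻¹.transpose)
        = Q⁻¹ * (δ * δ') * (Q * Ω * Q.transpose) * (δ' * δ) * Q⁻¹.transpose := by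
          simp only [Matrix.mul_assoc]
      _ = (Q⁻¹ * Q) * Ω * (Q.transpose * Q⁻¹.transpose) := by
          rw [hδδ, hδδ', Matrix.mul_one, Matrix.mul_one]
          simp only [Matrix.mul_assoc]
      _ = Ω := by rw [e1, e2, Matrix.one_mul, Matrix.mul_one]
  · intro i j hij
    rw [hδ, mul_diagonal, hU i j hij, zero_mul]
  · intro i
    rw [hδ, mul_diagonal, hU1 i i rfl, one_apply_eq, one_mul]
  · intro i j hij hne
    rw [hδ, mul_diagonal, hU1 i j hij, one_apply_ne hne, zero_mul]
  · intro i j hij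
    rw [hδ', mul_diagonal, diagonal_mul]
    rcases lt_or_gt_of_ne hij with h | h
    · rw [hΛsymm, hΛ0 j i h, mul_zero, zero_mul]
    · rw [hΛ0 i j h, mul_zero, zero_mul]

/-- If the matrix has a dominant diagonal for a valuation, its principal blocks are nonsingular. -/
theorem exists_vecMul_eq_of_valuation {Γ : Type*} [LinearOrderedCommGroupWithZero Γ]
    (v : Valuation K Γ) (Ω : Matrix I I K) {γ : Γ} (hγ : γ ≠ 0) (hd : ∀ i, v (Ω i i) = γ)
    (ho : ∀ i j, i ≠ j → v (Ω i j) < γ) (Z : Set I) (b : I → K) :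
    ∃ x : I → K, (∀ z ∉ Z, x z = 0) ∧ ∀ w ∈ Z, (x ᵥ* Ω) w = b w := by
  let A : Matrix Z Z K := fun i j => Ω i j
  have hA : Function.Injective (fun x : Z → K => x ᵥ* A) := by
    refine (injective_iff_map_eq_zero A.vecMulLinear).2 fun x hx => ?_
    by_contra hne
    obtain ⟨i0, hi0⟩ := Function.ne_iff.1 hne
    -- In the column where a kernel vector has a coordinate of maximal valuation, the diagonal term
    -- strictly dominates all others.
    obtain ⟨j, -, hj⟩ := Finset.exists_max_image Finset.univ (fun z => v (x z)) ⟨i0, Finset.mem_univ _⟩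
    have hxj : 0 < v (x j) := lt_of_lt_of_le
      (zero_lt_iff.2 ((Valuation.ne_zero_iff v).2 hi0)) (hj i0 (Finset.mem_univ _))
    have h1 := congrFun hx j
    have h2 : ∑ z, x z * A z j = 0 := h1
    rw [← Finset.add_sum_erase _ _ (Finset.mem_univ j)] at h2
    have h3 : v (∑ z ∈ Finset.univ.erase j, x z * A z j) < v (x j * A j j) := by
      refine Valuation.map_sum_lt v ?_ ?_
      · rw [map_mul, hd]; exact mul_ne_zero hxj.ne' hγ
      · intro z hz
        rw [map_mul, map_mul, hd]
        exact mul_lt_mul_of_le_of_lt_of_nonneg_of_pos (hj z (Finset.mem_univ _))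
          (ho z j (fun h => (Finset.ne_of_mem_erase hz) (Subtype.ext h))) zero_le hxj
    rw [add_eq_zero_iff_eq_neg.1 h2, Valuation.map_neg] at h3
    exact lt_irrefl _ h3
  have hA' : IsUnit A := Matrix.vecMul_injective_iff_isUnit.1 hA
  obtain ⟨y, hy⟩ := (Matrix.vecMul_surjective_iff_isUnit.2 hA') fun z : Z => b z
  refine ⟨fun z => if h : z ∈ Z then y ⟨z, h⟩ else 0, fun z hz => by simp [hz], fun w hw => ?_⟩
  have h1 := congrFun hy ⟨w, hw⟩
  rw [← h1]
  simp only [vecMul, dotProduct]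
  rw [← Finset.sum_filter_add_sum_filter_not Finset.univ (· ∈ Z),
    Finset.sum_subtype (p := (· ∈ Z)) _ (by simp), Finset.sum_eq_zero (s := Finset.filter _ _),
    add_zero]
  · exact Finset.sum_congr rfl fun z _ => by simp [A]
  · intro z hz
    rw [dif_neg (Finset.mem_filter.1 hz).2, zero_mul]

end Green

end

section

/-! ## Fourier analysis on `ZMod m` -/

/-- The character `k ↦ exp (2πik/m)` of `ZMod m`. -/
abbrev ec (m : ℕ) [NeZero m] : AddChar (ZMod m) ℂ := ZMod.stdAddChar

variable {m : ℕ}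

theorem mulVec_two {R : Type*} [CommRing R] (a b c d x y : R) :
    (!![a, b; c, d]).mulVec ![x, y] = ![a * x + b * y, c * x + d * y] := by
  ext i
  fin_cases i <;> simp [Matrix.mulVec, dotProduct, Fin.sum_univ_two]

variable [NeZero m]

theorem sum_ec (a : ZMod m) : ∑ k, ec m (a * k) = if a = 0 then (m : ℂ) else 0 := by
  have := AddChar.sum_mulShift (ψ := ec m) a (ZMod.isPrimitive_stdAddChar m)
  simp only [ZMod.card, Nat.cast_ite, Nat.cast_zero] at this
  rw [← this]
  exact Finset.sum_congr rfl fun k _ => by rw [mul_comm]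

theorem ec_natCast (j : ℕ) : ec m (j : ZMod m) = Complex.exp (2 * Real.pi * Complex.I * j / m) := by
  have := ZMod.stdAddChar_coe (N := m) (j : ℤ)
  simpa using this

theorem ec_mul_val (j : ℕ) (k : ZMod m) : ec m (j * k) =
    Complex.exp (2 * Real.pi * Complex.I * (j * k.val : ℕ) / m) := by
  rw [← ec_natCast, Nat.cast_mul, ZMod.natCast_zmod_val]

theorem ec_neg (a : ZMod m) : ec m (-a) = (ec m a)⁻¹ := AddChar.map_neg_eq_inv _ _

theorem ec_ne_zero (a : ZMod m) : ec m a ≠ 0 := by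
  intro h
  have := AddChar.map_add_eq_mul (ec m) a (-a)
  rw [h, zero_mul, add_neg_cancel, AddChar.map_zero_eq_one] at this
  exact one_ne_zero this

theorem two_cos_eq (j : ℕ) (k : ZMod m) :
    2 * (Real.cos (2 * Real.pi * j * k.val / m) : ℂ) = ec m (j * k) + ec m (-(j * k)) := by
  rw [ec_neg, ec_mul_val, ← Complex.exp_neg, Complex.ofReal_cos, Complex.cos, mul_div_cancel₀ _ two_ne_zero]
  push_cast
  congr 2 <;> ring

theorem natCast_add_self {j : ℕ} (hj : 2 * j = m) : (j : ZMod m) + j = 0 := by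
  have : ((2 * j : ℕ) : ZMod m) = 0 := by rw [hj]; exact ZMod.natCast_self m
  rw [← this]; push_cast; ring

theorem ec_half {j : ℕ} (hj : 2 * j = m) (k : ZMod m) : ec m (j * k) = (-1) ^ k.val := by
  have h1 : ec m (j : ZMod m) = -1 := by
    rw [ec_natCast, ← Complex.exp_pi_mul_I]
    congr 1
    have : (m : ℂ) ≠ 0 := NeZero.ne _
    rw [div_eq_iff this, ← hj]
    push_cast; ring
  have h2 : (j : ZMod m) * k = k.val • (j : ZMod m) := by
    rw [nsmul_eq_mul, ZMod.natCast_zmod_val, mul_comm]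
  rw [h2, AddChar.map_nsmul_eq_pow, h1]

theorem natCast_eq_zero_iff_of_lt {j : ℕ} (hj : j < m) : (j : ZMod m) = 0 ↔ j = 0 := by
  rw [ZMod.natCast_eq_zero_iff]
  exact ⟨fun h => Nat.eq_zero_of_dvd_of_lt h hj, fun h => h ▸ dvd_zero _⟩

/-! ## The irreducible characters -/

theorem sum_dihedral {M : Type*} [AddCommMonoid M] (f : DihedralGroup m → M) :
    ∑ g, f g = ∑ k, f (.r k) + ∑ k, f (.sr k) := by
  rw [← Equiv.sum_comp DihedralGroup.equivSum.symm, Fintype.sum_sum_type]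
  rfl

theorem mem_irrChars_of_matrix {n : ℕ} (hn : 0 < n)
    (ρ : DihedralGroup m →* Matrix (Fin n) (Fin n) ℂ)
    (hρ : ∀ U : Submodule ℂ (Fin n → ℂ), (∀ g, ∀ u ∈ U, (ρ g).mulVec u ∈ U) → U = ⊥ ∨ U = ⊤) :
    (fun g => (ρ g).trace) ∈ irrChars m := by
  let σ : Representation ℂ (DihedralGroup m) (Fin n → ℂ) :=
    (Matrix.toLinAlgEquiv' : _ ≃ₐ[ℂ] _).toAlgHom.toRingHom.toMonoidHom.comp ρ
  have hσ : ∀ g u, σ g u = (ρ g).mulVec u := fun g u => rfl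
  refine ⟨n, σ, ?_, ?_⟩
  · have : Nonempty (Fin n) := ⟨⟨0, hn⟩⟩
    refine @IsSimpleOrder.mk _ _ _ ⟨⟨⊥, ⊤, fun h => ?_⟩⟩ fun U => ?_
    · have h1 : (fun _ => 1 : Fin n → ℂ) ∈ (⊤ : Subrepresentation σ) := trivial
      rw [← h] at h1
      have h2 : (fun _ => 1 : Fin n → ℂ) = 0 := h1
      exact one_ne_zero (congrFun h2 ⟨0, hn⟩)
    · rcases hρ U.toSubmodule fun g u hu => U.apply_mem_toSubmodule g hu with h | h
      · left
        exact SetLike.ext fun x => by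
          change x ∈ U.toSubmodule ↔ x ∈ (⊥ : Submodule ℂ (Fin n → ℂ))
          rw [h]
      · right
        exact SetLike.ext fun x => by
          change x ∈ U.toSubmodule ↔ x ∈ (⊤ : Submodule ℂ (Fin n → ℂ))
          rw [h]
  · ext g
    exact Matrix.trace_toLin'_eq (ρ g)

theorem mem_irrChars_of_hom (f : DihedralGroup m →* ℂ) : (f : DihedralGroup m → ℂ) ∈ irrChars m := by
  have := mem_irrChars_of_matrix one_pos ((Matrix.scalar (Fin 1)).toMonoidHom.comp f) ?_
  · convert this using 1
    ext g
    simp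
  · intro U _
    exact (eq_bot_or_eq_top (Submodule.map (LinearEquiv.funUnique (Fin 1) ℂ ℂ).toLinearMap U)).imp
      (fun h => by simpa using h) (fun h => by simpa using h)

/-- The two-dimensional representation with rotation eigenvalues `ec m (±jk)`. -/
def rho (j : ZMod m) : DihedralGroup m →* Matrix (Fin 2) (Fin 2) ℂ where
  toFun
    | .r k => !![ec m (j * k), 0; 0, ec m (-(j * k))]
    | .sr k => !![0, ec m (-(j * k)); ec m (j * k), 0]
  map_one' := by
    change !![ec m (j * 0), 0; 0, ec m (-(j * 0))] = _
    simp [Matrix.one_fin_two]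
  map_mul' := by
    rintro (a | a) (b | b) <;>
    simp only [DihedralGroup.r_mul_r, DihedralGroup.r_mul_sr, DihedralGroup.sr_mul_r,
      DihedralGroup.sr_mul_sr, Matrix.mul_fin_two, mul_zero, zero_mul, add_zero, zero_add,
      ← AddChar.map_add_eq_mul] <;> ring_nf

theorem rho_r (j k : ZMod m) : rho j (.r k) = !![ec m (j * k), 0; 0, ec m (-(j * k))] := rfl

theorem rho_sr (j k : ZMod m) : rho j (.sr k) = !![0, ec m (-(j * k)); ec m (j * k), 0] := rfl

/-- The sign character as a homomorphism. -/
def sgnHom : DihedralGroup m →* ℂ where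
  toFun := sgn m
  map_one' := rfl
  map_mul' := by
    rintro (a | a) (b | b) <;> simp [sgn]

theorem sgn_mem : sgn m ∈ irrChars m := mem_irrChars_of_hom sgnHom

theorem chi_zero (s : ℤˣ) : chi m s 0 = fun _ => 1 := by
  ext (k | k) <;> simp [chi]

theorem chi_half {s : ℤˣ} {j : ℕ} (hj : 2 * j = m) :
    (∀ k, chi m s j (.r k) = ec m (j * k)) ∧
    (∀ k, chi m s j (.sr k) = ((s : ℤ) : ℂ) * ec m (j * k)) := by
  have hj0 : j ≠ 0 := by rintro rfl; exact NeZero.ne m (by simpa using hj.symm)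
  simp only [ec_half hj]
  exact ⟨fun k => by simp [chi, hj0, hj], fun k => by simp [chi, hj0, hj]⟩

theorem chi_two {s : ℤˣ} {j : ℕ} (hj0 : j ≠ 0) (hj : 2 * j ≠ m) :
    (∀ k, chi m s j (.r k) = ec m (j * k) + ec m (-(j * k))) ∧
    (∀ k, chi m s j (.sr k) = 0) := by
  simp only [← two_cos_eq]
  exact ⟨fun k => by simp [chi, hj0, hj], fun k => by simp [chi, hj0, hj]⟩

theorem chi'_eq (s : ℤˣ) (hm : Even m) : chi' m s = chi m (-s) (m / 2) := by
  have h : 2 * (m / 2) = m := Nat.two_mul_div_two_of_even hm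
  have h0 : m / 2 ≠ 0 := by intro h0; rw [h0] at h; exact NeZero.ne m (by simpa using h.symm)
  ext (k | k)
  · simp [chi, chi', h, h0]
  · simp [chi, chi', h, h0]

theorem natCast_ne_neg {j : ℕ} (hj0 : j ≠ 0) (hj : 2 * j < m) : (j : ZMod m) ≠ -j := by
  intro h
  have h1 : ((2 * j : ℕ) : ZMod m) = 0 := by
    push_cast; rw [two_mul]; nth_rewrite 1 [h]; ring
  rw [natCast_eq_zero_iff_of_lt hj] at h1
  omega

/-- The linear characters `χ_r`, `χ_r'` as homomorphisms. -/
def chiHom (s : ℤˣ) {j : ℕ} (hj : 2 * j = m) : DihedralGroup m →* ℂ where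
  toFun := chi m s j
  map_one' := by
    rw [DihedralGroup.one_def, (chi_half hj).1]; simp
  map_mul' := by
    have hneg : ∀ k : ZMod m, ec m (j * -k) = ec m (j * k) := by
      intro k
      congr 1
      have := natCast_add_self hj
      linear_combination (-k) * this
    have hs : ((s : ℤ) : ℂ) * ((s : ℤ) : ℂ) = 1 := by
      rw [← Int.cast_mul, Int.units_coe_mul_self]; simp
    obtain ⟨h1, h2⟩ := chi_half (s := s) hj
    rintro (a | a) (b | b) <;>
    simp only [DihedralGroup.r_mul_r, DihedralGroup.r_mul_sr, DihedralGroup.sr_mul_r,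
      DihedralGroup.sr_mul_sr, h1, h2]
    · rw [mul_add, AddChar.map_add_eq_mul]
    · rw [sub_eq_add_neg, mul_add, AddChar.map_add_eq_mul, hneg]; ring
    · rw [mul_add, AddChar.map_add_eq_mul]; ring
    · rw [sub_eq_add_neg, mul_add, AddChar.map_add_eq_mul, hneg]
      linear_combination (-ec m (j * a) * ec m (j * b)) * hs

theorem chi_mem (s : ℤˣ) {j : ℕ} (hj : 2 * j ≤ m) : chi m s j ∈ irrChars m := by
  by_cases hj0 : j = 0
  · subst hj0
    rw [chi_zero]
    exact mem_irrChars_of_hom 1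
  by_cases hj2 : 2 * j = m
  · exact mem_irrChars_of_hom (chiHom s hj2)
  · obtain ⟨h1, h2⟩ := chi_two (s := s) hj0 hj2
    have h3 : chi m s j = fun g => (rho (j : ZMod m) g).trace := by
      ext (k | k)
      · rw [h1, rho_r, Matrix.trace_fin_two_of]
      · rw [h2, rho_sr, Matrix.trace_fin_two_of, add_zero]
    rw [h3]
    refine mem_irrChars_of_matrix two_pos _ fun U hU => ?_
    by_cases hb : U = ⊥
    · exact Or.inl hb
    right
    -- The rotation `r 1` has two different eigenvalues, so `U` contains the eigencomponents of its
    -- vectors, and `sr 0` exchanges the two eigenlines.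
    have hne : ec m (j : ZMod m) ≠ ec m (-(j : ZMod m)) := fun h =>
      natCast_ne_neg hj0 (lt_of_le_of_ne hj hj2) (ZMod.injective_stdAddChar h)
    have hswap : ∀ x y : ℂ, ![x, y] ∈ U → ![y, x] ∈ U := by
      intro x y h
      have := hU (.sr 0) _ h
      rw [rho_sr, mulVec_two] at this
      simpa using this
    have hdiag : ∀ x y : ℂ, ![x, y] ∈ U → ![ec m (j : ZMod m) * x, ec m (-(j : ZMod m)) * y] ∈ U := by
      intro x y h
      have := hU (.r 1) _ h
      rw [rho_r, mulVec_two] at this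
      simpa using this
    have hfst : ∀ x y : ℂ, ![x, y] ∈ U → ![x, 0] ∈ U := by
      intro x y h
      have h4 := U.sub_mem (hdiag x y h) (U.smul_mem (ec m (-(j : ZMod m))) h)
      have h5 := U.smul_mem (ec m (j : ZMod m) - ec m (-(j : ZMod m)))⁻¹ h4
      have h6 : ec m (j : ZMod m) - ec m (-(j : ZMod m)) ≠ 0 := sub_ne_zero.2 hne
      refine (congrArg (· ∈ U) (funext fun i => ?_)).mpr h5
      fin_cases i
      · simp only [Fin.zero_eta, Matrix.cons_val_zero, Pi.smul_apply, Pi.sub_apply, smul_eq_mul]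
        rw [← sub_mul, inv_mul_cancel_left₀ h6]
      · simp
    obtain ⟨u, hu, hu0⟩ := (Submodule.ne_bot_iff _).1 hb
    have hu' : u = ![u 0, u 1] := by ext i; fin_cases i <;> rfl
    rw [hu'] at hu
    have h10 : ![(1 : ℂ), 0] ∈ U := by
      by_cases hx : u 0 = 0
      · have hy : u 1 ≠ 0 := by
          intro hy
          exact hu0 (by rw [hu', hx, hy]; ext i; fin_cases i <;> rfl)
        have := U.smul_mem (u 1)⁻¹ (hfst _ _ (hswap _ _ hu))
        simpa [hy] using this
      · have := U.smul_mem (u 0)⁻¹ (hfst _ _ hu)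
        simpa [hx] using this
    rw [eq_top_iff]
    intro v _
    have := U.add_mem (U.smul_mem (v 0) h10) (U.smul_mem (v 1) (hswap _ _ h10))
    convert this using 1
    ext i; fin_cases i <;> simp

theorem sum_mul_inv_eq_zero {χ χ' : DihedralGroup m → ℂ} (hχ : χ ∈ irrChars m)
    (hχ' : χ' ∈ irrChars m) (hne : χ ≠ χ') : ∑ g, χ g * χ' g⁻¹ = 0 := by
  obtain ⟨n, ρ, hρ, rfl⟩ := hχ
  obtain ⟨n', σ, hσ, rfl⟩ := hχ'
  have hc : (Nat.card (DihedralGroup m) : ℂ) ≠ 0 := Nat.cast_ne_zero.2 Nat.card_pos.ne'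
  let _ : Invertible (Nat.card (DihedralGroup m) : ℂ) := invertibleOfNonzero hc
  have h := Representation.char_orthonormal ρ σ
  rw [if_neg] at h
  · exact (mul_eq_zero.1 h).resolve_left (inv_ne_zero hc)
  · rintro ⟨e⟩
    exact hne (Representation.char_iso e).symm

theorem natCast_or_neg (a : ZMod m) : ∃ j : ℕ, 2 * j ≤ m ∧ (a = j ∨ a = -j) := by
  rcases le_or_gt (2 * a.val) m with h | h
  · exact ⟨a.val, h, Or.inl (ZMod.natCast_zmod_val a).symm⟩
  · have h1 := ZMod.val_lt a
    refine ⟨m - a.val, by omega, Or.inr ?_⟩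
    rw [Nat.cast_sub h1.le, ZMod.natCast_self, ZMod.natCast_zmod_val]; ring

/-- A further irreducible character would be orthogonal to all those listed. The degree two
characters and the sums `χ_0 + ε`, `χ_r + χ_r'` vanish on reflections and span the even functions on
the rotations. So all Fourier coefficients of `χ` on the rotations would vanish, and with them the
degree. -/
theorem irrChars_cases (s : ℤˣ) {χ : DihedralGroup m → ℂ} (hχ : χ ∈ irrChars m) :
    (∃ j, 2 * j < m ∧ χ = chi m s j) ∨ (Even m ∧ (χ = chi m s (m / 2) ∨ χ = chi' m s)) ∨
      χ = sgn m := by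
  by_contra! hcon
  obtain ⟨hc1, hc2, hc3⟩ := hcon
  have horth : ∀ χ' ∈ irrChars m, χ ≠ χ' →
      ∑ k, χ (.r k) * χ' (.r (-k)) + ∑ k, χ (.sr k) * χ' (.sr k) = 0 := by
    intro χ' h' hne
    have := sum_mul_inv_eq_zero hχ h' hne
    rw [sum_dihedral] at this
    simpa using this
  have heven : ∀ k, χ (.r (-k)) = χ (.r k) := by
    obtain ⟨n, ρ, hρ, rfl⟩ := hχ
    intro k
    have := Representation.char_conj (ρ := ρ) (.r k) (.sr 0)
    simpa using this
  have hneg : ∀ a : ZMod m, ∑ k, χ (.r k) * ec m (-(a * k)) = ∑ k, χ (.r k) * ec m (a * k) := by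
    intro a
    rw [← Equiv.sum_comp (Equiv.neg (ZMod m))]
    refine Finset.sum_congr rfl fun k _ => ?_
    rw [Equiv.neg_apply, heven, mul_neg, neg_neg]
  have hF : ∀ a : ZMod m, ∑ k, χ (.r k) * ec m (a * k) = 0 := by
    intro a
    obtain ⟨j, hj, ha⟩ := natCast_or_neg a
    suffices h : ∑ k, χ (.r k) * ec m ((j : ZMod m) * k) = 0 by
      rcases ha with rfl | rfl
      · exact h
      · simp only [neg_mul]
        rw [hneg, h]
    by_cases hj0 : j = 0
    · subst hj0
      have h1 := horth _ (chi_mem s (Nat.zero_le m)) (hc1 0 (Nat.pos_of_neZero m))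
      have h2 := horth _ sgn_mem hc3
      rw [chi_zero] at h1
      simp only [sgn, mul_one, mul_neg, Finset.sum_neg_distrib] at h1 h2
      simp only [Nat.cast_zero, zero_mul, AddChar.map_zero_eq_one, mul_one]
      linear_combination (h1 + h2) / 2
    by_cases hj2 : 2 * j = m
    · have hm : Even m := ⟨j, by omega⟩
      have hjm : m / 2 = j := by omega
      obtain ⟨hn1, hn2⟩ := hc2 hm
      rw [chi'_eq s hm] at hn2
      rw [hjm] at hn1 hn2
      have h1 := horth _ (chi_mem s hj) hn1
      have h2 := horth _ (chi_mem (-s) hj) hn2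
      simp only [(chi_half (s := s) hj2).1, (chi_half (s := s) hj2).2,
        (chi_half (s := -s) hj2).1, (chi_half (s := -s) hj2).2, mul_neg, Units.val_neg,
        Int.cast_neg, neg_mul, Finset.sum_neg_distrib, hneg] at h1 h2
      linear_combination (h1 + h2) / 2
    · have h1 := horth _ (chi_mem s hj) (hc1 j (lt_of_le_of_ne hj hj2))
      simp only [(chi_two (s := s) hj0 hj2).1, (chi_two (s := s) hj0 hj2).2, mul_zero,
        Finset.sum_const_zero, add_zero, mul_add, mul_neg, neg_neg, Finset.sum_add_distrib,
        hneg] at h1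
      linear_combination h1 / 2
  have h0 : (m : ℂ) * χ 1 = 0 := by
    have h1 : ∑ a, ∑ k, χ (.r k) * ec m (a * k) = 0 := Finset.sum_eq_zero fun a _ => hF a
    rw [Finset.sum_comm] at h1
    rw [← h1, Finset.sum_eq_single 0]
    · simp [mul_comm]
    · intro k _ hk
      rw [← Finset.mul_sum, Finset.sum_congr rfl fun a _ => by rw [mul_comm a k], sum_ec, if_neg hk,
        mul_zero]
    · simp
  have h1 : χ 1 = 0 := (mul_eq_zero.1 h0).resolve_left (NeZero.ne _)
  obtain ⟨n, ρ, hρ, rfl⟩ := hχ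
  rw [Representation.char_one] at h1
  have h2 : n = 0 := by simpa using h1
  subst h2
  obtain ⟨U, V, hUV⟩ := hρ.exists_pair_ne
  refine hUV (SetLike.ext fun x => ?_)
  have : x = 0 := Subsingleton.elim _ _
  subst this
  exact ⟨fun _ => V.toSubmodule.zero_mem, fun _ => U.toSubmodule.zero_mem⟩

end

section

variable {m : ℕ} [NeZero m]

/-! ## Fake degrees -/

theorem q_ne_zero : q ≠ 0 := RatFunc.X_ne_zero

theorem C_inj {a b : ℂ} : (RatFunc.C a : F) = RatFunc.C b ↔ a = b := RatFunc.C_injective.eq_iff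

theorem q_pow_eq (n : ℕ) : q ^ n = algebraMap (Polynomial ℂ) F (Polynomial.X ^ n) := by simp

theorem q_pow_sub_one_ne_zero {n : ℕ} (hn : n ≠ 0) : q ^ n - 1 ≠ 0 := by
  have h : q ^ n - 1 = algebraMap (Polynomial ℂ) F (Polynomial.X ^ n - Polynomial.C 1) := by simp
  rw [h]
  exact RatFunc.algebraMap_ne_zero (Polynomial.X_pow_sub_C_ne_zero (Nat.pos_of_ne_zero hn) 1)

theorem q_sub_one_ne_zero : q - 1 ≠ 0 := by simpa using q_pow_sub_one_ne_zero one_ne_zero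

theorem q_sub_C_ne_zero (a : ℂ) : q - RatFunc.C a ≠ 0 := by
  have h : q - RatFunc.C a = algebraMap (Polynomial ℂ) F (Polynomial.X - Polynomial.C a) := by simp
  rw [h]
  exact RatFunc.algebraMap_ne_zero (Polynomial.X_sub_C_ne_zero a)

theorem poincare_eq (m : ℕ) : (q - 1) ^ 2 * poincare m = (q ^ 2 - 1) * (q ^ m - 1) := by
  have := q_sub_one_ne_zero
  rw [poincare]; field_simp

theorem poincare_ne_zero : poincare m ≠ 0 := by
  intro h
  have := poincare_eq m
  rw [h, mul_zero] at this
  exact mul_ne_zero (q_pow_sub_one_ne_zero two_ne_zero) (q_pow_sub_one_ne_zero (NeZero.ne m)) this.symm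

/-- `q^a + q^(m-a)` for `a` modulo `m`. -/
def AZ (m : ℕ) (a : ZMod m) : F := q ^ a.val + q ^ (m - a.val)

theorem AZ_natCast {n : ℕ} (hn : n ≤ m) : AZ m n = q ^ n + q ^ (m - n) := by
  rcases hn.eq_or_lt with rfl | h
  · simp [AZ, add_comm]
  · rw [AZ, ZMod.val_natCast_of_lt h]

theorem AZ_neg (a : ZMod m) : AZ m (-a) = AZ m a := by
  have h : a = ((a.val : ℕ) : ZMod m) := (ZMod.natCast_zmod_val a).symm
  have hv := (ZMod.val_lt a).le
  have h2 : -a = ((m - a.val : ℕ) : ZMod m) := by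
    rw [Nat.cast_sub hv, ZMod.natCast_self, ZMod.natCast_zmod_val]; ring
  rw [h2, AZ_natCast (Nat.sub_le _ _), AZ, Nat.sub_sub_self hv, add_comm]

theorem ec_pow_m (a : ZMod m) : ec m a ^ m = 1 := by
  rw [← AddChar.map_nsmul_eq_pow]; simp

theorem sum_zmod_val {M : Type*} [AddCommMonoid M] (f : ℕ → M) :
    ∑ a : ZMod m, f a.val = ∑ n ∈ Finset.range m, f n := by
  obtain ⟨m', rfl⟩ : ∃ m', m = m' + 1 := ⟨m - 1, (Nat.succ_pred_eq_of_ne_zero (NeZero.ne m)).symm⟩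
  exact Fin.sum_univ_eq_sum_range f (m' + 1)

/-- With `e = ec m k` and `e ^ m = 1`, the sum splits into two geometric series, with values `e (q^m
- 1)/(q - e)` and `q (q^m - 1)/(q - e⁻¹)`. Thus `AZ m` is, up to a scalar, the inverse Fourier
transform of the Molien terms of the rotations. -/
theorem sum_AZ_ec (k : ZMod m) :
    (∑ i, AZ m i * RatFunc.C (ec m (-(i * k)))) * ((q - RatFunc.C (ec m k)) *
      (q - RatFunc.C (ec m (-k)))) = (q ^ 2 - 1) * (q ^ m - 1) := by
  set e : F := RatFunc.C (ec m k) with he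
  have he0 : e ≠ 0 := by
    rw [he, Ne, map_eq_zero]; exact ec_ne_zero k
  have hem : e ^ m = 1 := by rw [he, ← map_pow, ec_pow_m, map_one]
  have hneg : RatFunc.C (ec m (-k)) = e⁻¹ := by rw [ec_neg, map_inv₀]
  have hi : ∀ n : ℕ, (RatFunc.C (ec m (-((n : ZMod m) * k))) : F) = (e⁻¹) ^ n := by
    intro n
    rw [← hneg, ← map_pow, ← AddChar.map_nsmul_eq_pow, nsmul_eq_mul, mul_neg]
  have hsum : ∑ i, AZ m i * RatFunc.C (ec m (-(i * k))) =
      ∑ n ∈ Finset.range m, (q ^ n + q ^ (m - n)) * (e⁻¹) ^ n := by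
    rw [← sum_zmod_val]
    refine Finset.sum_congr rfl fun i _ => ?_
    rw [← hi, ZMod.natCast_zmod_val, AZ]
  rw [hsum, hneg]
  have h1 : (∑ n ∈ Finset.range m, q ^ n * (e⁻¹) ^ n) * (q - e) = e * (q ^ m - 1) := by
    have := geom_sum_mul (q * e⁻¹) m
    simp only [mul_pow, inv_pow, hem, inv_one, mul_one] at this
    rw [← this]
    simp only [inv_pow]
    field_simp
  have h2 : (∑ n ∈ Finset.range m, q ^ (m - n) * (e⁻¹) ^ n) * (q - e⁻¹) = q * (q ^ m - 1) := by
    have h3 : ∑ n ∈ Finset.range m, q ^ (m - n) * (e⁻¹) ^ n =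
        ∑ n ∈ Finset.range m, q * e * (q * e) ^ n := by
      rw [← Finset.sum_range_reflect]
      refine Finset.sum_congr rfl fun n hn => ?_
      have hn' := Finset.mem_range.1 hn
      have h4 : m - (m - 1 - n) = n + 1 := by omega
      have h5 : (e⁻¹) ^ (m - 1 - n) = e ^ (n + 1) := by
        rw [inv_pow]
        refine inv_eq_of_mul_eq_one_left ?_
        rw [← pow_add, ← hem]
        congr 1
        omega
      rw [h4, h5]; ring
    have := geom_sum_mul (q * e) m
    rw [mul_pow, hem, mul_one] at this
    rw [h3, ← Finset.mul_sum, ← this]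
    field_simp
  simp only [add_mul, Finset.sum_add_distrib]
  have h3 : e * e⁻¹ = 1 := mul_inv_cancel₀ he0
  linear_combination (q - e⁻¹) * h1 + (q - e) * h2 - (q ^ m - 1) * h3

theorem sum_ec_mul_sum_AZ (a : ZMod m) :
    ∑ k, RatFunc.C (ec m (a * k)) * ∑ i, AZ m i * RatFunc.C (ec m (-(i * k))) = m * AZ m a := by
  simp only [Finset.mul_sum]
  rw [Finset.sum_comm, Finset.sum_eq_single a]
  · have : ∀ k, RatFunc.C (ec m (a * k)) * (AZ m a * RatFunc.C (ec m (-(a * k)))) = AZ m a := by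
      intro k
      have h1 : ec m (a * k) * ec m (-(a * k)) = 1 := by
        rw [← AddChar.map_add_eq_mul, add_neg_cancel, AddChar.map_zero_eq_one]
      have h2 : (RatFunc.C (ec m (a * k)) : F) * RatFunc.C (ec m (-(a * k))) = 1 := by
        rw [← map_mul, h1, map_one]
      linear_combination AZ m a * h2
    simp only [this]
    simp
  · intro i _ hi
    have : ∀ k, RatFunc.C (ec m (a * k)) * (AZ m i * RatFunc.C (ec m (-(i * k)))) =
        AZ m i * RatFunc.C (ec m ((a - i) * k)) := by
      intro k
      rw [sub_mul, sub_eq_add_neg, AddChar.map_add_eq_mul, map_mul RatFunc.C]; ring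
    simp only [this]
    rw [← Finset.mul_sum, ← map_sum, sum_ec, if_neg (sub_ne_zero.2 hi.symm), map_zero, mul_zero]
  · simp

theorem reflRep_r_det (k : ZMod m) : (reflRep m (.r k)).det = 1 := by
  simp only [reflRep, rot, Matrix.det_fin_two_of]
  have := Complex.cos_sq_add_sin_sq (2 * Real.pi * k.val / m : ℝ)
  rw [← Complex.ofReal_cos, ← Complex.ofReal_sin] at this
  linear_combination this

theorem reflRep_sr_det (k : ZMod m) : (reflRep m (.sr k)).det = -1 := by
  have h := reflRep_r_det k
  rw [reflRep] at h
  rw [reflRep, Matrix.det_mul, h, Matrix.det_fin_two_of]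
  norm_num

theorem ec_add_ec_neg (k : ZMod m) : ec m k + ec m (-k) = 2 * (Real.cos (2 * Real.pi * k.val / m) : ℂ) := by
  have := two_cos_eq 1 k
  simp only [Nat.cast_one, one_mul, mul_one] at this
  exact this.symm

theorem reflRep_r_charpoly (k : ZMod m) : algebraMap (Polynomial ℂ) F (reflRep m (.r k)).charpoly =
    (q - RatFunc.C (ec m k)) * (q - RatFunc.C (ec m (-k))) := by
  have h1 : (RatFunc.C (ec m k) : F) * RatFunc.C (ec m (-k)) = 1 := by
    rw [← map_mul, ← AddChar.map_add_eq_mul, add_neg_cancel, AddChar.map_zero_eq_one, map_one]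
  have h2 : (reflRep m (.r k)).trace = ec m k + ec m (-k) := by
    rw [ec_add_ec_neg, reflRep, rot, Matrix.trace_fin_two_of]; ring
  rw [Matrix.charpoly_fin_two, reflRep_r_det, h2]
  simp only [map_add, map_sub, map_mul, map_pow, RatFunc.algebraMap_X, RatFunc.algebraMap_C, map_one]
  linear_combination -h1

theorem reflRep_sr_charpoly (k : ZMod m) : algebraMap (Polynomial ℂ) F (reflRep m (.sr k)).charpoly =
    q ^ 2 - 1 := by
  have h2 : (reflRep m (.sr k)).trace = 0 := by
    rw [reflRep, rot, Matrix.mul_fin_two, Matrix.trace_fin_two_of]; ring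
  rw [Matrix.charpoly_fin_two, reflRep_sr_det, h2]
  simp only [map_add, map_sub, map_mul, map_pow, RatFunc.algebraMap_X, map_one,
    map_neg, map_zero]
  ring

/-- A rotation contributes through `sum_AZ_ec`; every reflection has determinant `-1` and the same
characteristic polynomial `q ^ 2 - 1`, so only the sum of `f` over the reflections matters. -/
theorem fakeDegree_eq_sum (f : DihedralGroup m → ℂ) : 2 * (m : F) * fakeDegree m f =
    ∑ k, RatFunc.C (f (.r k)) * ∑ i, AZ m i * RatFunc.C (ec m (-(i * k))) -
      (q ^ m - 1) * RatFunc.C (∑ k, f (.sr k)) := by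
  have hm : (m : F) ≠ 0 := Nat.cast_ne_zero.2 (NeZero.ne m)
  have h2 : (q ^ 2 - 1 : F) ≠ 0 := q_pow_sub_one_ne_zero two_ne_zero
  rw [fakeDegree, poincare_eq, DihedralGroup.nat_card, sum_dihedral]
  simp only [reflRep_r_det, reflRep_sr_det, reflRep_r_charpoly, reflRep_sr_charpoly]
  rw [← Finset.sum_div]
  have h3 : ∀ k : ZMod m, (q ^ 2 - 1) * (q ^ m - 1) * (RatFunc.C (1 * f (.r k)) /
      ((q - RatFunc.C (ec m k)) * (q - RatFunc.C (ec m (-k))))) =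
      RatFunc.C (f (.r k)) * ∑ i, AZ m i * RatFunc.C (ec m (-(i * k))) := by
    intro k
    rw [← sum_AZ_ec k]
    have h4 := q_sub_C_ne_zero (ec m k)
    have h5 := q_sub_C_ne_zero (ec m (-k))
    rw [one_mul]
    field_simp
  simp only [← h3, ← Finset.mul_sum]
  simp only [neg_mul, one_mul, map_neg, Finset.sum_neg_distrib, map_sum]
  push_cast
  field_simp
  ring

/-- Fourier inversion. The four exponentials are those that occur in a product of two characters of
degree two on the rotations. -/
theorem fakeDegree_eq {f : DihedralGroup m → ℂ} {c g : ℂ} {a b : ZMod m}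
    (hr : ∀ k, f (.r k) = c * (ec m (a * k) + ec m (-(a * k)) + ec m (b * k) + ec m (-(b * k))))
    (hs : ∑ k, f (.sr k) = m * g) :
    fakeDegree m f = RatFunc.C c * (AZ m a + AZ m b) - RatFunc.C (g / 2) * (q ^ m - 1) := by
  have hm : (m : F) ≠ 0 := Nat.cast_ne_zero.2 (NeZero.ne m)
  have h := fakeDegree_eq_sum f
  rw [hs] at h
  have h1 : ∀ k, (RatFunc.C (f (.r k)) : F) * ∑ i, AZ m i * RatFunc.C (ec m (-(i * k))) =
      RatFunc.C c * (RatFunc.C (ec m (a * k)) * ∑ i, AZ m i * RatFunc.C (ec m (-(i * k))) +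
        RatFunc.C (ec m (-a * k)) * ∑ i, AZ m i * RatFunc.C (ec m (-(i * k))) +
        RatFunc.C (ec m (b * k)) * ∑ i, AZ m i * RatFunc.C (ec m (-(i * k))) +
        RatFunc.C (ec m (-b * k)) * ∑ i, AZ m i * RatFunc.C (ec m (-(i * k)))) := by
    intro k
    rw [hr, map_mul, map_add, map_add, map_add, neg_mul, neg_mul]; ring
  simp only [h1, ← Finset.mul_sum, Finset.sum_add_distrib, sum_ec_mul_sum_AZ, AZ_neg] at h
  have h2 : (2 * m : F) ≠ 0 := mul_ne_zero two_ne_zero hm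
  refine mul_left_cancel₀ h2 (h.trans ?_)
  have h3 : (RatFunc.C g : F) = 2 * RatFunc.C (g / 2) := by
    rw [← map_ofNat RatFunc.C 2, ← map_mul]; congr 1; ring
  rw [map_mul, h3, map_natCast]
  ring

end

/-! ### Values of fake degrees, of `Ω`, and of `Ω` reduced by the sign character -/

section

variable {m : ℕ} [NeZero m]

/-- The character `χ_i` as an irreducible character (with junk value `χ_0` if `m < 2i`). -/
def irrChi (m : ℕ) [NeZero m] (s : ℤˣ) (i : ℕ) : Irr m :=
  if h : 2 * i ≤ m then ⟨chi m s i, chi_mem s h⟩ else ⟨chi m s 0, chi_mem s (Nat.zero_le m)⟩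

/-- The sign character as an irreducible character. -/
def irrSgn (m : ℕ) [NeZero m] : Irr m := ⟨sgn m, sgn_mem⟩

theorem irrChi_val {s : ℤˣ} {i : ℕ} (h : 2 * i ≤ m) : (irrChi m s i).1 = chi m s i := by
  rw [irrChi, dif_pos h]

theorem chi_sign {s : ℤˣ} (s' : ℤˣ) {i : ℕ} (h : 2 * i ≠ m) : chi m s i = chi m s' i := by
  ext (k | k) <;> simp [chi, h]

theorem irrChi_sign {s : ℤˣ} (s' : ℤˣ) {i : ℕ} (h : 2 * i < m) :
    irrChi m s i = irrChi m s' i :=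
  Subtype.ext (by rw [irrChi_val h.le, irrChi_val h.le, chi_sign s' h.ne])

/-- The weight of `χ_i` on the rotations. -/
def wt (m i : ℕ) : ℂ := if i = 0 ∨ 2 * i = m then 1 / 2 else 1

theorem chi_r_eq (s : ℤˣ) (i : ℕ) (k : ZMod m) :
    chi m s i (.r k) = wt m i * (ec m (i * k) + ec m (-(i * k))) := by
  by_cases hi : i = 0
  · subst hi
    rw [chi_zero]
    simp only [wt, true_or, if_true, Nat.cast_zero, zero_mul, neg_zero, AddChar.map_zero_eq_one]
    norm_num
  by_cases hi2 : 2 * i = m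
  · have hneg : -((i : ZMod m) * k) = i * k := by
      linear_combination (-k) * natCast_add_self hi2
    rw [(chi_half hi2).1, hneg, wt, if_pos (Or.inr hi2)]; ring
  · rw [(chi_two hi hi2).1, wt, if_neg (by tauto), one_mul]

theorem sgn_r_eq (k : ZMod m) :
    sgn m (.r k) = 1 / 2 * (ec m ((0 : ℕ) * k) + ec m (-((0 : ℕ) * k))) := by
  simp only [sgn, Nat.cast_zero, zero_mul, neg_zero, AddChar.map_zero_eq_one]
  norm_num

theorem fakeDegree_of_rot {χ : DihedralGroup m → ℂ} {i : ℕ} {w g : ℂ} (hi : 2 * i ≤ m)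
    (hr : ∀ k, χ (.r k) = w * (ec m (i * k) + ec m (-(i * k))))
    (hs : ∑ k, χ (.sr k) = m * g) :
    fakeDegree m χ = RatFunc.C w * (q ^ i + q ^ (m - i)) - RatFunc.C (g / 2) * (q ^ m - 1) := by
  rw [fakeDegree_eq (c := w / 2) (a := i) (b := i) (g := g) (fun k => by rw [hr]; ring) hs,
    AZ_natCast (by omega)]
  have : (RatFunc.C w : F) = 2 * RatFunc.C (w / 2) := by
    rw [← map_ofNat RatFunc.C 2, ← map_mul]; congr 1; ring
  rw [this]; ring

theorem Omega_of_rot {χ χ' : Irr m} {i j : ℕ} {w w' g : ℂ} (hij : i ≤ j) (hj : 2 * j ≤ m)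
    (hr : ∀ k, χ.1 (.r k) = w * (ec m (i * k) + ec m (-(i * k))))
    (hr' : ∀ k, χ'.1 (.r k) = w' * (ec m (j * k) + ec m (-(j * k))))
    (hs : ∑ k, χ.1 (.sr k) * χ'.1 (.sr k) = m * g) :
    Omega m χ χ' = q ^ m * (RatFunc.C (w * w') *
      (q ^ (i + j) + q ^ (m - (i + j)) + (q ^ (j - i) + q ^ (m - (j - i)))) +
      RatFunc.C (g / 2) * (q ^ m - 1)) := by
  rw [Omega, fakeDegree_eq (c := w * w') (a := (i + j : ℕ)) (b := (j - i : ℕ)) (g := -g),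
    AZ_natCast (by omega), AZ_natCast (by omega), neg_div, map_neg]
  · ring
  · intro k
    rw [reflRep_r_det, hr, hr', map_one, mul_one, Nat.cast_add, Nat.cast_sub hij, add_mul, sub_mul,
      neg_add, neg_sub, sub_eq_add_neg, sub_eq_add_neg]
    simp only [AddChar.map_add_eq_mul]
    ring
  · simp only [reflRep_sr_det]
    rw [mul_neg, ← hs, ← Finset.sum_neg_distrib]
    refine Finset.sum_congr rfl fun k _ => ?_
    simp

theorem sum_chi_sr_two {s : ℤˣ} {i : ℕ} (hi : i ≠ 0) (hi2 : 2 * i ≠ m) (f : ZMod m → ℂ) :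
    ∑ k, chi m s i (.sr k) * f k = m * 0 := by
  simp [(chi_two (s := s) hi hi2).2]

theorem sum_ec_half {i : ℕ} (hi : 2 * i = m) : ∑ k, ec m (i * k) = 0 := by
  rw [sum_ec, if_neg]
  rw [natCast_eq_zero_iff_of_lt (by have := Nat.pos_of_neZero m; omega)]
  rintro rfl
  exact NeZero.ne m (by simpa using hi.symm)

/-- The fake degree of `χ_i`. -/
theorem fakeDegree_chi_two (s : ℤˣ) {i : ℕ} (hi : i ≠ 0) (hi2 : 2 * i < m) :
    fakeDegree m (chi m s i) = q ^ i + q ^ (m - i) := by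
  have h := sum_chi_sr_two (s := s) hi hi2.ne (fun _ => 1)
  simp only [mul_one] at h
  rw [fakeDegree_of_rot hi2.le (chi_r_eq s i) h, wt, if_neg (by omega)]
  simp

theorem fakeDegree_chi_zero (s : ℤˣ) : fakeDegree m (chi m s 0) = 1 := by
  have h : ∑ k : ZMod m, chi m s 0 (.sr k) = m * 1 := by simp [chi_zero]
  rw [fakeDegree_of_rot (Nat.zero_le m) (chi_r_eq s 0) h, wt, if_pos (Or.inl rfl)]
  have h2 : (RatFunc.C (1 / 2 : ℂ) : F) * 2 = 1 := by
    rw [← map_ofNat RatFunc.C 2, ← map_mul]; simp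
  simp only [pow_zero, tsub_zero]
  linear_combination h2

theorem fakeDegree_sgn : fakeDegree m (sgn m) = q ^ m := by
  have h : ∑ k : ZMod m, sgn m (.sr k) = m * (-1) := by simp [sgn]
  rw [fakeDegree_of_rot (Nat.zero_le m) sgn_r_eq h]
  have h2 : (RatFunc.C (1 / 2 : ℂ) : F) * 2 = 1 := by
    rw [← map_ofNat RatFunc.C 2, ← map_mul]; simp
  simp only [pow_zero, tsub_zero, neg_div, map_neg]
  linear_combination q ^ m * h2

theorem fakeDegree_chi_half (s : ℤˣ) {i : ℕ} (hi : 2 * i = m) :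
    fakeDegree m (chi m s i) = q ^ i := by
  have h : ∑ k : ZMod m, chi m s i (.sr k) = m * 0 := by
    simp only [(chi_half (s := s) hi).2, ← Finset.mul_sum, sum_ec_half hi, mul_zero]
  rw [fakeDegree_of_rot hi.le (chi_r_eq s i) h, wt, if_pos (Or.inr hi)]
  have h2 : (RatFunc.C (1 / 2 : ℂ) : F) * 2 = 1 := by
    rw [← map_ofNat RatFunc.C 2, ← map_mul]; simp
  have h3 : m - i = i := by omega
  simp only [zero_div, map_zero, h3]
  linear_combination q ^ i * h2

theorem Omega_comm (χ χ' : Irr m) : Omega m χ χ' = Omega m χ' χ := by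
  rw [Omega, Omega]
  congr 2
  ext w
  ring

theorem Omega_sgn (χ : Irr m) : Omega m (irrSgn m) χ = q ^ m * fakeDegree m χ.1 := by
  rw [Omega]
  congr 2
  ext (k | k)
  · rw [reflRep_r_det]; simp [irrSgn, sgn]
  · rw [reflRep_sr_det]; simp [irrSgn, sgn]

theorem Omega_two_two (s : ℤˣ) {i j : ℕ} (hi : i ≠ 0) (hij : i ≤ j) (hj : 2 * j < m) :
    Omega m (irrChi m s i) (irrChi m s j) =
      q ^ m * (q ^ (i + j) + q ^ (m - (i + j)) + (q ^ (j - i) + q ^ (m - (j - i)))) := by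
  rw [Omega_of_rot (w := 1) (w' := 1) (g := 0) hij hj.le]
  · simp
  · intro k
    rw [irrChi_val (by omega), chi_r_eq, wt, if_neg (by omega)]
  · intro k
    rw [irrChi_val (by omega), chi_r_eq, wt, if_neg (by omega)]
  · rw [irrChi_val (by omega)]
    exact sum_chi_sr_two hi (by omega) _

theorem Omega_zero_two (s : ℤˣ) {j : ℕ} (hj0 : j ≠ 0) (hj : 2 * j < m) :
    Omega m (irrChi m s 0) (irrChi m s j) = q ^ m * (q ^ j + q ^ (m - j)) := by
  rw [Omega_of_rot (w := 1 / 2) (w' := 1) (g := 0) (Nat.zero_le j) hj.le]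
  · have h2 : (RatFunc.C (1 / 2 : ℂ) : F) * 2 = 1 := by
      rw [← map_ofNat RatFunc.C 2, ← map_mul]; simp
    simp only [zero_add, tsub_zero, zero_div, map_zero, mul_one]
    linear_combination q ^ m * (q ^ j + q ^ (m - j)) * h2
  · intro k
    rw [irrChi_val (by omega), chi_r_eq, wt, if_pos (by omega)]
  · intro k
    rw [irrChi_val (by omega), chi_r_eq, wt, if_neg (by omega)]
  · rw [irrChi_val (i := j) (by omega), ← sum_chi_sr_two (s := s) hj0 hj.ne]
    exact Finset.sum_congr rfl fun k _ => mul_comm _ _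

theorem Omega_zero_zero (s : ℤˣ) :
    Omega m (irrChi m s 0) (irrChi m s 0) = q ^ (2 * m) := by
  rw [Omega_of_rot (w := 1 / 2) (w' := 1 / 2) (g := 1) le_rfl (show 2 * 0 ≤ m from Nat.zero_le m)]
  · have h2 : (RatFunc.C (1 / 2 : ℂ) : F) * 2 = 1 := by
      rw [← map_ofNat RatFunc.C 2, ← map_mul]; simp
    simp only [zero_add, tsub_zero, map_mul, pow_zero, pow_mul']
    linear_combination q ^ m * ((1 + q ^ m) * RatFunc.C (1 / 2) + q ^ m) * h2
  · intro k
    rw [irrChi_val (by omega), chi_r_eq, wt, if_pos (by omega)]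
  · intro k
    rw [irrChi_val (by omega), chi_r_eq, wt, if_pos (by omega)]
  · rw [irrChi_val (by omega), chi_zero]; simp

theorem Omega_two_half (s s' : ℤˣ) {i j : ℕ} (hi : i ≠ 0) (hij : i < j) (hj : 2 * j = m) :
    Omega m (irrChi m s i) (irrChi m s' j) = q ^ m * (q ^ (j + i) + q ^ (j - i)) := by
  rw [Omega_of_rot (w := 1) (w' := 1 / 2) (g := 0) hij.le hj.le]
  · have h2 : (RatFunc.C (1 / 2 : ℂ) : F) * 2 = 1 := by
      rw [← map_ofNat RatFunc.C 2, ← map_mul]; simp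
    have h3 : m - (j + i) = j - i := by omega
    have h4 : m - (j - i) = j + i := by omega
    simp only [one_mul, zero_div, map_zero, add_comm i j, h3, h4]
    linear_combination q ^ m * (q ^ (j + i) + q ^ (j - i)) * h2
  · intro k
    rw [irrChi_val (by omega), chi_r_eq, wt, if_neg (by omega)]
  · intro k
    rw [irrChi_val (by omega), chi_r_eq, wt, if_pos (by omega)]
  · rw [irrChi_val (by omega)]
    exact sum_chi_sr_two hi (by omega) _

theorem Omega_zero_half (s s' : ℤˣ) {j : ℕ} (hj : 2 * j = m) :
    Omega m (irrChi m s 0) (irrChi m s' j) = q ^ m * q ^ j := by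
  rw [Omega_of_rot (w := 1 / 2) (w' := 1 / 2) (g := 0) (Nat.zero_le j) hj.le]
  · have h2 : (RatFunc.C (1 / 2 : ℂ) : F) * 2 = 1 := by
      rw [← map_ofNat RatFunc.C 2, ← map_mul]; simp
    have h3 : m - j = j := by omega
    simp only [zero_add, tsub_zero, zero_div, map_zero, map_mul, h3]
    linear_combination q ^ m * q ^ j * (2 * RatFunc.C (1 / 2) + 1) * h2
  · intro k
    rw [irrChi_val (by omega), chi_r_eq, wt, if_pos (by omega)]
  · intro k
    rw [irrChi_val (by omega), chi_r_eq, wt, if_pos (by omega)]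
  · rw [irrChi_val (i := j) (by omega), irrChi_val (by omega), chi_zero]
    simp only [(chi_half (s := s') hj).2, ← Finset.mul_sum, sum_ec_half hj, mul_zero]

theorem Omega_half_half (s s' : ℤˣ) {j : ℕ} (hj : 2 * j = m) :
    Omega m (irrChi m s j) (irrChi m s' j) = if s = s' then q ^ (2 * m) else q ^ m := by
  rw [Omega_of_rot (w := 1 / 2) (w' := 1 / 2) (g := if s = s' then 1 else -1) le_rfl hj.le]
  · have h2 : (RatFunc.C (1 / 2 : ℂ) : F) * 2 = 1 := by
      rw [← map_ofNat RatFunc.C 2, ← map_mul]; simp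
    have h4 : j + j = m := by omega
    simp only [h4, tsub_self, tsub_zero, pow_zero, map_mul, pow_mul']
    split_ifs
    · linear_combination q ^ m * ((1 + q ^ m) * RatFunc.C (1 / 2) + q ^ m) * h2
    · rw [neg_div, map_neg]
      linear_combination q ^ m * ((1 + q ^ m) * RatFunc.C (1 / 2) + 1) * h2
  · intro k
    rw [irrChi_val (by omega), chi_r_eq, wt, if_pos (by omega)]
  · intro k
    rw [irrChi_val (by omega), chi_r_eq, wt, if_pos (by omega)]
  · rw [irrChi_val (by omega), irrChi_val (by omega)]
    have h1 : ∀ k : ZMod m, ec m (j * k) * ec m (j * k) = 1 := by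
      intro k
      rw [← AddChar.map_add_eq_mul, ← add_mul, natCast_add_self hj, zero_mul,
        AddChar.map_zero_eq_one]
    have h2 : ∀ k : ZMod m, chi m s j (.sr k) * chi m s' j (.sr k) =
        if s = s' then 1 else -1 := by
      intro k
      rw [(chi_half (s := s) hj).2, (chi_half (s := s') hj).2]
      have h3 : ((s : ℤ) : ℂ) * ((s' : ℤ) : ℂ) = if s = s' then 1 else -1 := by
        rcases Int.units_eq_one_or s with rfl | rfl <;> rcases Int.units_eq_one_or s' with rfl | rfl <;>
          simp [show (-1 : ℤˣ) ≠ 1 by decide, show (1 : ℤˣ) ≠ -1 by decide]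
      rw [← h3]
      linear_combination ((s : ℤ) : ℂ) * ((s' : ℤ) : ℂ) * h1 k
    simp only [h2]
    simp

/-! ### The reduced matrix -/

/-- The matrix `Ω` after elimination of the sign character, divided by `q^m - 1`. -/
def redOmega (m : ℕ) [NeZero m] : Matrix (Irr m) (Irr m) F := fun χ χ' =>
  (Omega m χ χ' - fakeDegree m χ.1 * fakeDegree m χ'.1) / (q ^ m - 1)

theorem redOmega_mul (χ χ' : Irr m) : (q ^ m - 1) * redOmega m χ χ' =
    Omega m χ χ' - fakeDegree m χ.1 * fakeDegree m χ'.1 :=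
  mul_div_cancel₀ _ (q_pow_sub_one_ne_zero (NeZero.ne m))

theorem redOmega_comm (χ χ' : Irr m) : redOmega m χ χ' = redOmega m χ' χ := by
  rw [redOmega, redOmega, Omega_comm, mul_comm (fakeDegree m χ.1)]

theorem redOmega_eq_of_mul {χ χ' : Irr m} {x : F}
    (h : Omega m χ χ' - fakeDegree m χ.1 * fakeDegree m χ'.1 = (q ^ m - 1) * x) :
    redOmega m χ χ' = x := by
  rw [redOmega, h, mul_div_cancel_left₀ _ (q_pow_sub_one_ne_zero (NeZero.ne m))]

theorem redOmega_sgn (χ : Irr m) : redOmega m (irrSgn m) χ = 0 := by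
  refine redOmega_eq_of_mul ?_
  rw [Omega_sgn, irrSgn, fakeDegree_sgn]; ring

/-- Subtracting the product of fake degrees removes the exceptional shape at index `0`. What remains
is a function of the smaller index times a function of the larger index, which is the source of all
later linear relations between rows. -/
theorem redOmega_two_two (s : ℤˣ) {i j : ℕ} (hij : i ≤ j) (hj : 2 * j < m) :
    redOmega m (irrChi m s i) (irrChi m s j) = q ^ i * (q ^ j + q ^ (m - j)) := by
  refine redOmega_eq_of_mul ?_
  rw [irrChi_val (by omega), irrChi_val (by omega)]
  by_cases hi : i = 0
  · subst hi
    rw [fakeDegree_chi_zero]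
    by_cases hj0 : j = 0
    · subst hj0
      rw [Omega_zero_zero, fakeDegree_chi_zero, pow_mul', tsub_zero]; ring
    · rw [Omega_zero_two s hj0 hj, fakeDegree_chi_two s hj0 hj]; ring
  · rw [Omega_two_two s hi hij hj, fakeDegree_chi_two s hi (by omega),
      fakeDegree_chi_two s (by omega) hj]
    obtain ⟨a, rfl⟩ : ∃ a, j = i + a := ⟨j - i, by omega⟩
    obtain ⟨b, hb⟩ : ∃ b, m = 2 * i + a + b := ⟨m - (2 * i + a), by omega⟩
    have e1 : m - (i + (i + a)) = b := by omega
    have e2 : i + a - i = a := by omega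
    have e3 : m - a = 2 * i + b := by omega
    have e4 : m - i = i + a + b := by omega
    have e5 : m - (i + a) = i + b := by omega
    rw [e1, e2, e3, e4, e5, hb]
    ring

theorem redOmega_two_half (s s' : ℤˣ) {i j : ℕ} (hij : i < j) (hj : 2 * j = m) :
    redOmega m (irrChi m s i) (irrChi m s' j) = q ^ (i + j) := by
  refine redOmega_eq_of_mul ?_
  rw [irrChi_val (by omega), irrChi_val (by omega), fakeDegree_chi_half s' hj]
  by_cases hi : i = 0
  · subst hi
    rw [fakeDegree_chi_zero, Omega_zero_half s s' hj, zero_add]; ring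
  · rw [Omega_two_half s s' hi hij hj, fakeDegree_chi_two s hi (by omega)]
    obtain ⟨a, rfl⟩ : ∃ a, j = i + a := ⟨j - i, by omega⟩
    have e1 : i + a - i = a := by omega
    have e2 : m - i = i + a + a := by omega
    rw [e1, e2, ← hj]
    ring

/-- The characters `χ_r` and `χ_r'` are orthogonal for the reduced form: the chain of indices forks
at its end. -/
theorem redOmega_half_half (s s' : ℤˣ) {j : ℕ} (hj : 2 * j = m) :
    redOmega m (irrChi m s j) (irrChi m s' j) = if s = s' then q ^ m else 0 := by
  refine redOmega_eq_of_mul ?_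
  rw [irrChi_val (by omega), irrChi_val (by omega), fakeDegree_chi_half s hj,
    fakeDegree_chi_half s' hj, Omega_half_half s s' hj, ← pow_add, show j + j = m by omega]
  split_ifs <;> ring

end

section

variable {m : ℕ} [NeZero m]

/-! ### The `b`-invariants and the list of irreducible characters -/

theorem ordZero_X_pow_mul (n : ℕ) {p : Polynomial ℂ} (hp : p.coeff 0 ≠ 0) :
    ordZero (q ^ n * algebraMap (Polynomial ℂ) F p) = n := by
  have hp0 : p ≠ 0 := by rintro rfl; simp at hp
  rw [q_pow_eq, ← map_mul, ordZero, RatFunc.num_algebraMap, RatFunc.denom_algebraMap,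
    Polynomial.natTrailingDegree_mul (pow_ne_zero _ Polynomial.X_ne_zero) hp0,
    Polynomial.natTrailingDegree_X_pow, Polynomial.natTrailingDegree_one,
    Nat.le_zero.1 (Polynomial.natTrailingDegree_le_of_ne_zero hp)]
  simp

theorem ordZero_q_pow (n : ℕ) : ordZero (q ^ n) = n := by
  have := ordZero_X_pow_mul n (p := 1) (by simp)
  simpa using this

theorem bInv_irrChi (s : ℤˣ) {i : ℕ} (hi : 2 * i ≤ m) : bInv m (irrChi m s i) = i := by
  rw [bInv, irrChi_val hi]
  by_cases hi0 : i = 0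
  · subst hi0
    rw [fakeDegree_chi_zero]
    exact ordZero_q_pow 0
  by_cases hi2 : 2 * i = m
  · rw [fakeDegree_chi_half s hi2, ordZero_q_pow]
  · rw [fakeDegree_chi_two s hi0 (by omega)]
    have h1 : q ^ i + q ^ (m - i) = q ^ i * algebraMap (Polynomial ℂ) F (1 + Polynomial.X ^ (m - 2 * i)) := by
      rw [map_add, ← q_pow_eq, map_one, mul_add, mul_one, ← pow_add]
      congr 2
      omega
    rw [h1, ordZero_X_pow_mul]
    rw [Polynomial.coeff_add, Polynomial.coeff_X_pow, if_neg (by omega)]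
    simp

theorem bInv_irrSgn : bInv m (irrSgn m) = m := by
  rw [bInv, irrSgn, fakeDegree_sgn, ordZero_q_pow]

theorem irrChi_inj {s s' : ℤˣ} {i j : ℕ} (hi : 2 * i ≤ m) (hj : 2 * j ≤ m)
    (h : irrChi m s i = irrChi m s' j) : i = j := by
  have h1 := bInv_irrChi s hi
  rw [h, bInv_irrChi s' hj] at h1
  exact_mod_cast h1.symm

theorem irrChi_ne_irrSgn (s : ℤˣ) {i : ℕ} (hi : 2 * i ≤ m) : irrChi m s i ≠ irrSgn m := by
  intro h
  have h1 := bInv_irrChi s hi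
  rw [h, bInv_irrSgn] at h1
  have := Nat.pos_of_neZero m
  omega

theorem irrChi_half_ne {s s' : ℤˣ} (hs : s ≠ s') {r : ℕ} (hr : 2 * r = m) :
    irrChi m s r ≠ irrChi m s' r := by
  intro h
  have h1 := redOmega_half_half s s' hr
  rw [if_neg hs, ← h, redOmega_half_half s s hr, if_pos rfl] at h1
  exact pow_ne_zero _ q_ne_zero h1

theorem irr_cases (s : ℤˣ) (χ : Irr m) :
    (∃ i, 2 * i < m ∧ χ = irrChi m s i) ∨
    (∃ r, 2 * r = m ∧ (χ = irrChi m s r ∨ χ = irrChi m (-s) r)) ∨ χ = irrSgn m := by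
  rcases irrChars_cases s χ.2 with ⟨j, hj, h⟩ | ⟨hm, h⟩ | h
  · exact Or.inl ⟨j, hj, Subtype.ext (by rw [h, irrChi_val hj.le])⟩
  · have h2 : 2 * (m / 2) = m := Nat.two_mul_div_two_of_even hm
    refine Or.inr (Or.inl ⟨m / 2, h2, h.imp (fun h => Subtype.ext ?_) fun h => Subtype.ext ?_⟩)
    · rw [h, irrChi_val h2.le]
    · rw [h, irrChi_val h2.le, chi'_eq s hm]
  · exact Or.inr (Or.inr (Subtype.ext h))

theorem neg_unit_ne (s : ℤˣ) : s ≠ -s := by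
  rcases Int.units_eq_one_or s with rfl | rfl <;> decide

theorem sum_irr {M : Type*} [AddCommMonoid M] (s : ℤˣ) (f : Irr m → M) :
    ∑ χ, f χ = ∑ i ∈ Finset.range ((m + 1) / 2), f (irrChi m s i) +
      (if Even m then f (irrChi m s (m / 2)) + f (irrChi m (-s) (m / 2)) else 0) +
      f (irrSgn m) := by
  let A : Finset (Irr m) := (Finset.range ((m + 1) / 2)).image (irrChi m s)
  let B : Finset (Irr m) := if Even m then {irrChi m s (m / 2), irrChi m (-s) (m / 2)} else ∅
  have hA : ∀ χ, χ ∈ A ↔ ∃ i, 2 * i < m ∧ χ = irrChi m s i := by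
    intro χ
    simp only [A, Finset.mem_image, Finset.mem_range]
    exact exists_congr fun i => and_congr (by omega) eq_comm
  have hB : ∀ χ, χ ∈ B ↔ ∃ r, 2 * r = m ∧ (χ = irrChi m s r ∨ χ = irrChi m (-s) r) := by
    intro χ
    by_cases hm : Even m
    · have h2 : 2 * (m / 2) = m := Nat.two_mul_div_two_of_even hm
      simp only [B, if_pos hm, Finset.mem_insert, Finset.mem_singleton]
      constructor
      · exact fun h => ⟨m / 2, h2, h⟩
      · rintro ⟨r, hr, h⟩
        obtain rfl : r = m / 2 := by omega
        exact h
    · simp only [B, if_neg hm, Finset.notMem_empty, false_iff]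
      rintro ⟨r, hr, -⟩
      exact hm ⟨r, by omega⟩
  have hAB : Disjoint A B := by
    rw [Finset.disjoint_left]
    intro χ h1 h2
    obtain ⟨i, hi, rfl⟩ := (hA χ).1 h1
    obtain ⟨r, hr, h | h⟩ := (hB _).1 h2 <;>
    · have := irrChi_inj (by omega) (by omega) h
      omega
  have hC : Disjoint (A ∪ B) {irrSgn m} := by
    rw [Finset.disjoint_singleton_right, Finset.mem_union, hA, hB]
    rintro (⟨i, hi, h⟩ | ⟨r, hr, h | h⟩)
    · exact irrChi_ne_irrSgn s hi.le h.symm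
    · exact irrChi_ne_irrSgn s hr.le h.symm
    · exact irrChi_ne_irrSgn (-s) hr.le h.symm
  have huniv : (Finset.univ : Finset (Irr m)) = (A ∪ B) ∪ {irrSgn m} := by
    ext χ
    simp only [Finset.mem_univ, true_iff, Finset.mem_union, hA, hB, Finset.mem_singleton, or_assoc]
    exact irr_cases s χ
  rw [huniv, Finset.sum_union hC, Finset.sum_union hAB, Finset.sum_singleton]
  congr 2
  · refine Finset.sum_image fun i hi j hj h => ?_
    have hi' := Finset.mem_range.1 hi
    have hj' := Finset.mem_range.1 hj
    exact irrChi_inj (by omega) (by omega) h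
  · by_cases hm : Even m
    · have h2 : 2 * (m / 2) = m := Nat.two_mul_div_two_of_even hm
      simp only [B, if_pos hm]
      exact Finset.sum_pair (irrChi_half_ne (neg_unit_ne s) h2)
    · simp [B, if_neg hm]

/-! ### Nonsingularity of `Ω` -/

theorem inftyValuation_q_pow (n : ℕ) : RatFunc.inftyValuation ℂ (q ^ n) = WithZero.exp (n : ℤ) := by
  have := RatFunc.inftyValuation.X_zpow ℂ (n : ℤ)
  simpa only [zpow_natCast] using this

theorem inftyValuation_q_pow_lt {a b : ℕ} (h : a < b) :
    RatFunc.inftyValuation ℂ (q ^ a) < WithZero.exp (b : ℤ) := by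
  rw [inftyValuation_q_pow, WithZero.exp_lt_exp]
  exact_mod_cast h

theorem inftyValuation_add_lt {x y : F} {g : WithZero (Multiplicative ℤ)}
    (hx : RatFunc.inftyValuation ℂ x < g) (hy : RatFunc.inftyValuation ℂ y < g) :
    RatFunc.inftyValuation ℂ (x + y) < g :=
  Valuation.map_add_lt _ hx hy

theorem inftyValuation_Omega_irrChi_lt (s : ℤˣ) {i j : ℕ} (hij : i < j) (hj : 2 * j ≤ m) (s' : ℤˣ) :
    RatFunc.inftyValuation ℂ (Omega m (irrChi m s i) (irrChi m s' j)) < WithZero.exp ((2 * m : ℕ) : ℤ) := by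
  by_cases hj2 : 2 * j = m
  · by_cases hi : i = 0
    · subst hi
      rw [Omega_zero_half s s' hj2, ← pow_add]
      exact inftyValuation_q_pow_lt (by omega)
    · rw [Omega_two_half s s' hi hij hj2, mul_add, ← pow_add, ← pow_add]
      exact inftyValuation_add_lt (inftyValuation_q_pow_lt (by omega))
        (inftyValuation_q_pow_lt (by omega))
  · rw [irrChi_sign s (show 2 * j < m by omega)]
    by_cases hi : i = 0
    · subst hi
      rw [Omega_zero_two s (by omega) (by omega), mul_add, ← pow_add, ← pow_add]
      exact inftyValuation_add_lt (inftyValuation_q_pow_lt (by omega))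
        (inftyValuation_q_pow_lt (by omega))
    · rw [Omega_two_two s hi hij.le (by omega)]
      simp only [mul_add, ← pow_add]
      exact inftyValuation_add_lt
        (inftyValuation_add_lt (inftyValuation_q_pow_lt (by omega)) (inftyValuation_q_pow_lt (by omega)))
        (inftyValuation_add_lt (inftyValuation_q_pow_lt (by omega)) (inftyValuation_q_pow_lt (by omega)))

theorem inftyValuation_Omega_irrChi (s : ℤˣ) {i : ℕ} (hi : 2 * i ≤ m) :
    RatFunc.inftyValuation ℂ (Omega m (irrChi m s i) (irrChi m s i)) = WithZero.exp ((2 * m : ℕ) : ℤ) := by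
  by_cases hi2 : 2 * i = m
  · rw [Omega_half_half s s hi2, if_pos rfl, inftyValuation_q_pow]
  by_cases hi0 : i = 0
  · subst hi0
    rw [Omega_zero_zero, inftyValuation_q_pow]
  · rw [Omega_two_two s hi0 le_rfl (by omega), tsub_self, pow_zero, tsub_zero]
    have h : q ^ m * (q ^ (i + i) + q ^ (m - (i + i)) + (1 + q ^ m)) =
        q ^ (2 * m) + (q ^ (m + (i + i)) + q ^ (m + (m - (i + i))) + q ^ m) := by
      simp only [pow_add, two_mul]; ring
    rw [h, Valuation.map_add_eq_of_lt_left, inftyValuation_q_pow]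
    rw [inftyValuation_q_pow (2 * m)]
    exact inftyValuation_add_lt
      (inftyValuation_add_lt (inftyValuation_q_pow_lt (by omega)) (inftyValuation_q_pow_lt (by omega)))
      (inftyValuation_q_pow_lt (by omega))

theorem inftyValuation_fakeDegree_lt (s : ℤˣ) {i : ℕ} (hi : 2 * i ≤ m) :
    RatFunc.inftyValuation ℂ (q ^ m * fakeDegree m (irrChi m s i).1) <
      WithZero.exp ((2 * m : ℕ) : ℤ) := by
  have hm := Nat.pos_of_neZero m
  rw [irrChi_val hi]
  by_cases hi2 : 2 * i = m
  · rw [fakeDegree_chi_half s hi2, ← pow_add]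
    exact inftyValuation_q_pow_lt (by omega)
  by_cases hi0 : i = 0
  · subst hi0
    rw [fakeDegree_chi_zero, mul_one]
    exact inftyValuation_q_pow_lt (by omega)
  · rw [fakeDegree_chi_two s hi0 (by omega), mul_add, ← pow_add, ← pow_add]
    exact inftyValuation_add_lt (inftyValuation_q_pow_lt (by omega))
        (inftyValuation_q_pow_lt (by omega))

theorem irr_cases' (χ : Irr m) : (∃ s i, 2 * i ≤ m ∧ χ = irrChi m s i) ∨ χ = irrSgn m := by
  rcases irr_cases 1 χ with ⟨i, hi, h⟩ | ⟨r, hr, h | h⟩ | h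
  · exact Or.inl ⟨1, i, hi.le, h⟩
  · exact Or.inl ⟨1, r, hr.le, h⟩
  · exact Or.inl ⟨-1, r, hr.le, h⟩
  · exact Or.inr h

/-- At `q = ∞` all diagonal entries of `Ω` have degree `2m` and all other entries have smaller
degree. -/
theorem exists_vecMul_Omega_eq (Z : Set (Irr m)) (b : Irr m → F) :
    ∃ x : Irr m → F, (∀ z ∉ Z, x z = 0) ∧ ∀ w ∈ Z, Matrix.vecMul x (Omega m) w = b w := by
  refine exists_vecMul_eq_of_valuation (RatFunc.inftyValuation ℂ) (Omega m)
    (γ := WithZero.exp ((2 * m : ℕ) : ℤ)) WithZero.exp_ne_zero ?_ ?_ Z b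
  · intro χ
    rcases irr_cases' χ with ⟨s, i, hi, rfl⟩ | rfl
    · exact inftyValuation_Omega_irrChi s hi
    · rw [Omega_sgn, irrSgn, fakeDegree_sgn, ← pow_add, inftyValuation_q_pow, two_mul]
  · intro χ χ' hne
    rcases irr_cases' χ with ⟨s, i, hi, rfl⟩ | rfl <;>
    rcases irr_cases' χ' with ⟨s', j, hj, rfl⟩ | rfl
    · rcases lt_trichotomy i j with h | rfl | h
      · exact inftyValuation_Omega_irrChi_lt s h hj s'
      · by_cases hi2 : 2 * i = m
        · rw [Omega_half_half s s' hi2, if_neg (by rintro rfl; exact hne rfl)]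
          have hm := Nat.pos_of_neZero m
          exact inftyValuation_q_pow_lt (by omega)
        · exact absurd (irrChi_sign s' (by omega)) hne
      · rw [Omega_comm]
        exact inftyValuation_Omega_irrChi_lt s' h hi s
    · rw [Omega_comm, Omega_sgn]
      exact inftyValuation_fakeDegree_lt s hi
    · rw [Omega_sgn]
      exact inftyValuation_fakeDegree_lt s' hj
    · exact absurd rfl hne

theorem isUnit_det_Omega : IsUnit (Omega m).det := by
  rw [← Matrix.isUnit_iff_isUnit_det, ← Matrix.vecMul_surjective_iff_isUnit]
  intro b
  obtain ⟨x, -, hx⟩ := exists_vecMul_Omega_eq (m := m) Set.univ b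
  exact ⟨x, funext fun w => hx w trivial⟩

end

section

variable {m : ℕ}

/-! ## Green functions of a Lusztig–Shoji datum -/

/-- The classes of a datum, as a totally ordered set. -/
def Datum.Cls (D : Datum m) : Type := D.X

instance (D : Datum m) : LinearOrder D.Cls :=
  @linearOrderOfSTO D.X D.lt D.isStrictTotalOrder _

theorem Datum.lt_iff {D : Datum m} {C C' : D.Cls} : C < C' ↔ D.lt C C' := Iff.rfl

variable [NeZero m]

instance (D : Datum m) : Finite D.Cls := inferInstanceAs (Finite D.X)

/-- The class containing a character. -/
def Datum.supp (D : Datum m) (χ : Irr m) : D.Cls :=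
  ⟨(D.isPartition.2 χ).choose, (D.isPartition.2 χ).choose_spec.1.1⟩

variable {D : Datum m}

theorem Datum.mem_supp (D : Datum m) (χ : Irr m) : χ ∈ (D.supp χ).1 :=
  (D.isPartition.2 χ).choose_spec.1.2

theorem Datum.supp_eq (C : D.Cls) {χ : Irr m} (h : χ ∈ C.1) : D.supp χ = C :=
  Subtype.ext ((D.isPartition.2 χ).unique ⟨(D.supp χ).2, D.mem_supp χ⟩ ⟨C.2, h⟩)

theorem Datum.mem_iff {C : D.Cls} {χ : Irr m} : χ ∈ C.1 ↔ D.supp χ = C :=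
  ⟨D.supp_eq C, fun h => h ▸ D.mem_supp χ⟩

theorem Datum.exists_supp (C : D.Cls) : ∃ χ, D.supp χ = C := by
  have h : C.1 ≠ ∅ := fun h => D.isPartition.1 (h ▸ C.2)
  obtain ⟨χ, hχ⟩ := Set.nonempty_iff_ne_empty.2 h
  exact ⟨χ, D.supp_eq C hχ⟩

theorem isGreenSystem_iff {P Λ : Matrix (Irr m) (Irr m) F} : IsGreenSystem m D P Λ ↔
    IsBlockDecomp D.supp (fun C : D.Cls => q ^ D.a C) (Omega m) P Λ := by
  constructor
  · intro h
    exact ⟨h.equation, fun i j hij => h.P_lt _ _ (Datum.lt_iff.1 hij) _ (D.mem_supp i) _ (D.mem_supp j),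
      fun i => h.P_diag _ _ (D.mem_supp i),
      fun i j hij hne => h.P_block _ _ (D.mem_supp i) _ (hij ▸ D.mem_supp j) hne,
      fun i j hij => h.Λ_block _ _ hij _ (D.mem_supp i) _ (D.mem_supp j)⟩
  · intro h
    refine ⟨h.equation, fun C C' hlt χ hχ χ' hχ' => h.lt _ _ ?_, fun C χ hχ => ?_,
      fun C χ hχ χ' hχ' hne => h.block _ _ ?_ hne, fun C C' hne χ hχ χ' hχ' => h.block_diag _ _ ?_⟩
    · rw [D.supp_eq C hχ, D.supp_eq C' hχ']; exact Datum.lt_iff.2 hlt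
    · rw [h.diag, D.supp_eq C hχ]
    · rw [D.supp_eq C hχ, D.supp_eq C hχ']
    · rw [D.supp_eq C hχ, D.supp_eq C' hχ']; exact hne

theorem exists_isGreenSystem (D : Datum m) : ∃ P Λ, IsGreenSystem m D P Λ := by
  simp only [isGreenSystem_iff]
  exact exists_isBlockDecomp _ _ (fun _ => pow_ne_zero _ q_ne_zero) _ Omega_comm
    exists_vecMul_Omega_eq

open Matrix in
/-- A linear relation between rows of the reduced matrix determines entries of `P`. -/
theorem IsGreenSystem.apply_eq {P Λ : Matrix (Irr m) (Irr m) F} (h : IsGreenSystem m D P Λ)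
    (hE : ∀ χ, D.supp (irrSgn m) ≤ D.supp χ) {i j z₁ z₂ z₃ : Irr m} {c₁ c₂ c₃ : F}
    (h₁ : D.supp z₁ ≤ D.supp j) (h₂ : D.supp z₂ ≤ D.supp j) (h₃ : D.supp z₃ ≤ D.supp j)
    (hM : ∀ w, D.supp w ≤ D.supp j → w ≠ irrSgn m →
      c₁ * redOmega m z₁ w + c₂ * redOmega m z₂ w + c₃ * redOmega m z₃ w = redOmega m i w)
    (hj : j ≠ irrSgn m) :
    P i j = ((if j = z₁ then c₁ else 0) + (if j = z₂ then c₂ else 0) +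
      (if j = z₃ then c₃ else 0)) * q ^ D.a (D.supp j) := by
  -- The row of `ε` in `Ω` is `q ^ m` times the row of fake degrees. With coefficient `γ` it
  -- corrects the terms lost in passing from `Ω` to `redOmega`, so that the relation holds for `Ω`
  -- itself.
  set γ : F := (fakeDegree m i.1 - (c₁ * fakeDegree m z₁.1 + c₂ * fakeDegree m z₂.1 +
    c₃ * fakeDegree m z₃.1)) / q ^ m with hγ
  have hγ' : γ * q ^ m = fakeDegree m i.1 - (c₁ * fakeDegree m z₁.1 + c₂ * fakeDegree m z₂.1 +
    c₃ * fakeDegree m z₃.1) := div_mul_cancel₀ _ (pow_ne_zero _ q_ne_zero)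
  have h4 := (isGreenSystem_iff.1 h).apply_eq (fun _ => pow_ne_zero _ q_ne_zero) isUnit_det_Omega
    (i := i) (c := D.supp j) (j := j) (x := c₁ • Pi.single z₁ 1 + c₂ • Pi.single z₂ 1 +
      c₃ • Pi.single z₃ 1 + γ • Pi.single (irrSgn m) 1) ?_ ?_ rfl
  · rw [h4]
    simp only [Pi.add_apply, Pi.smul_apply, Pi.single_apply, smul_eq_mul, mul_ite, mul_one,
      mul_zero, if_neg hj, add_zero]
  · intro z hz
    have e₁ : z ≠ z₁ := by rintro rfl; exact not_lt_of_ge h₁ hz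
    have e₂ : z ≠ z₂ := by rintro rfl; exact not_lt_of_ge h₂ hz
    have e₃ : z ≠ z₃ := by rintro rfl; exact not_lt_of_ge h₃ hz
    have e₄ : z ≠ irrSgn m := by rintro rfl; exact not_lt_of_ge (hE j) hz
    simp [e₁, e₂, e₃, e₄]
  · intro w hw
    simp only [add_vecMul, smul_vecMul, single_one_vecMul, Pi.add_apply, Pi.smul_apply, row_apply,
      smul_eq_mul]
    have hΩ : ∀ z, Omega m z w = (q ^ m - 1) * redOmega m z w +
        fakeDegree m z.1 * fakeDegree m w.1 := fun z => by rw [redOmega_mul]; ring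
    have h5 : c₁ * redOmega m z₁ w + c₂ * redOmega m z₂ w + c₃ * redOmega m z₃ w =
        redOmega m i w := by
      by_cases hwE : w = irrSgn m
      · subst hwE
        simp only [fun z => redOmega_comm z (irrSgn m), redOmega_sgn]; ring
      · exact hM w hw hwE
    rw [Omega_sgn, hΩ z₁, hΩ z₂, hΩ z₃, hΩ i]
    linear_combination (q ^ m - 1) * h5 + fakeDegree m w.1 * hγ'

open Matrix in
-- The smallest class is `{ε}`, so only one column has to be matched: the entries of the rows of `χ`
-- and `ε` there are `q ^ m` times the fake degree of `χ`, and `q ^ (2 * m)`.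
theorem IsGreenSystem.apply_sgn {P Λ : Matrix (Irr m) (Irr m) F} (h : IsGreenSystem m D P Λ)
    (hE : ∀ χ, χ ≠ irrSgn m → D.supp (irrSgn m) < D.supp χ) (ha : D.a (D.supp (irrSgn m)) = m)
    (i : Irr m) : P i (irrSgn m) = fakeDegree m i.1 := by
  rw [(isGreenSystem_iff.1 h).apply_eq (fun _ => pow_ne_zero _ q_ne_zero) isUnit_det_Omega
    (i := i) (c := D.supp (irrSgn m)) (j := irrSgn m)
    (x := (fakeDegree m i.1 / q ^ m) • Pi.single (irrSgn m) 1) ?_ ?_ rfl]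
  · simp only [Pi.smul_apply, Pi.single_eq_same, smul_eq_mul, mul_one, ha]
    exact div_mul_cancel₀ _ (pow_ne_zero _ q_ne_zero)
  · intro z hz
    have e₄ : z ≠ irrSgn m := by rintro rfl; exact lt_irrefl _ hz
    simp [e₄]
  · intro w hw
    obtain rfl : w = irrSgn m := by
      by_contra hne
      exact not_lt_of_ge hw (hE w hne)
    rw [smul_vecMul, single_one_vecMul, Pi.smul_apply, row_apply, smul_eq_mul, Omega_sgn,
      Omega_comm, Omega_sgn, irrSgn, fakeDegree_sgn]
    have : q ^ m ≠ 0 := pow_ne_zero _ q_ne_zero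
    field_simp

/-! ### Linear relations between rows of the reduced matrix -/

theorem q_pow_ne_one_aux {n : ℕ} (hn : n ≠ 0) : (q ^ (2 * n) - 1 : F) ≠ 0 :=
  q_pow_sub_one_ne_zero (by omega)

/-- The coefficient of the row of `χ_j` in the expression of the row of `χ_i` by those of `χ_j` and
`χ_l`. -/
def coefL (j i l : ℕ) : F := q ^ (i - j) * (q ^ (2 * (l - i)) - 1) / (q ^ (2 * (l - j)) - 1)

/-- The coefficient of the row of `χ_l` in the expression of the row of `χ_i` by those of `χ_j` and
`χ_l`. -/
def coefR (j i l : ℕ) : F := q ^ (l - i) * (q ^ (2 * (i - j)) - 1) / (q ^ (2 * (l - j)) - 1)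

/-- The coefficients are those which express the value at `i` by the values at `j` and `l` for all
combinations of the functions `q ^ n` and `q ^ (-n)` of `n`. This is the case of `q ^ n`;
`coef_pow_sub` is that of `q ^ (-n)`, scaled by `q ^ m`. -/
theorem coef_pow {j i l : ℕ} (hji : j < i) (hil : i < l) :
    coefL j i l * q ^ j + coefR j i l * q ^ l = q ^ i := by
  obtain ⟨a, rfl⟩ : ∃ a, i = j + a := ⟨i - j, by omega⟩
  obtain ⟨b, rfl⟩ : ∃ b, l = j + a + b := ⟨l - (j + a), by omega⟩
  have e1 : j + a - j = a := by omega
  have e2 : j + a + b - (j + a) = b := by omega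
  have e3 : j + a + b - j = a + b := by omega
  rw [coefL, coefR, e1, e2, e3]
  have := q_pow_ne_one_aux (n := a + b) (by omega)
  field_simp
  ring

theorem coef_pow_sub {j i l : ℕ} (hji : j < i) (hil : i < l) (hl : l ≤ m) :
    coefL j i l * q ^ (m - j) + coefR j i l * q ^ (m - l) = q ^ (m - i) := by
  obtain ⟨a, rfl⟩ : ∃ a, i = j + a := ⟨i - j, by omega⟩
  obtain ⟨b, rfl⟩ : ∃ b, l = j + a + b := ⟨l - (j + a), by omega⟩
  obtain ⟨c, hc⟩ : ∃ c, m = j + a + b + c := ⟨m - (j + a + b), by omega⟩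
  have e1 : j + a - j = a := by omega
  have e2 : j + a + b - (j + a) = b := by omega
  have e3 : j + a + b - j = a + b := by omega
  have e4 : m - j = a + b + c := by omega
  have e5 : m - (j + a) = b + c := by omega
  have e6 : m - (j + a + b) = c := by omega
  rw [coefL, coefR, e1, e2, e3, e4, e5, e6]
  have := q_pow_ne_one_aux (n := a + b) (by omega)
  field_simp
  ring

theorem redOmega_two_two' (s s' : ℤˣ) {i j : ℕ} (hij : i ≤ j) (hj : 2 * j < m) :
    redOmega m (irrChi m s i) (irrChi m s' j) = q ^ i * (q ^ j + q ^ (m - j)) := by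
  rw [irrChi_sign s (i := j) hj, redOmega_two_two s hij hj]

theorem redOmega_left {s s' : ℤˣ} {i w : ℕ} (hiw : i ≤ w) (hw : 2 * w ≤ m) (hi : 2 * i < m) :
    redOmega m (irrChi m s i) (irrChi m s' w) =
      q ^ i * if 2 * w = m then q ^ w else q ^ w + q ^ (m - w) := by
  split_ifs with h
  · rw [redOmega_two_half s s' (by omega) h, pow_add]
  · exact redOmega_two_two' s s' hiw (by omega)

/-- For a fixed column `w`, the entry as a function of the row index `n` is a multiple of `q ^ n`
for `n ≤ w`, and of `q ^ n + q ^ (m - n)` for `n ≥ w`. If `w` is not strictly between `j` and `l`, a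
single one of these formulas holds at `j`, `i` and `l`, and it is interpolated. -/
theorem row_between {s s' : ℤˣ} {j i l w : ℕ} (hji : j < i) (hil : i < l) (hl : 2 * l < m)
    (hw : 2 * w ≤ m) (hjw : w ≤ j ∨ l ≤ w) :
    coefL j i l * redOmega m (irrChi m s j) (irrChi m s' w) +
      coefR j i l * redOmega m (irrChi m s l) (irrChi m s' w) =
      redOmega m (irrChi m s i) (irrChi m s' w) := by
  have h1 := coef_pow hji hil
  rcases hjw with h | h
  · have h2 := coef_pow_sub (m := m) hji hil (by omega)
    simp only [fun x => redOmega_comm (irrChi m s x) (irrChi m s' w)]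
    rw [redOmega_two_two' s' s h (by omega), redOmega_two_two' s' s (j := l) (by omega) (by omega),
      redOmega_two_two' s' s (j := i) (by omega) (by omega)]
    linear_combination q ^ w * (h1 + h2)
  · rw [redOmega_left (by omega) hw (by omega), redOmega_left (by omega) hw (by omega),
      redOmega_left (by omega) hw (by omega)]
    linear_combination (if 2 * w = m then q ^ w else q ^ w + q ^ (m - w)) * h1

/-- The rows of `χ_r` and `χ_r'` together take the place of the right neighbour: their sum has the
entry `2 q ^ (w + r)` in a column `w ≤ j`, and `q ^ (2 * r)` in each of the columns of `χ_r` and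
`χ_r'`. -/
theorem row_fork {s s' : ℤˣ} {j i r w : ℕ} (hji : j < i) (hir : i < r) (hr : 2 * r = m)
    (hjw : w ≤ j ∨ w = r) :
    coefL j i r * redOmega m (irrChi m s j) (irrChi m s' w) +
      coefR j i r * redOmega m (irrChi m s r) (irrChi m s' w) +
      coefR j i r * redOmega m (irrChi m (-s) r) (irrChi m s' w) =
      redOmega m (irrChi m s i) (irrChi m s' w) := by
  have h1 := coef_pow hji hir
  rcases hjw with h | rfl
  · have h2 := coef_pow_sub (m := m) hji hir (by omega)
    rw [show m - r = r by omega] at h2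
    simp only [fun x t => redOmega_comm (irrChi m t x) (irrChi m s' w)]
    rw [redOmega_two_two' s' s h (by omega), redOmega_two_half s' s (by omega) hr,
      redOmega_two_half s' (-s) (by omega) hr,
      redOmega_two_two' s' s (j := i) (by omega) (by omega), pow_add]
    linear_combination q ^ w * (h1 + h2)
  · rw [redOmega_two_half s s' (by omega) hr, redOmega_half_half s s' hr,
      redOmega_half_half (-s) s' hr, redOmega_two_half s s' hir hr]
    have h3 : (if s = s' then q ^ m else (0 : F)) + (if -s = s' then q ^ m else 0) = q ^ m := by
      rcases Int.units_eq_one_or s with rfl | rfl <;> rcases Int.units_eq_one_or s' with rfl | rfl <;>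
        simp [show (-1 : ℤˣ) ≠ 1 by decide, show (1 : ℤˣ) ≠ -1 by decide]
    have h4 : q ^ m = q ^ w * q ^ w := by rw [← pow_add]; congr 1; omega
    rw [h4] at h3 ⊢
    simp only [pow_add]
    linear_combination q ^ w * h1 + coefR j i w * h3

/-- To the left of all columns considered, the rows are proportional to `q ^ n`. -/
theorem row_left {s s' : ℤˣ} {i j w : ℕ} (hij : i ≤ j) (hjw : j ≤ w) (hw : 2 * w ≤ m) (hj : 2 * j < m) :
    q ^ (-((j - i : ℕ) : ℤ)) * redOmega m (irrChi m s j) (irrChi m s' w) =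
      redOmega m (irrChi m s i) (irrChi m s' w) := by
  rw [redOmega_left hjw hw hj, redOmega_left (by omega) hw (by omega), ← mul_assoc]
  congr 1
  rw [zpow_neg, zpow_natCast, ← Nat.sub_add_cancel hij]
  have := q_ne_zero
  rw [pow_add, Nat.add_sub_cancel]
  field_simp

theorem q_pow_add_q_pow_ne_zero {a b : ℕ} : (q ^ a + q ^ b : F) ≠ 0 := by
  have h : (q ^ a + q ^ b : F) = algebraMap (Polynomial ℂ) F (Polynomial.X ^ a + Polynomial.X ^ b) := by
    rw [map_add, q_pow_eq, q_pow_eq]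
  rw [h]
  refine RatFunc.algebraMap_ne_zero fun h0 => ?_
  have := congrArg (Polynomial.eval 1) h0
  norm_num at this

/-- To the right of all columns considered, the rows are proportional to `q ^ n + q ^ (m - n)`, or
to `q ^ r` for `χ_r` and `χ_r'`. -/
theorem row_right {s s' : ℤˣ} {t i w : ℕ} (hti : t ≤ i) (hi : 2 * i ≤ m) (ht : 2 * t < m)
    (hwt : w ≤ t) :
    (if 2 * i = m then q ^ i else q ^ i + q ^ (m - i)) / (q ^ t + q ^ (m - t)) *
      redOmega m (irrChi m s t) (irrChi m s' w) = redOmega m (irrChi m s i) (irrChi m s' w) := by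
  rw [redOmega_comm, redOmega_comm (irrChi m s i), redOmega_left hwt ht.le (by omega),
    redOmega_left (by omega) hi (by omega), if_neg ht.ne]
  have := q_pow_add_q_pow_ne_zero (a := t) (b := m - t)
  field_simp

/-! ### Rational functions that are not polynomials -/

theorem eval_eq_zero_of_mul_eq {p D N : Polynomial ℂ} (h : algebraMap (Polynomial ℂ) F p *
    algebraMap (Polynomial ℂ) F D = algebraMap (Polynomial ℂ) F N) {ξ : ℂ} (hD : D.eval ξ = 0) :
    N.eval ξ = 0 := by
  rw [← map_mul] at h
  rw [← RatFunc.algebraMap_injective ℂ h, Polynomial.eval_mul, hD, mul_zero]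

/-- A primitive root of unity of order `2 * b` is a zero of the left side but not of the right side.
-/
theorem not_polynomial_of_lt {p : Polynomial ℂ} {e a b : ℕ} (ha : a ≠ 0) (hab : a < b)
    (h : algebraMap (Polynomial ℂ) F p * (q ^ (2 * b) - 1) = q ^ e * (q ^ (2 * a) - 1)) : False := by
  have hξ := Complex.isPrimitiveRoot_exp (2 * b) (by omega)
  set ξ := Complex.exp (2 * Real.pi * Complex.I / (2 * b : ℕ))
  have h1 := eval_eq_zero_of_mul_eq (p := p) (D := Polynomial.X ^ (2 * b) - 1)
    (N := Polynomial.X ^ e * (Polynomial.X ^ (2 * a) - 1)) (ξ := ξ) (by simpa using h)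
    (by simp [hξ.pow_eq_one])
  simp only [Polynomial.eval_mul, Polynomial.eval_pow, Polynomial.eval_X, Polynomial.eval_sub,
    Polynomial.eval_one] at h1
  refine mul_ne_zero (pow_ne_zero _ (hξ.ne_zero (by omega))) (sub_ne_zero.2 ?_) h1
  exact hξ.pow_ne_one_of_pos_of_lt (by omega) (by omega)

theorem exists_pow_eq_neg_one {b : ℕ} (hb : b ≠ 0) :
    ∃ ξ : ℂ, ξ ≠ 0 ∧ ξ ^ b = -1 ∧ ∀ a < b, ξ ^ a ≠ -1 := by
  have hξ := Complex.isPrimitiveRoot_exp (2 * b) (by omega)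
  set ξ := Complex.exp (2 * Real.pi * Complex.I / (2 * b : ℕ))
  refine ⟨ξ, hξ.ne_zero (by omega), ?_, fun a hab h => ?_⟩
  · have h1 : ξ ^ b * ξ ^ b = 1 := by rw [← pow_add, ← two_mul]; exact hξ.pow_eq_one
    exact (mul_self_eq_one_iff.1 h1).resolve_left (hξ.pow_ne_one_of_pos_of_lt hb (by omega))
  · by_cases ha : a = 0
    · subst ha
      norm_num at h
    · refine hξ.pow_ne_one_of_pos_of_lt (l := 2 * a) (by omega) (by omega) ?_
      rw [pow_mul', h]; norm_num

/-- A primitive root of unity `ξ` of order `2 * (m - 2 * t)` satisfies `ξ ^ (m - 2 * t) = -1` and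
kills the left side. The right side could vanish only if `ξ ^ (m - 2 * i) = -1`, which is impossible
for the smaller exponent. -/
theorem not_polynomial_top {p : Polynomial ℂ} {e i t : ℕ} (hti : t < i) (hi : 2 * i ≤ m)
    (h : algebraMap (Polynomial ℂ) F p * (q ^ t + q ^ (m - t)) =
      q ^ e * (if 2 * i = m then q ^ i else q ^ i + q ^ (m - i))) : False := by
  obtain ⟨ξ, hξ0, hξ1, hξ2⟩ := exists_pow_eq_neg_one (b := m - 2 * t) (by omega)
  have h1 := eval_eq_zero_of_mul_eq (p := p) (D := Polynomial.X ^ t + Polynomial.X ^ (m - t))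
    (N := Polynomial.X ^ e * (if 2 * i = m then Polynomial.X ^ i else
      Polynomial.X ^ i + Polynomial.X ^ (m - i))) (ξ := ξ) (by
        rw [map_add, ← q_pow_eq, ← q_pow_eq, h, map_mul, ← q_pow_eq]
        split_ifs
        · rw [← q_pow_eq]
        · rw [map_add, ← q_pow_eq, ← q_pow_eq])
    (by
      have : m - t = t + (m - 2 * t) := by omega
      simp [this, pow_add, hξ1])
  split_ifs at h1 with h2
  · simp [hξ0] at h1
  · have h3 : m - i = i + (m - 2 * i) := by omega
    rw [h3] at h1
    simp only [Polynomial.eval_mul, Polynomial.eval_add, Polynomial.eval_pow, Polynomial.eval_X,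
      pow_add] at h1
    rw [mul_eq_zero, or_iff_right (pow_ne_zero _ hξ0), ← mul_one_add, mul_eq_zero,
      or_iff_right (pow_ne_zero _ hξ0)] at h1
    exact hξ2 (m - 2 * i) (by omega) (by linear_combination h1)

theorem not_natPolynomial_neg {p : Polynomial ℕ} {a b : ℕ}
    (h : algebraMap (Polynomial ℂ) F (p.map (Nat.castRingHom ℂ)) * q ^ a = -q ^ b) : False := by
  have h1 : p.map (Nat.castRingHom ℂ) * Polynomial.X ^ a = -Polynomial.X ^ b :=
    RatFunc.algebraMap_injective ℂ (by rw [map_mul, map_neg, ← q_pow_eq, ← q_pow_eq, h])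
  have h2 := congrArg (Polynomial.eval 1) h1
  rw [Polynomial.eval_mul, Polynomial.eval_pow, Polynomial.eval_X, Polynomial.eval_neg,
    Polynomial.eval_pow, Polynomial.eval_X, one_pow, one_pow, mul_one] at h2
  have h3 := Polynomial.eval_natCast_map (Nat.castRingHom ℂ) p 1
  rw [Nat.cast_one] at h3
  rw [h3] at h2
  rw [Nat.cast_one] at h2
  have h4 : ((p.eval 1 + 1 : ℕ) : ℂ) = 0 := by
    push_cast
    simp only [eq_natCast] at h2
    rw [h2]; ring
  exact absurd (Nat.cast_eq_zero.1 h4) (by omega)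

end

section

variable {m : ℕ} [NeZero m]

/-! ## Springer correspondences: necessary conditions -/

/-- The set `S` consists of characters, contains `χ_0`, `χ_1` and `ε`, and `d_0 < ⋯ < d_N` are the
indices `i < m/2` with `χ_i ∈ S`. -/
structure IsLabelled (m : ℕ) [NeZero m] (s : ℤˣ) (S : Set (DihedralGroup m → ℂ)) (N : ℕ)
    (d : ℕ → ℕ) : Prop where
  three_le : 3 ≤ m
  subset : S ⊆ irrChars m
  zero_mem : chi m s 0 ∈ S
  one_mem : chi m s 1 ∈ S
  sgn_mem : sgn m ∈ S
  label : Even m → chi m s (m / 2) ∈ S → chi' m s ∈ S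
  strictMono : StrictMonoOn d (Set.Iic N)
  image : d '' Set.Iic N = {i | 2 * i < m ∧ chi m s i ∈ S}

variable {s : ℤˣ} {S : Set (DihedralGroup m → ℂ)} {N : ℕ} {d : ℕ → ℕ}

namespace IsLabelled

theorem two_mul_lt (h : IsLabelled m s S N d) {k : ℕ} (hk : k ≤ N) : 2 * d k < m := by
  have : d k ∈ d '' Set.Iic N := ⟨k, hk, rfl⟩
  rw [h.image] at this
  exact this.1

theorem mem (h : IsLabelled m s S N d) {k : ℕ} (hk : k ≤ N) : chi m s (d k) ∈ S := by
  have : d k ∈ d '' Set.Iic N := ⟨k, hk, rfl⟩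
  rw [h.image] at this
  exact this.2

theorem irrChi_mem (h : IsLabelled m s S N d) {k : ℕ} (hk : k ≤ N) :
    (irrChi m s (d k)).1 ∈ S := by
  rw [irrChi_val (h.two_mul_lt hk).le]
  exact h.mem hk

theorem exists_eq (h : IsLabelled m s S N d) {i : ℕ} (hi : 2 * i < m) (hS : chi m s i ∈ S) :
    ∃ k ≤ N, d k = i := by
  have : i ∈ d '' Set.Iic N := by rw [h.image]; exact ⟨hi, hS⟩
  exact this

theorem lt (h : IsLabelled m s S N d) {k l : ℕ} (hkl : k < l) (hl : l ≤ N) : d k < d l :=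
  h.strictMono (hkl.le.trans hl) hl hkl

theorem le (h : IsLabelled m s S N d) {k l : ℕ} (hkl : k ≤ l) (hl : l ≤ N) : d k ≤ d l :=
  h.strictMono.monotoneOn (hkl.trans hl) hl hkl

theorem d_zero (h : IsLabelled m s S N d) : d 0 = 0 := by
  have h3 := h.three_le
  obtain ⟨k, hk, hk0⟩ := h.exists_eq (i := 0) (by omega) h.zero_mem
  have := h.le (Nat.zero_le k) hk
  omega

theorem one_le (h : IsLabelled m s S N d) : 1 ≤ N := by
  have h3 := h.three_le
  obtain ⟨k, hk, hk1⟩ := h.exists_eq (i := 1) (by omega) h.one_mem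
  have h0 := h.d_zero
  rcases Nat.eq_zero_or_pos k with rfl | hk'
  · omega
  · omega

theorem d_one (h : IsLabelled m s S N d) : d 1 = 1 := by
  have h3 := h.three_le
  obtain ⟨k, hk, hk1⟩ := h.exists_eq (i := 1) (by omega) h.one_mem
  have h0 := h.d_zero
  have h4 := h.lt (k := 0) (l := 1) one_pos h.one_le
  rcases Nat.eq_zero_or_pos k with rfl | hk'
  · omega
  · have := h.le (k := 1) (l := k) hk' hk
    omega

/-- The index `k` with `d_k ≤ i < d_{k+1}`. -/
theorem exists_index (h : IsLabelled m s S N d) (i : ℕ) :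
    ∃ k ≤ N, d k ≤ i ∧ (k < N → i < d (k + 1)) := by
  have h0 : d 0 ≤ i := by rw [h.d_zero]; exact Nat.zero_le i
  refine ⟨Nat.findGreatest (fun k => d k ≤ i) N, Nat.findGreatest_le N,
    Nat.findGreatest_spec (P := fun k => d k ≤ i) (Nat.zero_le N) h0, fun hk => ?_⟩
  have := Nat.findGreatest_is_greatest (P := fun k => d k ≤ i) (Nat.lt_succ_self _) hk
  simpa using this

end IsLabelled

theorem bInv_le (χ : Irr m) : χ ≠ irrSgn m → 2 * bInv m χ ≤ m := by
  intro hne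
  rcases irr_cases' χ with ⟨s, i, hi, rfl⟩ | h
  · rw [bInv_irrChi s hi]; exact_mod_cast hi
  · exact absurd h hne

variable {D : Datum m}

namespace IsSpringerFor

theorem isSpringerRep (h : IsSpringerFor m S D) {χ : Irr m} (hχ : χ.1 ∈ S) :
    IsSpringerRep m (D.supp χ).1 χ := by
  rw [← h.2] at hχ
  obtain ⟨C, hC, χ', hχ', hr⟩ := hχ
  obtain rfl : χ' = χ := Subtype.ext hχ'
  rwa [D.supp_eq ⟨C, hC⟩ hr.1]

theorem a_eq (h : IsSpringerFor m S D) {χ : Irr m} (hχ : χ.1 ∈ S) :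
    (D.a (D.supp χ) : ℤ) = bInv m χ := by
  obtain ⟨χ', h1, h2⟩ := h.1.springer_rep (D.supp χ)
  have h3 := h.isSpringerRep hχ
  by_cases he : χ' = χ
  · rw [← he] at h2 ⊢; exact h2
  · exact absurd (h1.2 χ h3.1 (Ne.symm he)) (not_lt_of_gt (h3.2 χ' h1.1 he))

theorem exists_rep (h : IsSpringerFor m S D) (χ : Irr m) :
    ∃ χ', χ'.1 ∈ S ∧ D.supp χ' = D.supp χ ∧ (χ' = χ ∨ bInv m χ' < bInv m χ) := by
  obtain ⟨χ', h1, h2⟩ := h.1.springer_rep (D.supp χ)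
  refine ⟨χ', ?_, D.supp_eq _ h1.1, ?_⟩
  · rw [← h.2]
    exact ⟨_, (D.supp χ).2, χ', rfl, h1⟩
  · by_cases he : χ' = χ
    · exact Or.inl he
    · exact Or.inr (h1.2 χ (D.mem_supp χ) (Ne.symm he))

theorem supp_inj (h : IsSpringerFor m S D) {χ χ' : Irr m} (hχ : χ.1 ∈ S) (hχ' : χ'.1 ∈ S)
    (he : D.supp χ = D.supp χ') : χ = χ' := by
  by_contra hne
  have h1 := h.isSpringerRep hχ
  have h2 := h.isSpringerRep hχ'
  rw [he] at h1
  exact absurd (h1.2 _ h2.1 (Ne.symm hne)) (not_lt_of_gt (h2.2 _ h1.1 hne))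

/-- The function `a` is weakly order reversing and takes the `b`-invariants of the Springer
representations as values. -/
theorem supp_lt (h : IsSpringerFor m S D) {χ χ' : Irr m} (hχ : χ.1 ∈ S) (hχ' : χ'.1 ∈ S)
    (hb : bInv m χ < bInv m χ') : D.supp χ' < D.supp χ := by
  rcases lt_trichotomy (D.supp χ') (D.supp χ) with h1 | h1 | h1
  · exact h1
  · rw [h.supp_inj hχ hχ' h1.symm] at hb
    exact absurd hb (lt_irrefl _)
  · have := D.a_anti _ _ (Datum.lt_iff.1 h1)
    have h2 := h.a_eq hχ
    have h3 := h.a_eq hχ'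
    have h4 : (D.a (D.supp χ') : ℤ) ≤ D.a (D.supp χ) := by exact_mod_cast this
    omega

theorem le_of_supp_eq (h : IsSpringerFor m S D) {χ χ' : Irr m} (hχ : χ.1 ∈ S)
    (he : D.supp χ' = D.supp χ) : χ' = χ ∨ bInv m χ < bInv m χ' := by
  by_cases hne : χ' = χ
  · exact Or.inl hne
  · exact Or.inr ((h.isSpringerRep hχ).2 _ (D.mem_iff.2 he) hne)

theorem sgn_lt (hL : IsLabelled m s S N d) (h : IsSpringerFor m S D) {χ : Irr m}
    (hχ : χ ≠ irrSgn m) : D.supp (irrSgn m) < D.supp χ := by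
  have h3 := hL.three_le
  obtain ⟨χ', h1, h2, h4⟩ := h.exists_rep χ
  have hE : (irrSgn m).1 ∈ S := hL.sgn_mem
  have hb := bInv_le χ hχ
  rw [← h2]
  refine h.supp_lt h1 hE ?_
  rw [bInv_irrSgn]
  rcases h4 with rfl | h4
  · omega
  · omega

theorem sgn_le (hL : IsLabelled m s S N d) (h : IsSpringerFor m S D) (χ : Irr m) :
    D.supp (irrSgn m) ≤ D.supp χ := by
  by_cases hχ : χ = irrSgn m
  · rw [hχ]
  · exact (h.sgn_lt hL hχ).le

/-- No character except `ε` has a larger `b`-invariant than `χ_r` and `χ_r'`, and `ε` lies in a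
smaller class. So the class of a Springer representation `χ_r` or `χ_r'` is a singleton. -/
theorem half_eq (hL : IsLabelled m s S N d) (h : IsSpringerFor m S D) {s' : ℤˣ} {r : ℕ}
    (hr : 2 * r = m) (hS : (irrChi m s' r).1 ∈ S) {χ : Irr m}
    (he : D.supp χ = D.supp (irrChi m s' r)) : χ = irrChi m s' r := by
  refine (h.le_of_supp_eq hS he).resolve_right fun hb => ?_
  rw [bInv_irrChi _ hr.le] at hb
  by_cases hχ : χ = irrSgn m
  · subst hχ
    exact (h.sgn_lt hL (irrChi_ne_irrSgn s' hr.le)).ne he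
  · have := bInv_le χ hχ
    omega

theorem exists_index (hL : IsLabelled m s S N d) (h : IsSpringerFor m S D) {i : ℕ}
    (hi : 2 * i < m) : ∃ k ≤ N, d k ≤ i ∧ D.supp (irrChi m s i) = D.supp (irrChi m s (d k)) := by
  obtain ⟨χ, h1, h2, h3⟩ := h.exists_rep (irrChi m s i)
  rw [bInv_irrChi _ hi.le] at h3
  have hb : bInv m χ ≤ i := by
    rcases h3 with rfl | h3
    · rw [bInv_irrChi _ hi.le]
    · exact h3.le
  rcases irr_cases s χ with ⟨j, hj, rfl⟩ | ⟨r, hr, hχ⟩ | rfl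
  · rw [irrChi_val hj.le] at h1
    rw [bInv_irrChi _ hj.le] at hb
    obtain ⟨k, hk, rfl⟩ := hL.exists_eq hj h1
    exact ⟨k, hk, by omega, h2.symm⟩
  · exfalso
    rcases hχ with rfl | rfl <;>
    · rw [bInv_irrChi _ hr.le] at hb
      omega
  · rw [bInv_irrSgn] at hb
    omega

theorem supp_d_lt (hL : IsLabelled m s S N d) (h : IsSpringerFor m S D) {k l : ℕ} (hkl : k < l)
    (hl : l ≤ N) : D.supp (irrChi m s (d l)) < D.supp (irrChi m s (d k)) := by
  have h1 := hL.lt hkl hl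
  refine h.supp_lt (hL.irrChi_mem (hkl.le.trans hl)) (hL.irrChi_mem hl) ?_
  rw [bInv_irrChi _ (hL.two_mul_lt hl).le, bInv_irrChi _ (hL.two_mul_lt (hkl.le.trans hl)).le]
  exact_mod_cast h1

theorem supp_d_le (hL : IsLabelled m s S N d) (h : IsSpringerFor m S D) {k l : ℕ} (hkl : k ≤ l)
    (hl : l ≤ N) : D.supp (irrChi m s (d l)) ≤ D.supp (irrChi m s (d k)) := by
  rcases hkl.eq_or_lt with rfl | hkl
  · exact le_rfl
  · exact (h.supp_d_lt hL hkl hl).le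

theorem le_supp (hL : IsLabelled m s S N d) (h : IsSpringerFor m S D) {i : ℕ}
    (hi : 2 * i < m) : D.supp (irrChi m s (d N)) ≤ D.supp (irrChi m s i) := by
  obtain ⟨k, hk, -, h2⟩ := h.exists_index hL hi
  rw [h2]
  exact h.supp_d_le hL hk le_rfl

/-- Entries of the Green functions are polynomials with nonnegative coefficients, and are given by
linear relations between rows of the reduced matrix. -/
theorem relation (hL : IsLabelled m s S N d) (h : IsSpringerFor m S D)
    {i j z₁ z₂ z₃ : Irr m} {c₁ c₂ c₃ : F}
    (h₁ : D.supp z₁ ≤ D.supp j) (h₂ : D.supp z₂ ≤ D.supp j) (h₃ : D.supp z₃ ≤ D.supp j)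
    (hM : ∀ (s' : ℤˣ) (n : ℕ), 2 * n ≤ m → D.supp (irrChi m s' n) ≤ D.supp j →
      c₁ * redOmega m z₁ (irrChi m s' n) + c₂ * redOmega m z₂ (irrChi m s' n) +
        c₃ * redOmega m z₃ (irrChi m s' n) = redOmega m i (irrChi m s' n))
    (hj : j ≠ irrSgn m) :
    (∃ p : Polynomial ℕ, algebraMap (Polynomial ℂ) F (p.map (Nat.castRingHom ℂ)) =
      ((if j = z₁ then c₁ else 0) + (if j = z₂ then c₂ else 0) +
      (if j = z₃ then c₃ else 0)) * q ^ D.a (D.supp j)) ∧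
    ∃ p : Polynomial ℤ, q ^ D.a (D.supp i) * algebraMap (Polynomial ℂ) F (p.map (Int.castRingHom ℂ)) =
      ((if j = z₁ then c₁ else 0) + (if j = z₂ then c₂ else 0) +
      (if j = z₃ then c₃ else 0)) * q ^ D.a (D.supp j) := by
  obtain ⟨P, Λ, hG, -, hP, hdiv⟩ := h.1.green
  have h4 := hG.apply_eq (i := i) (h.sgn_le hL) h₁ h₂ h₃ (fun w hw hwE => by
    rcases irr_cases' w with ⟨s', n, hn, rfl⟩ | rfl
    · exact hM s' n hn hw
    · exact absurd rfl hwE) hj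
  obtain ⟨p, hp⟩ := hP i j
  obtain ⟨p', hp'⟩ := hdiv (D.supp i) i (D.mem_supp i) j
  exact ⟨⟨p, by rw [← hp, h4]⟩, ⟨p', by rw [← hp', h4]⟩⟩

theorem coef_false {p : Polynomial ℂ} {j i l a : ℕ} (hji : j < i) (hil : i < l)
    (h : algebraMap (Polynomial ℂ) F p = coefL j i l * q ^ a ∨
      algebraMap (Polynomial ℂ) F p = coefR j i l * q ^ a) : False := by
  have h0 := q_pow_ne_one_aux (n := l - j) (by omega)
  rcases h with h | h
  · refine not_polynomial_of_lt (p := p) (e := i - j + a) (a := l - i) (b := l - j) (by omega)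
      (by omega) ?_
    rw [h, coefL, pow_add]
    field_simp
  · refine not_polynomial_of_lt (p := p) (e := l - i + a) (a := i - j) (b := l - j) (by omega)
      (by omega) ?_
    rw [h, coefR, pow_add]
    field_simp

/-- The nearest index below `i` whose class is smaller. -/
theorem exists_nearest {T : ℕ → Prop} {i j : ℕ} (hji : j < i) (hj : T j) :
    ∃ j', j ≤ j' ∧ j' < i ∧ T j' ∧ ∀ n, n < i → T n → n ≤ j' := by
  refine ⟨Nat.findGreatest T (i - 1), Nat.le_findGreatest (by omega) hj, ?_,
    Nat.findGreatest_spec (m := j) (by omega) hj, fun n hn hT => Nat.le_findGreatest (by omega) hT⟩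
  have := Nat.findGreatest_le (P := T) (i - 1)
  omega

/-- An index cannot have indices of smaller classes on both sides. Take the nearest such neighbours:
no column of a smaller class lies strictly between them, so `row_between` applies. The entry of `P`
at the neighbour with the larger class is an interpolation coefficient times a power of `q`, hence
not a polynomial. -/
theorem between (hL : IsLabelled m s S N d) (h : IsSpringerFor m S D) {j i l : ℕ} (hji : j < i)
    (hil : i < l) (hl : 2 * l < m) (h1 : D.supp (irrChi m s j) < D.supp (irrChi m s i))
    (h2 : D.supp (irrChi m s l) < D.supp (irrChi m s i)) : False := by
  obtain ⟨j', -, hj'i, hj', hjmax⟩ := exists_nearest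
    (T := fun n => D.supp (irrChi m s n) < D.supp (irrChi m s i)) hji h1
  have hex : ∃ n, i < n ∧ D.supp (irrChi m s n) < D.supp (irrChi m s i) := ⟨l, hil, h2⟩
  obtain ⟨hl'i, hl'⟩ := Nat.find_spec hex
  have hl'l : Nat.find hex ≤ l := Nat.find_min' hex ⟨hil, h2⟩
  have hlmin : ∀ n, i < n → D.supp (irrChi m s n) < D.supp (irrChi m s i) → Nat.find hex ≤ n :=
    fun n hn hn' => Nat.find_min' hex ⟨hn, hn'⟩
  generalize Nat.find hex = l' at *
  have hrow : ∀ (c : D.Cls), c < D.supp (irrChi m s i) → ∀ (s' : ℤˣ) (n : ℕ), 2 * n ≤ m →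
      D.supp (irrChi m s' n) ≤ c →
      coefL j' i l' * redOmega m (irrChi m s j') (irrChi m s' n) +
        coefR j' i l' * redOmega m (irrChi m s l') (irrChi m s' n) +
        0 * redOmega m (irrChi m s j') (irrChi m s' n) =
      redOmega m (irrChi m s i) (irrChi m s' n) := by
    intro c hc s' n hn hnc
    rw [zero_mul, add_zero]
    refine row_between hj'i hl'i (by omega) hn ?_
    rcases hn.eq_or_lt with hn | hn
    · right; omega
    · rw [irrChi_sign s hn] at hnc
      have h3 := hnc.trans_lt hc
      rcases lt_trichotomy n i with h4 | rfl | h4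
      · exact Or.inl (hjmax n h4 h3)
      · exact absurd h3 (lt_irrefl _)
      · exact Or.inr (hlmin n h4 h3)
  have hne : irrChi m s j' ≠ irrChi m s l' := fun he => by
    have := irrChi_inj (by omega) (by omega) he
    omega
  rcases le_total (D.supp (irrChi m s j')) (D.supp (irrChi m s l')) with h5 | h5
  · obtain ⟨⟨p, hp⟩, -⟩ := h.relation hL h5 le_rfl h5 (hrow _ hl') (irrChi_ne_irrSgn s (by omega))
    rw [if_neg hne.symm, if_pos rfl, ite_self, zero_add, add_zero] at hp
    exact coef_false hj'i hl'i (Or.inr hp)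
  · obtain ⟨⟨p, hp⟩, -⟩ := h.relation hL le_rfl h5 le_rfl (hrow _ hj') (irrChi_ne_irrSgn s (by omega))
    rw [if_neg hne, if_pos rfl, ite_self, add_zero, add_zero] at hp
    exact coef_false hj'i hl'i (Or.inl hp)

/-- This is the argument of `between` with the fork as right neighbour. The indices from `i` to `r`
contribute no column of a smaller class, by `between`, and the entry is read at the largest of the
three classes that occur in `row_fork`. -/
theorem between_half (hL : IsLabelled m s S N d) (h : IsSpringerFor m S D) {j i r : ℕ} (hji : j < i)
    (hir : i < r) (hr : 2 * r = m) (h1 : D.supp (irrChi m s j) < D.supp (irrChi m s i))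
    (h2 : ∀ s', D.supp (irrChi m s' r) < D.supp (irrChi m s i)) : False := by
  obtain ⟨j', -, hj'i, hj', hjmax⟩ := exists_nearest
    (T := fun n => D.supp (irrChi m s n) < D.supp (irrChi m s i)) hji h1
  have hrow : ∀ (c : D.Cls), c < D.supp (irrChi m s i) → ∀ (s' : ℤˣ) (n : ℕ), 2 * n ≤ m →
      D.supp (irrChi m s' n) ≤ c →
      coefL j' i r * redOmega m (irrChi m s j') (irrChi m s' n) +
        coefR j' i r * redOmega m (irrChi m s r) (irrChi m s' n) +
        coefR j' i r * redOmega m (irrChi m (-s) r) (irrChi m s' n) =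
      redOmega m (irrChi m s i) (irrChi m s' n) := by
    intro c hc s' n hn hnc
    refine row_fork hj'i hir hr ?_
    rcases hn.eq_or_lt with hn | hn
    · right; omega
    · rw [irrChi_sign s hn] at hnc
      have h3 := hnc.trans_lt hc
      rcases lt_trichotomy n i with h4 | rfl | h4
      · exact Or.inl (hjmax n h4 h3)
      · exact absurd h3 (lt_irrefl _)
      · exact (h.between hL hji h4 hn h1 h3).elim
  have hne : ∀ s', irrChi m s j' ≠ irrChi m s' r := fun s' he => by
    have := irrChi_inj (by omega) (by omega) he
    omega
  have hne' := irrChi_half_ne (neg_unit_ne s) hr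
  obtain ⟨z, hz, hzmax⟩ : ∃ z ∈ ({irrChi m s j', irrChi m s r, irrChi m (-s) r} : Finset (Irr m)),
      ∀ w ∈ ({irrChi m s j', irrChi m s r, irrChi m (-s) r} : Finset (Irr m)),
        D.supp w ≤ D.supp z :=
    Finset.exists_max_image _ _ ⟨irrChi m s j', by simp⟩
  have hz1 := hzmax (irrChi m s j') (by simp)
  have hz2 := hzmax (irrChi m s r) (by simp)
  have hz3 := hzmax (irrChi m (-s) r) (by simp)
  simp only [Finset.mem_insert, Finset.mem_singleton] at hz
  rcases hz with rfl | rfl | rfl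
  · obtain ⟨⟨p, hp⟩, -⟩ := h.relation hL hz1 hz2 hz3 (hrow _ hj') (irrChi_ne_irrSgn s (by omega))
    rw [if_pos rfl, if_neg (hne _), if_neg (hne _), add_zero, add_zero] at hp
    exact coef_false hj'i hir (Or.inl hp)
  · obtain ⟨⟨p, hp⟩, -⟩ := h.relation hL hz1 hz2 hz3 (hrow _ (h2 _)) (irrChi_ne_irrSgn s (by omega))
    rw [if_neg (hne _).symm, if_pos rfl, if_neg hne', zero_add, add_zero] at hp
    exact coef_false hj'i hir (Or.inr hp)
  · obtain ⟨⟨p, hp⟩, -⟩ := h.relation hL hz1 hz2 hz3 (hrow _ (h2 _)) (irrChi_ne_irrSgn _ (by omega))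
    rw [if_neg (hne _).symm, if_neg hne'.symm, if_pos rfl, zero_add, zero_add] at hp
    exact coef_false hj'i hir (Or.inr hp)

/-- An index beyond all indices of smaller classes. -/
theorem beyond (hL : IsLabelled m s S N d) (h : IsSpringerFor m S D) {s' : ℤˣ} {j i : ℕ} (hji : j < i)
    (hi : 2 * i ≤ m) (h1 : D.supp (irrChi m s j) < D.supp (irrChi m s' i))
    (h2 : ∀ s'' r, 2 * r = m → D.supp (irrChi m s' i) ≤ D.supp (irrChi m s'' r)) : False := by
  obtain ⟨j', -, hj'i, hj', hjmax⟩ := exists_nearest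
    (T := fun n => D.supp (irrChi m s n) < D.supp (irrChi m s' i)) hji h1
  -- No column of a class at most that of `χ_j'` has index above `j'`: `between` excludes indices
  -- above `i`, and `h2` excludes `χ_r` and `χ_r'`. So `row_right` applies, and its ratio is not a
  -- polynomial by `not_polynomial_top`.
  have hrow : ∀ (s'' : ℤˣ) (n : ℕ), 2 * n ≤ m →
      D.supp (irrChi m s'' n) ≤ D.supp (irrChi m s j') →
      (if 2 * i = m then q ^ i else q ^ i + q ^ (m - i)) / (q ^ j' + q ^ (m - j')) *
        redOmega m (irrChi m s j') (irrChi m s'' n) +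
        0 * redOmega m (irrChi m s j') (irrChi m s'' n) +
        0 * redOmega m (irrChi m s j') (irrChi m s'' n) =
      redOmega m (irrChi m s' i) (irrChi m s'' n) := by
    intro s'' n hn hnc
    rw [zero_mul, add_zero, add_zero]
    have hnj : n ≤ j' := by
      rcases hn.eq_or_lt with hn | hn
      · exact absurd (h2 s'' n hn) (not_le_of_gt (hnc.trans_lt hj'))
      · rw [irrChi_sign s hn] at hnc
        have h3 := hnc.trans_lt hj'
        rcases lt_trichotomy n i with h4 | rfl | h4
        · exact hjmax n h4 h3
        · rw [irrChi_sign s' hn] at h3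
          exact absurd h3 (lt_irrefl _)
        · rw [irrChi_sign (s := s') s (by omega)] at h1 h3
          exact (h.between hL hji h4 hn h1 h3).elim
    have h5 := row_right (s := s) (s' := s'') hj'i.le hi (by omega) hnj
    rw [h5]
    rcases hi.eq_or_lt with hi | hi
    · rw [redOmega_comm, redOmega_two_half s'' s (by omega) hi, redOmega_comm,
        redOmega_two_half s'' s' (by omega) hi]
    · rw [irrChi_sign s' hi]
  obtain ⟨⟨p, hp⟩, -⟩ := h.relation hL le_rfl le_rfl le_rfl hrow (irrChi_ne_irrSgn s (by omega))
  rw [if_pos rfl, if_pos rfl, add_zero, add_zero] at hp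
  refine not_polynomial_top (m := m) (p := p.map (Nat.castRingHom ℂ))
    (e := D.a (D.supp (irrChi m s j'))) hj'i hi ?_
  rw [hp]
  have := q_pow_add_q_pow_ne_zero (a := j') (b := m - j')
  field_simp

/-- The two characters `χ_r`, `χ_r'` cannot be separated by the smallest class. -/
theorem half_half (hL : IsLabelled m s S N d) (h : IsSpringerFor m S D) {s' : ℤˣ} {r : ℕ}
    (hr : 2 * r = m) (h1 : D.supp (irrChi m s' r) = D.supp (irrChi m s (d N)))
    (h2 : D.supp (irrChi m s (d N)) < D.supp (irrChi m (-s') r)) : False := by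
  have hdN := hL.two_mul_lt le_rfl
  obtain ⟨t, -, htr, ht, htmax⟩ := exists_nearest (i := r) (j := d N)
    (T := fun n => D.supp (irrChi m s n) ≤ D.supp (irrChi m s (d N))) (by omega) le_rfl
  -- Here `t` is the last index in a class at most that of `χ_(d N)`. Among the columns concerned
  -- only one side of the fork is present, and the row of the other side involves it with a negative
  -- coefficient, which contradicts nonnegativity.
  have hrow : ∀ (s'' : ℤˣ) (n : ℕ), 2 * n ≤ m →
      D.supp (irrChi m s'' n) ≤ D.supp (irrChi m s' r) →
      q ^ (-((r - t : ℕ) : ℤ)) * redOmega m (irrChi m s t) (irrChi m s'' n) +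
        (-q ^ (-((2 * (r - t) : ℕ) : ℤ))) * redOmega m (irrChi m s' r) (irrChi m s'' n) +
        0 * redOmega m (irrChi m s' r) (irrChi m s'' n) =
      redOmega m (irrChi m (-s') r) (irrChi m s'' n) := by
    intro s'' n hn hnc
    rw [h1] at hnc
    obtain ⟨a, rfl⟩ : ∃ a, r = t + a := ⟨r - t, by omega⟩
    rw [zero_mul, add_zero, Nat.add_sub_cancel_left, zpow_neg, zpow_natCast, zpow_neg, zpow_natCast]
    have hq := q_ne_zero
    rcases hn.eq_or_lt with hn | hn
    · obtain rfl : n = t + a := by omega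
      rw [redOmega_two_half s s'' htr hr, redOmega_half_half s' s'' hr,
        redOmega_half_half (-s') s'' hr]
      have hs : s'' = s' := by
        by_contra hne
        have : s'' = -s' := by
          rcases Int.units_eq_one_or s' with rfl | rfl <;>
            rcases Int.units_eq_one_or s'' with rfl | rfl <;> simp_all
        rw [this] at hnc
        exact not_lt_of_ge hnc h2
      rw [hs, if_pos rfl, if_neg (neg_unit_ne s').symm, ← hr]
      field_simp
      ring
    · rw [irrChi_sign s hn] at hnc ⊢
      have hnt := htmax n (by omega) hnc
      simp only [fun z => redOmega_comm z (irrChi m s n)]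
      rw [redOmega_two_two s hnt (by omega), redOmega_two_half s s' (by omega) hr,
        redOmega_two_half s (-s') (by omega) hr, show m - t = t + 2 * a by omega]
      field_simp
      ring
  obtain ⟨⟨p, hp⟩, -⟩ := h.relation hL (by rw [h1]; exact ht) le_rfl le_rfl hrow
    (irrChi_ne_irrSgn s' hr.le)
  rw [if_neg, if_pos rfl, ite_self, zero_add, add_zero] at hp
  · refine not_natPolynomial_neg (p := p) (a := 2 * (r - t)) (b := D.a (D.supp (irrChi m s' r))) ?_
    rw [hp, zpow_neg, zpow_natCast]
    have hq := q_ne_zero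
    field_simp
  · intro he
    have := irrChi_inj hr.le (by omega) he
    omega

end IsSpringerFor

end

section

variable {m : ℕ} [NeZero m] {s : ℤˣ} {S : Set (DihedralGroup m → ℂ)} {N : ℕ} {d : ℕ → ℕ}
  {D : Datum m}

/-! ### The form of the classes -/

theorem irrChi_half_val {r : ℕ} (hr : 2 * r = m) : (irrChi m s r).1 = chi m s (m / 2) := by
  rw [irrChi_val hr.le]; congr 1; omega

theorem irrChi_half_val' {r : ℕ} (hr : 2 * r = m) : (irrChi m (-s) r).1 = chi' m s := by
  rw [irrChi_half_val hr, chi'_eq s ⟨r, by omega⟩]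

theorem eq_or_neg (s s' : ℤˣ) : s' = s ∨ s' = -s := by
  rcases Int.units_eq_one_or s with rfl | rfl <;>
    rcases Int.units_eq_one_or s' with rfl | rfl <;> simp

theorem chi_inj {s s' : ℤˣ} {i j : ℕ} (hi : 2 * i ≤ m) (hj : 2 * j ≤ m)
    (h : chi m s i = chi m s' j) : i = j :=
  irrChi_inj (s := s) (s' := s') hi hj (Subtype.ext (by rw [irrChi_val hi, irrChi_val hj, h]))

theorem chi_mem_image {s' : ℤˣ} {T : Set ℕ} (hT : ∀ n ∈ T, 2 * n ≤ m) {n : ℕ} (hn : 2 * n ≤ m) :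
    chi m s' n ∈ chi m s '' T ↔ n ∈ T ∧ (2 * n = m → s' = s) := by
  constructor
  · rintro ⟨n', hn', h⟩
    obtain rfl := chi_inj (hT n' hn') hn h
    refine ⟨hn', fun h2 => ?_⟩
    by_contra hne
    refine irrChi_half_ne (Ne.symm hne) h2 (Subtype.ext ?_)
    rw [irrChi_val hn, irrChi_val hn, h]
  · rintro ⟨h1, h2⟩
    refine ⟨n, h1, ?_⟩
    by_cases h3 : 2 * n = m
    · rw [h2 h3]
    · exact chi_sign s' h3

theorem sgn_notMem_image {T : Set ℕ} (hT : ∀ n ∈ T, 2 * n ≤ m) : sgn m ∉ chi m s '' T := by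
  rintro ⟨n, hn, h⟩
  refine irrChi_ne_irrSgn s (hT n hn) (Subtype.ext ?_)
  rw [irrChi_val (hT n hn), h]
  rfl

namespace IsSpringerFor

theorem classIs (h : IsSpringerFor m S D) {χ : Irr m} (hχ : χ.1 ∈ S)
    {A : Set (DihedralGroup m → ℂ)} (hA : A ⊆ irrChars m)
    (hiff : ∀ χ' : Irr m, D.supp χ' = D.supp χ ↔ χ'.1 ∈ A) : ClassIs m D χ.1 A := by
  refine ⟨(D.supp χ).1, (D.supp χ).2, ⟨χ, rfl, h.isSpringerRep hχ⟩, ?_⟩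
  ext φ
  constructor
  · rintro ⟨χ', h1, rfl⟩
    exact (hiff χ').1 (D.mem_iff.1 h1)
  · intro hφ
    exact ⟨⟨φ, hA hφ⟩, D.mem_iff.2 ((hiff ⟨φ, hA hφ⟩).2 hφ), rfl⟩

theorem classIs_image (hL : IsLabelled m s S N d) (h : IsSpringerFor m S D) {k : ℕ} (hk : k ≤ N)
    {T : Set ℕ} (hT : ∀ n ∈ T, 2 * n ≤ m)
    (h1 : ∀ n, 2 * n ≤ m → (D.supp (irrChi m s n) = D.supp (irrChi m s (d k)) ↔ n ∈ T))
    (h2 : ∀ r, 2 * r = m → D.supp (irrChi m (-s) r) ≠ D.supp (irrChi m s (d k))) :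
    ClassIs m D (chi m s (d k)) (chi m s '' T) := by
  have h3 := h.classIs (A := chi m s '' T) (hL.irrChi_mem hk) ?_ ?_
  · rwa [irrChi_val (hL.two_mul_lt hk).le] at h3
  · rintro _ ⟨n, hn, rfl⟩
    exact chi_mem s (hT n hn)
  · intro χ
    rcases irr_cases s χ with ⟨n, hn, rfl⟩ | ⟨r, hr, rfl | rfl⟩ | rfl
    · rw [h1 n hn.le, irrChi_val hn.le, chi_mem_image hT hn.le]
      exact ⟨fun h => ⟨h, fun _ => rfl⟩, fun h => h.1⟩
    · rw [h1 r hr.le, irrChi_val hr.le, chi_mem_image hT hr.le]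
      exact ⟨fun h => ⟨h, fun _ => rfl⟩, fun h => h.1⟩
    · rw [irrChi_val hr.le, chi_mem_image hT hr.le]
      exact ⟨fun h4 => absurd h4 (h2 r hr), fun h4 => absurd (h4.2 hr).symm (neg_unit_ne s)⟩
    · refine ⟨fun h4 => ?_, fun h4 => absurd h4 (sgn_notMem_image hT)⟩
      exact absurd h4 (h.sgn_lt hL (irrChi_ne_irrSgn s (hL.two_mul_lt hk).le)).ne

theorem classIs_sgn (hL : IsLabelled m s S N d) (h : IsSpringerFor m S D) :
    ClassIs m D (sgn m) {sgn m} := by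
  refine h.classIs (χ := irrSgn m) hL.sgn_mem (by rintro _ rfl; exact sgn_mem) fun χ => ?_
  refine ⟨fun h1 => ?_, fun h1 => congrArg _ (Subtype.ext h1)⟩
  by_contra hne
  exact (h.sgn_lt hL (fun h2 => hne (congrArg Subtype.val h2))).ne' h1

theorem classIs_half (hL : IsLabelled m s S N d) (h : IsSpringerFor m S D) {s' : ℤˣ} {r : ℕ}
    (hr : 2 * r = m) (hS : (irrChi m s' r).1 ∈ S) :
    ClassIs m D (irrChi m s' r).1 {(irrChi m s' r).1} := by
  refine h.classIs hS (by rintro _ rfl; exact (irrChi m s' r).2) fun χ => ?_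
  exact ⟨fun h1 => congrArg Subtype.val (h.half_eq hL hr hS h1),
    fun h1 => congrArg _ (Subtype.ext h1)⟩

theorem half_index (hL : IsLabelled m s S N d) (h : IsSpringerFor m S D) {s' : ℤˣ} {r : ℕ}
    (hr : 2 * r = m) (hS : (irrChi m s' r).1 ∉ S) :
    ∃ k ≤ N, D.supp (irrChi m s' r) = D.supp (irrChi m s (d k)) := by
  obtain ⟨χ, h1, h2, h3⟩ := h.exists_rep (irrChi m s' r)
  have h4 : bInv m χ < r := by
    rcases h3 with rfl | h3
    · exact absurd h1 hS
    · rwa [bInv_irrChi _ hr.le] at h3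
  rcases irr_cases s χ with ⟨j, hj, rfl⟩ | ⟨r', hr', hχ⟩ | rfl
  · rw [irrChi_val hj.le] at h1
    obtain ⟨k, hk, rfl⟩ := hL.exists_eq hj h1
    exact ⟨k, hk, h2.symm⟩
  · exfalso
    rcases hχ with rfl | rfl <;>
    · rw [bInv_irrChi _ hr'.le] at h4
      omega
  · rw [bInv_irrSgn] at h4
    omega

theorem half_lt (hL : IsLabelled m s S N d) (h : IsSpringerFor m S D) {s' : ℤˣ} {r : ℕ}
    (hr : 2 * r = m) (hS : (irrChi m s' r).1 ∈ S) {i : ℕ} (hi : 2 * i < m) :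
    D.supp (irrChi m s' r) < D.supp (irrChi m s i) := by
  refine lt_of_lt_of_le ?_ (h.le_supp hL hi)
  refine h.supp_lt (hL.irrChi_mem le_rfl) hS ?_
  have := hL.two_mul_lt le_rfl
  rw [bInv_irrChi _ this.le, bInv_irrChi _ hr.le]
  omega

/-- The class of `χ_i` is that of some `χ_(d k')` with `k' ≤ k`. If `k' < k`, then `d k` and `d (k +
1)` are indices of smaller classes on both sides of `i`. -/
theorem supp_of_lt (hL : IsLabelled m s S N d) (h : IsSpringerFor m S D) {k i : ℕ} (hk : k < N)
    (hki : d k ≤ i) (hik : i < d (k + 1)) :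
    D.supp (irrChi m s i) = D.supp (irrChi m s (d k)) := by
  have hdk := hL.two_mul_lt (show k + 1 ≤ N from hk)
  obtain ⟨k', hk', hle, he⟩ := h.exists_index hL (i := i) (by omega)
  have h1 : k' ≤ k := by
    by_contra hlt
    have := hL.le (k := k + 1) (l := k') (by omega) hk'
    omega
  rcases h1.eq_or_lt with rfl | h1
  · exact he
  · exfalso
    have h2 : d k < i := by
      rcases hki.eq_or_lt with h3 | h3
      · rw [← h3] at he
        exact absurd he (h.supp_d_lt hL h1 hk.le).ne
      · exact h3
    refine h.between hL h2 hik hdk ?_ ?_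
    · rw [he]; exact h.supp_d_lt hL h1 hk.le
    · rw [he]; exact h.supp_d_lt hL (by omega) hk

/-- No `χ_n` with `2 * n < m` has a smaller class than `χ_(d N)`. A descent after `d N` would
produce an index with smaller classes on both sides. -/
theorem supp_mono (hL : IsLabelled m s S N d) (h : IsSpringerFor m S D) {i l : ℕ} (hi : d N ≤ i)
    (hil : i ≤ l) (hl : 2 * l < m) : D.supp (irrChi m s i) ≤ D.supp (irrChi m s l) := by
  by_contra hlt
  rw [not_le] at hlt
  have h1 := h.le_supp hL hl
  have h2 : d N < i := by
    rcases hi.eq_or_lt with h3 | h3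
    · rw [← h3] at hlt
      exact absurd h1 (not_le_of_gt hlt)
    · exact h3
  have h3 : i < l := by
    rcases hil.eq_or_lt with h3 | h3
    · rw [h3] at hlt
      exact absurd hlt (lt_irrefl _)
    · exact h3
  exact h.between hL h2 h3 hl (h1.trans_lt hlt) hlt

/-- The smaller of the classes of `χ_r` and `χ_r'` equals that of `χ_(d N)` by `beyond`, and then so
does the other one by `half_half`. -/
theorem half_const (hL : IsLabelled m s S N d) (h : IsSpringerFor m S D) {r : ℕ} (hr : 2 * r = m)
    (hS : ∀ s', (irrChi m s' r).1 ∉ S) (s' : ℤˣ) :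
    D.supp (irrChi m s' r) = D.supp (irrChi m s (d N)) := by
  have hdN := hL.two_mul_lt le_rfl
  have hle : ∀ t, D.supp (irrChi m s (d N)) ≤ D.supp (irrChi m t r) := by
    intro t
    obtain ⟨k, hk, he⟩ := h.half_index hL hr (hS t)
    rw [he]
    exact h.supp_d_le hL hk le_rfl
  obtain ⟨t, ht⟩ : ∃ t, ∀ t', D.supp (irrChi m t r) ≤ D.supp (irrChi m t' r) := by
    rcases le_total (D.supp (irrChi m s r)) (D.supp (irrChi m (-s) r)) with h1 | h1
    · exact ⟨s, fun t' => by rcases eq_or_neg s t' with rfl | rfl <;> [exact le_rfl; exact h1]⟩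
    · exact ⟨-s, fun t' => by rcases eq_or_neg s t' with rfl | rfl <;> [exact h1; exact le_rfl]⟩
  have h1 : D.supp (irrChi m t r) = D.supp (irrChi m s (d N)) := by
    refine le_antisymm (not_lt.1 fun h2 => ?_) (hle t)
    refine h.beyond hL (show d N < r by omega) hr.le h2 fun t' r' hr' => ?_
    obtain rfl : r' = r := by omega
    exact ht t'
  rcases eq_or_neg t s' with rfl | rfl
  · exact h1
  · exact le_antisymm (not_lt.1 fun h2 => h.half_half hL hr h1 h2) (hle _)

/-- An index after `d N` with a larger class has the smaller class of `χ_(d N)` on its left. On its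
right, either both sides of the fork lie in smaller classes, against `between_half`, or `m` is odd
and there is no smaller class, against `beyond`. Only the case where `S` contains exactly one of
`χ_r`, `χ_r'` escapes. -/
theorem tail_const (hL : IsLabelled m s S N d) (h : IsSpringerFor m S D)
    (hS : ¬ (Even m ∧ chi m s (m / 2) ∉ S ∧ chi' m s ∈ S)) {i : ℕ} (hi : d N ≤ i)
    (him : 2 * i < m) : D.supp (irrChi m s i) = D.supp (irrChi m s (d N)) := by
  refine le_antisymm (not_lt.1 fun h2 => ?_) (h.le_supp hL him)
  have hi' : d N < i := lt_of_le_of_ne hi (by rintro rfl; exact lt_irrefl _ h2)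
  by_cases hm : Even m
  · obtain ⟨r, hr⟩ := hm
    have hr : 2 * r = m := by omega
    by_cases h3 : chi m s (m / 2) ∈ S
    · have h4 := hL.label ⟨r, by omega⟩ h3
      rw [← irrChi_half_val' hr] at h4
      rw [← irrChi_half_val hr] at h3
      refine h.between_half hL hi' (by omega) hr h2 fun s' => ?_
      rcases eq_or_neg s s' with rfl | rfl
      · exact h.half_lt hL hr h3 him
      · exact h.half_lt hL hr h4 him
    · have h4 : chi' m s ∉ S := fun h4 => hS ⟨⟨r, by omega⟩, h3, h4⟩
      rw [← irrChi_half_val' hr] at h4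
      rw [← irrChi_half_val hr] at h3
      refine h.between_half hL hi' (by omega) hr h2 fun s' => ?_
      rw [h.half_const hL hr (fun s'' => by rcases eq_or_neg s s'' with rfl | rfl <;> assumption) s']
      exact h2
  · exact h.beyond hL hi' him.le h2 fun s'' r hr => absurd ⟨r, by omega⟩ hm

theorem supp_eq_iff_of_lt (hL : IsLabelled m s S N d) (h : IsSpringerFor m S D) {k : ℕ} (hk : k ≤ N)
    {i : ℕ} (hi : i < d N) :
    D.supp (irrChi m s i) = D.supp (irrChi m s (d k)) ↔ k < N ∧ d k ≤ i ∧ i < d (k + 1) := by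
  constructor
  · intro he
    obtain ⟨k', hk', h1, h2⟩ := hL.exists_index i
    have hk'N : k' < N := lt_of_le_of_ne hk' (by rintro rfl; omega)
    rw [h.supp_of_lt hL hk'N h1 (h2 hk'N)] at he
    obtain rfl : k' = k := by
      rcases lt_trichotomy k' k with h3 | h3 | h3
      · exact absurd he (h.supp_d_lt hL h3 hk).ne'
      · exact h3
      · exact absurd he (h.supp_d_lt hL h3 hk').ne
    exact ⟨hk'N, h1, h2 hk'N⟩
  · rintro ⟨h1, h2, h3⟩
    exact h.supp_of_lt hL h1 h2 h3

/-- For a constant sequence the intervals `Ioc (f (k + 1)) (f k)` in `classSet` are empty, so the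
classes before the last are plain intervals `[d k, d (k + 1))`. -/
theorem hasForm_const (hL : IsLabelled m s S N d) (h : IsSpringerFor m S D)
    (hS : ¬ (Even m ∧ chi m s (m / 2) ∉ S ∧ chi' m s ∈ S)) :
    HasForm m s S N d (fun _ => (m - 1) / 2) D := by
  have hN := hL.one_le
  have hd0 := hL.d_zero
  have hd1 := hL.d_one
  have hdN := hL.two_mul_lt le_rfl
  have hm3 := hL.three_le
  have hpos : ∀ k ≤ N, ∀ n, 2 * n < m → (D.supp (irrChi m s n) = D.supp (irrChi m s (d k)) ↔
      d k ≤ n ∧ (k < N → n < d (k + 1))) := by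
    intro k hk n hn
    rcases lt_or_ge n (d N) with h1 | h1
    · rw [h.supp_eq_iff_of_lt hL hk h1]
      constructor
      · rintro ⟨-, h2, h3⟩
        exact ⟨h2, fun _ => h3⟩
      · rintro ⟨h2, h3⟩
        have hkN : k < N := lt_of_le_of_ne hk (by rintro rfl; omega)
        exact ⟨hkN, h2, h3 hkN⟩
    · rw [h.tail_const hL hS h1 hn]
      constructor
      · intro he
        have hkN : k = N := by
          by_contra hne
          exact (h.supp_d_lt hL (lt_of_le_of_ne hk hne) le_rfl).ne he
        subst hkN
        exact ⟨h1, fun h2 => absurd h2 (lt_irrefl _)⟩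
      · rintro ⟨h2, h3⟩
        have hkN : k = N := by
          by_contra hne
          have h4 : k < N := lt_of_le_of_ne hk hne
          have := hL.le (k := k + 1) (l := N) h4 le_rfl
          have := h3 h4
          omega
        rw [hkN]
  have hhalf : ∀ s' r, 2 * r = m → ∀ k < N,
      D.supp (irrChi m s' r) ≠ D.supp (irrChi m s (d k)) := by
    intro s' r hr k hk he
    by_cases h1 : (irrChi m s' r).1 ∈ S
    · exact (h.half_lt hL hr h1 (hL.two_mul_lt hk.le)).ne he
    · have h2 : ∀ s'', (irrChi m s'' r).1 ∉ S := by
        by_contra! hcon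
        obtain ⟨s'', h3⟩ := hcon
        have hev : Even m := ⟨r, by omega⟩
        have h4 : (irrChi m (-s) r).1 ∈ S := by
          rcases eq_or_neg s s'' with rfl | rfl
          · rw [irrChi_half_val' hr]
            rw [irrChi_half_val hr] at h3
            exact hL.label hev h3
          · exact h3
        have h5 : (irrChi m s r).1 ∈ S := by
          by_contra h5
          rw [irrChi_half_val' hr] at h4
          rw [irrChi_half_val hr] at h5
          exact hS ⟨hev, h5, h4⟩
        rcases eq_or_neg s s' with rfl | rfl
        · exact h1 h5
        · exact h1 h4
      rw [h.half_const hL hr h2 s'] at he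
      exact (h.supp_d_lt hL hk le_rfl).ne he
  refine ⟨fun k hk => ?_, fun hm hr => ?_, fun hm hr => ?_, h.classIs_sgn hL⟩
  · rcases hk.eq_or_lt with rfl | hkN
    · by_cases hc : Odd m ∨ (chi m s (m / 2) ∈ S ∧ chi' m s ∈ S)
      · rw [classSet, if_neg (by omega), if_neg (lt_irrefl _), if_pos hc]
        have hhalf' : ∀ s' r, 2 * r = m → D.supp (irrChi m s' r) ≠ D.supp (irrChi m s (d k)) := by
          intro s' r hr
          have hev : Even m := ⟨r, by omega⟩
          obtain ⟨h1, h2⟩ := hc.resolve_left (Nat.not_odd_iff_even.2 hev)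
          rw [← irrChi_half_val hr] at h1
          rw [← irrChi_half_val' hr] at h2
          rcases eq_or_neg s s' with rfl | rfl
          · exact (h.half_lt hL hr h1 hdN).ne
          · exact (h.half_lt hL hr h2 hdN).ne
        refine h.classIs_image hL le_rfl (fun n hn => ?_) (fun n hn => ?_) (hhalf' _)
        · have := hn.2
          omega
        · rcases hn.eq_or_lt with hn | hn
          · refine ⟨fun h1 => absurd h1 (hhalf' s n hn), fun h1 => ?_⟩
            have := h1.2
            omega
          · rw [hpos k le_rfl n hn, Set.mem_Icc]
            exact ⟨fun h1 => ⟨h1.1, by omega⟩, fun h1 => ⟨h1.1, fun h2 => absurd h2 (lt_irrefl _)⟩⟩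
      · rw [not_or, Nat.not_odd_iff_even, not_and] at hc
        obtain ⟨hev, hc⟩ := hc
        have h1 : chi m s (m / 2) ∉ S := fun h1 => hc h1 (hL.label hev h1)
        have h2 : chi' m s ∉ S := fun h2 => hS ⟨hev, h1, h2⟩
        rw [classSet, if_neg (by omega), if_neg (lt_irrefl _), if_neg, if_neg]
        · have hr : 2 * (m / 2) = m := Nat.two_mul_div_two_of_even hev
          have hc := h.half_const hL hr (fun s' => by
            rcases eq_or_neg s s' with rfl | rfl
            · rwa [irrChi_half_val hr]
            · rwa [irrChi_half_val' hr])
          have hT : ∀ n ∈ Set.Icc (d k) (m / 2), 2 * n ≤ m := fun n hn => by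
            have := hn.2
            omega
          have h3 := h.classIs (A := chi m s '' Set.Icc (d k) (m / 2) ∪ {chi' m s})
            (hL.irrChi_mem le_rfl) ?_ ?_
          · rwa [irrChi_val (hL.two_mul_lt le_rfl).le] at h3
          · rintro _ (⟨n, hn, rfl⟩ | rfl)
            · exact chi_mem s (hT n hn)
            · rw [← irrChi_half_val' hr]
              exact (irrChi m (-s) _).2
          · intro χ
            rcases irr_cases s χ with ⟨n, hn, rfl⟩ | ⟨r, hr', rfl | rfl⟩ | rfl
            · rw [hpos k le_rfl n hn, Set.mem_union, irrChi_val hn.le, chi_mem_image hT hn.le,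
                Set.mem_Icc]
              constructor
              · exact fun h1 => Or.inl ⟨⟨h1.1, by omega⟩, fun _ => rfl⟩
              · rintro (h1 | h1)
                · exact ⟨h1.1.1, fun h2 => absurd h2 (lt_irrefl _)⟩
                · rw [Set.mem_singleton_iff, chi'_eq s hev] at h1
                  have := chi_inj hn.le hr.le h1
                  omega
            · obtain rfl : r = m / 2 := by omega
              refine iff_of_true (hc _) (Or.inl ⟨m / 2, ⟨by omega, le_rfl⟩, ?_⟩)
              rw [irrChi_val hr.le]
            · obtain rfl : r = m / 2 := by omega
              exact iff_of_true (hc _) (Or.inr (irrChi_half_val' hr))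
            · refine iff_of_false
                (h.sgn_lt hL (irrChi_ne_irrSgn s (hL.two_mul_lt le_rfl).le)).ne ?_
              rintro (h4 | h4)
              · exact sgn_notMem_image hT h4
              · refine irrChi_ne_irrSgn (-s) hr.le (Subtype.ext ?_)
                rw [irrChi_half_val' hr]
                exact h4.symm
        · exact fun h3 => h2 h3.2
        · rintro (h3 | h3)
          · exact Nat.not_odd_iff_even.2 hev h3
          · exact h1 h3.1
    · have h1 : ∀ n ∈ Set.Ico (d k) (d (k + 1)), 2 * n < m := fun n hn => by
        have := hn.2
        have := hL.two_mul_lt (show k + 1 ≤ N from hkN)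
        omega
      have h2 : ClassIs m D (chi m s (d k)) (chi m s '' Set.Ico (d k) (d (k + 1))) := by
        refine h.classIs_image hL hk (fun n hn => (h1 n hn).le) (fun n hn => ?_)
          (fun r hr => hhalf _ r hr k hkN)
        rcases hn.eq_or_lt with hn | hn
        · exact ⟨fun h3 => absurd h3 (hhalf s n hn k hkN), fun h3 => absurd hn (h1 n h3).ne⟩
        · rw [hpos k hk n hn, Set.mem_Ico]
          exact ⟨fun h3 => ⟨h3.1, h3.2 hkN⟩, fun h3 => ⟨h3.1, fun _ => h3.2⟩⟩
      rw [classSet]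
      by_cases hk0 : k = 0
      · subst hk0
        rw [if_pos rfl]
        convert h2
        rw [hd0, zero_add, hd1]
        have : Set.Ico 0 1 = {0} := by
          ext n
          simp only [Set.mem_Ico, Set.mem_singleton_iff]
          omega
        rw [this, Set.image_singleton]
      · rw [if_neg hk0, if_pos hkN, Set.Ioc_self, Set.image_empty, Set.union_empty]
        exact h2
  · have hr2 : 2 * (m / 2) = m := Nat.two_mul_div_two_of_even hm
    rw [← irrChi_half_val hr2] at hr ⊢
    exact h.classIs_half hL hr2 hr
  · have hr2 : 2 * (m / 2) = m := Nat.two_mul_div_two_of_even hm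
    rw [← irrChi_half_val' hr2] at hr ⊢
    exact h.classIs_half hL hr2 hr

/-! ### The case of exactly one of `χ_r`, `χ_r'` -/

/-- The indices of the members of `C_k` if `S` contains exactly one of `χ_r`, `χ_r'`. -/
def _root_.LusztigShoji.indexSet (N : ℕ) (d f : ℕ → ℕ) (k : ℕ) : Set ℕ :=
  if k = 0 then {0} else if k < N then Set.Ico (d k) (d (k + 1)) ∪ Set.Ioc (f (k + 1)) (f k)
  else Set.Icc (d N) (f N)

theorem _root_.LusztigShoji.classSet_eq_image (hS : Even m ∧ chi m s (m / 2) ∉ S ∧ chi' m s ∈ S) (f : ℕ → ℕ)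
    (k : ℕ) : classSet m s S N d f k = chi m s '' indexSet N d f k := by
  rw [classSet, indexSet]
  split_ifs with h1 h2 h3
  · rw [Set.image_singleton]
  · rw [Set.image_union]
  · exfalso
    rcases h3 with h3 | h3
    · exact Nat.not_odd_iff_even.2 hS.1 h3
    · exact hS.2.1 h3.1
  · rfl
  · exact absurd hS.2 ‹_›

theorem hasForm_of_indexSet (hL : IsLabelled m s S N d) (h : IsSpringerFor m S D)
    (hS : Even m ∧ chi m s (m / 2) ∉ S ∧ chi' m s ∈ S) {f : ℕ → ℕ}
    (hf : ∀ k ≤ N, ∀ n ∈ indexSet N d f k, 2 * n ≤ m)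
    (h1 : ∀ k ≤ N, ∀ n, 2 * n ≤ m →
      (D.supp (irrChi m s n) = D.supp (irrChi m s (d k)) ↔ n ∈ indexSet N d f k)) :
    HasForm m s S N d f D := by
  have hr : 2 * (m / 2) = m := Nat.two_mul_div_two_of_even hS.1
  refine ⟨fun k hk => ?_, fun _ h2 => absurd h2 hS.2.1, fun hm h2 => ?_, h.classIs_sgn hL⟩
  · rw [classSet_eq_image hS]
    refine h.classIs_image hL hk (hf k hk) (h1 k hk) fun r hr => ?_
    have h2 := hS.2.2
    rw [← irrChi_half_val' hr] at h2
    exact (h.half_lt hL hr h2 (hL.two_mul_lt hk)).ne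
  · rw [← irrChi_half_val' hr] at h2 ⊢
    exact h.classIs_half hL hr h2

/-- From `d N` up to `r` the classes increase weakly with the index, so the indices of class at most
`C_k` there form an initial interval, and `f k` is its last member. The hypothesis `hfam`, a
consequence of the family condition, says that this interval is everything for `k = 1`. -/
theorem exists_hasForm (hL : IsLabelled m s S N d) (h : IsSpringerFor m S D)
    (hS : Even m ∧ chi m s (m / 2) ∉ S ∧ chi' m s ∈ S)
    (hfam : D.supp (irrChi m s (m / 2)) ≤ D.supp (irrChi m s 1)) :
    ∃ f : ℕ → ℕ, AntitoneOn f (Set.Icc 1 N) ∧ HasForm m s S N d f D ∧ f 1 = m / 2 ∧ d N ≤ f N := by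
  have hr : 2 * (m / 2) = m := Nat.two_mul_div_two_of_even hS.1
  have hN := hL.one_le
  have hd0 := hL.d_zero
  have hd1 := hL.d_one
  have hdN := hL.two_mul_lt le_rfl
  set r := m / 2 with hrdef
  have hSr : (irrChi m s r).1 ∉ S := by rw [irrChi_half_val hr]; exact hS.2.1
  have hSr' : (irrChi m (-s) r).1 ∈ S := by rw [irrChi_half_val' hr]; exact hS.2.2
  have hidx : ∀ i, 2 * i ≤ m → ∃ k ≤ N, D.supp (irrChi m s i) = D.supp (irrChi m s (d k)) := by
    intro i hi
    rcases hi.eq_or_lt with hi | hi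
    · obtain rfl : i = r := by omega
      exact h.half_index hL hr hSr
    · obtain ⟨k, hk, -, he⟩ := h.exists_index hL hi
      exact ⟨k, hk, he⟩
  -- This extends `supp_mono` to the index `r` itself. The character `χ_r'` is a Springer
  -- representation below all `χ_i` with `i < r`, so a descent at `χ_r` would put both sides of the
  -- fork below.
  have hmono : ∀ i l, d N ≤ i → i ≤ l → 2 * l ≤ m →
      D.supp (irrChi m s i) ≤ D.supp (irrChi m s l) := by
    intro i l hi hil hl
    rcases hl.eq_or_lt with hl | hl
    · obtain rfl : l = r := by omega
      rcases hil.eq_or_lt with rfl | hil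
      · exact le_rfl
      · by_contra hlt
        rw [not_le] at hlt
        obtain ⟨k, hk, hek⟩ := hidx r hr.le
        have h1 : D.supp (irrChi m s (d N)) < D.supp (irrChi m s i) := by
          refine lt_of_le_of_lt ?_ hlt
          rw [hek]
          exact h.supp_d_le hL hk le_rfl
        refine h.between_half hL (lt_of_le_of_ne hi ?_) hil hr h1 fun s' => ?_
        · rintro rfl
          exact lt_irrefl _ h1
        · rcases eq_or_neg s s' with rfl | rfl
          · exact hlt
          · exact h.half_lt hL hr hSr' (by omega)
    · exact h.supp_mono hL hi hil hl
  let T : ℕ → ℕ → Prop := fun k i => d N ≤ i ∧ D.supp (irrChi m s i) ≤ D.supp (irrChi m s (d k))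
  let f : ℕ → ℕ := fun k => Nat.findGreatest (T k) r
  have hfr : ∀ k, f k ≤ r := fun k => Nat.findGreatest_le r
  have hfT : ∀ k ≤ N, T k (f k) := fun k hk =>
    Nat.findGreatest_spec (P := T k) (m := d N) (by omega) ⟨le_rfl, h.supp_d_le hL hk le_rfl⟩
  have hf : ∀ k ≤ N, ∀ i, d N ≤ i → i ≤ r →
      (D.supp (irrChi m s i) ≤ D.supp (irrChi m s (d k)) ↔ i ≤ f k) := by
    intro k hk i hi hir
    constructor
    · intro h1
      exact Nat.le_findGreatest hir ⟨hi, h1⟩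
    · intro h1
      exact (hmono i (f k) hi h1 (by have := hfr k; omega)).trans (hfT k hk).2
  have hfanti : ∀ k l, k ≤ l → l ≤ N → f l ≤ f k := by
    intro k l hkl hl
    exact Nat.le_findGreatest (hfr l) ⟨(hfT l hl).1, (hfT l hl).2.trans (h.supp_d_le hL hkl hl)⟩
  have hf1 : f 1 = r := by
    refine le_antisymm (hfr 1) ((hf 1 hN r (by omega) le_rfl).1 ?_)
    rw [hd1]
    exact hfam
  refine ⟨f, fun k hk l hl hkl => hfanti k l hkl hl.2, ?_, hf1, (hfT N le_rfl).1⟩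
  refine h.hasForm_of_indexSet hL hS (fun k hk n hn => ?_) fun k hk n hn => ?_
  · rw [indexSet] at hn
    split_ifs at hn with h1 h2
    · have : n = 0 := hn
      omega
    · rcases hn with hn | hn
      · have := hn.2
        have := hL.two_mul_lt (show k + 1 ≤ N from h2)
        omega
      · have := hn.2
        have := hfr k
        omega
    · have := hn.2
      have := hfr N
      omega
  · rw [indexSet]
    rcases lt_or_ge n (d N) with h1 | h1
    · rw [h.supp_eq_iff_of_lt hL hk h1]
      split_ifs with h2 h3
      · subst h2
        rw [hd0, zero_add, hd1, Set.mem_singleton_iff]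
        omega
      · have := (hfT (k + 1) h3).1
        simp only [Set.mem_union, Set.mem_Ico, Set.mem_Ioc]
        omega
      · rw [Set.mem_Icc]
        omega
    · have hle : ∀ k ≤ N, (D.supp (irrChi m s n) ≤ D.supp (irrChi m s (d k)) ↔ n ≤ f k) :=
        fun k hk => hf k hk n h1 (by omega)
      split_ifs with h2 h3
      · subst h2
        have h4 : D.supp (irrChi m s n) < D.supp (irrChi m s (d 0)) :=
          ((hle 1 hN).2 (by omega)).trans_lt (h.supp_d_lt hL one_pos hN)
        have h5 : 0 < d N := by
          have := hL.le hN le_rfl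
          omega
        exact iff_of_false h4.ne (by rw [Set.mem_singleton_iff]; omega)
      · have h4 : ¬ n < d (k + 1) := by
          have := hL.le (show k + 1 ≤ N from h3) le_rfl
          omega
        simp only [Set.mem_union, Set.mem_Ico, Set.mem_Ioc, h4, and_false, false_or]
        constructor
        · intro he
          refine ⟨not_le.1 fun h5 => ?_, (hle k hk).1 he.le⟩
          exact absurd ((hle (k + 1) h3).2 h5) (not_le_of_gt (by
            rw [he]; exact h.supp_d_lt hL (Nat.lt_succ_self k) h3))
        · rintro ⟨h5, h6⟩
          obtain ⟨k', hk', he⟩ := hidx n hn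
          have h7 := (hle k hk).2 h6
          have h8 := mt (hle (k + 1) h3).1 (not_le_of_gt h5)
          rw [he] at h7 h8 ⊢
          have h9 : k ≤ k' := by
            by_contra hlt
            exact not_le_of_gt (h.supp_d_lt hL (not_le.1 hlt) hk) h7
          have h10 : k' ≤ k := by
            by_contra hlt
            exact h8 (h.supp_d_le hL (by omega) hk')
          rw [le_antisymm h9 h10]
      · obtain rfl : k = N := by omega
        rw [Set.mem_Icc]
        constructor
        · exact fun he => ⟨h1, (hle k hk).1 he.le⟩
        · rintro ⟨-, h5⟩
          obtain ⟨k', hk', he⟩ := hidx n hn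
          refine le_antisymm ((hle k hk).2 h5) ?_
          rw [he]
          exact h.supp_d_le hL hk' le_rfl

end IsSpringerFor

end

section

variable {m : ℕ} [NeZero m] {s : ℤˣ} {S : Set (DihedralGroup m → ℂ)} {N : ℕ} {d : ℕ → ℕ}

/-! ## Springer correspondences: the inequality and uniqueness -/

/-- The coefficient of the row of `χ_r'` in the expression of the row of `χ_i` by those of `χ_t` and
`χ_r'`. -/
def coefHalf (t i r : ℕ) : F := ((if i = r then 0 else q ^ i) - q ^ (2 * t) / q ^ i) / q ^ r

/-- Columns `n ≤ t` see a row only through its right factor, and the column of `χ_r'` gives one more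
condition. These two conditions are solved by the rows of `χ_t` and `χ_r'`. The coefficient of `χ_t`
is a monomial, so unlike in the other relations polynomiality only bounds its exponent. -/
theorem row_beyond {s s' : ℤˣ} {t i r n : ℕ} (hti : t < i) (hir : i ≤ r) (hr : 2 * r = m)
    (hn : 2 * n ≤ m) (h : n ≤ t ∨ (n = r ∧ s' = -s)) :
    q ^ t / q ^ i * redOmega m (irrChi m s t) (irrChi m s' n) +
      coefHalf t i r * redOmega m (irrChi m (-s) r) (irrChi m s' n) =
      redOmega m (irrChi m s i) (irrChi m s' n) := by
  have hq := q_ne_zero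
  have hs := neg_unit_ne s
  rw [coefHalf]
  rcases h with h | ⟨rfl, rfl⟩
  · rw [redOmega_comm (irrChi m s t), redOmega_comm (irrChi m (-s) r),
      redOmega_comm (irrChi m s i), redOmega_left h (by omega) (by omega),
      redOmega_left (by omega) hr.le (by omega), redOmega_left (by omega) (by omega) (by omega),
      if_neg (by omega), if_pos hr]
    have h1 : m - t = (m - i) + (i - t) := by omega
    have h2 : i = t + (i - t) := by omega
    by_cases hi : i = r
    · rw [if_pos hi, if_pos (by omega), h1, show m - i = r by omega]
      field_simp
      rw [← hi]
      generalize i - t = a at h2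
      subst h2
      ring
    · rw [if_neg hi, if_neg (by omega), h1]
      generalize m - i = b
      generalize i - t = a at h2
      subst h2
      field_simp
      ring
  · rw [redOmega_two_half _ _ (by omega) hr, redOmega_half_half _ _ hr, if_pos rfl]
    rcases hir.eq_or_lt with rfl | hi
    · rw [if_pos rfl, redOmega_half_half _ _ hr, if_neg hs, ← hr]
      field_simp
      ring
    · rw [if_neg hi.ne, redOmega_two_half _ _ hi hr, ← hr]
      field_simp
      ring

theorem le_of_q_pow_mul_eq {p : Polynomial ℂ} {a b : ℕ}
    (h : q ^ a * algebraMap (Polynomial ℂ) F p = q ^ b) : a ≤ b := by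
  rw [q_pow_eq, q_pow_eq, ← map_mul] at h
  have h1 := RatFunc.algebraMap_injective ℂ h
  have h2 : (Polynomial.X : Polynomial ℂ) ^ a ∣ Polynomial.X ^ b := ⟨p, h1.symm⟩
  exact (pow_dvd_pow_iff Polynomial.X_ne_zero Polynomial.not_isUnit_X).1 h2

theorem supp_val_of_classIs {D : Datum m} {χ : Irr m} {A : Set (DihedralGroup m → ℂ)}
    (h : ClassIs m D χ.1 A) : Subtype.val '' (D.supp χ).1 = A := by
  obtain ⟨C, hC, ⟨χ', hχ', hrep⟩, rfl⟩ := h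
  obtain rfl : χ' = χ := Subtype.ext hχ'
  rw [D.supp_eq (⟨C, hC⟩ : D.Cls) hrep.1]

theorem supp_eq_iff_of_classIs {D : Datum m} {χ : Irr m} {A : Set (DihedralGroup m → ℂ)}
    (h : ClassIs m D χ.1 A) (χ' : Irr m) : D.supp χ' = D.supp χ ↔ χ'.1 ∈ A := by
  rw [← supp_val_of_classIs h, ← Datum.mem_iff]
  exact ⟨fun h => ⟨χ', h, rfl⟩, fun ⟨χ'', h1, h2⟩ => Subtype.ext h2 ▸ h1⟩

theorem irrChi_val_mem_image_iff {T : Set ℕ} (hT : ∀ n ∈ T, 2 * n ≤ m) {n : ℕ} (hn : 2 * n ≤ m) :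
    (irrChi m s n).1 ∈ chi m s '' T ↔ n ∈ T := by
  rw [irrChi_val hn, chi_mem_image hT hn]
  exact and_iff_left fun _ => rfl

namespace IsSpringerFor

variable {D D' : Datum m}

theorem indexSet_le (hL : IsLabelled m s S N d) {f : ℕ → ℕ} (hf : AntitoneOn f (Set.Icc 1 N))
    (hf1 : f 1 ≤ m / 2) {k : ℕ} (hk : k ≤ N) {n : ℕ} (hn : n ∈ indexSet N d f k) :
    2 * n ≤ m := by
  have hle : ∀ k, 1 ≤ k → k ≤ N → f k ≤ m / 2 := fun k hk hkN =>
    (hf ⟨le_rfl, hL.one_le⟩ ⟨hk, hkN⟩ hk).trans hf1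
  rw [indexSet] at hn
  split_ifs at hn with h1 h2
  · have : n = 0 := hn
    omega
  · rcases hn with hn | hn
    · have := hn.2
      have := hL.two_mul_lt (show k + 1 ≤ N from h2)
      omega
    · have := hn.2
      have := hle k (by omega) hk
      omega
  · have := hn.2
    have := hle N hL.one_le le_rfl
    omega

theorem supp_eq_iff_mem_indexSet (hL : IsLabelled m s S N d)
    (hS : Even m ∧ chi m s (m / 2) ∉ S ∧ chi' m s ∈ S) {f : ℕ → ℕ}
    (hf : AntitoneOn f (Set.Icc 1 N)) (hf1 : f 1 = m / 2) (hF : HasForm m s S N d f D) {k : ℕ}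
    (hk : k ≤ N) {n : ℕ} (hn : 2 * n ≤ m) :
    D.supp (irrChi m s n) = D.supp (irrChi m s (d k)) ↔ n ∈ indexSet N d f k := by
  have h1 := hF.main k hk
  rw [classSet_eq_image hS, ← irrChi_val (hL.two_mul_lt hk).le] at h1
  rw [supp_eq_iff_of_classIs h1,
    irrChi_val_mem_image_iff (fun n hn => indexSet_le hL hf hf1.le hk hn) hn]

/-- By `row_beyond`, the entry of `P` at `χ_(f k)` and `χ_(f l)` is `q ^ (d l + f l - f k)`. It has
to be divisible by the power of `q` attached to the class of `χ_(f k)`. The condition on `l` ensures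
that `χ_(f l)` lies in `C_l`. -/
theorem sub_le_sub (hL : IsLabelled m s S N d) (h : IsSpringerFor m S D)
    (hS : Even m ∧ chi m s (m / 2) ∉ S ∧ chi' m s ∈ S) {f : ℕ → ℕ}
    (hf : AntitoneOn f (Set.Icc 1 N)) (hf1 : f 1 = m / 2) (hfN : d N ≤ f N)
    (hF : HasForm m s S N d f D) {k l : ℕ} (hk : 1 ≤ k) (hkl : k < l) (hl : l ≤ N)
    (hfl : l = N ∨ f (l + 1) < f l) : (f k : ℤ) - f l ≤ d l - d k := by
  have hr : 2 * (m / 2) = m := Nat.two_mul_div_two_of_even hS.1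
  have hfkl : f l ≤ f k := hf ⟨hk, hkl.le.trans hl⟩ ⟨hk.trans hkl.le, hl⟩ hkl.le
  have hdkl := hL.lt hkl hl
  rcases hfkl.eq_or_lt with heq | hlt
  · omega
  -- If `f` is constant from `k` on for a while, `χ_(f k)` lies in the last class `C_k'` with the
  -- same value of `f`. The inequality for `k'` is stronger, as `d k ≤ d k'`.
  have hex : ∃ k', k ≤ k' ∧ k' < l ∧ f k' = f k ∧ f (k' + 1) < f k' := by
    obtain ⟨k', h1, h2, h3, h4⟩ := exists_nearest (T := fun n => f n = f k) hkl rfl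
    refine ⟨k', h1, h2, h3, lt_of_le_of_ne
      (hf ⟨by omega, by omega⟩ ⟨by omega, by omega⟩ (by omega)) fun he => ?_⟩
    rcases (show k' + 1 ≤ l from h2).eq_or_lt with h5 | h5
    · rw [h5] at he
      omega
    · have := h4 (k' + 1) h5 (he.trans h3)
      omega
  obtain ⟨k', hkk', hk'l, hfk', hstep⟩ := hex
  have hfk1 : f k ≤ m / 2 := hf1 ▸ hf ⟨le_rfl, by omega⟩ ⟨hk, by omega⟩ hk
  have hmem := fun k (hk : k ≤ N) n (hn : 2 * n ≤ m) =>
    supp_eq_iff_mem_indexSet hL hS hf hf1 hF (k := k) hk (n := n) hn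
  have hi : D.supp (irrChi m s (f k')) = D.supp (irrChi m s (d k')) := by
    rw [hmem k' (by omega) _ (by omega), indexSet, if_neg (by omega), if_pos (by omega)]
    exact Or.inr ⟨hstep, le_rfl⟩
  have ht : D.supp (irrChi m s (f l)) = D.supp (irrChi m s (d l)) := by
    rw [hmem l hl _ (by omega), indexSet, if_neg (by omega)]
    split_ifs with h1
    · exact Or.inr ⟨hfl.resolve_left h1.ne, le_rfl⟩
    · obtain rfl : l = N := by omega
      exact ⟨hfN, le_rfl⟩
  have hSr : (irrChi m s (m / 2)).1 ∉ S := by rw [irrChi_half_val hr]; exact hS.2.1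
  have hSr' : (irrChi m (-s) (m / 2)).1 ∈ S := by rw [irrChi_half_val' hr]; exact hS.2.2
  -- Such an index belongs to some `C_l'` with `l ≤ l'`, whose members are bounded by `f l'` or by
  -- `d N`, hence by `f l`. This leaves exactly the columns allowed in `row_beyond`.
  have hle : ∀ n, 2 * n ≤ m → D.supp (irrChi m s n) ≤ D.supp (irrChi m s (f l)) → n ≤ f l := by
    intro n hn hsupp
    obtain ⟨l', hl', he⟩ : ∃ l' ≤ N, D.supp (irrChi m s n) = D.supp (irrChi m s (d l')) := by
      rcases hn.eq_or_lt with hn | hn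
      · exact h.half_index hL hn (by rwa [show n = m / 2 by omega])
      · obtain ⟨k, hk, -, he⟩ := h.exists_index hL hn
        exact ⟨k, hk, he⟩
    have hll' : l ≤ l' := by
      by_contra hlt
      rw [ht, he] at hsupp
      exact absurd (h.supp_d_lt hL (not_le.1 hlt) hl) hsupp.not_gt
    have hn' := (hmem l' hl' n hn).1 he
    have hfN' : f N ≤ f l := hf ⟨by omega, hl⟩ ⟨by omega, le_rfl⟩ hl
    have hfl' : f l' ≤ f l := hf ⟨by omega, hl⟩ ⟨by omega, hl'⟩ hll'
    rw [indexSet, if_neg (by omega)] at hn'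
    split_ifs at hn' with h1
    · rcases hn' with hn' | hn'
      · have := hL.le (show l' + 1 ≤ N from h1) le_rfl
        have := hn'.2
        omega
      · exact hn'.2.trans hfl'
    · exact hn'.2.trans hfN'
  have hlt' : f l < f k' := by omega
  obtain ⟨-, p, hp⟩ := h.relation hL (i := irrChi m s (f k')) (j := irrChi m s (f l))
    (z₁ := irrChi m s (f l)) (z₂ := irrChi m (-s) (m / 2)) (z₃ := irrChi m s (f l))
    (c₁ := q ^ f l / q ^ f k') (c₂ := coefHalf (f l) (f k') (m / 2)) (c₃ := 0) le_rfl
    (h.half_lt hL hr hSr' (by omega)).le le_rfl (fun s' n hn hsupp => by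
      rw [zero_mul, add_zero]
      refine row_beyond hlt' (by omega) hr hn ?_
      by_cases hn2 : 2 * n = m
      · rcases eq_or_neg s s' with rfl | rfl
        · exact Or.inl (hle n hn hsupp)
        · exact Or.inr ⟨by omega, rfl⟩
      · rw [irrChi_sign s (by omega)] at hsupp
        exact Or.inl (hle n hn hsupp)) (irrChi_ne_irrSgn s (by omega))
  have hak : D.a (D.supp (irrChi m s (f k'))) = d k' := by
    have := h.a_eq (hL.irrChi_mem (k := k') (by omega))
    rw [← hi, bInv_irrChi s (hL.two_mul_lt (by omega)).le] at this
    exact_mod_cast this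
  have hal : D.a (D.supp (irrChi m s (f l))) = d l := by
    have := h.a_eq (hL.irrChi_mem hl)
    rw [← ht, bInv_irrChi s (hL.two_mul_lt hl).le] at this
    exact_mod_cast this
  rw [if_pos rfl, if_neg, hak, hal, ite_self, add_zero, add_zero] at hp
  · have h5 : q ^ (d k' + f k') * algebraMap (Polynomial ℂ) F (p.map (Int.castRingHom ℂ)) =
        q ^ (d l + f l) := by
      have hq := q_ne_zero
      rw [pow_add, mul_right_comm, hp]
      field_simp
      ring
    have h6 := le_of_q_pow_mul_eq h5
    have h7 := hL.le hkk' (by omega)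
    omega
  · intro he
    have := irrChi_inj (m := m) (by omega) (by omega) he
    omega

/-- Members of `S` with the same `b`-invariant. -/
theorem _root_.LusztigShoji.eq_or_bInv_ne (χ χ' : Irr m) : χ = χ' ∨ bInv m χ < bInv m χ' ∨
    bInv m χ' < bInv m χ ∨ ∃ r s', 2 * r = m ∧ χ = irrChi m s' r ∧ χ' = irrChi m (-s') r := by
  by_cases hne : bInv m χ = bInv m χ'
  swap
  · rcases lt_or_gt_of_ne hne with h | h <;> simp [h]
  rcases irr_cases' χ with ⟨s, i, hi, rfl⟩ | rfl <;> rcases irr_cases' χ' with ⟨s', j, hj, rfl⟩ | rfl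
  · rw [bInv_irrChi s hi, bInv_irrChi s' hj] at hne
    obtain rfl : i = j := by exact_mod_cast hne
    rcases hi.eq_or_lt with h2 | h2
    · rcases eq_or_neg s s' with rfl | rfl
      · exact Or.inl rfl
      · exact Or.inr (Or.inr (Or.inr ⟨i, s, h2, rfl, rfl⟩))
    · exact Or.inl (irrChi_sign s' h2)
  · rw [bInv_irrChi s hi, bInv_irrSgn] at hne
    have := NeZero.ne m
    omega
  · rw [bInv_irrChi s' hj, bInv_irrSgn] at hne
    have := NeZero.ne m
    omega
  · exact Or.inl rfl

theorem supp_val_eq (hL : IsLabelled m s S N d) (h : IsSpringerFor m S D)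
    (h' : IsSpringerFor m S D') (hS : ¬ (Even m ∧ chi m s (m / 2) ∉ S ∧ chi' m s ∈ S)) {χ : Irr m}
    (hχ : χ.1 ∈ S) : (D.supp χ).1 = (D'.supp χ).1 := by
  have hinj : Function.Injective (Set.image (Subtype.val : Irr m → _)) :=
    Set.image_injective.2 Subtype.val_injective
  refine hinj ?_
  obtain ⟨A, hA, hA'⟩ : ∃ A, ClassIs m D χ.1 A ∧ ClassIs m D' χ.1 A := by
    rcases irr_cases s χ with ⟨i, hi, rfl⟩ | ⟨r, hr, rfl | rfl⟩ | rfl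
    · rw [irrChi_val hi.le] at hχ ⊢
      obtain ⟨k, hk, rfl⟩ := hL.exists_eq hi hχ
      exact ⟨_, (h.hasForm_const hL hS).main k hk, (h'.hasForm_const hL hS).main k hk⟩
    · exact ⟨_, h.classIs_half hL hr hχ, h'.classIs_half hL hr hχ⟩
    · exact ⟨_, h.classIs_half hL hr hχ, h'.classIs_half hL hr hχ⟩
    · exact ⟨_, h.classIs_sgn hL, h'.classIs_sgn hL⟩
  rw [supp_val_of_classIs hA, supp_val_of_classIs hA']

theorem exists_rep_of_mem (h : IsSpringerFor m S D) {C : Set (Irr m)} (hC : C ∈ D.X) :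
    ∃ χ : Irr m, χ.1 ∈ S ∧ D.supp χ = ⟨C, hC⟩ := by
  obtain ⟨χ, hχ⟩ := D.exists_supp (⟨C, hC⟩ : D.Cls)
  obtain ⟨χ', h1, h2, -⟩ := h.exists_rep χ
  exact ⟨χ', h1, h2.trans hχ⟩

theorem X_subset (hL : IsLabelled m s S N d) (h : IsSpringerFor m S D)
    (h' : IsSpringerFor m S D') (hS : ¬ (Even m ∧ chi m s (m / 2) ∉ S ∧ chi' m s ∈ S)) :
    D.X ⊆ D'.X := by
  intro C hC
  obtain ⟨χ, hχ, he⟩ := h.exists_rep_of_mem hC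
  have h1 : C = (D'.supp χ).1 := by
    rw [← h.supp_val_eq hL h' hS hχ, he]
  rw [h1]
  exact (D'.supp χ).2

theorem X_eq (hL : IsLabelled m s S N d) (h : IsSpringerFor m S D)
    (h' : IsSpringerFor m S D') (hS : ¬ (Even m ∧ chi m s (m / 2) ∉ S ∧ chi' m s ∈ S)) :
    D.X = D'.X := (h.X_subset hL h' hS).antisymm (h'.X_subset hL h hS)

theorem supp_eq_mk (hL : IsLabelled m s S N d) (h : IsSpringerFor m S D)
    (h' : IsSpringerFor m S D') (hS : ¬ (Even m ∧ chi m s (m / 2) ∉ S ∧ chi' m s ∈ S))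
    {C : Set (Irr m)} (hC : C ∈ D.X) (hC' : C ∈ D'.X) {χ : Irr m} (hχ : χ.1 ∈ S)
    (he : D.supp χ = ⟨C, hC⟩) : D'.supp χ = ⟨C, hC'⟩ :=
  Subtype.ext ((h.supp_val_eq hL h' hS hχ).symm.trans (congrArg Subtype.val he))

theorem a_unique (hL : IsLabelled m s S N d) (h : IsSpringerFor m S D)
    (h' : IsSpringerFor m S D') (hS : ¬ (Even m ∧ chi m s (m / 2) ∉ S ∧ chi' m s ∈ S))
    {C : Set (Irr m)} (hC : C ∈ D.X) (hC' : C ∈ D'.X) : D.a ⟨C, hC⟩ = D'.a ⟨C, hC'⟩ := by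
  obtain ⟨χ, hχ, he⟩ := h.exists_rep_of_mem hC
  have he' := h.supp_eq_mk hL h' hS hC hC' hχ he
  have h1 := h.a_eq hχ
  rw [← h'.a_eq hχ, he, he'] at h1
  exact_mod_cast h1

/-- The `b`-invariants of the Springer representations determine the order, and they are distinct
except for `χ_r` and `χ_r'`. -/
theorem lt_unique (hL : IsLabelled m s S N d) (h : IsSpringerFor m S D)
    (h' : IsSpringerFor m S D') (hS : ¬ (Even m ∧ chi m s (m / 2) ∉ S ∧ chi' m s ∈ S))
    {C₁ C₂ : Set (Irr m)} (h₁ : C₁ ∈ D.X) (h₂ : C₂ ∈ D.X) (h₁' : C₁ ∈ D'.X) (h₂' : C₂ ∈ D'.X)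
    (hne : Even m → chi m s (m / 2) ∈ S →
      ({Subtype.val '' C₁, Subtype.val '' C₂} : Set (Set (DihedralGroup m → ℂ))) ≠
        {{chi m s (m / 2)}, {chi' m s}}) :
    D.lt ⟨C₁, h₁⟩ ⟨C₂, h₂⟩ ↔ D'.lt ⟨C₁, h₁'⟩ ⟨C₂, h₂'⟩ := by
  obtain ⟨χ, hχ, he⟩ := h.exists_rep_of_mem h₁
  obtain ⟨ψ, hψ, hf⟩ := h.exists_rep_of_mem h₂
  have he' := h.supp_eq_mk hL h' hS h₁ h₁' hχ he
  have hf' := h.supp_eq_mk hL h' hS h₂ h₂' hψ hf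
  rw [← he, ← he', ← hf, ← hf']
  change D.supp χ < D.supp ψ ↔ D'.supp χ < D'.supp ψ
  rcases eq_or_bInv_ne χ ψ with rfl | hb | hb | ⟨r, s', hr, rfl, rfl⟩
  · exact iff_of_false (lt_irrefl _) (lt_irrefl _)
  · exact iff_of_false (h.supp_lt hχ hψ hb).not_gt (h'.supp_lt hχ hψ hb).not_gt
  · exact iff_of_true (h.supp_lt hψ hχ hb) (h'.supp_lt hψ hχ hb)
  · exfalso
    have h1 := supp_val_of_classIs (h.classIs_half hL hr hχ)
    have h2 := supp_val_of_classIs (h.classIs_half hL hr hψ)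
    rw [he] at h1
    rw [hf] at h2
    have hm : Even m := ⟨r, by omega⟩
    rcases eq_or_neg s s' with rfl | rfl
    · rw [irrChi_half_val hr] at h1 hχ
      rw [irrChi_half_val' hr] at h2
      refine hne hm hχ ?_
      rw [← h1, ← h2]
    · rw [irrChi_half_val' hr] at h1
      rw [neg_neg, irrChi_half_val hr] at h2 hψ
      refine hne hm hψ ?_
      rw [← h1, ← h2, Set.pair_comm]

theorem _root_.LusztigShoji.Datum.ext_of {D D' : Datum m} (hX : D.X = D'.X)
    (ha : ∀ C (h : C ∈ D.X) (h' : C ∈ D'.X), D.a ⟨C, h⟩ = D'.a ⟨C, h'⟩)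
    (hlt : ∀ C₁ C₂ (h₁ : C₁ ∈ D.X) (h₂ : C₂ ∈ D.X) (h₁' : C₁ ∈ D'.X) (h₂' : C₂ ∈ D'.X),
      D.lt ⟨C₁, h₁⟩ ⟨C₂, h₂⟩ ↔ D'.lt ⟨C₁, h₁'⟩ ⟨C₂, h₂'⟩) : D = D' := by
  obtain ⟨X, hP, lt, hlt', a, ha'⟩ := D
  obtain ⟨X', hP', lt', hlt'', a', ha''⟩ := D'
  obtain rfl : X = X' := hX
  obtain rfl : lt = lt' := funext₂ fun C C' => propext (hlt C.1 C'.1 C.2 C'.2 C.2 C'.2)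
  obtain rfl : a = a' := funext fun C => ha C.1 C.2 C.2
  rfl

theorem eq_of_half_notMem (hL : IsLabelled m s S N d) (h : IsSpringerFor m S D)
    (h' : IsSpringerFor m S D') (hS : ¬ (Even m ∧ chi m s (m / 2) ∉ S ∧ chi' m s ∈ S))
    (hr : ¬ (Even m ∧ chi m s (m / 2) ∈ S)) : D = D' :=
  Datum.ext_of (h.X_eq hL h' hS) (fun _ => h.a_unique hL h' hS) fun _ _ h₁ h₂ h₁' h₂' =>
    h.lt_unique hL h' hS h₁ h₂ h₁' h₂' fun hm hmem => absurd ⟨hm, hmem⟩ hr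

end IsSpringerFor

end

section

variable {m : ℕ} [NeZero m]

/-! ## Data defined by a level function -/

/-- The level of a class. -/
def levelOf {lev : Irr m → ℕ} (C : (Setoid.ker lev).classes) : ℕ := lev C.2.choose

theorem levelOf_eq {lev : Irr m → ℕ} {C : (Setoid.ker lev).classes} {χ : Irr m} (h : χ ∈ C.1) :
    levelOf C = lev χ := by
  have h1 := C.2.choose_spec
  rw [h1] at h
  exact (Setoid.ker_def.1 h).symm

theorem levelOf_injective {lev : Irr m → ℕ} : Function.Injective (levelOf (lev := lev)) := by
  intro C C' h
  have h1 := C.2.choose_spec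
  have h2 := C'.2.choose_spec
  refine Subtype.ext ?_
  rw [h1, h2]
  ext χ
  simp only [Set.mem_ofPred_eq, Setoid.ker_def]
  exact iff_of_eq (congrArg _ h)

/-- The datum whose classes are the fibres of a function `lev`, in the order opposite to the one of
the levels. -/
def Datum.ofLevel (lev : Irr m → ℕ) (A : ℕ → ℕ) (hA : Monotone A) : Datum m where
  X := (Setoid.ker lev).classes
  isPartition := Setoid.isPartition_classes _
  lt C C' := levelOf C' < levelOf C
  isStrictTotalOrder :=
    { trichotomous := fun _ _ h h' => levelOf_injective (le_antisymm (not_lt.1 h) (not_lt.1 h'))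
      irrefl := fun _ => lt_irrefl _
      trans := fun _ _ _ h h' => lt_trans h' h }
  a C := A (levelOf C)
  a_anti _ _ h := hA (le_of_lt h)

variable {lev : Irr m → ℕ} {A : ℕ → ℕ} {hA : Monotone A}

theorem Datum.ofLevel_supp_lt {χ χ' : Irr m} : (Datum.ofLevel lev A hA).supp χ <
    (Datum.ofLevel lev A hA).supp χ' ↔ lev χ' < lev χ := by
  rw [← levelOf_eq (Datum.mem_supp (Datum.ofLevel lev A hA) χ),
    ← levelOf_eq (Datum.mem_supp (Datum.ofLevel lev A hA) χ')]
  exact Datum.lt_iff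

theorem Datum.ofLevel_supp_le {χ χ' : Irr m} : (Datum.ofLevel lev A hA).supp χ ≤
    (Datum.ofLevel lev A hA).supp χ' ↔ lev χ' ≤ lev χ := by
  rw [← not_lt, ← not_lt, Datum.ofLevel_supp_lt]

theorem Datum.ofLevel_supp_eq {χ χ' : Irr m} : (Datum.ofLevel lev A hA).supp χ =
    (Datum.ofLevel lev A hA).supp χ' ↔ lev χ = lev χ' := by
  rw [le_antisymm_iff, Datum.ofLevel_supp_le, Datum.ofLevel_supp_le, le_antisymm_iff, and_comm]

theorem Datum.ofLevel_a (χ : Irr m) :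
    (Datum.ofLevel lev A hA).a ((Datum.ofLevel lev A hA).supp χ) = A (lev χ) := by
  rw [← levelOf_eq (Datum.mem_supp (Datum.ofLevel lev A hA) χ)]
  rfl

/-! ## Integrality -/

/-- The polynomials with integral coefficients. -/
def intPoly : Subring F :=
  ((algebraMap (Polynomial ℂ) F).comp (Polynomial.mapRingHom (Int.castRingHom ℂ))).range

theorem mem_intPoly {x : F} : x ∈ intPoly ↔
    ∃ p : Polynomial ℤ, x = algebraMap (Polynomial ℂ) F (p.map (Int.castRingHom ℂ)) :=
  ⟨fun ⟨p, hp⟩ => ⟨p, hp.symm⟩, fun ⟨p, hp⟩ => ⟨p, hp.symm⟩⟩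

/-- The polynomials with natural coefficients. -/
def natPoly : Subsemiring F :=
  ((algebraMap (Polynomial ℂ) F).comp (Polynomial.mapRingHom (Nat.castRingHom ℂ))).rangeS

theorem mem_natPoly {x : F} : x ∈ natPoly ↔
    ∃ p : Polynomial ℕ, x = algebraMap (Polynomial ℂ) F (p.map (Nat.castRingHom ℂ)) :=
  ⟨fun ⟨p, hp⟩ => ⟨p, hp.symm⟩, fun ⟨p, hp⟩ => ⟨p, hp.symm⟩⟩

theorem natPoly_le {x : F} (h : x ∈ natPoly) : x ∈ intPoly := by
  obtain ⟨p, rfl⟩ := mem_natPoly.1 h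
  refine mem_intPoly.2 ⟨p.map (Nat.castRingHom ℤ), ?_⟩
  rw [Polynomial.map_map]
  congr

theorem q_mem_natPoly : q ∈ natPoly := mem_natPoly.2 ⟨Polynomial.X, by simp⟩

theorem q_pow_mem_natPoly (n : ℕ) : q ^ n ∈ natPoly := pow_mem q_mem_natPoly n

theorem q_pow_mem_intPoly (n : ℕ) : q ^ n ∈ intPoly := natPoly_le (q_pow_mem_natPoly n)

/-- `x` is `q ^ a` times a polynomial with natural coefficients. -/
def NatDiv (a : ℕ) (x : F) : Prop := ∃ y ∈ natPoly, x = q ^ a * y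

theorem natDiv_zero (a : ℕ) : NatDiv a 0 := ⟨0, zero_mem _, (mul_zero _).symm⟩

theorem natDiv_pow {a n : ℕ} (h : a ≤ n) : NatDiv a (q ^ n) :=
  ⟨q ^ (n - a), q_pow_mem_natPoly _, by rw [← pow_add, Nat.add_sub_cancel' h]⟩

theorem NatDiv.add {a : ℕ} {x y : F} (hx : NatDiv a x) (hy : NatDiv a y) : NatDiv a (x + y) := by
  obtain ⟨u, hu, rfl⟩ := hx
  obtain ⟨v, hv, rfl⟩ := hy
  exact ⟨u + v, add_mem hu hv, by ring⟩

theorem natDiv_fakeDegree_irrChi {a i : ℕ} {s : ℤˣ} (ha : a ≤ i) (hi : 2 * i ≤ m) :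
    NatDiv a (fakeDegree m (irrChi m s i).1) := by
  rw [irrChi_val hi]
  rcases hi.eq_or_lt with h2 | h2
  · rw [fakeDegree_chi_half s h2]
    exact natDiv_pow ha
  · by_cases h0 : i = 0
    · subst h0
      rw [fakeDegree_chi_zero, ← pow_zero q]
      exact natDiv_pow ha
    · rw [fakeDegree_chi_two s h0 h2]
      exact (natDiv_pow ha).add (natDiv_pow (by omega))

theorem Omega_irrChi_mem {s s' : ℤˣ} {i j : ℕ} (hij : i ≤ j) (hj : 2 * j ≤ m) :
    ∃ y ∈ intPoly, Omega m (irrChi m s i) (irrChi m s' j) = q ^ m * y := by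
  rcases hj.eq_or_lt with h2 | h2
  · rcases hij.eq_or_lt with rfl | hij
    · rw [Omega_half_half _ _ h2]
      split_ifs
      · exact ⟨q ^ m, q_pow_mem_intPoly m, by ring⟩
      · exact ⟨1, one_mem _, by ring⟩
    · by_cases h0 : i = 0
      · subst h0
        rw [Omega_zero_half _ _ h2]
        exact ⟨_, q_pow_mem_intPoly _, rfl⟩
      · rw [Omega_two_half _ _ h0 hij h2]
        exact ⟨_, add_mem (q_pow_mem_intPoly _) (q_pow_mem_intPoly _), rfl⟩
  · rw [irrChi_sign s h2]
    by_cases h0 : i = 0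
    · subst h0
      by_cases hj0 : j = 0
      · subst hj0
        rw [Omega_zero_zero]
        exact ⟨_, q_pow_mem_intPoly m, by ring⟩
      · rw [Omega_zero_two _ hj0 h2]
        exact ⟨_, add_mem (q_pow_mem_intPoly _) (q_pow_mem_intPoly _), rfl⟩
    · rw [Omega_two_two _ h0 hij h2]
      exact ⟨_, add_mem (add_mem (q_pow_mem_intPoly _) (q_pow_mem_intPoly _))
        (add_mem (q_pow_mem_intPoly _) (q_pow_mem_intPoly _)), rfl⟩

theorem Omega_mem {χ χ' : Irr m} (hχ : χ ≠ irrSgn m) (hχ' : χ' ≠ irrSgn m) :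
    ∃ y ∈ intPoly, Omega m χ χ' = q ^ m * y := by
  rcases irr_cases' χ with ⟨s, i, hi, rfl⟩ | rfl
  · rcases irr_cases' χ' with ⟨s', j, hj, rfl⟩ | rfl
    · rcases le_total i j with h | h
      · exact Omega_irrChi_mem h hj
      · rw [Omega_comm]
        exact Omega_irrChi_mem h hi
    · exact absurd rfl hχ'
  · exact absurd rfl hχ

/-- Induction over the classes. In the block of a class `C`, the equation says that `Ω` is `q ^ (2
a_C) Λ` plus terms from smaller classes. By divisibility of `P` and induction those terms are `q ^
(2 a_C)` times integral polynomials, so the power of `q` cancels. -/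
theorem IsGreenSystem.lambda_mem {D : Datum m} {P Λ : Matrix (Irr m) (Irr m) F}
    (h : IsGreenSystem m D P Λ) (hP : ∀ i j, NatDiv (D.a (D.supp i)) (P i j))
    (hΩ : ∀ i j, D.supp i = D.supp j →
      ∃ y ∈ intPoly, Omega m i j = q ^ (2 * D.a (D.supp i)) * y) (i j : Irr m) :
    Λ i j ∈ intPoly := by
  have hB := isGreenSystem_iff.1 h
  choose p hp hpe using hP
  suffices ∀ C : D.Cls, ∀ i j, D.supp i = C → Λ i j ∈ intPoly from this _ i j rfl
  intro C
  induction C using WellFoundedLT.induction with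
  | ind C ih =>
    intro i j hi
    by_cases hij : D.supp i = D.supp j
    swap
    · rw [hB.block_diag _ _ hij]
      exact zero_mem _
    obtain ⟨y, hy, hye⟩ := hΩ i j hij
    -- Within the block of `C` the matrix `P` is scalar, so `(z, w) = (i, j)` is the only term that
    -- involves `Λ` on `C`.
    have key : ∀ z w, P i z * Λ z w * P j w - (if z = i ∧ w = j then
        q ^ (2 * D.a (D.supp i)) * Λ i j else 0) ∈
        {x | ∃ v ∈ intPoly, x = q ^ (2 * D.a (D.supp i)) * v} := by
      intro z w
      split_ifs with hzw
      · obtain ⟨rfl, rfl⟩ := hzw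
        refine ⟨0, zero_mem _, ?_⟩
        rw [hB.diag, hB.diag, ← hij]
        ring
      · by_cases hzero : P i z * Λ z w * P j w = 0
        · exact ⟨0, zero_mem _, by rw [hzero]; ring⟩
        have h1 : P i z ≠ 0 := fun h => hzero (by rw [h]; ring)
        have h2 : Λ z w ≠ 0 := fun h => hzero (by rw [h]; ring)
        have h3 : P j w ≠ 0 := fun h => hzero (by rw [h]; ring)
        have e2 : D.supp z = D.supp w := by
          by_contra hne
          exact h2 (hB.block_diag _ _ hne)
        have e1 : D.supp z ≤ D.supp i := by
          by_contra hlt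
          exact h1 (hB.lt _ _ (not_le.1 hlt))
        rcases e1.eq_or_lt with e1 | e1
        · exfalso
          refine hzw ⟨?_, ?_⟩
          · by_contra hne
            exact h1 (hB.block _ _ e1.symm fun h => hne h.symm)
          · by_contra hne
            exact h3 (hB.block _ _ (by rw [← hij, ← e1, e2]) fun h => hne h.symm)
        · refine ⟨p i z * Λ z w * p j w, mul_mem (mul_mem (natPoly_le (hp _ _))
            (ih _ (hi ▸ e1) z w rfl)) (natPoly_le (hp _ _)), ?_⟩
          rw [hpe i z, hpe j w, ← hij]
          ring
    choose v hv hve using key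
    have hsum : Omega m i j = ∑ w, ∑ z, P i z * Λ z w * P j w := by
      rw [← h.equation]
      simp only [Matrix.mul_apply, Matrix.transpose_apply, Finset.sum_mul]
    have h4 : ∑ w, ∑ z, (if z = i ∧ w = j then q ^ (2 * D.a (D.supp i)) * Λ i j else 0) =
        q ^ (2 * D.a (D.supp i)) * Λ i j := by
      rw [Finset.sum_eq_single j, Finset.sum_eq_single i]
      · simp
      · intro z _ hz
        simp [hz]
      · simp
      · intro w _ hw
        simp [hw]
      · simp
    have h5 : q ^ (2 * D.a (D.supp i)) * (y - Λ i j) =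
        q ^ (2 * D.a (D.supp i)) * ∑ w, ∑ z, v z w := by
      rw [mul_sub, ← hye, hsum, ← h4, ← Finset.sum_sub_distrib, Finset.mul_sum]
      refine Finset.sum_congr rfl fun w _ => ?_
      rw [← Finset.sum_sub_distrib, Finset.mul_sum]
      exact Finset.sum_congr rfl fun z _ => hve z w
    have h6 := mul_left_cancel₀ (pow_ne_zero _ q_ne_zero) h5
    have h7 : Λ i j = y - ∑ w, ∑ z, v z w := by rw [← h6]; ring
    rw [h7]
    exact sub_mem hy (sum_mem fun w _ => sum_mem fun z _ => hv z w)

end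

section

variable {m : ℕ} [NeZero m]

/-! ## Existence of Springer correspondences -/

/-- The index `k` of the class `C_k` that contains `χ_i`, unless this is a class of its own. -/
def idx (N : ℕ) (d f : ℕ → ℕ) (i : ℕ) : ℕ :=
  Nat.findGreatest (fun k => d k ≤ i ∧ (k = 0 ∨ i ≤ f k)) N

/-- The position of the class of a character, from above. -/
def lev (m : ℕ) [NeZero m] (s : ℤˣ) (S : Set (DihedralGroup m → ℂ)) (N : ℕ) (d f : ℕ → ℕ)
    (χ : Irr m) : ℕ :=
  if χ = irrSgn m then N + 3 else
    if χ.1 ∈ S ∧ 2 * bInv m χ = m then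
      if χ = irrChi m (-s) (m / 2) then N + 2 else N + 1
    else idx N d f (bInv m χ).toNat

/-- The value of `a` on the `k`-th class from above. -/
def levA (m N : ℕ) (d : ℕ → ℕ) (k : ℕ) : ℕ := if k ≤ N then d k else if k ≤ N + 2 then m / 2 else m

/-- The conditions on the sequence `f`. -/
structure IsTail (m : ℕ) [NeZero m] (s : ℤˣ) (S : Set (DihedralGroup m → ℂ)) (N : ℕ)
    (d f : ℕ → ℕ) : Prop where
  anti : AntitoneOn f (Set.Icc 1 N)
  le : d N ≤ f N
  alt : (Even m ∧ chi m s (m / 2) ∉ S ∧ chi' m s ∈ S) ∧ f 1 = m / 2 ∨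
    ¬ (Even m ∧ chi m s (m / 2) ∉ S ∧ chi' m s ∈ S) ∧ ∀ k, f k = m
  cond : ∀ k l, 1 ≤ k → k < l → l ≤ N → (l = N ∨ f (l + 1) < f l) → (f k : ℤ) - f l ≤ d l - d k

variable {s : ℤˣ} {S : Set (DihedralGroup m → ℂ)} {N : ℕ} {d f : ℕ → ℕ}

theorem levA_mono (hL : IsLabelled m s S N d) : Monotone (levA m N d) := by
  intro k l hkl
  rw [levA, levA]
  split_ifs with h1 h2 h3 h4 h5
  · exact hL.le hkl h2
  · have := hL.two_mul_lt h1
    omega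
  · have := hL.two_mul_lt h1
    omega
  all_goals omega

theorem idx_le {i : ℕ} : idx N d f i ≤ N := Nat.findGreatest_le N

namespace IsTail

theorem le_f (hL : IsLabelled m s S N d) (hT : IsTail m s S N d f) {k : ℕ} (hk : 1 ≤ k)
    (hkN : k ≤ N) : d N ≤ f k :=
  hT.le.trans (hT.anti ⟨hk, hkN⟩ ⟨hL.one_le, le_rfl⟩ hkN)

theorem half_le (hT : IsTail m s S N d f) : m / 2 ≤ f 1 := by
  rcases hT.alt with h | h
  · exact h.2.ge
  · rw [h.2]; omega

theorem idx_spec (hL : IsLabelled m s S N d) (i : ℕ) :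
    d (idx N d f i) ≤ i ∧ (idx N d f i = 0 ∨ i ≤ f (idx N d f i)) :=
  Nat.findGreatest_spec (P := fun k => d k ≤ i ∧ (k = 0 ∨ i ≤ f k)) (Nat.zero_le N)
    ⟨by rw [hL.d_zero]; omega, Or.inl rfl⟩

theorem le_idx {k i : ℕ} (hk : k ≤ N) (h1 : d k ≤ i) (h2 : i ≤ f k) : k ≤ idx N d f i :=
  Nat.le_findGreatest hk ⟨h1, Or.inr h2⟩

theorem one_le_idx (hL : IsLabelled m s S N d) (hT : IsTail m s S N d f) {i : ℕ} (hi : 1 ≤ i)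
    (him : 2 * i ≤ m) : 1 ≤ idx N d f i :=
  le_idx hL.one_le (by rw [hL.d_one]; exact hi) ((by omega : i ≤ m / 2).trans hT.half_le)

theorem idx_d (hL : IsLabelled m s S N d) (hT : IsTail m s S N d f) {k : ℕ} (hk : k ≤ N) :
    idx N d f (d k) = k := by
  refine le_antisymm ?_ ?_
  · by_contra hlt
    exact absurd (hL.lt (not_le.1 hlt) idx_le) (not_lt.2 (idx_spec hL (d k)).1)
  · by_cases h0 : k = 0
    · omega
    · exact le_idx hk le_rfl ((hL.le hk le_rfl).trans (hT.le_f hL (by omega) hk))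

theorem le_idx_f (hL : IsLabelled m s S N d) (hT : IsTail m s S N d f) {k : ℕ} (h1 : 1 ≤ k)
    (hk : k ≤ N) : k ≤ idx N d f (f k) :=
  le_idx hk ((hL.le hk le_rfl).trans (hT.le_f hL h1 hk)) le_rfl

/-- The indices of the characters in `C_k`. -/
theorem idx_eq_iff (hL : IsLabelled m s S N d) (hT : IsTail m s S N d f) {k n : ℕ} (hk : k ≤ N)
    (hn : 2 * n ≤ m) : idx N d f n = k ↔ n ∈ indexSet N d f k := by
  have hd0 := hL.d_zero
  have hd1 := hL.d_one
  have hspec := idx_spec (f := f) hL n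
  have hle : ∀ {k}, k ≤ N → d k ≤ n → n ≤ f k → k ≤ idx N d f n := le_idx
  have hN : idx N d f n ≤ N := idx_le
  rw [indexSet]
  constructor
  · intro he
    rw [he] at hspec hle
    split_ifs with h1 h2
    · rcases Nat.eq_zero_or_pos n with h3 | h3
      · exact h3
      · have := hT.one_le_idx hL h3 hn
        omega
    · have h4 := hle (k := k + 1) (by omega)
      by_cases h5 : n < d (k + 1)
      · exact Or.inl ⟨hspec.1, h5⟩
      · refine Or.inr ⟨?_, by omega⟩
        by_contra h6
        have := h4 (by omega) (by omega)
        omega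
    · obtain rfl : k = N := by omega
      exact ⟨hspec.1, by omega⟩
  · intro hmem
    split_ifs at hmem with h1 h2
    · obtain rfl : n = 0 := hmem
      rw [← hd0, hT.idx_d hL (Nat.zero_le N), h1]
    · have hdk := hL.le (show k + 1 ≤ N from h2) le_rfl
      have hfk := hT.le_f hL (show 1 ≤ k by omega) hk
      have hfk1 := hT.le_f hL (show 1 ≤ k + 1 by omega) h2
      have hdkk := hL.lt (Nat.lt_succ_self k) h2
      rcases hmem with ⟨h3, h4⟩ | ⟨h3, h4⟩
      · refine le_antisymm ?_ (hle hk h3 (by omega))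
        by_contra hlt
        have := hL.le (show k + 1 ≤ idx N d f n by omega) hN
        omega
      · refine le_antisymm ?_ (hle hk (by rw [Nat.succ_eq_add_one] at hdkk; omega) h4)
        by_contra hlt
        have := hT.anti (a := k + 1) (b := idx N d f n) ⟨by omega, h2⟩ ⟨by omega, hN⟩ (by omega)
        omega
    · obtain rfl : k = N := by omega
      exact le_antisymm hN (hle le_rfl hmem.1 hmem.2)

end IsTail

theorem lev_sgn : lev m s S N d f (irrSgn m) = N + 3 := if_pos rfl

theorem lev_idx {s' : ℤˣ} {i : ℕ} (hi : 2 * i ≤ m) (hS : 2 * i = m → (irrChi m s' i).1 ∉ S) :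
    lev m s S N d f (irrChi m s' i) = idx N d f i := by
  rw [lev, if_neg (irrChi_ne_irrSgn s' hi), bInv_irrChi s' hi, if_neg, Int.toNat_natCast]
  rintro ⟨h1, h2⟩
  exact hS (by exact_mod_cast h2) h1

theorem lev_two {s' : ℤˣ} {i : ℕ} (hi : 2 * i < m) :
    lev m s S N d f (irrChi m s' i) = idx N d f i :=
  lev_idx hi.le fun h => absurd h hi.ne

theorem lev_half' {r : ℕ} (hr : 2 * r = m) (hS : (irrChi m (-s) r).1 ∈ S) :
    lev m s S N d f (irrChi m (-s) r) = N + 2 := by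
  rw [lev, if_neg (irrChi_ne_irrSgn _ hr.le), bInv_irrChi _ hr.le, if_pos ⟨hS, by exact_mod_cast hr⟩,
    if_pos (by rw [show m / 2 = r by omega])]

theorem lev_half {r : ℕ} (hr : 2 * r = m) (hS : (irrChi m s r).1 ∈ S) :
    lev m s S N d f (irrChi m s r) = N + 1 := by
  rw [lev, if_neg (irrChi_ne_irrSgn _ hr.le), bInv_irrChi _ hr.le, if_pos ⟨hS, by exact_mod_cast hr⟩,
    if_neg]
  rw [show m / 2 = r by omega]
  exact irrChi_half_ne (neg_unit_ne s) hr

theorem lev_half_mem {s' : ℤˣ} {r : ℕ} (hr : 2 * r = m) (hS : (irrChi m s' r).1 ∈ S) :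
    N + 1 ≤ lev m s S N d f (irrChi m s' r) ∧ lev m s S N d f (irrChi m s' r) ≤ N + 2 := by
  rcases eq_or_neg s s' with rfl | rfl
  · rw [lev_half hr hS]; omega
  · rw [lev_half' hr hS]; omega

theorem lev_cases (χ : Irr m) : χ = irrSgn m ∨
    (∃ s' i, 2 * i ≤ m ∧ χ = irrChi m s' i ∧ (2 * i = m → χ.1 ∉ S) ∧
      lev m s S N d f χ = idx N d f i) ∨
    ∃ s' r, 2 * r = m ∧ χ = irrChi m s' r ∧ χ.1 ∈ S ∧ N + 1 ≤ lev m s S N d f χ ∧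
      lev m s S N d f χ ≤ N + 2 := by
  rcases irr_cases' χ with ⟨s', i, hi, rfl⟩ | rfl
  · by_cases h : 2 * i = m ∧ (irrChi m s' i).1 ∈ S
    · exact Or.inr (Or.inr ⟨s', i, h.1, rfl, h.2, lev_half_mem h.1 h.2⟩)
    · have h' : 2 * i = m → (irrChi m s' i).1 ∉ S := fun h1 h2 => h ⟨h1, h2⟩
      exact Or.inr (Or.inl ⟨s', i, hi, rfl, h', lev_idx hi h'⟩)
  · exact Or.inl rfl

theorem lev_lt_sgn {χ : Irr m} (h : χ ≠ irrSgn m) :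
    lev m s S N d f χ < lev m s S N d f (irrSgn m) := by
  rw [lev_sgn]
  rcases lev_cases (s := s) (S := S) (N := N) (d := d) (f := f) χ with h1 | ⟨s', i, -, -, -, h1⟩ |
    ⟨s', i, -, -, -, -, h1⟩
  · exact absurd h1 h
  · rw [h1]
    exact lt_of_le_of_lt idx_le (by omega)
  · omega

/-- Entries `q ^ i` in the row of `χ_i` are divisible by the power of `q` attached to its class
because of this bound. -/
theorem levA_lev_le (hL : IsLabelled m s S N d) {s' : ℤˣ} {i : ℕ} (hi : 2 * i ≤ m) :
    levA m N d (lev m s S N d f (irrChi m s' i)) ≤ i := by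
  by_cases h : 2 * i = m ∧ (irrChi m s' i).1 ∈ S
  · have := lev_half_mem (s := s) (N := N) (d := d) (f := f) h.1 h.2
    rw [levA, if_neg (by omega), if_pos (by omega)]
    omega
  · rw [lev_idx hi fun h1 h2 => h ⟨h1, h2⟩, levA, if_pos idx_le]
    exact (IsTail.idx_spec hL i).1

/-- The datum with Springer representations in `S` given by the sequence `f`. -/
def levDatum (hL : IsLabelled m s S N d) (f : ℕ → ℕ) : Datum m :=
  Datum.ofLevel (lev m s S N d f) (levA m N d) (levA_mono hL)

/-! ### Green functions of the datum attached to the sequence `f` -/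

section Green

variable {hL : IsLabelled m s S N d} {P Λ : Matrix (Irr m) (Irr m) F}

theorem levDatum_apply (h : IsGreenSystem m (levDatum hL f) P Λ) {i j z₁ z₂ : Irr m} {c₁ c₂ : F}
    (h₁ : lev m s S N d f j ≤ lev m s S N d f z₁) (h₂ : lev m s S N d f j ≤ lev m s S N d f z₂)
    (hM : ∀ w, lev m s S N d f j ≤ lev m s S N d f w → w ≠ irrSgn m →
      c₁ * redOmega m z₁ w + c₂ * redOmega m z₂ w = redOmega m i w) (hj : j ≠ irrSgn m) :
    P i j = ((if j = z₁ then c₁ else 0) + (if j = z₂ then c₂ else 0)) *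
      q ^ levA m N d (lev m s S N d f j) := by
  have h1 := h.apply_eq (fun χ => Datum.ofLevel_supp_le.2 (by
    by_cases hχ : χ = irrSgn m
    · rw [hχ]
    · exact (lev_lt_sgn hχ).le)) (i := i) (j := j) (z₁ := z₁) (z₂ := z₂) (z₃ := z₁) (c₁ := c₁)
      (c₂ := c₂) (c₃ := 0) (Datum.ofLevel_supp_le.2 h₁)
      (Datum.ofLevel_supp_le.2 h₂) (Datum.ofLevel_supp_le.2 h₁)
      (fun w hw hwE => by
        rw [zero_mul, add_zero]
        exact hM w (Datum.ofLevel_supp_le.1 hw) hwE) hj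
  rw [h1, ite_self, add_zero]
  congr 2
  exact Datum.ofLevel_a j

/-- At or below the class of `χ_r` or `χ_r'` there is, besides `ε`, at most the other side of the
fork, which is orthogonal to it for `redOmega`. So the coefficient is `q ^ i / q ^ r` and the entry
is `q ^ i`, or `0` for the opposite side of the fork. -/
theorem natDiv_levDatum_half (h : IsGreenSystem m (levDatum hL f) P Λ) {s' t : ℤˣ} {i r : ℕ}
    (hi : 2 * i ≤ m) (hr : 2 * r = m) (hS : (irrChi m t r).1 ∈ S)
    (hlt : lev m s S N d f (irrChi m s' i) < lev m s S N d f (irrChi m t r)) :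
    NatDiv (levA m N d (lev m s S N d f (irrChi m s' i))) (P (irrChi m s' i) (irrChi m t r)) := by
  have hq := q_ne_zero
  have hlev := lev_half_mem (s := s) (N := N) (d := d) (f := f) hr hS
  have hw : ∀ w, lev m s S N d f (irrChi m t r) ≤ lev m s S N d f w → w ≠ irrSgn m →
      w = irrChi m t r ∨ (w = irrChi m (-t) r ∧
        lev m s S N d f (irrChi m t r) ≤ lev m s S N d f (irrChi m (-t) r)) := by
    intro w hw hwE
    rcases lev_cases (s := s) (S := S) (N := N) (d := d) (f := f) w with h1 | ⟨s', i, -, -, -, h1⟩ |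
      ⟨s', i, hi, rfl, -, -⟩
    · exact absurd h1 hwE
    · have := idx_le (N := N) (d := d) (f := f) (i := i)
      omega
    · obtain rfl : i = r := by omega
      rcases eq_or_neg t s' with rfl | rfl
      · exact Or.inl rfl
      · exact Or.inr ⟨rfl, hw⟩
  have ht := neg_unit_ne t
  rcases hi.eq_or_lt with hi2 | hi2
  · obtain rfl : i = r := by omega
    rcases eq_or_neg t s' with rfl | rfl
    · exact absurd hlt (lt_irrefl _)
    · rw [levDatum_apply h (c₁ := 0) (c₂ := 0) le_rfl le_rfl (fun w hw1 hw2 => ?_)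
        (irrChi_ne_irrSgn t hi)]
      · rw [ite_self, add_zero, zero_mul]
        exact natDiv_zero _
      · rcases hw w hw1 hw2 with rfl | ⟨rfl, h3⟩
        · simp only [redOmega_half_half _ _ hr, if_neg ht.symm]; ring
        · exact absurd hlt (not_lt.2 h3)
  · have hlo : q ^ i / q ^ r * q ^ m = q ^ (i + r) := by
      rw [← hr]; field_simp; ring
    have hval : q ^ i / q ^ r * q ^ levA m N d (lev m s S N d f (irrChi m t r)) = q ^ i := by
      rw [levA, if_neg (by omega), if_pos (by omega), show m / 2 = r by omega]
      field_simp
    by_cases h2 : lev m s S N d f (irrChi m t r) ≤ lev m s S N d f (irrChi m (-t) r)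
    · rw [levDatum_apply h (c₁ := q ^ i / q ^ r) (z₁ := irrChi m t r) (c₂ := q ^ i / q ^ r)
        (z₂ := irrChi m (-t) r) le_rfl h2 (fun w hw1 hw2 => ?_)
        (irrChi_ne_irrSgn t hr.le), if_pos rfl, if_neg (irrChi_half_ne ht hr), add_zero, hval]
      · exact natDiv_pow (levA_lev_le hL hi)
      · rcases hw w hw1 hw2 with rfl | ⟨rfl, -⟩
        · rw [redOmega_half_half _ _ hr, redOmega_half_half _ _ hr, if_pos rfl, if_neg ht.symm,
            redOmega_two_half _ _ (by omega) hr, hlo]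
          ring
        · rw [redOmega_half_half _ _ hr, redOmega_half_half _ _ hr, if_pos rfl, if_neg ht,
            redOmega_two_half _ _ (by omega) hr, hlo]
          ring
    · rw [levDatum_apply h (c₁ := q ^ i / q ^ r) (z₁ := irrChi m t r) (c₂ := 0)
        (z₂ := irrChi m t r) le_rfl le_rfl (fun w hw1 hw2 => ?_)
        (irrChi_ne_irrSgn t hr.le), if_pos rfl, if_pos rfl, add_zero, hval]
      · exact natDiv_pow (levA_lev_le hL hi)
      · rcases hw w hw1 hw2 with rfl | ⟨rfl, h3⟩
        · rw [redOmega_half_half _ _ hr, if_pos rfl,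
            redOmega_two_half _ _ (by omega) hr, hlo]
          ring
        · exact absurd h3 h2

/-- Let `χ_j` lie in `C_k`. If `i < d k`, all columns of classes at most `C_k` lie to the right of
`d k`, and `row_left` leaves only the entry `q ^ i` at `χ_(d k)`. Otherwise `i > f k`, since `χ_i`
lies in a larger class. Then `row_beyond` leaves in `C_k` only the entry `q ^ (f k + d k - i)` at
`χ_(f k)`, and the condition on `f` gives its divisibility. -/
theorem natDiv_levDatum_two (hT : IsTail m s S N d f) (h : IsGreenSystem m (levDatum hL f) P Λ)
    {s' t : ℤˣ} {i j : ℕ} (hi : 2 * i ≤ m) (hj : 2 * j ≤ m)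
    (hjS : 2 * j = m → (irrChi m t j).1 ∉ S)
    (hlt : lev m s S N d f (irrChi m s' i) < lev m s S N d f (irrChi m t j)) :
    NatDiv (levA m N d (lev m s S N d f (irrChi m s' i))) (P (irrChi m s' i) (irrChi m t j)) := by
  have hq := q_ne_zero
  have hiA := levA_lev_le (f := f) hL (s' := s') hi
  set k := idx N d f j with hkdef
  have hkN : k ≤ N := idx_le
  have hlj : lev m s S N d f (irrChi m t j) = k := lev_idx hj hjS
  have hdk := hL.two_mul_lt hkN
  have hval : q ^ levA m N d (lev m s S N d f (irrChi m t j)) = q ^ d k := by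
    rw [hlj, levA, if_pos hkN]
  have hiS : 2 * i = m → (irrChi m s' i).1 ∉ S := by
    intro h1 h2
    have := lev_half_mem (s := s) (N := N) (d := d) (f := f) h1 h2
    omega
  have hli : lev m s S N d f (irrChi m s' i) = idx N d f i := lev_idx hi hiS
  rcases lt_or_ge i (d k) with hik | hik
  · rw [levDatum_apply h (c₁ := q ^ (-((d k - i : ℕ) : ℤ))) (z₁ := irrChi m s (d k)) (c₂ := 0)
      (z₂ := irrChi m s (d k)) ?_ ?_ (fun w hw1 hw2 => ?_) (irrChi_ne_irrSgn t hj), ite_self,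
      add_zero, hval]
    · split_ifs with h3
      · have : q ^ (-((d k - i : ℕ) : ℤ)) * q ^ d k = q ^ i := by
          rw [← zpow_natCast, ← zpow_add₀ hq, ← zpow_natCast]
          congr 1
          omega
        rw [this]
        exact natDiv_pow hiA
      · rw [zero_mul]
        exact natDiv_zero _
    · rw [hlj, lev_two hdk, hT.idx_d hL hkN]
    · rw [hlj, lev_two hdk, hT.idx_d hL hkN]
    · rw [zero_mul, add_zero]
      rcases lev_cases (s := s) (S := S) (N := N) (d := d) (f := f) w with h1 |
        ⟨t', n, hn, rfl, -, h1⟩ | ⟨t', n, hn, rfl, -, -⟩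
      · exact absurd h1 hw2
      · rw [irrChi_sign (s := s') s (by omega)]
        refine row_left hik.le ?_ hn hdk
        rw [hlj, h1] at hw1
        exact (hL.le hw1 idx_le).trans (IsTail.idx_spec hL n).1
      · rw [irrChi_sign (s := s') s (by omega)]
        exact row_left hik.le (by omega) hn.le hdk
  · rw [hli, hlj] at hlt
    have hk1 : 1 ≤ k := by omega
    have hfk : f k < i := by
      by_contra hle
      have := IsTail.le_idx hkN hik (not_lt.1 hle)
      omega
    obtain ⟨hS, hf1⟩ | ⟨-, hfm⟩ := hT.alt
    swap
    · rw [hfm] at hfk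
      omega
    have hr : 2 * (m / 2) = m := Nat.two_mul_div_two_of_even hS.1
    have hSr' : (irrChi m (-s) (m / 2)).1 ∈ S := by rw [irrChi_half_val' hr]; exact hS.2.2
    have hs' : irrChi m s' i = irrChi m s i := by
      rcases hi.eq_or_lt with h2 | h2
      · rcases eq_or_neg s s' with rfl | rfl
        · rfl
        · refine absurd ?_ (hiS h2)
          rwa [show i = m / 2 by omega]
      · exact irrChi_sign s h2
    rw [hs'] at hli ⊢
    have hlr : lev m s S N d f (irrChi m (-s) (m / 2)) = N + 2 := lev_half' hr hSr'
    have hdNf := hT.le_f hL hk1 hkN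
    have hlf : lev m s S N d f (irrChi m s (f k)) = idx N d f (f k) := lev_two (by omega)
    rw [levDatum_apply h (c₁ := q ^ f k / q ^ i) (z₁ := irrChi m s (f k))
      (c₂ := coefHalf (f k) i (m / 2)) (z₂ := irrChi m (-s) (m / 2)) ?_ ?_ (fun w hw1 hw2 => ?_)
      (irrChi_ne_irrSgn t hj), hval, if_neg (c := irrChi m t j = irrChi m (-s) (m / 2)), add_zero]
    · split_ifs with h3
      · have hjf := irrChi_inj hj (by omega) h3
        have hk' : idx N d f i ≤ N := idx_le
        have hspec := IsTail.idx_spec (f := f) hL i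
        have hpos := hT.one_le_idx hL (show 1 ≤ i by omega) hi
        -- If `k < N` and `f (k + 1) = f k`, then `χ_(f k)` would lie in a later class. Combined
        -- with `i ≤ f (idx N d f i)`, the inequality bounds the exponent of the entry from below.
        have hcond := hT.cond (idx N d f i) k hpos hlt hkN (by
          by_contra hne
          rw [not_or, not_lt] at hne
          have := IsTail.le_idx (N := N) (d := d) (f := f) (k := k + 1) (i := j) (by omega)
            ((hL.le (show k + 1 ≤ N by omega) le_rfl).trans (by omega)) (by omega)
          omega)
        have : q ^ f k / q ^ i * q ^ d k = q ^ (f k + d k - i) := by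
          rw [div_mul_eq_mul_div, div_eq_iff (pow_ne_zero _ hq), ← pow_add, ← pow_add]
          congr 1
          omega
        rw [this, hli, levA, if_pos hk']
        exact natDiv_pow (by omega)
      · rw [zero_mul]
        exact natDiv_zero _
    · intro h3
      rw [h3, hlr] at hlj
      omega
    · rw [hlj, hlf]
      exact hT.le_idx_f hL hk1 hkN
    · rw [hlj, hlr]
      omega
    · have hidx : ∀ n, k ≤ idx N d f n → n ≤ f k := fun n hn => by
        have h4 := (IsTail.idx_spec (f := f) hL n).2
        exact (h4.resolve_left (by omega)).trans (hT.anti ⟨hk1, hkN⟩ ⟨by omega, idx_le⟩ hn)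
      rw [hlj] at hw1
      rcases lev_cases (s := s) (S := S) (N := N) (d := d) (f := f) w with h1 |
        ⟨t', n, hn, rfl, -, h1⟩ | ⟨t', n, hn, rfl, h1, -⟩
      · exact absurd h1 hw2
      · exact row_beyond hfk (by omega) hr hn (Or.inl (hidx n (h1 ▸ hw1)))
      · rcases eq_or_neg s t' with rfl | rfl
        · rw [irrChi_half_val hn] at h1
          exact absurd h1 hS.2.1
        · exact row_beyond hfk (by omega) hr hn.le (Or.inr ⟨by omega, rfl⟩)

theorem natDiv_levDatum (hT : IsTail m s S N d f) (h : IsGreenSystem m (levDatum hL f) P Λ)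
    (χ ψ : Irr m) : NatDiv (levA m N d (lev m s S N d f χ)) (P χ ψ) := by
  have hB := isGreenSystem_iff.1 h
  rcases lt_trichotomy (lev m s S N d f χ) (lev m s S N d f ψ) with hlt | heq | hlt
  · rcases irr_cases' χ with ⟨s', i, hi, rfl⟩ | rfl
    swap
    · by_cases hψ : ψ = irrSgn m
      · exact absurd hlt (by rw [hψ]; exact lt_irrefl _)
      · exact absurd hlt (lev_lt_sgn hψ).not_gt
    rcases lev_cases (s := s) (S := S) (N := N) (d := d) (f := f) ψ with rfl |
        ⟨t, j, hj, rfl, hjS, -⟩ | ⟨t, j, hj, rfl, hjS, -⟩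
    · rw [h.apply_sgn (fun χ hχ => Datum.ofLevel_supp_lt.2 (lev_lt_sgn hχ))]
      · exact natDiv_fakeDegree_irrChi (levA_lev_le hL hi) hi
      · refine (Datum.ofLevel_a _).trans ?_
        rw [lev_sgn, levA, if_neg (by omega), if_neg (by omega)]
    · exact natDiv_levDatum_two hT h hi hj hjS hlt
    · exact natDiv_levDatum_half h hi hj hjS hlt
  · by_cases he : χ = ψ
    · subst he
      rw [hB.diag]
      exact natDiv_pow (Datum.ofLevel_a χ).ge
    · rw [hB.block _ _ (Datum.ofLevel_supp_eq.2 heq) he]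
      exact natDiv_zero _
  · rw [hB.lt _ _ (Datum.ofLevel_supp_lt.2 hlt)]
    exact natDiv_zero _

theorem exists_green_levDatum (hT : IsTail m s S N d f) :
    ∃ P Λ : Matrix (Irr m) (Irr m) F, IsGreenSystem m (levDatum hL f) P Λ ∧
    (∀ χ χ', ∃ p : Polynomial ℤ,
      Λ χ χ' = algebraMap (Polynomial ℂ) F (p.map (Int.castRingHom ℂ))) ∧
    (∀ χ χ', ∃ p : Polynomial ℕ,
      P χ χ' = algebraMap (Polynomial ℂ) F (p.map (Nat.castRingHom ℂ))) ∧
    (∀ C : (levDatum hL f).X, ∀ χ ∈ C.1, ∀ χ', ∃ p : Polynomial ℤ,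
      P χ χ' = q ^ (levDatum hL f).a C *
        algebraMap (Polynomial ℂ) F (p.map (Int.castRingHom ℂ))) := by
  obtain ⟨P, Λ, h⟩ := exists_isGreenSystem (levDatum hL f)
  have hP := fun χ ψ => natDiv_levDatum hT h χ ψ
  have hP' : ∀ χ ψ, NatDiv ((levDatum hL f).a ((levDatum hL f).supp χ)) (P χ ψ) := fun χ ψ => by
    have h1 : (levDatum hL f).a ((levDatum hL f).supp χ) = _ := Datum.ofLevel_a χ
    rw [h1]
    exact hP χ ψ
  refine ⟨P, Λ, h, fun χ χ' => mem_intPoly.1 (h.lambda_mem hP' (fun i j hij => ?_) χ χ'),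
    fun χ χ' => ?_, fun C χ hχ χ' => ?_⟩
  · have hij := Datum.ofLevel_supp_eq.1 hij
    have h1 : (levDatum hL f).a ((levDatum hL f).supp i) = _ := Datum.ofLevel_a i
    rw [h1]
    by_cases hi : i = irrSgn m
    · subst hi
      obtain rfl : j = irrSgn m := by
        by_contra hne
        exact (lev_lt_sgn (s := s) (S := S) (N := N) (d := d) (f := f) hne).ne' hij
      refine ⟨1, one_mem _, ?_⟩
      rw [Omega_sgn, lev_sgn, levA, if_neg (by omega), if_neg (by omega), irrSgn, fakeDegree_sgn]
      ring
    · have hj : j ≠ irrSgn m := by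
        rintro rfl
        exact (lev_lt_sgn (s := s) (S := S) (N := N) (d := d) (f := f) hi).ne hij
      obtain ⟨y, hy, he⟩ := Omega_mem hi hj
      obtain ⟨s', n, hn, rfl⟩ | rfl := irr_cases' i
      · have hle := levA_lev_le (f := f) hL (s' := s') hn
        refine ⟨q ^ (m - 2 * levA m N d (lev m s S N d f (irrChi m s' n))) * y,
          mul_mem (q_pow_mem_intPoly _) hy, ?_⟩
        rw [he, ← mul_assoc, ← pow_add]
        congr 2
        omega
      · exact absurd rfl hi
  · obtain ⟨y, hy, he⟩ := hP χ χ'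
    rw [he]
    exact mem_natPoly.1 (mul_mem (q_pow_mem_natPoly _) hy)
  · obtain ⟨y, hy, he⟩ := hP' χ χ'
    obtain ⟨p, rfl⟩ := mem_intPoly.1 (natPoly_le hy)
    have hC : (levDatum hL f).supp χ = C := (levDatum hL f).supp_eq C hχ
    exact ⟨p, by rw [he, hC]⟩

end Green

/-! ### The Springer representations -/

theorem exists_mem_lev_eq (hL : IsLabelled m s S N d) (hT : IsTail m s S N d f) (χ : Irr m) :
    ∃ ψ : Irr m, ψ.1 ∈ S ∧ lev m s S N d f χ = lev m s S N d f ψ := by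
  rcases lev_cases (s := s) (S := S) (N := N) (d := d) (f := f) χ with rfl |
        ⟨t, j, hj, rfl, hjS, hlev⟩ | ⟨t, j, hj, rfl, hjS, -⟩
  · exact ⟨_, hL.sgn_mem, rfl⟩
  · refine ⟨_, hL.irrChi_mem (k := idx N d f j) idx_le, ?_⟩
    rw [hlev, lev_two (hL.two_mul_lt idx_le), hT.idx_d hL idx_le]
  · exact ⟨_, hjS, rfl⟩

theorem bInv_lt_of_lev_eq (hL : IsLabelled m s S N d) (hT : IsTail m s S N d f) {χ ψ : Irr m}
    (hψ : ψ.1 ∈ S) (hlev : lev m s S N d f χ = lev m s S N d f ψ) (hne : χ ≠ ψ) :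
    bInv m ψ < bInv m χ := by
  by_cases hE : ψ = irrSgn m
  · subst hE
    exact absurd hlev (lev_lt_sgn hne).ne
  have hE' : χ ≠ irrSgn m := by
    rintro rfl
    exact absurd hlev (lev_lt_sgn hE).ne'
  rcases irr_cases s ψ with ⟨i, hi, rfl⟩ | ⟨r, hr, h⟩ | h
  · rw [irrChi_val hi.le] at hψ
    obtain ⟨k, hk, rfl⟩ := hL.exists_eq hi hψ
    rw [lev_two hi, hT.idx_d hL hk] at hlev
    rcases lev_cases (s := s) (S := S) (N := N) (d := d) (f := f) χ with rfl |
        ⟨t, j, hj, rfl, hjS, hlev'⟩ | ⟨t, j, hj, rfl, hjS, hlev', -⟩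
    · exact absurd rfl hE'
    · rw [bInv_irrChi _ hi.le, bInv_irrChi _ hj]
      have h1 := (IsTail.idx_spec (f := f) hL j).1
      rw [← hlev', hlev] at h1
      rcases h1.eq_or_lt with h1 | h1
      · subst h1
        exact absurd (irrChi_sign s hi) hne
      · exact_mod_cast h1
    · omega
  · exfalso
    have hψ' : ∃ t, ψ = irrChi m t r := h.elim (fun h => ⟨_, h⟩) fun h => ⟨_, h⟩
    obtain ⟨t, rfl⟩ := hψ'
    have h1 := lev_half_mem (s := s) (N := N) (d := d) (f := f) hr hψ
    rcases lev_cases (s := s) (S := S) (N := N) (d := d) (f := f) χ with rfl |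
        ⟨t', j, hj, rfl, hjS, hlev'⟩ | ⟨t', j, hj, rfl, hjS, -⟩
    · exact absurd rfl hE'
    · have := idx_le (N := N) (d := d) (f := f) (i := j)
      omega
    · obtain rfl : j = r := by omega
      rcases eq_or_neg s t with ht | ht <;> rcases eq_or_neg s t' with ht' | ht' <;> subst ht ht'
      · exact hne rfl
      · rw [lev_half hr hψ, lev_half' hr hjS] at hlev
        omega
      · rw [lev_half' hr hψ, lev_half hr hjS] at hlev
        omega
      · exact hne rfl
  · exact absurd h hE

theorem levA_lev (hL : IsLabelled m s S N d) (hT : IsTail m s S N d f) {ψ : Irr m}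
    (hψ : ψ.1 ∈ S) : (levA m N d (lev m s S N d f ψ) : ℤ) = bInv m ψ := by
  rcases lev_cases (s := s) (S := S) (N := N) (d := d) (f := f) ψ with rfl |
        ⟨t, j, hj, rfl, hjS, hlev⟩ | ⟨t, j, hj, rfl, hjS, h1, h2⟩
  · rw [bInv_irrSgn, lev_sgn, levA, if_neg (by omega), if_neg (by omega)]
  · have hj2 : 2 * j < m := lt_of_le_of_ne hj fun h => hjS h hψ
    rw [irrChi_sign s hj2, irrChi_val hj] at hψ
    obtain ⟨k, hk, rfl⟩ := hL.exists_eq hj2 hψ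
    rw [hlev, hT.idx_d hL hk, levA, if_pos hk, bInv_irrChi _ hj]
  · rw [levA, if_neg (by omega), if_pos h2, bInv_irrChi _ hj.le]
    omega

theorem isSpringerRep_levDatum (hL : IsLabelled m s S N d) (hT : IsTail m s S N d f) {ψ : Irr m}
    (hψ : ψ.1 ∈ S) : IsSpringerRep m ((levDatum hL f).supp ψ).1 ψ :=
  ⟨Datum.mem_supp _ _, fun _ hχ hne => bInv_lt_of_lev_eq hL hT hψ
    (Datum.ofLevel_supp_eq.1 (Datum.mem_iff.1 hχ)) hne⟩

/-- Of the families only that of `ε` has to be known. The class of `χ_0` is the largest and that of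
`χ_1` comes next, so with all other characters at level at least one the family condition holds for
`χ_0` and `χ_1`, whatever their families are. -/
theorem isSpringerFor_levDatum (hL : IsLabelled m s S N d) (hT : IsTail m s S N d f)
    (hspecial : ∀ χ : Irr m, IsSpecial m χ ↔
      χ = irrChi m s 0 ∨ χ = irrChi m s 1 ∨ χ = irrSgn m)
    (hfam : ∀ χ : Irr m, SameFamily m (irrSgn m) χ → χ = irrSgn m) :
    IsSpringerFor m S (levDatum hL f) := by
  have hm := hL.three_le
  have hmem : ∀ χ : Irr m, IsSpecial m χ → χ.1 ∈ S := by
    intro χ hχ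
    rcases (hspecial χ).1 hχ with rfl | rfl | rfl
    · rw [irrChi_val (by omega)]; exact hL.zero_mem
    · rw [irrChi_val (by omega)]; exact hL.one_mem
    · exact hL.sgn_mem
  refine ⟨⟨fun C => ?_, fun χ hχ => ?_, fun χ χ' hχ hχ' hf C C' hC hC' => ?_,
    exists_green_levDatum hT⟩, ?_⟩
  · obtain ⟨χ, hχ⟩ := (levDatum hL f).exists_supp C
    obtain ⟨ψ, hψ, hlev⟩ := exists_mem_lev_eq (f := f) hL hT χ
    have hC : (levDatum hL f).supp ψ = C := (Datum.ofLevel_supp_eq.2 hlev).symm.trans hχ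
    refine ⟨ψ, hC ▸ isSpringerRep_levDatum hL hT hψ, ?_⟩
    rw [← levA_lev hL hT hψ, ← hC]
    exact congrArg _ (Datum.ofLevel_a ψ)
  · exact ⟨_, ((levDatum hL f).supp χ).2, isSpringerRep_levDatum hL hT (hmem χ hχ)⟩
  · have h1 : lev m s S N d f χ ≤ lev m s S N d f χ' := by
      rcases (hspecial χ).1 hχ with rfl | rfl | rfl
      · rw [lev_two (by omega), ← hL.d_zero, hT.idx_d hL (Nat.zero_le N)]
        exact Nat.zero_le _
      · have e1 := hT.idx_d hL hL.one_le
        rw [hL.d_one] at e1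
        rw [lev_two (by omega), e1]
        rcases lev_cases (s := s) (S := S) (N := N) (d := d) (f := f) χ' with rfl |
          ⟨t, j, hj, rfl, hjS, hlev⟩ | ⟨t, j, hj, rfl, hjS, h1, h2⟩
        · rw [lev_sgn]; omega
        · rw [hlev]
          refine hT.one_le_idx hL (Nat.one_le_iff_ne_zero.2 ?_) hj
          rintro rfl
          exact hχ' ((hspecial _).2 (Or.inl (irrChi_sign s (by omega))))
        · omega
      · exact absurd (hfam _ hf ▸ hχ) hχ'
    have h2 : (levDatum hL f).supp χ' ≤ (levDatum hL f).supp χ := Datum.ofLevel_supp_le.2 h1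
    rw [(levDatum hL f).supp_eq C hC, (levDatum hL f).supp_eq C' hC'] at h2
    exact h2.eq_or_lt
  · ext φ
    constructor
    · rintro ⟨C, hC, χ, rfl, hrep⟩
      obtain ⟨ψ, hψ, hlev⟩ := exists_mem_lev_eq (f := f) hL hT χ
      have h1 := (levDatum hL f).supp_eq (⟨C, hC⟩ : Datum.Cls _) hrep.1
      have h2 : (levDatum hL f).supp ψ = ⟨C, hC⟩ := (Datum.ofLevel_supp_eq.2 hlev).symm.trans h1
      by_contra hne
      have hne' : ψ ≠ χ := by
        rintro rfl
        exact hne hψ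
      have h3 := hrep.2 ψ (Datum.mem_iff.2 h2) hne'
      exact h3.not_gt (bInv_lt_of_lev_eq hL hT hψ hlev hne'.symm)
    · intro hφ
      exact ⟨_, ((levDatum hL f).supp ⟨φ, hL.subset hφ⟩).2, ⟨φ, hL.subset hφ⟩, rfl,
        isSpringerRep_levDatum hL hT hφ⟩

theorem hasForm_levDatum (hL : IsLabelled m s S N d) (hT : IsTail m s S N d f)
    (h : IsSpringerFor m S (levDatum hL f))
    (hS : Even m ∧ chi m s (m / 2) ∉ S ∧ chi' m s ∈ S) (hf1 : f 1 = m / 2) :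
    HasForm m s S N d f (levDatum hL f) := by
  have hr : 2 * (m / 2) = m := Nat.two_mul_div_two_of_even hS.1
  refine h.hasForm_of_indexSet hL hS
    (fun k hk n hn => IsSpringerFor.indexSet_le hL hT.anti hf1.le hk hn) fun k hk n hn => ?_
  have h1 : (levDatum hL f).supp (irrChi m s n) = (levDatum hL f).supp (irrChi m s (d k)) ↔ _ :=
    Datum.ofLevel_supp_eq
  rw [h1, lev_idx hn fun h2 => ?_, lev_two (hL.two_mul_lt hk), hT.idx_d hL hk,
    hT.idx_eq_iff hL hk hn]
  rw [irrChi_half_val h2]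
  exact hS.2.1

theorem cond_of_step {f : ℕ → ℕ}
    (h : ∀ k, 1 ≤ k → k < N → (f k : ℤ) - f (k + 1) ≤ d (k + 1) - d k) {k l : ℕ} (hk : 1 ≤ k)
    (hkl : k ≤ l) (hl : l ≤ N) : (f k : ℤ) - f l ≤ d l - d k := by
  induction l, hkl using Nat.le_induction with
  | base => simp
  | succ l hkl ih =>
    have h1 := ih (by omega)
    have h2 := h l (by omega) (by omega)
    omega

/-- A sequence that satisfies the conditions always exists. -/
theorem exists_isTail (hL : IsLabelled m s S N d) : ∃ f, IsTail m s S N d f := by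
  by_cases hS : Even m ∧ chi m s (m / 2) ∉ S ∧ chi' m s ∈ S
  · have := hL.two_mul_lt le_rfl
    refine ⟨fun _ => m / 2, fun _ _ _ _ _ => le_rfl, by omega, Or.inl ⟨hS, rfl⟩, ?_⟩
    intro k l hk hkl hl _
    have := hL.lt hkl hl
    omega
  · have := hL.two_mul_lt le_rfl
    -- The value `m` exceeds all indices, so that the bound `i ≤ f k` in `idx` is void in this case.
    refine ⟨fun _ => m, fun _ _ _ _ _ => le_rfl, by omega, Or.inr ⟨hS, fun _ => rfl⟩, ?_⟩
    intro k l hk hkl hl _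
    have := hL.lt hkl hl
    omega

end

section

/-! ## Alternating words and representations of the Hecke algebra -/

theorem altWord_length (i : Bool) (n : ℕ) : (altWord i n).length = n := by
  induction n generalizing i with
  | zero => rfl
  | succ n ih => rw [altWord, List.length_cons, ih]

theorem altWord_even {M : Type*} [Monoid M] (f : Bool → M) (i : Bool) (k : ℕ) :
    ((altWord i (2 * k)).map f).prod = (f i * f (!i)) ^ k := by
  induction k with
  | zero => simp [altWord]
  | succ k ih =>
    rw [show 2 * (k + 1) = 2 * k + 1 + 1 by ring, altWord, altWord, Bool.not_not, List.map_cons,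
      List.map_cons, List.prod_cons, List.prod_cons, ih, pow_succ', mul_assoc]

theorem altWord_odd {M : Type*} [Monoid M] (f : Bool → M) (i : Bool) (k : ℕ) :
    ((altWord i (2 * k + 1)).map f).prod = (f i * f (!i)) ^ k * f i := by
  rw [altWord, List.map_cons, List.prod_cons, altWord_even, Bool.not_not, mul_pow_mul]

section Hom

variable {m : ℕ} {A : Type*} [Ring A] [Algebra F A]

theorem heckeT_quadratic (m : ℕ) (i : Bool) :
    (heckeT m i - algebraMap F (Hecke m) q) * (heckeT m i + 1) = 0 := by
  have h := RingQuot.mkAlgHom_rel F (HeckeRel.quadratic (m := m) i)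
  rwa [map_mul, map_sub, map_add, map_one, map_zero, AlgHom.commutes] at h

theorem map_heckeT_quadratic (f : Hecke m →ₐ[F] A) (i : Bool) :
    (f (heckeT m i) - algebraMap F A q) * (f (heckeT m i) + 1) = 0 := by
  have h := congrArg f (heckeT_quadratic m i)
  rwa [map_mul, map_sub, map_add, map_one, map_zero, AlgHom.commutes] at h

theorem map_heckeWord (f : Hecke m →ₐ[F] A) (l : List Bool) :
    f (heckeWord m l) = (l.map fun i => f (heckeT m i)).prod := by
  rw [heckeWord, map_list_prod, List.map_map]
  rfl

theorem heckeWord_braid (m : ℕ) : heckeWord m (altWord false m) = heckeWord m (altWord true m) := by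
  have h := RingQuot.mkAlgHom_rel F (HeckeRel.braid (m := m))
  rwa [map_list_prod, map_list_prod, List.map_map, List.map_map] at h

/-- The homomorphism from the Hecke algebra given by the images of the generators. -/
def heckeHom (m : ℕ) (M : Bool → A) (h : ∀ i, (M i - algebraMap F A q) * (M i + 1) = 0)
    (hb : ((altWord false m).map M).prod = ((altWord true m).map M).prod) : Hecke m →ₐ[F] A :=
  RingQuot.liftAlgHom F ⟨FreeAlgebra.lift F M, by
    have hl : ∀ l : List Bool, FreeAlgebra.lift F M (l.map (FreeAlgebra.ι F)).prod =
        (l.map M).prod := fun l => by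
      rw [map_list_prod, List.map_map]
      congr 2
      ext i
      exact FreeAlgebra.lift_ι_apply M i
    rintro x y (i | _)
    · rw [map_mul, map_sub, map_add, map_one, map_zero, AlgHom.commutes, FreeAlgebra.lift_ι_apply]
      exact h i
    · rw [hl, hl, hb]⟩

theorem heckeHom_T {M : Bool → A} {h : ∀ i, (M i - algebraMap F A q) * (M i + 1) = 0}
    {hb : ((altWord false m).map M).prod = ((altWord true m).map M).prod} (i : Bool) :
    heckeHom m M h hb (heckeT m i) = M i := by
  rw [heckeHom, heckeT, RingQuot.liftAlgHom_mkAlgHom_apply, FreeAlgebra.lift_ι_apply]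

theorem heckeHom_word {M : Bool → A} {h : ∀ i, (M i - algebraMap F A q) * (M i + 1) = 0}
    {hb : ((altWord false m).map M).prod = ((altWord true m).map M).prod} (l : List Bool) :
    heckeHom m M h hb (heckeWord m l) = (l.map M).prod := by
  rw [map_heckeWord]
  simp only [heckeHom_T]

end Hom

/-- Representations given by polynomial matrices. -/
def HeckeLift.ofPolynomial {m n : ℕ} {χ : DihedralGroup m → ℂ} (hn : 0 < n)
    (M : Bool → Matrix (Fin n) (Fin n) (Polynomial ℂ))
    (h : ∀ i, ((M i).map (algebraMap (Polynomial ℂ) F) - algebraMap F _ q) *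
      ((M i).map (algebraMap (Polynomial ℂ) F) + 1) = 0)
    (hb : ((altWord false m).map fun i => (M i).map (algebraMap (Polynomial ℂ) F)).prod =
      ((altWord true m).map fun i => (M i).map (algebraMap (Polynomial ℂ) F)).prod)
    (hirr : ∀ U : Submodule F (Fin n → F), (∀ i, ∀ u ∈ U,
      ((M i).map (algebraMap (Polynomial ℂ) F)).mulVec u ∈ U) → U = ⊥ ∨ U = ⊤)
    (hspec : ∀ l : List Bool, ((l.map fun i => (M i).map (Polynomial.evalRingHom 1)).prod).trace =
      χ ((l.map (simpleRefl m)).prod)) : HeckeLift m χ :=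
  have key : ∀ l : List Bool, (heckeHom m _ h hb (heckeWord m l)).trace =
      algebraMap (Polynomial ℂ) F ((l.map M).prod).trace := fun l => by
    have h1 : (l.map fun i => (M i).map (algebraMap (Polynomial ℂ) F)).prod =
        (algebraMap (Polynomial ℂ) F).mapMatrix (l.map M).prod := by
      rw [map_list_prod, List.map_map]
      rfl
    rw [heckeHom_word, h1]
    exact (AddMonoidHom.map_trace (algebraMap (Polynomial ℂ) F).toAddMonoidHom (l.map M).prod).symm
  { n := n
    rep := heckeHom m _ h hb
    pos := hn
    irreducible := fun U hU => hirr U fun i u hu => by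
      have := hU (heckeT m i) u hu
      rwa [heckeHom_T] at this
    regular := fun l => by
      rw [key, RatFunc.denom_algebraMap, Polynomial.eval_one]
      exact one_ne_zero
    specializes := fun l => by
      have h1 : (l.map fun i => (M i).map (Polynomial.evalRingHom 1)).prod =
          (Polynomial.evalRingHom (1 : ℂ)).mapMatrix (l.map M).prod := by
        rw [map_list_prod, List.map_map]
        rfl
      rw [key, RatFunc.eval_algebraMap, ← hspec, h1]
      exact AddMonoidHom.map_trace (Polynomial.evalRingHom (1 : ℂ)).toAddMonoidHom (l.map M).prod }

theorem HeckeLift.ofPolynomial_rep {m n : ℕ} {χ : DihedralGroup m → ℂ} {hn : 0 < n}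
    {M : Bool → Matrix (Fin n) (Fin n) (Polynomial ℂ)} {h hb hirr hspec} (i : Bool) :
    (HeckeLift.ofPolynomial (χ := χ) hn M h hb hirr hspec).rep (heckeT m i) =
      (M i).map (algebraMap (Polynomial ℂ) F) := heckeHom_T (h := h) (hb := hb) i

/-! ### The one-dimensional representations -/

/-- The eigenvalue `q` or `-1`. -/
def linVal (b : Bool) : Polynomial ℂ := if b then Polynomial.X else -1

/-- The one-dimensional representation with generators acting by `q` or `-1`. -/
def linLift {m : ℕ} (t : Bool → Bool) (ht : Odd m → t false = t true) (f : DihedralGroup m →* ℂ)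
    (hf : ∀ i, f (simpleRefl m i) = if t i then 1 else -1) : HeckeLift m f :=
  HeckeLift.ofPolynomial (n := 1) one_pos (fun i => !![linVal (t i)])
    (fun i => by
      ext a b
      fin_cases a; fin_cases b
      rw [linVal, Matrix.algebraMap_eq_diagonal]
      split_ifs <;> simp [Matrix.mul_apply])
    (by
      rcases Nat.even_or_odd' m with ⟨k, rfl | rfl⟩
      · rw [altWord_even, altWord_even, Bool.not_false, Bool.not_true]
        congr 1
        ext a b
        fin_cases a; fin_cases b
        simp [Matrix.mul_apply, mul_comm]
      · rw [altWord_odd, altWord_odd, Bool.not_false, Bool.not_true, ht ⟨k, rfl⟩])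
    (fun U _ => by
      refine or_iff_not_imp_left.2 fun hb => ?_
      obtain ⟨u, hu, hu0⟩ := (Submodule.ne_bot_iff _).1 hb
      have h0 : u 0 ≠ 0 := fun h => hu0 (by ext i; fin_cases i; exact h)
      rw [eq_top_iff]
      intro v _
      convert U.smul_mem (v 0 / u 0) hu using 1
      ext i
      fin_cases i
      exact (div_mul_cancel₀ _ h0).symm)
    (fun l => by
      rw [map_list_prod, List.map_map]
      have h1 : ∀ l : List Bool, (l.map fun i => (!![linVal (t i)]).map
          (Polynomial.evalRingHom (1 : ℂ))).prod = !![(l.map (f ∘ simpleRefl m)).prod] := by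
        intro l
        induction l with
        | nil => ext a b; fin_cases a; fin_cases b; simp
        | cons i l ih =>
          rw [List.map_cons, List.prod_cons, ih, List.map_cons, List.prod_cons, Function.comp, hf]
          ext a b
          fin_cases a; fin_cases b
          rw [linVal]
          split_ifs <;> simp [Matrix.mul_apply]
      rw [h1]
      simp)

theorem linLift_rep {m : ℕ} {t : Bool → Bool} {ht : Odd m → t false = t true}
    {f : DihedralGroup m →* ℂ} {hf} (i : Bool) :
    (linLift t ht f hf).rep (heckeT m i) =
      (!![linVal (t i)] : Matrix (Fin 1) (Fin 1) (Polynomial ℂ)).map (algebraMap (Polynomial ℂ) F) :=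
  HeckeLift.ofPolynomial_rep i

/-! ### The two-dimensional representations -/

/-- The matrices of the generators in the two-dimensional representations. -/
def twoMat {R : Type*} [CommRing R] (x c : R) (i : Bool) : Matrix (Fin 2) (Fin 2) R :=
  if i then !![x, 1; 0, -1] else !![-1, 0; x * (2 + c), x]

theorem twoMat_map {R R' : Type*} [CommRing R] [CommRing R'] (φ : R →+* R') (x c : R) (i : Bool) :
    (twoMat x c i).map φ = twoMat (φ x) (φ c) i := by
  cases i <;> ext a b <;> fin_cases a <;> fin_cases b <;> simp [twoMat, map_ofNat φ 2]

section TwoMat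

variable {R : Type*} [CommRing R]

theorem twoMat_quadratic (x c : R) (i : Bool) :
    (twoMat x c i - algebraMap R _ x) * (twoMat x c i + 1) = 0 := by
  cases i <;> ext a b <;> fin_cases a <;> fin_cases b <;>
    simp [twoMat, Matrix.algebraMap_eq_diagonal, Matrix.mul_apply, Fin.sum_univ_two]

/-- Cayley–Hamilton: the product of the two generators has trace `x * c` and determinant `x ^ 2`. -/
theorem twoMat_mul_sq (x c : R) (i : Bool) :
    twoMat x c i * twoMat x c (!i) * (twoMat x c i * twoMat x c (!i)) =
      (x * c) • (twoMat x c i * twoMat x c (!i)) - (x ^ 2) • 1 := by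
  cases i <;> ext a b <;> fin_cases a <;> fin_cases b <;>
    simp [twoMat, Matrix.mul_apply, Fin.sum_univ_two] <;> ring

theorem twoMat_braid (x c : R) :
    twoMat x c false * twoMat x c true * twoMat x c false -
      twoMat x c true * twoMat x c false * twoMat x c true =
      (x * (1 + c)) • (twoMat x c false - twoMat x c true) := by
  ext a b
  fin_cases a <;> fin_cases b <;> simp [twoMat] <;> ring

/-- The quadratic relation has the roots `x * z` and `x * z'`; this is the resulting closed form of
the powers, multiplied by `z - z'` to avoid division. -/
theorem pow_eq_of_sq {A : Type*} [Ring A] [Algebra R A] {w : A} {x z z' : R} (hz : z * z' = 1)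
    (hw : w * w = (x * (z + z')) • w - (x ^ 2) • (1 : A)) (k : ℕ) :
    (z - z') • w ^ (k + 1) = (x ^ k * (z ^ (k + 1) - z' ^ (k + 1))) • w -
      (x ^ (k + 1) * (z ^ k - z' ^ k)) • (1 : A) := by
  induction k with
  | zero => simp
  | succ k ih =>
    rw [pow_succ w (k + 1), ← smul_mul_assoc, ih, sub_mul, smul_mul_assoc, hw, smul_mul_assoc,
      one_mul]
    have h1 : x ^ k * (z ^ (k + 1) - z' ^ (k + 1)) * (x * (z + z')) - x ^ (k + 1) * (z ^ k - z' ^ k) =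
        x ^ (k + 1) * (z ^ (k + 1 + 1) - z' ^ (k + 1 + 1)) := by
      linear_combination (x ^ (k + 1) * (z ^ k - z' ^ k)) * hz
    rw [← h1]
    module

end TwoMat

/-- For even `m` the coefficient of the product of the generators in the closed form vanishes since
`z ^ (m / 2) = z' ^ (m / 2)`, and both sides are the same scalar. For odd `m` the difference of both
sides is reduced by `twoMat_braid` to a multiple of the difference of the generators, and the scalar
vanishes by `z ^ m = 1`. -/
theorem twoMat_prod_eq {K : Type*} [Field K] {m : ℕ} (hm : 2 ≤ m) {x z z' : K} (hz : z * z' = 1)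
    (hzz : z ≠ z') (hzm : z ^ m = 1) :
    ((altWord false m).map (twoMat x (z + z'))).prod =
      ((altWord true m).map (twoMat x (z + z'))).prod := by
  have hne : z - z' ≠ 0 := sub_ne_zero.2 hzz
  have hz0 : z ≠ 0 := left_ne_zero_of_mul_eq_one hz
  have hinv : ∀ a b : ℕ, z ^ (a + b) = 1 → z ^ a = z' ^ b := fun a b h => by
    have h1 : (z * z') ^ b = 1 := by rw [hz, one_pow]
    rw [mul_pow] at h1
    rw [pow_add] at h
    have := pow_ne_zero b hz0
    refine mul_left_cancel₀ this ?_
    rw [h1, mul_comm, h]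
  set A := twoMat x (z + z') false
  set B := twoMat x (z + z') true
  have hAB := pow_eq_of_sq hz (twoMat_mul_sq x (z + z') false)
  have hBA := pow_eq_of_sq hz (twoMat_mul_sq x (z + z') true)
  change ∀ k, (z - z') • (A * B) ^ (k + 1) = _ • (A * B) - _ • 1 at hAB
  change ∀ k, (z - z') • (B * A) ^ (k + 1) = _ • (B * A) - _ • 1 at hBA
  refine smul_right_injective _ hne ?_
  rcases Nat.even_or_odd' m with ⟨k, rfl | rfl⟩
  · obtain ⟨k, rfl⟩ : ∃ k', k = k' + 1 := ⟨k - 1, by omega⟩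
    change (z - z') • _ = (z - z') • _
    rw [altWord_even, altWord_even, Bool.not_false, Bool.not_true, hAB, hBA,
      hinv (k + 1) (k + 1) (by rw [← two_mul]; exact hzm), sub_self, mul_zero, zero_smul, zero_smul]
  · obtain ⟨k, rfl⟩ : ∃ k', k = k' + 1 := ⟨k - 1, by omega⟩
    change (z - z') • _ = (z - z') • _
    rw [altWord_odd, altWord_odd, Bool.not_false, Bool.not_true, ← smul_mul_assoc,
      ← smul_mul_assoc, hAB, hBA, ← sub_eq_zero, sub_mul, sub_mul, smul_mul_assoc, smul_mul_assoc,
      smul_mul_assoc, smul_mul_assoc, one_mul, one_mul]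
    have hbr : A * B * A = B * A * B + (x * (1 + (z + z'))) • (A - B) := by
      rw [← twoMat_braid x (z + z')]; abel
    have h1 := hinv (k + 1 + 1) (k + 1) (by rw [← hzm]; congr 1; ring)
    have h2 := hinv (k + 1) (k + 1 + 1) (by rw [← hzm]; congr 1; ring)
    have h3 : x ^ k * (z ^ (k + 1) - z' ^ (k + 1)) * (x * (1 + (z + z'))) -
        x ^ (k + 1) * (z ^ k - z' ^ k) = 0 := by
      linear_combination x ^ (k + 1) * (h1 + h2 + (z ^ k - z' ^ k) * hz)
    rw [hbr]
    have h4 : ∀ (a b e : K) (X A B : Matrix (Fin 2) (Fin 2) K),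
        a • (X + e • (A - B)) - b • A - (a • X - b • B) = (a * e - b) • (A - B) := by
      intros; module
    rw [h4, h3, zero_smul]

/-- Adding `1` to the generators gives two matrices of rank one whose images are the two coordinate
lines. By `hxc` they have no common kernel, so a nonzero submodule contains one of the lines, and by
`hx` each line is mapped onto the other. -/
theorem twoMat_irreducible {K : Type*} [Field K] {x c : K} (hx : x * (2 + c) ≠ 0)
    (hxc : x * (2 + c) ≠ (x + 1) ^ 2) (U : Submodule K (Fin 2 → K))
    (hU : ∀ i, ∀ u ∈ U, (twoMat x c i).mulVec u ∈ U) : U = ⊥ ∨ U = ⊤ := by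
  by_cases hb : U = ⊥
  · exact Or.inl hb
  right
  have h0 : ∀ a b, ![a, b] ∈ U → ![0, x * (2 + c) * a + (x + 1) * b] ∈ U := by
    intro a b h
    convert U.add_mem (hU false _ h) h using 1
    ext i; fin_cases i <;> simp [twoMat]; ring
  have h1 : ∀ a b, ![a, b] ∈ U → ![(x + 1) * a + b, 0] ∈ U := by
    intro a b h
    convert U.add_mem (hU true _ h) h using 1
    ext i; fin_cases i <;> simp [twoMat]; ring
  have hs0 : ∀ a, a ≠ 0 → ![a, 0] ∈ U → ![1, 0] ∈ U := fun a ha h => by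
    have := U.smul_mem a⁻¹ h
    simpa [ha] using this
  have hs1 : ∀ a, a ≠ 0 → ![0, a] ∈ U → ![0, 1] ∈ U := fun a ha h => by
    have := U.smul_mem a⁻¹ h
    simpa [ha] using this
  have hfin : ![1, 0] ∈ U → ![0, 1] ∈ U → U = ⊤ := by
    intro h2 h3
    rw [eq_top_iff]
    intro v _
    convert U.add_mem (U.smul_mem (v 0) h2) (U.smul_mem (v 1) h3) using 1
    ext i; fin_cases i <;> simp
  obtain ⟨u, hu, hu0⟩ := (Submodule.ne_bot_iff _).1 hb
  have hu' : u = ![u 0, u 1] := by ext i; fin_cases i <;> rfl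
  rw [hu'] at hu
  by_cases h2 : (x + 1) * u 0 + u 1 = 0
  · have h3 := h0 _ _ hu
    have h4 : ![0, 1] ∈ U := by
      refine hs1 _ ?_ h3
      rw [show x * (2 + c) * u 0 + (x + 1) * u 1 = (x * (2 + c) - (x + 1) ^ 2) * u 0 by
        linear_combination (x + 1) * h2]
      refine mul_ne_zero (sub_ne_zero.2 hxc) fun h5 => hu0 ?_
      rw [hu', h5]
      rw [h5, mul_zero, zero_add] at h2
      rw [h2]
      ext i; fin_cases i <;> rfl
    have h5 := h1 _ _ h4
    rw [mul_zero, zero_add] at h5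
    exact hfin h5 h4
  · have h3 := hs0 _ h2 (h1 _ _ hu)
    have h4 := h0 _ _ h3
    rw [mul_one, mul_zero, add_zero] at h4
    exact hfin h3 (hs1 _ hx h4)

section TwoLift

variable {m : ℕ} [NeZero m]

/-- An explicit intertwiner between the specialization at `q = 1` and `rho j`. -/
theorem twoMat_one_mul (j : ZMod m) (i : Bool) :
    !![1 + ec m (-j), 1; 1 + ec m j, 1] * twoMat (1 : ℂ) (ec m j + ec m (-j)) i =
      rho j (simpleRefl m i) * !![1 + ec m (-j), 1; 1 + ec m j, 1] := by
  have h : ec m j * ec m (-j) = 1 := by rw [← AddChar.map_add_eq_mul]; simp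
  cases i
  · rw [simpleRefl, if_neg (by simp), rho_sr, twoMat, if_neg (by simp), mul_zero, neg_zero,
      AddChar.map_zero_eq_one]
    ext a b; fin_cases a <;> fin_cases b <;> simp [Matrix.mul_apply, Fin.sum_univ_two] <;> ring
  · rw [simpleRefl, if_pos rfl, rho_sr, twoMat, if_pos rfl, mul_one]
    ext a b; fin_cases a <;> fin_cases b <;> simp [Matrix.mul_apply, Fin.sum_univ_two] <;>
      linear_combination -h

theorem trace_prod_twoMat_one {j : ZMod m} (hj : ec m j ≠ ec m (-j)) (l : List Bool) :
    ((l.map (twoMat (1 : ℂ) (ec m j + ec m (-j)))).prod).trace =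
      (rho j ((l.map (simpleRefl m)).prod)).trace := by
  set S : Matrix (Fin 2) (Fin 2) ℂ := !![1 + ec m (-j), 1; 1 + ec m j, 1]
  have hS : S.det ≠ 0 := by
    rw [Matrix.det_fin_two_of]
    intro h
    exact hj (by linear_combination -h)
  have h1 : ∀ l : List Bool, S * (l.map (twoMat (1 : ℂ) (ec m j + ec m (-j)))).prod =
      rho j ((l.map (simpleRefl m)).prod) * S := by
    intro l
    induction l with
    | nil => simp
    | cons i l ih =>
      rw [List.map_cons, List.prod_cons, ← mul_assoc, twoMat_one_mul, mul_assoc, ih, ← mul_assoc,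
        List.map_cons, List.prod_cons, map_mul]
  have hu : IsUnit S.det := isUnit_iff_ne_zero.2 hS
  have h2 : (l.map (twoMat (1 : ℂ) (ec m j + ec m (-j)))).prod =
      S⁻¹ * (rho j ((l.map (simpleRefl m)).prod) * S) := by
    rw [← h1, ← mul_assoc, Matrix.nonsing_inv_mul _ hu, one_mul]
  rw [h2, Matrix.trace_mul_comm, mul_assoc, Matrix.mul_nonsing_inv _ hu, mul_one]

/-- The two-dimensional representation that corresponds to `χ_j`. -/
def twoLift (hm : 2 ≤ m) {χ : DihedralGroup m → ℂ} (j : ZMod m) (hj : ec m j ≠ ec m (-j))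
    (hχ : ∀ g, χ g = (rho j g).trace) : HeckeLift m χ :=
  HeckeLift.ofPolynomial (n := 2) two_pos
    (twoMat Polynomial.X (Polynomial.C (ec m j + ec m (-j))))
    (fun i => by
      rw [twoMat_map, RatFunc.algebraMap_X]
      exact twoMat_quadratic _ _ _)
    (by
      simp only [twoMat_map, RatFunc.algebraMap_X, RatFunc.algebraMap_C, map_add]
      refine twoMat_prod_eq hm ?_ (fun h => hj (C_inj.1 h)) ?_
      · rw [← map_mul, ← AddChar.map_add_eq_mul, add_neg_cancel, AddChar.map_zero_eq_one, map_one]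
      · rw [← map_pow, ec_pow_m, map_one])
    (fun U hU => by
      refine twoMat_irreducible (x := q) (c := RatFunc.C (ec m j + ec m (-j))) ?_ ?_ U fun i u hu => by
        have := hU i u hu
        rwa [twoMat_map, RatFunc.algebraMap_X, RatFunc.algebraMap_C] at this
      -- If `ec m j + ec m (-j) = -2`, then both summands are `-1`, against `hj`.
      · refine mul_ne_zero q_ne_zero fun h => ?_
        have h1 : (2 : ℂ) + (ec m j + ec m (-j)) = 0 := by
          refine C_inj.1 ?_
          rw [map_add, map_ofNat, h, map_zero]
        have h2 : ec m j * ec m (-j) = 1 := by rw [← AddChar.map_add_eq_mul]; simp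
        have h3 : (ec m j + 1) ^ 2 = 0 := by linear_combination (ec m j) * h1 - h2
        have h4 := pow_eq_zero_iff two_ne_zero |>.1 h3
        exact hj (by linear_combination 2 * h4 - h1)
      -- The two sides have the constant terms `0` and `1`.
      · intro h
        have h1 : algebraMap (Polynomial ℂ) F (Polynomial.X ^ 2 + Polynomial.C (-(ec m j + ec m (-j))) *
            Polynomial.X + 1) = 0 := by
          rw [map_add, map_add, map_mul, map_pow, RatFunc.algebraMap_X, RatFunc.algebraMap_C, map_one,
            map_neg]
          linear_combination -h
        rw [map_eq_zero_iff _ (RatFunc.algebraMap_injective ℂ)] at h1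
        have h2 := congrArg (Polynomial.eval 0) h1
        simp at h2)
    (fun l => by
      have h1 : (fun i => (twoMat Polynomial.X (Polynomial.C (ec m j + ec m (-j))) i).map
          (Polynomial.evalRingHom 1)) = twoMat (1 : ℂ) (ec m j + ec m (-j)) := funext fun i => by
        rw [twoMat_map, Polynomial.coe_evalRingHom, Polynomial.eval_X, Polynomial.eval_C]
      rw [hχ, h1]
      exact trace_prod_twoMat_one hj l)

theorem twoLift_rep {hm : 2 ≤ m} {χ : DihedralGroup m → ℂ} {j : ZMod m} {hj : ec m j ≠ ec m (-j)}
    {hχ : ∀ g, χ g = (rho j g).trace} (i : Bool) :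
    (twoLift hm j hj hχ).rep (heckeT m i) = twoMat q (RatFunc.C (ec m j + ec m (-j))) i := by
  refine (HeckeLift.ofPolynomial_rep i).trans ?_
  rw [twoMat_map, RatFunc.algebraMap_X, RatFunc.algebraMap_C]

end TwoLift

end

section

variable {m : ℕ} [NeZero m]

/-! ## Reduced words -/

/-- The element of `I₂(m)` given by a word. -/
def wordProd (m : ℕ) (l : List Bool) : DihedralGroup m := (l.map (simpleRefl m)).prod

theorem wordProd_cons (i : Bool) (l : List Bool) :
    wordProd m (i :: l) = simpleRefl m i * wordProd m l := by
  rw [wordProd, List.map_cons, List.prod_cons]; rfl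

theorem simpleRefl_mul_self (i : Bool) : simpleRefl m i * simpleRefl m i = 1 := by
  cases i <;> simp [simpleRefl]

theorem simpleRefl_false_mul : simpleRefl m false * simpleRefl m true = .r 1 := by
  simp [simpleRefl]

theorem simpleRefl_true_mul : simpleRefl m true * simpleRefl m false = .r (-1) := by
  simp [simpleRefl]

theorem wordProd_false (k : ℕ) : wordProd m (altWord false (2 * k)) = .r k := by
  rw [wordProd, altWord_even, Bool.not_false, simpleRefl_false_mul, DihedralGroup.r_pow, one_mul]

theorem wordProd_true (k : ℕ) : wordProd m (altWord true (2 * k)) = .r (-k) := by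
  rw [wordProd, altWord_even, Bool.not_true, simpleRefl_true_mul, DihedralGroup.r_pow, neg_one_mul]

theorem wordProd_braid : wordProd m (altWord false m) = wordProd m (altWord true m) := by
  rcases Nat.even_or_odd' m with ⟨k, hk | hk⟩
  · have h := natCast_add_self hk.symm
    rw [show altWord false m = altWord false (2 * k) by rw [← hk],
      show altWord true m = altWord true (2 * k) by rw [← hk], wordProd_false, wordProd_true]
    congr 1
    linear_combination h
  · have h : ((2 * k + 1 : ℕ) : ZMod m) = 0 := by rw [← hk, ZMod.natCast_self]
    push_cast at h
    rw [show altWord false m = altWord false (2 * k + 1) by rw [← hk],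
      show altWord true m = altWord true (2 * k + 1) by rw [← hk], wordProd, wordProd, altWord_odd,
      altWord_odd, Bool.not_false, Bool.not_true, simpleRefl_false_mul, simpleRefl_true_mul,
      DihedralGroup.r_pow, DihedralGroup.r_pow]
    simp only [simpleRefl, Bool.false_eq_true, if_false, if_true, DihedralGroup.r_mul_sr]
    congr 1
    linear_combination -h

theorem sgn_mul (g h : DihedralGroup m) : sgn m (g * h) = sgn m g * sgn m h := sgnHom.map_mul g h

theorem sgn_simpleRefl (i : Bool) : sgn m (simpleRefl m i) = -1 := by
  cases i <;> simp [simpleRefl, sgn]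

theorem sgn_wordProd (l : List Bool) : sgn m (wordProd m l) = (-1) ^ l.length := by
  induction l with
  | nil => rfl
  | cons i l ih => rw [wordProd_cons, sgn_mul, ih, sgn_simpleRefl, List.length_cons, pow_succ']

/-- A repeated letter cancels, and in an alternating word of length `m + 1` the braid relation
produces a repeated letter. -/
theorem IsReducedWord.exists_eq {l : List Bool} (hl : IsReducedWord m l) :
    ∃ i n, n ≤ m ∧ l = altWord i n := by
  induction l with
  | nil => exact ⟨false, 0, Nat.zero_le _, rfl⟩
  | cons a l ih =>
    have hl' : ∀ l' : List Bool, wordProd m l' = wordProd m (a :: l) → l.length + 1 ≤ l'.length := hl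
    obtain ⟨i, n, hn, rfl⟩ := ih fun l' h => by
      have h1 := hl' (a :: l') (by rw [wordProd_cons, wordProd_cons]; exact congrArg _ h)
      rw [List.length_cons] at h1
      omega
    rw [altWord_length] at hl'
    cases n with
    | zero => exact ⟨a, 1, Nat.pos_of_neZero m, rfl⟩
    | succ n =>
      have hai : i = !a := by
        by_contra hne
        have hia : i = a := by revert hne; cases i <;> cases a <;> simp
        subst hia
        have h1 := hl' (altWord (!i) n) (by
          rw [altWord, wordProd_cons, wordProd_cons, ← mul_assoc, simpleRefl_mul_self, one_mul])
        rw [altWord_length] at h1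
        omega
      subst hai
      refine ⟨a, n + 1 + 1, ?_, rfl⟩
      by_contra hlt
      have hnm : n + 1 = m := by omega
      have hbr : wordProd m (altWord (!a) (n + 1)) = wordProd m (altWord a (n + 1)) := by
        rw [hnm]
        cases a
        · exact wordProd_braid.symm
        · exact wordProd_braid
      have h1 := hl' (altWord (!a) n) (by
        rw [wordProd_cons, hbr, altWord, wordProd_cons, ← mul_assoc, simpleRefl_mul_self, one_mul])
      rw [altWord_length] at h1
      omega

theorem exists_isReducedWord (l : List Bool) :
    ∃ l', IsReducedWord m l' ∧ wordProd m l' = wordProd m l ∧ l'.length ≤ l.length := by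
  induction h : l.length using Nat.strong_induction_on generalizing l with
  | _ n ih =>
    by_cases hl : IsReducedWord m l
    · exact ⟨l, hl, rfl, h.le⟩
    · rw [IsReducedWord] at hl
      push Not at hl
      obtain ⟨l', h1, h2⟩ := hl
      obtain ⟨l'', h3, h4, h5⟩ := ih l'.length (h ▸ h2) l' rfl
      exact ⟨l'', h3, h4.trans h1, by omega⟩

theorem isReducedWord_false {k : ℕ} (hk : 2 * k ≤ m) : IsReducedWord m (altWord false (2 * k)) := by
  intro l' hl'
  by_contra hlt
  obtain ⟨l, h1, h2, h3⟩ := exists_isReducedWord (m := m) l'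
  obtain ⟨i, n, hn, rfl⟩ := h1.exists_eq
  rw [altWord_length] at h3 hlt
  have h4 : wordProd m (altWord i n) = wordProd m (altWord false (2 * k)) := h2.trans hl'
  have h5 := congrArg (sgn m) h4
  rw [sgn_wordProd, sgn_wordProd, altWord_length, altWord_length, pow_mul, neg_one_sq, one_pow] at h5
  have h6 : Even n := by
    by_contra ho
    rw [(Nat.not_even_iff_odd.1 ho).neg_one_pow] at h5
    norm_num at h5
  obtain ⟨n, rfl⟩ := h6.exists_two_nsmul _
  rw [smul_eq_mul] at *
  rw [wordProd_false] at h4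
  cases i
  · rw [wordProd_false] at h4
    have h7 : ((k - n : ℕ) : ZMod m) = 0 := by
      rw [Nat.cast_sub (by omega), sub_eq_zero]
      exact (DihedralGroup.r.inj h4).symm
    rw [natCast_eq_zero_iff_of_lt (by omega)] at h7
    omega
  · rw [wordProd_true] at h4
    have h7 : ((k + n : ℕ) : ZMod m) = 0 := by
      have := DihedralGroup.r.inj h4
      push_cast
      rw [← this]
      ring
    rw [natCast_eq_zero_iff_of_lt (by omega)] at h7
    omega

theorem isReducedWord_singleton (i : Bool) : IsReducedWord m [i] := by
  intro l' hl'
  have h5 := congrArg (sgn m) hl'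
  change sgn m (wordProd m l') = sgn m (wordProd m [i]) at h5
  rw [sgn_wordProd, sgn_wordProd] at h5
  rcases l' with _ | ⟨a, l'⟩
  · simp at h5
    norm_num at h5
  · simp

/-! ## Characters of the lifts -/

/-- The value at `q = 1`. -/
def evalOne (x : F) : ℂ := RatFunc.eval (RingHom.id ℂ) 1 x

/-- The rational functions without pole at `q = 1`. -/
def RegOne (x : F) : Prop := x.denom.eval 1 ≠ 0

theorem RegOne.evalOne_add {x y : F} (hx : RegOne x) (hy : RegOne y) :
    evalOne (x + y) = evalOne x + evalOne y := RatFunc.eval_add _ _ hx hy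

theorem RegOne.evalOne_mul {x y : F} (hx : RegOne x) (hy : RegOne y) :
    evalOne (x * y) = evalOne x * evalOne y := RatFunc.eval_mul _ _ hx hy

theorem evalOne_algebraMap (p : Polynomial ℂ) : evalOne (algebraMap (Polynomial ℂ) F p) = p.eval 1 := by
  rw [evalOne, RatFunc.eval_algebraMap]; rfl

theorem regOne_algebraMap (p : Polynomial ℂ) : RegOne (algebraMap (Polynomial ℂ) F p) := by
  rw [RegOne, RatFunc.denom_algebraMap, Polynomial.eval_one]
  exact one_ne_zero

/-- The field `ℂ` is algebraically closed, so it contains all elements of `ℂ(q)` algebraic over it.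
This is what rules out a nonconstant deformation of the eigenvalues in `trace_chebyshev`. -/
theorem mem_range_C_of_aeval_eq_zero {x : F} {p : Polynomial ℂ} (hp : p ≠ 0)
    (h : Polynomial.aeval x p = 0) : ∃ a, x = RatFunc.C a := by
  have hx : IsIntegral ℂ x := IsAlgebraic.isIntegral ⟨p, hp, h⟩
  obtain ⟨a, ha⟩ := minpoly.mem_range_of_degree_eq_one ℂ x
    (IsAlgClosed.degree_eq_one_of_irreducible ℂ (minpoly.irreducible hx))
  exact ⟨a, by rw [← ha, RatFunc.algebraMap_eq_C]⟩

theorem HeckeLift.n_eq {χ : DihedralGroup m → ℂ} (L : HeckeLift m χ) : (L.n : ℂ) = χ 1 := by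
  have h := L.specializes []
  rw [show heckeWord m [] = 1 from rfl, map_one, Matrix.trace_one, Fintype.card_fin] at h
  rw [show χ 1 = χ (([] : List Bool).map (simpleRefl m)).prod from rfl, ← h,
    show ((L.n : ℕ) : F) = RatFunc.C (L.n : ℂ) from (map_natCast _ _).symm, RatFunc.eval_C,
    RingHom.id_apply]

/-- The eigenvalue of a generator in a one-dimensional representation. -/
def linEig (χ : DihedralGroup m → ℂ) (i : Bool) : F := if χ (simpleRefl m i) = 1 then q else -1

theorem HeckeLift.rep_of_n_eq_one {χ : DihedralGroup m → ℂ} (L : HeckeLift m χ) (hn : L.n = 1)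
    (i : Bool) : L.rep (heckeT m i) = algebraMap F _ (linEig χ i) ∧
      (χ (simpleRefl m i) = 1 ∨ χ (simpleRefl m i) = -1) := by
  obtain ⟨n, rep, hpos, hirr, hreg, hspec⟩ := L
  subst hn
  have h1 := map_heckeT_quadratic rep i
  have h2 := hspec [i]
  rw [show heckeWord m [i] = heckeT m i by simp [heckeWord]] at h2
  simp only [List.map_cons, List.map_nil, List.prod_cons, List.prod_nil, mul_one] at h2
  rw [Matrix.trace_fin_one] at h2
  have h3 := congrFun (congrFun h1 0) 0
  rw [Matrix.algebraMap_eq_diagonal] at h3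
  simp only [Matrix.mul_apply, Finset.univ_unique, Fin.default_eq_zero, Finset.sum_singleton,
    Matrix.sub_apply, Matrix.add_apply, Matrix.one_apply_eq, Matrix.zero_apply,
    Matrix.diagonal_apply_eq, Pi.algebraMap_apply, mul_eq_zero] at h3
  rw [linEig]
  have hq : RatFunc.eval (RingHom.id ℂ) 1 q = 1 := RatFunc.eval_X _ _
  have hq' : RatFunc.eval (RingHom.id ℂ) 1 (-1 : F) = -1 := by
    rw [show (-1 : F) = RatFunc.C (-1 : ℂ) by rw [map_neg, map_one], RatFunc.eval_C, RingHom.id_apply]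
  rcases h3 with h3 | h3
  · have h4 : rep (heckeT m i) 0 0 = q := sub_eq_zero.1 h3
    rw [h4, hq] at h2
    rw [if_pos h2.symm]
    refine ⟨?_, Or.inl h2.symm⟩
    ext a b
    fin_cases a; fin_cases b
    rw [Matrix.algebraMap_eq_diagonal]
    exact h4
  · have h4 : rep (heckeT m i) 0 0 = -1 := eq_neg_of_add_eq_zero_left h3
    rw [h4, hq'] at h2
    rw [← h2, if_neg (by norm_num)]
    refine ⟨?_, Or.inr rfl⟩
    ext a b
    fin_cases a; fin_cases b
    rw [Matrix.algebraMap_eq_diagonal]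
    exact h4

theorem HeckeLift.trace_of_n_eq_one {χ : DihedralGroup m → ℂ} (L : HeckeLift m χ) (hn : L.n = 1)
    (l : List Bool) : (L.rep (heckeWord m l)).trace = (l.map (linEig χ)).prod := by
  have h1 : L.rep (heckeWord m l) = algebraMap F _ (l.map (linEig χ)).prod := by
    rw [map_heckeWord, map_list_prod, List.map_map]
    congr 2
    ext1 i
    exact (L.rep_of_n_eq_one hn i).1
  rw [h1, Matrix.algebraMap_eq_diagonal, Matrix.trace_diagonal]
  simp [hn]

section FinTwo

variable {K : Type*} [Field K]

theorem mul_self_fin_two (M : Matrix (Fin 2) (Fin 2) K) : M * M = M.trace • M - M.det • 1 := by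
  ext a b
  fin_cases a <;> fin_cases b <;>
    simp [Matrix.mul_apply, Fin.sum_univ_two, Matrix.trace_fin_two, Matrix.det_fin_two] <;> ring

theorem trace_det_of_quadratic {M : Matrix (Fin 2) (Fin 2) K} {x : K}
    (h : (M - algebraMap K _ x) * (M + 1) = 0) :
    M.trace = 2 * x ∨ M.trace = -2 ∨ (M.trace = x - 1 ∧ M.det = -x) := by
  have e := fun a b => congrFun (congrFun h a) b
  have e00 := e 0 0
  have e01 := e 0 1
  have e10 := e 1 0
  have e11 := e 1 1
  simp [Matrix.mul_apply, Fin.sum_univ_two, Matrix.algebraMap_eq_diagonal] at e00 e01 e10 e11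
  rw [Matrix.trace_fin_two, Matrix.det_fin_two]
  by_cases hb : M 0 1 = 0 ∧ M 1 0 = 0
  · rw [hb.1, hb.2] at e00 e11
    rw [hb.1]
    simp only [mul_zero, add_zero, zero_add, mul_eq_zero] at e00 e11
    rcases e00 with h0 | h0 <;> rcases e11 with h1 | h1
    · left; linear_combination h0 + h1
    · right; right
      exact ⟨by linear_combination h0 + h1, by linear_combination (-1) * h0 + M 0 0 * h1⟩
    · right; right
      exact ⟨by linear_combination h0 + h1, by linear_combination (-1) * h1 + M 1 1 * h0⟩
    · right; left; linear_combination h0 + h1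
  · right; right
    have htr : M 0 0 + M 1 1 = x - 1 := by
      by_cases h0 : M 0 1 = 0
      · have h1 : M 1 0 ≠ 0 := fun h1 => hb ⟨h0, h1⟩
        refine mul_left_cancel₀ h1 ?_
        linear_combination e10
      · refine mul_left_cancel₀ h0 ?_
        linear_combination e01
    exact ⟨htr, by linear_combination M 0 0 * htr - e00⟩

theorem pow_chebyshev {M : Matrix (Fin 2) (Fin 2) K} {x y : K} (hM : M * M = (x * y) • M - (x ^ 2) • 1)
    (k : ℕ) : M ^ (k + 1) = (x ^ k * (Polynomial.Chebyshev.S K k).eval y) • M -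
      (x ^ (k + 1) * (Polynomial.Chebyshev.S K (k - 1 : ℤ)).eval y) • 1 := by
  induction k with
  | zero => simp
  | succ k ih =>
    rw [pow_succ, ih, sub_mul, smul_mul_assoc, hM, smul_mul_assoc, one_mul]
    have h1 : Polynomial.Chebyshev.S K ((k : ℤ) + 1) =
        Polynomial.X * Polynomial.Chebyshev.S K k - Polynomial.Chebyshev.S K (k - 1 : ℤ) :=
      Polynomial.Chebyshev.S_add_one K k
    have h2 : (((k + 1 : ℕ) : ℤ) - 1) = k := by push_cast; ring
    rw [h2]
    push_cast
    rw [h1, Polynomial.eval_sub, Polynomial.eval_mul, Polynomial.eval_X]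
    module

end FinTwo

/-- Computes the traces of an arbitrary lift, so that no choice of lifts matters later. The
quadratic relation and the value at `q = 1` give each generator trace `q - 1` and determinant `-q`.
The products `A * B` and `B * A` of the generators do not commute into each other, have equal trace
`t` and determinant `q ^ 2`, and have equal `m`-th powers. So a Chebyshev polynomial vanishes at `t
/ q`, which is therefore a constant, determined at `q = 1`. -/
theorem trace_chebyshev {χ : DihedralGroup m → ℂ} (hm : 2 ≤ m) (L : HeckeLift m χ) (hn : L.n = 2)
    {j : ℕ} (hj0 : j ≠ 0) (hj : 2 * j < m) (hχ : χ = chi m 1 j) :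
    (∀ i, (L.rep (heckeT m i)).trace = q - 1) ∧
    ∀ k : ℕ, (L.rep (heckeWord m (altWord false (2 * k)))).trace =
      q ^ k * RatFunc.C (ec m (j * k) + ec m (-(j * k))) := by
  obtain ⟨n, rep, hpos, hirr, hreg, hspec⟩ := L
  subst hn
  change (∀ i, (rep (heckeT m i)).trace = q - 1) ∧
    ∀ k : ℕ, (rep (heckeWord m (altWord false (2 * k)))).trace = _
  have hsingle : ∀ i, heckeWord m [i] = heckeT m i := fun i => by simp [heckeWord]
  have hχr : ∀ k : ℕ, χ (.r k) = ec m (j * k) + ec m (-(j * k)) := fun k => by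
    rw [hχ]; exact (chi_two hj0 hj.ne).1 k
  have hχs : ∀ i, χ (simpleRefl m i) = 0 := fun i => by
    rw [hχ]; cases i <;> exact (chi_two hj0 hj.ne).2 _
  have hT : ∀ i, (rep (heckeT m i)).trace = q - 1 ∧ (rep (heckeT m i)).det = -q := by
    intro i
    have h2 := hspec [i]
    rw [hsingle] at h2
    simp only [List.map_cons, List.map_nil, List.prod_cons, List.prod_nil, mul_one, hχs] at h2
    rcases trace_det_of_quadratic (map_heckeT_quadratic rep i) with h | h | h
    · rw [h, show (2 * q : F) = algebraMap (Polynomial ℂ) F (2 * Polynomial.X) by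
        simp [map_ofNat (algebraMap (Polynomial ℂ) F) 2]] at h2
      have h3 := evalOne_algebraMap (2 * Polynomial.X)
      rw [evalOne, h2] at h3
      simp at h3
    · rw [h, show (-2 : F) = algebraMap (Polynomial ℂ) F (-2) by
        simp [map_ofNat (algebraMap (Polynomial ℂ) F) 2]] at h2
      have h3 := evalOne_algebraMap (-2)
      rw [evalOne, h2] at h3
      simp at h3
    · exact h
  refine ⟨fun i => (hT i).1, ?_⟩
  set A := rep (heckeT m false) with hA
  set B := rep (heckeT m true) with hB
  have hA1 : A.trace = q - 1 := (hT false).1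
  have hB1 : B.trace = q - 1 := (hT true).1
  have hword : ∀ k, rep (heckeWord m (altWord false (2 * k))) = (A * B) ^ k := fun k => by
    rw [map_heckeWord, altWord_even]; rfl
  have hdet : (A * B).det = q ^ 2 := by rw [Matrix.det_mul, (hT false).2, (hT true).2]; ring
  have hdet' : (B * A).det = q ^ 2 := by rw [Matrix.det_mul, (hT false).2, (hT true).2]; ring
  set t := (A * B).trace with ht
  have hq := q_ne_zero
  have hty : t = q * (t / q) := by field_simp
  have hAB : (A * B) * (A * B) = (q * (t / q)) • (A * B) - (q ^ 2) • 1 := by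
    rw [mul_self_fin_two, hdet, ← hty]
  have hBA : (B * A) * (B * A) = (q * (t / q)) • (B * A) - (q ^ 2) • 1 := by
    rw [mul_self_fin_two, hdet', ← hty, Matrix.trace_mul_comm B A]
  have hreg1 : RegOne t := by
    have := hreg (altWord false (2 * 1))
    rwa [hword, pow_one] at this
  have hevt : evalOne t = ec m j + ec m (-j) := by
    have h1 := hspec (altWord false (2 * 1))
    rw [hword, pow_one] at h1
    refine h1.trans ?_
    change χ (wordProd m _) = _
    rw [wordProd_false, hχr, Nat.cast_one, mul_one]
  -- If the generators commuted, the quadratic relations would give the trace of `(A * B) ^ 2`, with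
  -- value `2` at `q = 1`. Then `2 * j` would be zero modulo `m`.
  have hne : A * B ≠ B * A := by
    intro hcomm
    have hsq : ∀ M : Matrix (Fin 2) (Fin 2) F, M.trace = q - 1 → M.det = -q →
        M * M = (q - 1) • M + q • 1 := fun M h1 h2 => by
      rw [mul_self_fin_two, h1, h2, neg_smul, sub_neg_eq_add]
    have h1 : (A * B) ^ 2 = (A * A) * (B * B) := by
      rw [pow_two, mul_assoc, ← mul_assoc B A B, ← hcomm]
      noncomm_ring
    have h2 : ((A * B) ^ 2).trace = (q - 1) ^ 2 * t + (2 * q * (q - 1) ^ 2 + 2 * q ^ 2) := by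
      rw [h1, hsq A (hT false).1 (hT false).2, hsq B (hT true).1 (hT true).2]
      simp only [add_mul, mul_add, smul_mul_assoc, mul_smul_comm, one_mul, mul_one, Matrix.trace_add,
        Matrix.trace_smul, smul_eq_mul, Matrix.trace_one, Fintype.card_fin, hA1, hB1, ← ht]
      push_cast
      ring
    have h3 := hspec (altWord false (2 * 2))
    rw [hword, h2] at h3
    change evalOne _ = χ (wordProd m _) at h3
    have e1 : ((q - 1) ^ 2 : F) = algebraMap (Polynomial ℂ) F ((Polynomial.X - 1) ^ 2) := by simp
    have e2 : (2 * q * (q - 1) ^ 2 + 2 * q ^ 2 : F) = algebraMap (Polynomial ℂ) F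
      (2 * Polynomial.X * (Polynomial.X - 1) ^ 2 + 2 * Polynomial.X ^ 2) := by
      simp [map_ofNat (algebraMap (Polynomial ℂ) F) 2]
    have hr1 : RegOne ((q - 1) ^ 2 * t) := by
      rw [e1]
      intro h0
      have hd := RatFunc.denom_mul_dvd (algebraMap (Polynomial ℂ) F ((Polynomial.X - 1) ^ 2)) t
      rw [RatFunc.denom_algebraMap, one_mul] at hd
      obtain ⟨u, hu⟩ := hd
      refine hreg1 ?_
      rw [hu, Polynomial.eval_mul, h0, zero_mul]
    rw [e2, hr1.evalOne_add (regOne_algebraMap _), evalOne_algebraMap, e1,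
      (regOne_algebraMap _).evalOne_mul hreg1, evalOne_algebraMap, wordProd_false, hχr] at h3
    simp at h3
    set u := ec m ((j : ZMod m) * 2) with hu
    have h4 : u * ec m (-((j : ZMod m) * 2)) = 1 := by rw [hu, ← AddChar.map_add_eq_mul]; simp
    have h5 : (u - 1) ^ 2 = 0 := by linear_combination (-u) * h3 - h4
    have h6 : u = 1 := sub_eq_zero.1 (pow_eq_zero_iff two_ne_zero |>.1 h5)
    have h7 : (j : ZMod m) * 2 = 0 := ZMod.injective_stdAddChar (by
      rw [AddChar.map_zero_eq_one]; exact h6)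
    refine natCast_ne_neg hj0 hj ?_
    linear_combination h7
  -- The square of the longest element is central; the braid relation is applied twice.
  have hpow : (A * B) ^ m = (B * A) ^ m := by
    have hb := congrArg rep (heckeWord_braid m)
    rw [map_heckeWord, map_heckeWord] at hb
    rcases Nat.even_or_odd' m with ⟨k, hk | hk⟩
    · have e1 := altWord_even (fun i => rep (heckeT m i)) false k
      have e2 := altWord_even (fun i => rep (heckeT m i)) true k
      rw [← hk] at e1 e2
      rw [e1, e2] at hb
      change (A * B) ^ k = (B * A) ^ k at hb
      rw [hk, mul_comm 2 k, pow_mul, pow_mul, hb]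
    · have e1 := altWord_odd (fun i => rep (heckeT m i)) false k
      have e2 := altWord_odd (fun i => rep (heckeT m i)) true k
      rw [← hk] at e1 e2
      rw [e1, e2] at hb
      change (A * B) ^ k * A = (B * A) ^ k * B at hb
      have f1 : (A * B) ^ (k + 1 + k) = ((A * B) ^ k * A) * ((B * A) ^ k * B) := by
        rw [pow_add, pow_succ, mul_assoc, mul_assoc, mul_assoc, ← mul_pow_mul]
      have f2 : (B * A) ^ (k + 1 + k) = ((B * A) ^ k * B) * ((A * B) ^ k * A) := by
        rw [pow_add, pow_succ, mul_assoc, mul_assoc, mul_assoc, ← mul_pow_mul]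
      rw [hk, show 2 * k + 1 = k + 1 + k by ring, f1, f2, hb]
  obtain ⟨a, ha⟩ : ∃ a, t / q = RatFunc.C a := by
    have e1 := pow_chebyshev hAB (m - 1)
    have e2 := pow_chebyshev hBA (m - 1)
    rw [show m - 1 + 1 = m by omega] at e1 e2
    rw [e1, e2, sub_left_inj, ← sub_eq_zero, ← smul_sub, smul_eq_zero] at hpow
    have h0 := hpow.resolve_right (sub_ne_zero.2 hne)
    have h1 := (mul_eq_zero.1 h0).resolve_left (pow_ne_zero _ hq)
    refine mem_range_C_of_aeval_eq_zero (p := Polynomial.Chebyshev.S ℂ ((m - 1 : ℕ) : ℤ))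
      (fun h => ?_) ?_
    · have h2 := Polynomial.Chebyshev.S_eval_two ℂ ((m - 1 : ℕ) : ℤ)
      rw [h, Polynomial.eval_zero] at h2
      have h3 : ((m - 1 : ℕ) : ℂ) + 1 = m := by exact_mod_cast (show m - 1 + 1 = m by omega)
      push_cast at h2
      rw [h3] at h2
      exact NeZero.ne (m : ℂ) h2.symm
    · rw [Polynomial.aeval_def, ← Polynomial.eval_map, Polynomial.Chebyshev.map_S]
      exact h1
  have ha' : t = RatFunc.C a * q := by rw [← ha]; field_simp
  have ha'' : a = ec m j + ec m (-j) := by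
    rw [← hevt, ha', show RatFunc.C a * q = algebraMap (Polynomial ℂ) F (Polynomial.C a * Polynomial.X)
      by simp, evalOne_algebraMap]
    simp
  suffices h : ∀ k : ℕ, (((A * B) ^ k).trace = q ^ k * RatFunc.C (ec m (j * k) + ec m (-(j * k)))) ∧
      ((A * B) ^ (k + 1)).trace =
        q ^ (k + 1) * RatFunc.C (ec m (j * (k + 1 : ℕ)) + ec m (-(j * (k + 1 : ℕ)))) from
    fun k => by rw [hword, (h k).1]
  intro k
  induction k with
  | zero =>
    constructor
    · rw [pow_zero, Matrix.trace_one]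
      simp
      norm_num
    · rw [zero_add, pow_one, Nat.cast_one, mul_one, ← ht, ha', ha'']
      ring
  | succ k ih =>
    refine ⟨ih.2, ?_⟩
    have h1 : (A * B) ^ (k + 1 + 1) = (q * (t / q)) • (A * B) ^ (k + 1) - (q ^ 2) • (A * B) ^ k := by
      rw [pow_succ, pow_succ, mul_assoc, hAB, mul_sub, mul_smul_comm, mul_smul_comm, mul_one]
    have h2 : ec m j * ec m (-j) = 1 := by rw [← AddChar.map_add_eq_mul]; simp
    rw [h1, Matrix.trace_sub, Matrix.trace_smul, Matrix.trace_smul, ih.1, ih.2, ha, ha'']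
    simp only [smul_eq_mul]
    have h3 : (ec m j + ec m (-j)) * (ec m (j * (k + 1 : ℕ)) + ec m (-(j * (k + 1 : ℕ)))) -
        (ec m (j * k) + ec m (-(j * k))) =
        ec m (j * (k + 1 + 1 : ℕ)) + ec m (-(j * (k + 1 + 1 : ℕ))) := by
      push_cast
      simp only [mul_add, mul_one, neg_add, AddChar.map_add_eq_mul]
      linear_combination (ec m (j * k) + ec m (-(j * k))) * h2
    rw [← h3, RingHom.map_sub, RingHom.map_mul]
    ring

end

section

variable {m : ℕ} [NeZero m]

/-! ## Traces along words -/

theorem trace_heckeWord_true {n : ℕ} (f : Hecke m →ₐ[F] Matrix (Fin n) (Fin n) F) (k : ℕ) :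
    (f (heckeWord m (altWord true (2 * k)))).trace =
      (f (heckeWord m (altWord false (2 * k)))).trace := by
  rw [map_heckeWord, map_heckeWord, altWord_even, altWord_even, Bool.not_true, Bool.not_false]
  cases k with
  | zero => rw [pow_zero, pow_zero]
  | succ k =>
    rw [pow_succ, ← mul_assoc, Matrix.trace_mul_comm, ← mul_assoc, ← mul_pow_mul, mul_assoc, ← pow_succ]

theorem heckeT_mul_self (i : Bool) :
    heckeT m i * heckeT m i = (q - 1) • heckeT m i + q • (1 : Hecke m) := by
  have h := heckeT_quadratic m i
  rw [Algebra.smul_def, Algebra.smul_def, mul_one, map_sub, map_one, ← sub_eq_zero, ← h,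
    sub_mul, sub_mul, one_mul, mul_add, mul_one, mul_add, mul_one]
  abel

/-- An alternating word of odd length begins and ends with the same letter. Cyclicity of the trace
brings the two together, and the quadratic relation applies. Hence traces on alternating words are
determined by those on words of even length and on single letters. -/
theorem trace_heckeWord_odd {n : ℕ} (f : Hecke m →ₐ[F] Matrix (Fin n) (Fin n) F) (i : Bool) (k : ℕ) :
    (f (heckeWord m (altWord i (2 * k + 3)))).trace =
      (q - 1) * (f (heckeWord m (altWord i (2 * k + 2)))).trace +
        q * (f (heckeWord m (altWord (!i) (2 * k + 1)))).trace := by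
  have h1 : heckeWord m (altWord i (2 * k + 3)) =
      heckeT m i * (heckeWord m (altWord (!i) (2 * k + 1)) * heckeT m i) := by
    have e1 := altWord_odd (heckeT m) i (k + 1)
    have e2 := altWord_odd (heckeT m) (!i) k
    rw [heckeWord, heckeWord, e2, show 2 * k + 3 = 2 * (k + 1) + 1 by ring, e1, pow_succ', Bool.not_not]
    simp only [mul_assoc]
    rw [mul_pow_mul, ← mul_assoc (heckeT m (!i)) (heckeT m i), ← pow_succ', pow_succ]
  have h2 : heckeWord m (altWord i (2 * k + 2)) =
      heckeT m i * heckeWord m (altWord (!i) (2 * k + 1)) := by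
    rw [heckeWord, altWord, List.map_cons, List.prod_cons, heckeWord]
  rw [h1, h2, map_mul, map_mul, Matrix.trace_mul_comm, mul_assoc, ← map_mul, heckeT_mul_self, map_mul,
    map_add, map_smul, map_smul, map_one, mul_add, Matrix.trace_add, mul_smul_comm, mul_smul_comm,
    Matrix.trace_smul, Matrix.trace_smul, mul_one, Matrix.trace_mul_comm]
  rfl

/-! ## Sums over residues and over characters -/

theorem sum_zmod_symm {M : Type*} [AddCommMonoid M] (G : ZMod m → M) :
    ∑ a, G a = G 0 + ∑ i ∈ Finset.range ((m - 1) / 2), (G ((i + 1 : ℕ) : ZMod m) + G (-((i + 1 : ℕ) : ZMod m))) +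
      if Even m then G ((m / 2 : ℕ) : ZMod m) else 0 := by
  have h0 : ∑ a, G a = ∑ n ∈ Finset.range m, G (n : ZMod m) := by
    rw [← sum_zmod_val]
    simp only [ZMod.natCast_zmod_val]
  have hneg : ∀ n ≤ m, ((m - n : ℕ) : ZMod m) = -(n : ZMod m) := fun n hn => by
    rw [Nat.cast_sub hn, ZMod.natCast_self, zero_sub]
  rw [h0]
  rcases Nat.even_or_odd' m with ⟨t, ht | ht⟩
  · have ht0 : t ≠ 0 := by rintro rfl; exact NeZero.ne m ht
    obtain ⟨u, rfl⟩ : ∃ u, t = u + 1 := ⟨t - 1, by omega⟩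
    have e1 : (m - 1) / 2 = u := by omega
    have e2 : m / 2 = u + 1 := by omega
    have e3 : Finset.range m = Finset.range ((u + 1) + 1 + u) := by congr 1; omega
    rw [e1, e2, if_pos ⟨u + 1, by omega⟩, e3, Finset.sum_range_add, Finset.sum_range_succ,
      Finset.sum_range_succ', Finset.sum_add_distrib, Nat.cast_zero]
    have e4 : ∑ x ∈ Finset.range u, G ((u + 1 + 1 + x : ℕ) : ZMod m) =
        ∑ x ∈ Finset.range u, G (-((x + 1 : ℕ) : ZMod m)) := by
      rw [← Finset.sum_range_reflect]
      refine Finset.sum_congr rfl fun n hn => ?_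
      have := Finset.mem_range.1 hn
      rw [← hneg _ (by omega)]
      congr 2
      omega
    rw [e4]
    abel
  · have e1 : (m - 1) / 2 = t := by omega
    have e3 : Finset.range m = Finset.range (t + 1 + t) := by congr 1; omega
    rw [e1, if_neg (Nat.not_even_iff_odd.2 ⟨t, ht⟩), e3, Finset.sum_range_add,
      Finset.sum_range_succ', Finset.sum_add_distrib, Nat.cast_zero]
    have e4 : ∑ x ∈ Finset.range t, G ((t + 1 + x : ℕ) : ZMod m) =
        ∑ x ∈ Finset.range t, G (-((x + 1 : ℕ) : ZMod m)) := by
      rw [← Finset.sum_range_reflect]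
      refine Finset.sum_congr rfl fun n hn => ?_
      have := Finset.mem_range.1 hn
      rw [← hneg _ (by omega)]
      congr 2
      omega
    rw [e4]
    abel

theorem sum_irr_succ {M : Type*} [AddCommMonoid M] (f : Irr m → M) :
    ∑ χ, f χ = f (irrChi m 1 0) + ∑ i ∈ Finset.range ((m - 1) / 2), f (irrChi m 1 (i + 1)) +
      (if Even m then f (irrChi m 1 (m / 2)) + f (irrChi m (-1) (m / 2)) else 0) +
      f (irrSgn m) := by
  have hm := Nat.pos_of_neZero m
  rw [sum_irr 1, show (m + 1) / 2 = (m - 1) / 2 + 1 by omega, Finset.sum_range_succ']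
  abel

/-! ## Traces of the generators and of the powers of the Coxeter element -/

section Trace

variable (L : ∀ χ : Irr m, HeckeLift m χ.1)

theorem n_eq_of_val_one {χ : Irr m} {n : ℕ} (h : χ.1 1 = n) : (L χ).n = n := by
  have h1 := (L χ).n_eq
  rw [h] at h1
  exact_mod_cast h1

theorem trace_triv (l : List Bool) :
    ((L (irrChi m 1 0)).rep (heckeWord m l)).trace = q ^ l.length := by
  have hv : (irrChi m 1 0).1 = fun _ => 1 := by rw [irrChi_val (Nat.zero_le _), chi_zero]
  rw [HeckeLift.trace_of_n_eq_one _ (n_eq_of_val_one L (n := 1) (by rw [hv]; simp))]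
  have : linEig (irrChi m 1 0).1 = fun _ => q := by
    funext i
    rw [linEig, hv, if_pos rfl]
  rw [this, List.map_const', List.prod_replicate]

theorem trace_sgn (l : List Bool) :
    ((L (irrSgn m)).rep (heckeWord m l)).trace = (-1) ^ l.length := by
  have hv : (irrSgn m).1 = sgn m := rfl
  rw [HeckeLift.trace_of_n_eq_one _ (n_eq_of_val_one L (n := 1) (by rw [hv, DihedralGroup.one_def, sgn]; simp))]
  have : linEig (irrSgn m).1 = fun _ => -1 := by
    funext i
    rw [linEig, hv, sgn_simpleRefl, if_neg (by norm_num)]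
  rw [this, List.map_const', List.prod_replicate]

theorem chi_half_simpleRefl (hm : 2 ≤ m) (s : ℤˣ) {r : ℕ} (hr : 2 * r = m) (i : Bool) :
    chi m s r (simpleRefl m i) = ((s : ℤ) : ℂ) * if i then -1 else 1 := by
  have : Fact (1 < m) := ⟨by omega⟩
  cases i
  · rw [simpleRefl, if_neg (by simp), (chi_half hr).2]; simp
  · rw [simpleRefl, if_pos rfl, (chi_half hr).2, ec_half hr, ZMod.val_one]; simp

theorem trace_half (hm : 2 ≤ m) (he : Even m) (s : ℤˣ) (l : List Bool) :
    ((L (irrChi m s (m / 2))).rep (heckeWord m l)).trace =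
      (l.map fun i => if s = (if i then -1 else 1) then q else -1).prod := by
  have h2 : 2 * (m / 2) = m := Nat.two_mul_div_two_of_even he
  have hv : (irrChi m s (m / 2)).1 = chi m s (m / 2) := irrChi_val h2.le
  rw [HeckeLift.trace_of_n_eq_one _ (n_eq_of_val_one L (n := 1) (by
    rw [hv, DihedralGroup.one_def, (chi_half h2).1]; simp))]
  congr 2
  funext i
  rw [linEig, hv]
  rw [chi_half_simpleRefl hm s h2]
  rcases Int.units_eq_one_or s with rfl | rfl <;> cases i <;> norm_num

theorem trace_two (hm : 2 ≤ m) {j : ℕ} (hj0 : j ≠ 0) (hj : 2 * j < m) :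
    (∀ i, ((L (irrChi m 1 j)).rep (heckeWord m [i])).trace = q - 1) ∧
    ∀ k : ℕ, ((L (irrChi m 1 j)).rep (heckeWord m (altWord false (2 * k)))).trace =
      q ^ k * RatFunc.C (ec m (j * k) + ec m (-(j * k))) := by
  have hv : (irrChi m 1 j).1 = chi m 1 j := irrChi_val hj.le
  have hn : (L (irrChi m 1 j)).n = 2 := n_eq_of_val_one L (by
    rw [hv, DihedralGroup.one_def, (chi_two hj0 hj.ne).1]; simp; norm_num)
  have h := trace_chebyshev hm (L (irrChi m 1 j)) hn hj0 hj hv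
  refine ⟨fun i => ?_, h.2⟩
  rw [← h.1 i]
  simp [heckeWord]

/-- The sum of the coefficients of the characters with `b`-invariant `±a` modulo `m`. -/
def foldCoeff (x : Irr m → F) (a : ZMod m) : F :=
  if a = 0 then 0
  else if 2 * a.val = m then x (irrChi m 1 (m / 2)) + x (irrChi m (-1) (m / 2))
  else x (irrChi m 1 (min a.val (m - a.val)))

theorem val_neg_natCast {j : ℕ} (hj0 : j ≠ 0) (hj : j < m) : (-(j : ZMod m)).val = m - j := by
  rw [show -(j : ZMod m) = ((m - j : ℕ) : ZMod m) by
    rw [Nat.cast_sub hj.le, ZMod.natCast_self, zero_sub], ZMod.val_natCast_of_lt (by omega)]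

theorem foldCoeff_natCast (x : Irr m → F) {j : ℕ} (hj0 : j ≠ 0) (hj : 2 * j < m) :
    foldCoeff x (j : ZMod m) = x (irrChi m 1 j) ∧ foldCoeff x (-(j : ZMod m)) = x (irrChi m 1 j) := by
  have h0 : (j : ZMod m) ≠ 0 := by rwa [Ne, natCast_eq_zero_iff_of_lt (by omega)]
  rw [foldCoeff, foldCoeff, if_neg h0, if_neg (neg_ne_zero.2 h0), val_neg_natCast hj0 (by omega),
    ZMod.val_natCast_of_lt (by omega), if_neg (by omega), if_neg (by omega)]
  constructor <;> congr 2 <;> omega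

theorem foldCoeff_half (x : Irr m → F) (he : Even m) :
    foldCoeff x ((m / 2 : ℕ) : ZMod m) = x (irrChi m 1 (m / 2)) + x (irrChi m (-1) (m / 2)) := by
  have h2 : 2 * (m / 2) = m := Nat.two_mul_div_two_of_even he
  have hm := Nat.pos_of_neZero m
  rw [foldCoeff, if_neg, ZMod.val_natCast_of_lt (by omega), if_pos h2]
  rw [natCast_eq_zero_iff_of_lt (by omega)]
  omega

/-- On powers of the Coxeter element, all characters other than `χ_0` and `ε` together give the
Fourier transform of their coefficients, folded onto the residues `±i`. -/
theorem sum_trace_even (hm : 2 ≤ m) (x : Irr m → F) (k : ℕ) :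
    ∑ χ, x χ * ((L χ).rep (heckeWord m (altWord false (2 * k)))).trace =
      x (irrChi m 1 0) * q ^ (2 * k) + x (irrSgn m) +
        q ^ k * ∑ a, foldCoeff x a * RatFunc.C (ec m (a * k)) := by
  rw [sum_irr_succ, sum_zmod_symm, trace_triv, trace_sgn, altWord_length, pow_mul (-1 : F), neg_one_sq,
    one_pow, foldCoeff, if_pos rfl, zero_mul, zero_add, mul_add, Finset.mul_sum]
  have h1 : ∑ i ∈ Finset.range ((m - 1) / 2), x (irrChi m 1 (i + 1)) *
      ((L (irrChi m 1 (i + 1))).rep (heckeWord m (altWord false (2 * k)))).trace =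
      ∑ i ∈ Finset.range ((m - 1) / 2), q ^ k *
        (foldCoeff x ((i + 1 : ℕ) : ZMod m) * RatFunc.C (ec m ((i + 1 : ℕ) * k)) +
          foldCoeff x (-((i + 1 : ℕ) : ZMod m)) * RatFunc.C (ec m (-((i + 1 : ℕ) : ZMod m) * k))) := by
    refine Finset.sum_congr rfl fun i hi => ?_
    have := Finset.mem_range.1 hi
    rw [(trace_two L hm (by omega) (by omega)).2, (foldCoeff_natCast x (by omega) (by omega)).1,
      (foldCoeff_natCast x (by omega) (by omega)).2, map_add, neg_mul]
    ring
  have h2 : (if Even m then x (irrChi m 1 (m / 2)) *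
        ((L (irrChi m 1 (m / 2))).rep (heckeWord m (altWord false (2 * k)))).trace +
      x (irrChi m (-1) (m / 2)) *
        ((L (irrChi m (-1) (m / 2))).rep (heckeWord m (altWord false (2 * k)))).trace else 0) =
      q ^ k * if Even m then foldCoeff x ((m / 2 : ℕ) : ZMod m) *
        RatFunc.C (ec m ((m / 2 : ℕ) * k)) else 0 := by
    by_cases he : Even m
    · have h2 : 2 * (m / 2) = m := Nat.two_mul_div_two_of_even he
      have : Fact (1 < m) := ⟨by omega⟩
      have hec : ec m ((m / 2 : ℕ) * k) = (-1) ^ k := by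
        have e1 := ec_half h2 1
        rw [mul_one, ZMod.val_one, pow_one] at e1
        rw [mul_comm, ← nsmul_eq_mul, AddChar.map_nsmul_eq_pow, e1]
      rw [if_pos he, if_pos he, trace_half L hm he, trace_half L hm he, foldCoeff_half x he, hec,
        altWord_even, altWord_even]
      have hne : (-1 : ℤˣ) ≠ 1 := by decide
      simp [hne, hne.symm]
      ring
    · rw [if_neg he, if_neg he, mul_zero]
  rw [h1, h2]
  ring

theorem sum_trace_single (hm : 2 ≤ m) (x : Irr m → F) (i : Bool) :
    ∑ χ, x χ * ((L χ).rep (heckeWord m [i])).trace =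
      q * x (irrChi m 1 0) - x (irrSgn m) +
        (q - 1) * ∑ j ∈ Finset.range ((m - 1) / 2), x (irrChi m 1 (j + 1)) +
        if Even m then
          (if i then -1 else q) * x (irrChi m 1 (m / 2)) + (if i then q else -1) * x (irrChi m (-1) (m / 2))
        else 0 := by
  rw [sum_irr_succ, trace_triv, trace_sgn, List.length_singleton, pow_one, pow_one, Finset.mul_sum]
  have h1 : ∑ j ∈ Finset.range ((m - 1) / 2), x (irrChi m 1 (j + 1)) *
      ((L (irrChi m 1 (j + 1))).rep (heckeWord m [i])).trace =
      ∑ j ∈ Finset.range ((m - 1) / 2), (q - 1) * x (irrChi m 1 (j + 1)) := by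
    refine Finset.sum_congr rfl fun j hj => ?_
    have := Finset.mem_range.1 hj
    rw [(trace_two L hm (by omega) (by omega)).1, mul_comm]
  have h2 : (if Even m then x (irrChi m 1 (m / 2)) *
        ((L (irrChi m 1 (m / 2))).rep (heckeWord m [i])).trace +
      x (irrChi m (-1) (m / 2)) *
        ((L (irrChi m (-1) (m / 2))).rep (heckeWord m [i])).trace else 0) =
      if Even m then
          (if i then -1 else q) * x (irrChi m 1 (m / 2)) + (if i then q else -1) * x (irrChi m (-1) (m / 2))
        else 0 := by
    by_cases he : Even m
    · have hne : (-1 : ℤˣ) ≠ 1 := by decide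
      rw [if_pos he, if_pos he, trace_half L hm he, trace_half L hm he]
      cases i <;> simp [hne, hne.symm] <;> ring
    · rw [if_neg he, if_neg he]
  rw [h1, h2]
  ring

end Trace

end

section

variable {m : ℕ} [NeZero m]

/-! ## Schur elements -/

/-- The discrete Fourier transform of `AZ m`. -/
def AHat (m : ℕ) [NeZero m] (a : ZMod m) : F := ∑ i, AZ m i * RatFunc.C (ec m (-(i * a)))

theorem AHat_neg (a : ZMod m) : AHat m (-a) = AHat m a := by
  rw [AHat, AHat, ← Equiv.sum_comp (Equiv.neg (ZMod m))]
  refine Finset.sum_congr rfl fun i _ => ?_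
  rw [Equiv.neg_apply, AZ_neg, neg_mul_neg]

theorem AHat_mul (a : ZMod m) :
    AHat m a * ((q - RatFunc.C (ec m a)) * (q - RatFunc.C (ec m (-a)))) = (q - 1) ^ 2 * poincare m := by
  rw [poincare_eq]
  exact sum_AZ_ec a

theorem AHat_zero : AHat m 0 = poincare m := by
  have h := AHat_mul (m := m) 0
  rw [neg_zero, AddChar.map_zero_eq_one, map_one] at h
  have := pow_ne_zero 2 q_sub_one_ne_zero
  refine mul_right_cancel₀ this ?_
  linear_combination h

/-- The inverse Schur element of `χ_a` (twice this element if `χ_a` is linear). -/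
def schurInv (m : ℕ) [NeZero m] (a : ZMod m) : F := (m : F)⁻¹ * (1 - AHat m a / poincare m)

theorem schurInv_zero : schurInv m 0 = 0 := by
  rw [schurInv, AHat_zero, div_self poincare_ne_zero, sub_self, mul_zero]

theorem schurInv_neg (a : ZMod m) : schurInv m (-a) = schurInv m a := by
  rw [schurInv, schurInv, AHat_neg]

theorem sum_schurInv (k : ZMod m) : ∑ a, schurInv m a * RatFunc.C (ec m (a * k)) =
    (if k = 0 then 1 else 0) - AZ m k / poincare m := by
  have hm : (m : F) ≠ 0 := Nat.cast_ne_zero.2 (NeZero.ne m)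
  have h1 := sum_ec_mul_sum_AZ k
  have h2 : ∑ a, (RatFunc.C (ec m (a * k)) : F) = (m : F) * if k = 0 then 1 else 0 := by
    rw [← map_sum]
    simp only [mul_comm _ k]
    rw [sum_ec]
    split_ifs <;> simp
  have h3 : ∀ a, schurInv m a * RatFunc.C (ec m (a * k)) = (m : F)⁻¹ * RatFunc.C (ec m (a * k)) -
      (m : F)⁻¹ * (poincare m)⁻¹ * (RatFunc.C (ec m (k * a)) * AHat m a) := fun a => by
    rw [schurInv, mul_comm k a, div_eq_mul_inv]; ring
  simp only [h3, Finset.sum_sub_distrib, ← Finset.mul_sum]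
  rw [h2, show ∑ a, RatFunc.C (ec m (k * a)) * AHat m a = m * AZ m k from h1]
  field_simp

/-! ### The order of vanishing -/

theorem ordZero_of_mul_eq {x : F} {n : ℕ} {N D : Polynomial ℂ} (hN : N.coeff 0 ≠ 0) (hD : D.coeff 0 ≠ 0)
    (h : x * algebraMap (Polynomial ℂ) F D = q ^ n * algebraMap (Polynomial ℂ) F N) : ordZero x = n := by
  have hN0 : N ≠ 0 := by rintro rfl; simp at hN
  have hD0 : D ≠ 0 := by rintro rfl; simp at hD
  have hx : x ≠ 0 := by
    rintro rfl
    rw [zero_mul] at h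
    exact mul_ne_zero (pow_ne_zero n q_ne_zero) (RatFunc.algebraMap_ne_zero hN0) h.symm
  have h1 : x.num * D = x.denom * (Polynomial.X ^ n * N) := by
    refine RatFunc.algebraMap_injective ℂ ?_
    have h2 : algebraMap (Polynomial ℂ) F x.denom ≠ 0 := RatFunc.algebraMap_ne_zero x.denom_ne_zero
    have h3 := RatFunc.num_div_denom x
    rw [div_eq_iff h2] at h3
    rw [map_mul, map_mul, map_mul, ← q_pow_eq, h3]
    linear_combination algebraMap (Polynomial ℂ) F x.denom * h
  have h2 := congrArg Polynomial.natTrailingDegree h1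
  rw [Polynomial.natTrailingDegree_mul (RatFunc.num_ne_zero hx) hD0,
    Polynomial.natTrailingDegree_mul x.denom_ne_zero (mul_ne_zero (pow_ne_zero n Polynomial.X_ne_zero) hN0),
    Polynomial.natTrailingDegree_mul (pow_ne_zero n Polynomial.X_ne_zero) hN0,
    Polynomial.natTrailingDegree_X_pow,
    Polynomial.natTrailingDegree_eq_zero.2 (Or.inr hN),
    Polynomial.natTrailingDegree_eq_zero.2 (Or.inr hD)] at h2
  rw [ordZero]
  omega

theorem poincare_eq_algebraMap : poincare m = algebraMap (Polynomial ℂ) F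
    ((Polynomial.X + 1) * ∑ i ∈ Finset.range m, Polynomial.X ^ i) := by
  have h := q_sub_one_ne_zero
  have h1 := poincare_eq m
  rw [map_mul, map_sum, map_add, map_one, RatFunc.algebraMap_X]
  simp only [← q_pow_eq]
  have h2 := geom_sum_mul q m
  refine mul_left_cancel₀ (pow_ne_zero 2 h) (h1.trans ?_)
  linear_combination -(q ^ 2 - 1) * h2

/-- With `e = ec m a`, the factor `1 - AHat m a / poincare m` equals `q (2 - e - e⁻¹) / ((q - e) (q
- e⁻¹))`. Here `2 - e - e⁻¹ ≠ 0` because `e ≠ 1`, and the denominator has the value `1` at `q = 0`.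
-/
theorem ordZero_poincare_mul_schurInv {a : ZMod m} (ha : a ≠ 0) {c : ℂ} (hc : c ≠ 0) :
    ordZero (poincare m * (schurInv m a * RatFunc.C c)) = 1 := by
  have hm : (m : F) ≠ 0 := Nat.cast_ne_zero.2 (NeZero.ne m)
  have hmC : (m : ℂ) ≠ 0 := Nat.cast_ne_zero.2 (NeZero.ne m)
  have h0 : ec m a * ec m (-a) = 1 := by rw [← AddChar.map_add_eq_mul]; simp
  have h0' : (RatFunc.C (ec m a) : F) * RatFunc.C (ec m (-a)) = 1 := by rw [← map_mul, h0, map_one]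
  have hz : 2 - ec m a - ec m (-a) ≠ 0 := fun h => by
    have h1 : (ec m a - 1) ^ 2 = 0 := by linear_combination -(ec m a) * h - h0
    have h2 := sub_eq_zero.1 (pow_eq_zero_iff two_ne_zero |>.1 h1)
    exact ha (ZMod.injective_stdAddChar (by rw [AddChar.map_zero_eq_one]; exact h2))
  have hcoef : ((Polynomial.X + 1) * ∑ i ∈ Finset.range m, Polynomial.X ^ i : Polynomial ℂ).coeff 0 = 1 := by
    rw [Polynomial.coeff_zero_eq_eval_zero, Polynomial.eval_mul, Polynomial.eval_geom_sum]
    obtain ⟨m', hm'⟩ : ∃ m', m = m' + 1 := ⟨m - 1, by have := NeZero.ne m; omega⟩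
    rw [hm', Finset.sum_range_succ']
    simp
  have := ordZero_of_mul_eq (n := 1) (x := poincare m * (schurInv m a * RatFunc.C c))
    (N := Polynomial.C ((2 - ec m a - ec m (-a)) * c) *
      ((Polynomial.X + 1) * ∑ i ∈ Finset.range m, Polynomial.X ^ i))
    (D := Polynomial.C (m : ℂ) *
      ((Polynomial.X - Polynomial.C (ec m a)) * (Polynomial.X - Polynomial.C (ec m (-a)))))
    (by rw [Polynomial.coeff_C_mul, hcoef, mul_one]; exact mul_ne_zero hz hc)
    (by
      rw [Polynomial.coeff_zero_eq_eval_zero]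
      simp only [Polynomial.eval_mul, Polynomial.eval_sub, Polynomial.eval_C, Polynomial.eval_X,
        zero_sub, neg_mul_neg, h0, mul_one]
      exact hmC)
    (by
      rw [map_mul (algebraMap (Polynomial ℂ) F) (Polynomial.C _) (_ * Finset.sum _ _),
        ← poincare_eq_algebraMap, schurInv]
      have hA := AHat_mul a
      have hP := poincare_ne_zero (m := m)
      simp only [map_mul, map_sub, RatFunc.algebraMap_C, RatFunc.algebraMap_X, map_natCast, map_ofNat]
      field_simp
      linear_combination RatFunc.C c * (-hA + poincare m * h0'))
  exact_mod_cast this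

/-! ## Generic degrees -/

section System

variable (L : ∀ χ : Irr m, HeckeLift m χ.1)

/-- The two single letters give equal coefficients to `χ_r` and `χ_r'`, and with the empty word to
`χ_0` and `ε`. Even words then express the Fourier transform of `foldCoeff x` by the coefficient of
`ε`. As `foldCoeff x` vanishes at `0`, this transform has sum zero, which kills that coefficient;
Fourier inversion does the rest. -/
theorem eq_zero_of_forall_sum_trace_eq_zero (hm : 2 ≤ m) {x : Irr m → F}
    (hx : ∀ l, IsReducedWord m l → ∑ χ, x χ * ((L χ).rep (heckeWord m l)).trace = 0) : x = 0 := by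
  have hE : ∀ k : ℕ, 2 * k ≤ m → x (irrChi m 1 0) * q ^ (2 * k) + x (irrSgn m) +
        q ^ k * ∑ a, foldCoeff x a * RatFunc.C (ec m (a * k)) = 0 := fun k hk => by
    rw [← sum_trace_even L hm]
    exact hx _ (isReducedWord_false hk)
  have hT := fun i => (sum_trace_single L hm x i).symm.trans (hx _ (isReducedWord_singleton i))
  have hT0 := hT false
  have hT1 := hT true
  simp only [Bool.false_eq_true, if_false, if_true] at hT0 hT1
  have hq1 : q + 1 ≠ 0 := by
    have := q_sub_C_ne_zero (-1)
    rwa [map_neg, map_one, sub_neg_eq_add] at this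
  have hhalf : Even m → x (irrChi m 1 (m / 2)) = x (irrChi m (-1) (m / 2)) := fun he => by
    rw [if_pos he] at hT0 hT1
    refine mul_left_cancel₀ hq1 ?_
    linear_combination hT0 - hT1
  have h0E : x (irrChi m 1 0) = x (irrSgn m) := by
    have h0 := hE 0 (Nat.zero_le _)
    have hfold : ∑ a, foldCoeff x a * RatFunc.C (ec m (a * (0 : ℕ))) =
        2 * ∑ j ∈ Finset.range ((m - 1) / 2), x (irrChi m 1 (j + 1)) +
          if Even m then x (irrChi m 1 (m / 2)) + x (irrChi m (-1) (m / 2)) else 0 := by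
      simp only [Nat.cast_zero, mul_zero, AddChar.map_zero_eq_one, map_one, mul_one]
      rw [sum_zmod_symm, foldCoeff, if_pos rfl, zero_add, Finset.mul_sum]
      congr 1
      · refine Finset.sum_congr rfl fun j hj => ?_
        have := Finset.mem_range.1 hj
        rw [(foldCoeff_natCast x (by omega) (by omega)).1,
          (foldCoeff_natCast x (by omega) (by omega)).2, two_mul]
      · split_ifs with he
        · rw [foldCoeff_half x he]
        · rfl
    rw [hfold, mul_zero, pow_zero, mul_one, one_mul] at h0
    refine mul_left_cancel₀ hq1 ?_
    by_cases he : Even m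
    · simp only [if_pos he] at hT0 hT1 h0
      linear_combination hT0 + hT1 - (q - 1) * h0
    · simp only [if_neg he] at hT0 hT1 h0
      linear_combination hT0 + hT1 - (q - 1) * h0
  have hfneg : ∀ a, foldCoeff x (-a) = foldCoeff x a := fun a => by
    by_cases ha : a = 0
    · rw [ha, neg_zero]
    · rw [foldCoeff, foldCoeff, if_neg ha, if_neg (neg_ne_zero.2 ha)]
      have hv := ZMod.val_lt a
      have hv0 : a.val ≠ 0 := (ZMod.val_ne_zero a).2 ha
      have h1 : (-a).val = m - a.val := by
        rw [ZMod.neg_val, if_neg ha]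
      rw [h1]
      by_cases h2 : 2 * a.val = m
      · rw [if_pos h2, if_pos (by omega)]
      · rw [if_neg h2, if_neg (by omega), min_comm]
        congr 3
        omega
  set Y : ZMod m → F := fun k => ∑ a, foldCoeff x a * RatFunc.C (ec m (a * k)) with hY
  have hYneg : ∀ k, Y (-k) = Y k := fun k => by
    simp only [hY]
    rw [← Equiv.sum_comp (Equiv.neg (ZMod m))]
    refine Finset.sum_congr rfl fun a _ => ?_
    rw [Equiv.neg_apply, hfneg, neg_mul_neg]
  have hYval : ∀ k : ZMod m, Y k * q ^ m = -(x (irrSgn m) *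
      (q ^ (m + min k.val (m - k.val)) + q ^ (m - min k.val (m - k.val)))) := fun k => by
    set κ := min k.val (m - k.val) with hκ
    have hv := ZMod.val_lt k
    have hκm : 2 * κ ≤ m := by omega
    have h1 : Y κ = Y k := by
      rcases le_total k.val (m - k.val) with h | h
      · rw [hκ, min_eq_left h, ZMod.natCast_zmod_val]
      · rw [hκ, min_eq_right h, Nat.cast_sub hv.le, ZMod.natCast_self, zero_sub, hYneg,
          ZMod.natCast_zmod_val]
    have h2 := hE κ hκm
    rw [h0E, show ∑ a, foldCoeff x a * RatFunc.C (ec m (a * κ)) = Y k from h1] at h2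
    have h3 : q ^ m = q ^ κ * q ^ (m - κ) := by rw [← pow_add]; congr 1; omega
    rw [pow_add, h3]
    have h4 : q ^ (2 * κ) = q ^ κ * q ^ κ := by rw [two_mul, pow_add]
    rw [h4] at h2
    linear_combination q ^ (m - κ) * h2
  have hYsum : ∑ k, Y k = 0 := by
    simp only [hY]
    rw [Finset.sum_comm]
    refine Finset.sum_eq_zero fun a _ => ?_
    rw [← Finset.mul_sum, ← map_sum, sum_ec]
    by_cases ha : a = 0
    · rw [ha, foldCoeff, if_pos rfl, zero_mul]
    · rw [if_neg ha, map_zero, mul_zero]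
  -- The factor of `x (irrSgn m)` in the vanishing sum is a polynomial with value `2 * m` at `q =
  -- 1`.
  have hsgn : x (irrSgn m) = 0 := by
    have h1 : x (irrSgn m) * ∑ k : ZMod m,
        (q ^ (m + min k.val (m - k.val)) + q ^ (m - min k.val (m - k.val))) = 0 := by
      rw [Finset.mul_sum, ← neg_eq_zero, ← Finset.sum_neg_distrib]
      simp only [← hYval]
      rw [← Finset.sum_mul, hYsum, zero_mul]
    refine (mul_eq_zero.1 h1).resolve_right fun h2 => ?_
    simp only [q_pow_eq, ← map_add, ← map_sum] at h2
    rw [map_eq_zero_iff _ (RatFunc.algebraMap_injective ℂ)] at h2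
    have h3 := congrArg (Polynomial.eval 1) h2
    simp [Polynomial.eval_finsetSum] at h3
    exact NeZero.ne m h3
  have hYz : ∀ k, Y k = 0 := fun k => by
    have := hYval k
    rw [hsgn, zero_mul, neg_zero] at this
    exact (mul_eq_zero.1 this).resolve_right (pow_ne_zero m q_ne_zero)
  have hfz : ∀ a, foldCoeff x a = 0 := fun b => by
    have h1 : ∑ k, Y k * RatFunc.C (ec m (-b * k)) = m * foldCoeff x b := by
      simp only [hY, Finset.sum_mul]
      rw [Finset.sum_comm, Finset.sum_eq_single b]
      · have : ∀ k, foldCoeff x b * RatFunc.C (ec m (b * k)) * RatFunc.C (ec m (-b * k)) =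
            foldCoeff x b := fun k => by
          rw [mul_assoc, ← map_mul, ← AddChar.map_add_eq_mul, neg_mul, add_neg_cancel,
            AddChar.map_zero_eq_one, map_one, mul_one]
        simp only [this]
        simp
      · intro a _ ha
        have : ∀ k, foldCoeff x a * RatFunc.C (ec m (a * k)) * RatFunc.C (ec m (-b * k)) =
            foldCoeff x a * RatFunc.C (ec m ((a - b) * k)) := fun k => by
          rw [mul_assoc, ← map_mul, ← AddChar.map_add_eq_mul]
          congr 4
          ring
        simp only [this]
        rw [← Finset.mul_sum, ← map_sum, sum_ec, if_neg (sub_ne_zero.2 ha), map_zero, mul_zero]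
      · simp
    simp only [hYz, zero_mul, Finset.sum_const_zero] at h1
    exact (mul_eq_zero.1 h1.symm).resolve_left (Nat.cast_ne_zero.2 (NeZero.ne m))
  have hr : ∀ r, 2 * r = m → x (irrChi m 1 r) = 0 ∧ x (irrChi m (-1) r) = 0 := fun r hr => by
    have he : Even m := ⟨r, by omega⟩
    have h1 := foldCoeff_half x he
    rw [hfz, ← hhalf he, ← two_mul] at h1
    have h2 := (mul_eq_zero.1 h1.symm).resolve_left two_ne_zero
    have h3 := hhalf he
    rw [h2] at h3
    rw [show r = m / 2 by omega]
    exact ⟨h2, h3.symm⟩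
  funext χ
  rcases irr_cases 1 χ with ⟨i, hi, rfl⟩ | ⟨r, hr', rfl | rfl⟩ | rfl
  · rcases eq_or_ne i 0 with rfl | hi0
    · exact h0E.trans hsgn
    · rw [← (foldCoeff_natCast x hi0 hi).1, hfz]; rfl
  · exact (hr r hr').1
  · exact (hr r hr').2
  · exact hsgn

/-- The inverse of the Schur element of `χ`. -/
def schurInvIrr (χ : Irr m) : F :=
  if χ = irrSgn m then q ^ m / poincare m
  else if bInv m χ = 0 then (poincare m)⁻¹
  else schurInv m ((bInv m χ).toNat : ZMod m) * RatFunc.C (if 2 * bInv m χ = m then 1 / 2 else 1)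

theorem schurInvIrr_irrChi (s : ℤˣ) {i : ℕ} (hi0 : i ≠ 0) (hi : 2 * i ≤ m) :
    schurInvIrr (irrChi m s i) = schurInv m i * RatFunc.C (if 2 * i = m then 1 / 2 else 1) := by
  rw [schurInvIrr, if_neg (irrChi_ne_irrSgn s hi), bInv_irrChi s hi, if_neg (by exact_mod_cast hi0),
    Int.toNat_natCast]
  norm_cast

theorem foldCoeff_schurInvIrr (a : ZMod m) : foldCoeff schurInvIrr a = schurInv m a := by
  by_cases ha : a = 0
  · rw [foldCoeff, if_pos ha, ha, schurInv_zero]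
  · obtain ⟨j, hj, h⟩ := natCast_or_neg a
    have hj0 : j ≠ 0 := by
      rintro rfl
      rw [Nat.cast_zero, neg_zero, or_self] at h
      exact ha h
    have h1 : schurInv m a = schurInv m j := by
      rcases h with rfl | rfl
      · rfl
      · exact schurInv_neg _
    rw [h1]
    rcases hj.lt_or_eq with hj | hj
    · have h2 : foldCoeff schurInvIrr a = schurInvIrr (irrChi m 1 j) := by
        rcases h with rfl | rfl
        · exact (foldCoeff_natCast _ hj0 hj).1
        · exact (foldCoeff_natCast _ hj0 hj).2
      rw [h2, schurInvIrr_irrChi 1 hj0 hj.le, if_neg hj.ne, map_one, mul_one]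
    · have hneg : -(j : ZMod m) = j := by
        linear_combination -natCast_add_self hj
      rw [hneg, or_self] at h
      have he : Even m := ⟨j, by omega⟩
      have hj' : m / 2 = j := by omega
      have h2 := foldCoeff_half (m := m) schurInvIrr he
      rw [hj'] at h2
      rw [h, h2, schurInvIrr_irrChi 1 hj0 hj.le, schurInvIrr_irrChi (-1) hj0 hj.le, if_pos hj,
        ← mul_add, ← map_add]
      norm_num

theorem schurInvIrr_triv : schurInvIrr (irrChi m 1 0) = (poincare m)⁻¹ := by
  rw [schurInvIrr, if_neg (irrChi_ne_irrSgn 1 (Nat.zero_le _)), bInv_irrChi 1 (Nat.zero_le _), if_pos (by simp)]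

theorem schurInvIrr_sgn : schurInvIrr (irrSgn m) = q ^ m / poincare m := by
  rw [schurInvIrr, if_pos rfl]

/-- The contribution `(q ^ (2 * k) + q ^ m) / poincare m` of `χ_0` and `ε` cancels the term `AZ m k`
of `sum_schurInv`. -/
theorem sum_schurInvIrr_even (hm : 2 ≤ m) {k : ℕ} (hk : 2 * k ≤ m) :
    ∑ χ, schurInvIrr χ * ((L χ).rep (heckeWord m (altWord false (2 * k)))).trace =
      if k = 0 then 1 else 0 := by
  rw [sum_trace_even L hm, schurInvIrr_triv, schurInvIrr_sgn]
  simp only [foldCoeff_schurInvIrr]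
  rw [sum_schurInv, AZ_natCast (by omega)]
  simp only [natCast_eq_zero_iff_of_lt (m := m) (j := k) (by omega)]
  have h3 : q ^ m = q ^ k * q ^ (m - k) := by rw [← pow_add]; congr 1; omega
  have h4 : q ^ (2 * k) = q ^ k * q ^ k := by rw [two_mul, pow_add]
  have hP := poincare_ne_zero (m := m)
  rw [h3, h4]
  split_ifs with h0
  · rw [h0]; field_simp; ring
  · field_simp; ring

/-- The sum of the coefficients of the remaining characters is already known from the empty word,
and the coefficients of `χ_r` and `χ_r'` agree. -/
theorem sum_schurInvIrr_single (hm : 2 ≤ m) (i : Bool) :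
    ∑ χ, schurInvIrr χ * ((L χ).rep (heckeWord m [i])).trace = 0 := by
  have h0 := sum_schurInvIrr_even L hm (k := 0) (Nat.zero_le _)
  rw [if_pos rfl, sum_trace_even L hm, schurInvIrr_triv, schurInvIrr_sgn] at h0
  simp only [Nat.cast_zero, mul_zero, AddChar.map_zero_eq_one, map_one, mul_one, pow_zero, one_mul] at h0
  rw [sum_zmod_symm, foldCoeff_schurInvIrr, schurInv_zero, zero_add] at h0
  rw [sum_trace_single L hm, schurInvIrr_triv, schurInvIrr_sgn]
  have h1 : ∑ j ∈ Finset.range ((m - 1) / 2), (foldCoeff schurInvIrr ((j + 1 : ℕ) : ZMod m) +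
      foldCoeff schurInvIrr (-((j + 1 : ℕ) : ZMod m))) =
      2 * ∑ j ∈ Finset.range ((m - 1) / 2), schurInvIrr (irrChi m 1 (j + 1)) := by
    rw [Finset.mul_sum]
    refine Finset.sum_congr rfl fun j hj => ?_
    have := Finset.mem_range.1 hj
    rw [(foldCoeff_natCast _ (by omega) (by omega)).1,
      (foldCoeff_natCast _ (by omega) (by omega)).2, two_mul]
  rw [h1] at h0
  have hP := poincare_ne_zero (m := m)
  have h2 : (q + 1) * (1 - q ^ m) + (q - 1) * poincare m = 0 := by
    refine mul_left_cancel₀ q_sub_one_ne_zero ?_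
    linear_combination poincare_eq m
  have h3 : (q + 1) * ((poincare m)⁻¹ - q ^ m / poincare m) + (q - 1) = 0 := by
    field_simp
    linear_combination h2
  refine mul_left_cancel₀ (two_ne_zero (α := F)) ?_
  by_cases he : Even m
  · have h2' : 2 * (m / 2) = m := Nat.two_mul_div_two_of_even he
    have hh := fun s => schurInvIrr_irrChi s (i := m / 2) (by omega) h2'.le
    rw [if_pos he, foldCoeff_half _ he] at h0
    rw [if_pos he]
    rw [hh, hh] at h0 ⊢
    cases i
    · simp only [Bool.false_eq_true, if_false]
      linear_combination h3 + (q - 1) * h0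
    · simp only [if_true]
      linear_combination h3 + (q - 1) * h0
  · rw [if_neg he] at h0 ⊢
    linear_combination h3 + (q - 1) * h0

theorem sum_schurInvIrr_altWord (hm : 2 ≤ m) (n : ℕ) (hn : n ≤ m) (i : Bool) :
    ∑ χ, schurInvIrr χ * ((L χ).rep (heckeWord m (altWord i n))).trace = if n = 0 then 1 else 0 := by
  have heven : ∀ k i, 2 * k ≤ m →
      ∑ χ, schurInvIrr χ * ((L χ).rep (heckeWord m (altWord i (2 * k)))).trace =
        if k = 0 then 1 else 0 := fun k i hk => by
    rw [← sum_schurInvIrr_even L hm hk]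
    cases i
    · rfl
    · simp only [trace_heckeWord_true]
  rcases Nat.even_or_odd' n with ⟨k, rfl | rfl⟩
  · rw [heven k i hn]
    simp
  · rw [if_neg (by omega)]
    induction k generalizing i with
    | zero => exact sum_schurInvIrr_single L hm i
    | succ k ih =>
      have h1 := heven (k + 1) i (by omega)
      rw [if_neg (by omega)] at h1
      have h2 := ih (!i) (by omega)
      have h3 : ∀ χ : Irr m, schurInvIrr χ * ((L χ).rep (heckeWord m (altWord i (2 * (k + 1) + 1)))).trace =
          (q - 1) * (schurInvIrr χ * ((L χ).rep (heckeWord m (altWord i (2 * (k + 1))))).trace) +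
          q * (schurInvIrr χ * ((L χ).rep (heckeWord m (altWord (!i) (2 * k + 1)))).trace) := fun χ => by
        rw [show 2 * (k + 1) + 1 = 2 * k + 3 by ring, show 2 * (k + 1) = 2 * k + 2 by ring,
          trace_heckeWord_odd]
        ring
      simp only [h3, Finset.sum_add_distrib, ← Finset.mul_sum, h1, h2, mul_zero, add_zero]

theorem isGenericDegrees_iff (hm : 2 ≤ m) (D : Irr m → F) :
    IsGenericDegrees m L D ↔ D = fun χ => poincare m * schurInvIrr χ := by
  have hP := poincare_ne_zero (m := m)
  have hex : ∀ l, IsReducedWord m l →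
      ∑ χ, schurInvIrr χ * ((L χ).rep (heckeWord m l)).trace = if l = [] then 1 else 0 := fun l hl => by
    obtain ⟨i, n, hn, rfl⟩ := hl.exists_eq
    rw [sum_schurInvIrr_altWord L hm n hn i]
    cases n <;> simp [altWord]
  constructor
  · intro h
    have h1 := eq_zero_of_forall_sum_trace_eq_zero L hm
      (x := fun χ => D χ / poincare m - schurInvIrr χ) fun l hl => by
        simp only [sub_mul, Finset.sum_sub_distrib]
        rw [hex l hl, sub_eq_zero]
        exact h l hl
    funext χ
    have h2 := sub_eq_zero.1 (congrFun h1 χ)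
    rw [← h2]
    field_simp
  · rintro rfl l hl
    rw [← hex l hl]
    refine Finset.sum_congr rfl fun χ _ => ?_
    rw [mul_div_cancel_left₀ _ hP]

end System

/-- The one-dimensional representation that corresponds to `χ_r` or `χ_r'`. -/
def halfLift (hm : 2 ≤ m) (s : ℤˣ) {r : ℕ} (hr : 2 * r = m) : HeckeLift m (chiHom s hr) :=
  linLift (fun i => s = if i then -1 else 1) (fun ho => absurd ho (Nat.not_odd_iff_even.2 ⟨r, by omega⟩))
    (chiHom s hr) fun i => by
      refine (chi_half_simpleRefl hm s hr i).trans ?_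
      rcases Int.units_eq_one_or s with rfl | rfl <;> cases i <;> simp

theorem halfLift_rep (hm : 2 ≤ m) (s : ℤˣ) {r : ℕ} (hr : 2 * r = m) (i : Bool) :
    (halfLift hm s hr).rep (heckeT m i) =
      (!![linVal (s = if i then -1 else 1)] : Matrix (Fin 1) (Fin 1) (Polynomial ℂ)).map
        (algebraMap (Polynomial ℂ) F) := linLift_rep i

theorem nonempty_heckeLift (hm : 2 ≤ m) (χ : Irr m) : Nonempty (HeckeLift m χ.1) := by
  rcases irr_cases 1 χ with ⟨i, hi, rfl⟩ | ⟨r, hr, rfl | rfl⟩ | rfl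
  · rw [irrChi_val hi.le]
    rcases eq_or_ne i 0 with rfl | hi0
    · rw [chi_zero]
      exact ⟨linLift (fun _ => true) (fun _ => rfl) 1 (by simp)⟩
    · refine ⟨twoLift hm (i : ZMod m) (fun h => ?_) fun g => ?_⟩
      · exact natCast_ne_neg hi0 hi (ZMod.injective_stdAddChar h)
      · rcases g with k | k
        · rw [(chi_two hi0 hi.ne).1, rho_r, Matrix.trace_fin_two_of]
        · rw [(chi_two hi0 hi.ne).2, rho_sr, Matrix.trace_fin_two_of, add_zero]
  · rw [irrChi_val hr.le]; exact ⟨halfLift hm 1 hr⟩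
  · rw [irrChi_val hr.le]; exact ⟨halfLift hm (-1) hr⟩
  · exact ⟨linLift (fun _ => false) (fun _ => rfl) sgnHom fun i => by
      rw [if_neg (by simp)]; exact sgn_simpleRefl i⟩

theorem isSpecial_iff_ordZero (hm : 2 ≤ m) (χ : Irr m) :
    IsSpecial m χ ↔ ordZero (poincare m * schurInvIrr χ) = bInv m χ := by
  constructor
  · rintro ⟨L, D, hD, h⟩
    rwa [(isGenericDegrees_iff L hm D).1 hD] at h
  · intro h
    refine ⟨fun χ => (nonempty_heckeLift hm χ).some, _, (isGenericDegrees_iff _ hm _).2 rfl, h⟩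

/-- The special characters are the trivial, the sign and the reflection character. -/
theorem isSpecial_iff (hm : 3 ≤ m) (s : ℤˣ) (χ : Irr m) : IsSpecial m χ ↔
    χ = irrChi m s 0 ∨ χ = irrChi m s 1 ∨ χ = irrSgn m := by
  rw [isSpecial_iff_ordZero (by omega)]
  have hP := poincare_ne_zero (m := m)
  -- For positive index the generic degree vanishes to order one, so only the `b`-invariant `1`
  -- matches.
  have key : ∀ s' i, 2 * i ≤ m → (ordZero (poincare m * schurInvIrr (irrChi m s' i)) =
      bInv m (irrChi m s' i) ↔ i ≤ 1) := fun s' i hi => by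
    rw [bInv_irrChi s' hi]
    rcases eq_or_ne i 0 with rfl | hi0
    · rw [irrChi_sign 1 (by omega), schurInvIrr_triv, mul_inv_cancel₀ hP, ← pow_zero q, ordZero_q_pow]
      simp
    · rw [schurInvIrr_irrChi s' hi0 hi, ordZero_poincare_mul_schurInv
        (by rwa [Ne, natCast_eq_zero_iff_of_lt (by omega)]) (by split_ifs <;> norm_num)]
      omega
  rcases irr_cases' χ with ⟨s', i, hi, rfl⟩ | rfl
  · rw [key s' i hi]
    constructor
    · intro h
      interval_cases i
      · exact Or.inl (irrChi_sign _ (by omega))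
      · exact Or.inr (Or.inl (irrChi_sign _ (by omega)))
    · rintro (h | h | h)
      · exact (irrChi_inj hi (by omega) h).le.trans zero_le_one
      · exact (irrChi_inj hi (by omega) h).le
      · exact absurd h (irrChi_ne_irrSgn s' hi)
  · rw [schurInvIrr_sgn, mul_div_cancel₀ _ hP, ordZero_q_pow, bInv_irrSgn]
    simp

end

section

variable {m : ℕ} [NeZero m]

/-! ## The idempotent of the sign character -/

section SignSum

variable {A : Type*} [Ring A] [Algebra F A]

/-- The sum of `(-q)^(-l(w)) T_w` over `w`. -/
def signSum (m : ℕ) (T : Bool → A) : A :=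
  ∑ n ∈ Finset.range m, (-q⁻¹) ^ n • ((altWord true n).map T).prod +
    ∑ n ∈ Finset.range m, (-q⁻¹) ^ (n + 1) • ((altWord false (n + 1)).map T).prod

theorem signSum_eq (T : Bool → A) : signSum m T =
    ∑ n ∈ Finset.range m, (-q⁻¹) ^ n •
      (((altWord true n).map T).prod + ((altWord false n).map T).prod) +
    ((-q⁻¹) ^ m • ((altWord false m).map T).prod - 1) := by
  have h := Finset.sum_range_succ (fun n => (-q⁻¹) ^ n • ((altWord false n).map T).prod) m
  rw [Finset.sum_range_succ'] at h
  have h0 : (-q⁻¹) ^ 0 • ((altWord false 0).map T).prod = 1 := by simp [altWord]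
  rw [h0] at h
  rw [signSum, eq_sub_of_add_eq h]
  simp only [smul_add, Finset.sum_add_distrib]
  abel

/-- The definition writes the longest element with one of its two reduced words; the braid relation
restores the symmetry. -/
theorem signSum_swap (T : Bool → A)
    (hb : ((altWord false m).map T).prod = ((altWord true m).map T).prod) :
    signSum m (fun i => T (!i)) = signSum m T := by
  have h1 : ∀ i n, (altWord i n).map (fun i => T (!i)) = (altWord (!i) n).map T := fun i n => by
    induction n generalizing i with
    | zero => rfl
    | succ n ih => rw [altWord, altWord, List.map_cons, List.map_cons, ih]
  rw [signSum_eq, signSum_eq]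
  simp only [h1, Bool.not_true, Bool.not_false]
  rw [hb]
  congr 1
  exact Finset.sum_congr rfl fun n _ => by rw [add_comm]

/-- The elements of the group are paired by left multiplication with the generator. Each pair of
summands is an eigenvector for `-1` by the quadratic relation. -/
theorem mul_signSum_false (T : Bool → A) (hT : T false * T false = (q - 1) • T false + q • (1 : A)) :
    T false * signSum m T = -signSum m T := by
  have hq := q_ne_zero
  rw [signSum, mul_add, Finset.mul_sum, Finset.mul_sum, ← Finset.sum_add_distrib,
    ← Finset.sum_add_distrib, ← Finset.sum_neg_distrib]
  refine Finset.sum_congr rfl fun n _ => ?_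
  have h1 : ((altWord false (n + 1)).map T).prod = T false * ((altWord true n).map T).prod := by
    rw [altWord, List.map_cons, List.prod_cons, Bool.not_false]
  rw [h1, mul_smul_comm, mul_smul_comm, ← mul_assoc, hT, add_mul, smul_mul_assoc, smul_mul_assoc, one_mul]
  set B := ((altWord true n).map T).prod
  have e1 : (-q⁻¹) ^ (n + 1) * q = -(-q⁻¹) ^ n := by
    rw [pow_succ]
    field_simp
  have e2 : (-q⁻¹) ^ n + (-q⁻¹) ^ (n + 1) * (q - 1) = -(-q⁻¹) ^ (n + 1) := by
    linear_combination e1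
  rw [smul_add, smul_smul, smul_smul, e1, ← add_assoc, ← add_smul, e2, neg_smul, neg_smul]
  abel

theorem mul_signSum (T : Bool → A) (hT : ∀ i, T i * T i = (q - 1) • T i + q • (1 : A))
    (hb : ((altWord false m).map T).prod = ((altWord true m).map T).prod) (i : Bool) :
    T i * signSum m T = -signSum m T := by
  cases i
  · exact mul_signSum_false T (hT false)
  · have := mul_signSum_false (m := m) (fun i => T (!i)) (hT true)
    rwa [signSum_swap T hb] at this

/-- Reversal of words preserves `signSum`: alternating words of odd length are palindromes, and
those of even length are exchanged in pairs. This reduces right multiplication to left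
multiplication in the opposite algebra. -/
theorem signSum_op (T : Bool → A)
    (hb : ((altWord false m).map T).prod = ((altWord true m).map T).prod) :
    signSum m (fun i => MulOpposite.op (T i)) = MulOpposite.op (signSum m T) ∧
    ((altWord false m).map fun i => MulOpposite.op (T i)).prod =
      ((altWord true m).map fun i => MulOpposite.op (T i)).prod := by
  have h1 : ∀ n, (∀ i, ((altWord i n).map fun i => MulOpposite.op (T i)).prod =
      MulOpposite.op ((altWord i n).map T).prod) ∨
      (∀ i, ((altWord i n).map fun i => MulOpposite.op (T i)).prod =
      MulOpposite.op ((altWord (!i) n).map T).prod) := fun n => by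
    rcases Nat.even_or_odd' n with ⟨k, rfl | rfl⟩
    · right
      intro i
      rw [altWord_even, altWord_even, Bool.not_not, MulOpposite.op_pow, MulOpposite.op_mul]
    · left
      intro i
      rw [altWord_odd, altWord_odd, mul_pow_mul, MulOpposite.op_mul, MulOpposite.op_pow,
        MulOpposite.op_mul]
  constructor
  · rw [signSum_eq, signSum_eq, MulOpposite.op_add, MulOpposite.op_sub, MulOpposite.op_smul,
      MulOpposite.op_one, Finset.op_sum]
    congr 1
    · refine Finset.sum_congr rfl fun n _ => ?_
      rw [MulOpposite.op_smul, MulOpposite.op_add]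
      rcases h1 n with h | h
      · rw [h, h]
      · rw [h, h, Bool.not_true, Bool.not_false, add_comm]
    · rcases h1 m with h | h
      · rw [h]
      · rw [h, Bool.not_false, hb]
  · rcases h1 m with h | h <;> rw [h, h]
    · rw [hb]
    · rw [Bool.not_false, Bool.not_true, hb]

theorem signSum_mul (T : Bool → A) (hT : ∀ i, T i * T i = (q - 1) • T i + q • (1 : A))
    (hb : ((altWord false m).map T).prod = ((altWord true m).map T).prod) (i : Bool) :
    signSum m T * T i = -signSum m T := by
  have h := signSum_op T hb
  have := mul_signSum (m := m) (fun i => MulOpposite.op (T i)) (fun i => by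
    rw [← MulOpposite.op_mul, hT, MulOpposite.op_add, MulOpposite.op_smul, MulOpposite.op_smul,
      MulOpposite.op_one]) h.2 i
  rw [h.1, ← MulOpposite.op_mul, ← MulOpposite.op_neg] at this
  exact MulOpposite.op_injective this

/-- The value of the sign representation on `signSum`. -/
def signScalar (m : ℕ) : F := ∑ n ∈ Finset.range m, q⁻¹ ^ n + ∑ n ∈ Finset.range m, q⁻¹ ^ (n + 1)

theorem signScalar_mul : signScalar m * q ^ m = poincare m := by
  have hq := q_ne_zero
  have hm := Nat.pos_of_neZero m
  rw [poincare_eq_algebraMap, map_mul, map_sum, map_add, map_one, RatFunc.algebraMap_X]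
  simp only [← q_pow_eq]
  have h1 : (∑ n ∈ Finset.range m, q⁻¹ ^ n) * q ^ m = q * ∑ n ∈ Finset.range m, q ^ n := by
    rw [← Finset.sum_range_reflect, Finset.sum_mul, Finset.mul_sum]
    refine Finset.sum_congr rfl fun n hn => ?_
    have := Finset.mem_range.1 hn
    rw [show q ^ m = q ^ (m - 1 - n) * (q * q ^ n) by
      rw [← pow_succ', ← pow_add]; congr 1; omega, ← mul_assoc, ← mul_pow, inv_mul_cancel₀ hq, one_pow, one_mul]
  have h2 : ∑ n ∈ Finset.range m, q⁻¹ ^ (n + 1) = q⁻¹ * ∑ n ∈ Finset.range m, q⁻¹ ^ n := by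
    rw [Finset.mul_sum]
    exact Finset.sum_congr rfl fun n _ => pow_succ' _ _
  rw [signScalar, h2, add_mul, mul_assoc, h1, ← mul_assoc, inv_mul_cancel₀ hq]
  ring

theorem signScalar_ne_zero : signScalar m ≠ 0 := fun h => by
  have := signScalar_mul (m := m)
  rw [h, zero_mul] at this
  exact poincare_ne_zero this.symm

/-- If every word of length `n` acts by `(-1)^n` on `y`, then `signSum` acts by `signScalar`. -/
theorem signSum_smul {M : Type*} [AddCommGroup M] [Module F M] [Module A M] [IsScalarTower F A M]
    (T : Bool → A) (y : M) (hy : ∀ i, T i • y = -y) : signSum m T • y = signScalar m • y := by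
  have h1 : ∀ l : List Bool, (l.map T).prod • y = (-1 : F) ^ l.length • y := fun l => by
    induction l with
    | nil => simp
    | cons i l ih =>
      rw [List.map_cons, List.prod_cons, mul_smul, ih, List.length_cons, pow_succ, mul_neg_one, neg_smul,
        ← algebraMap_smul A ((-1 : F) ^ l.length), ← mul_smul, ← Algebra.commutes, mul_smul, hy, smul_neg]
  rw [signSum, signScalar, add_smul, add_smul, Finset.sum_smul, Finset.sum_smul, Finset.sum_smul,
    Finset.sum_smul]
  have e : ∀ n, (-q⁻¹) ^ n * (-1) ^ n = q⁻¹ ^ n := fun n => by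
    rw [← mul_pow, neg_mul_neg, mul_one]
  congr 1 <;>
  · refine Finset.sum_congr rfl fun n _ => ?_
    rw [smul_assoc, h1, altWord_length, smul_smul, e]

end SignSum

theorem hecke_induction {p : Hecke m → Prop} (hC : ∀ c : F, p (algebraMap F _ c))
    (hT : ∀ i, p (heckeT m i)) (hadd : ∀ x y, p x → p y → p (x + y))
    (hmul : ∀ x y, p x → p y → p (x * y)) (x : Hecke m) : p x := by
  obtain ⟨y, rfl⟩ := RingQuot.mkAlgHom_surjective F (HeckeRel m) x
  induction y using FreeAlgebra.induction with
  | grade0 c => rw [AlgHom.commutes]; exact hC c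
  | grade1 i => exact hT i
  | mul a b ha hb => rw [map_mul]; exact hmul _ _ ha hb
  | add a b ha hb => rw [map_add]; exact hadd _ _ ha hb

theorem heckeT_mul_signSum (i : Bool) :
    heckeT m i * signSum m (heckeT m) = -signSum m (heckeT m) :=
  mul_signSum _ heckeT_mul_self (heckeWord_braid m) i

theorem signSum_mul_heckeT (i : Bool) :
    signSum m (heckeT m) * heckeT m i = -signSum m (heckeT m) :=
  signSum_mul _ heckeT_mul_self (heckeWord_braid m) i

theorem commute_signSum (x : Hecke m) : Commute (signSum m (heckeT m)) x := by
  refine hecke_induction (p := Commute (signSum m (heckeT m))) (fun c => Algebra.commute_algebraMap_right _ _)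
    (fun i => ?_) (fun _ _ => Commute.add_right) (fun _ _ => Commute.mul_right) x
  rw [Commute, SemiconjBy, heckeT_mul_signSum, signSum_mul_heckeT]

/-- The vectors on which both generators act by `-1` form a submodule that contains the image of
`signSum`; by irreducibility it is everything. -/
theorem HeckeLift.rep_signSum {χ : DihedralGroup m → ℂ} (L : HeckeLift m χ)
    (h : L.rep (signSum m (heckeT m)) ≠ 0) (i : Bool) : L.rep (heckeT m i) = -1 := by
  let U : Submodule F (Fin L.n → F) :=
    { carrier := {v | ∀ i, (L.rep (heckeT m i)).mulVec v = -v}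
      add_mem' := fun {a b} ha hb i => by rw [Matrix.mulVec_add, ha, hb, neg_add]
      zero_mem' := fun i => by rw [Matrix.mulVec_zero, neg_zero]
      smul_mem' := fun c v hv i => by rw [Matrix.mulVec_smul, hv, smul_neg] }
  have hU : ∀ h : Hecke m, ∀ u ∈ U, (L.rep h).mulVec u ∈ U := by
    refine hecke_induction (p := fun h => ∀ u ∈ U, (L.rep h).mulVec u ∈ U) (fun c u hu => ?_)
      (fun i u hu => ?_) (fun x y hx hy u hu => ?_) (fun x y hx hy u hu => ?_)
    · rw [AlgHom.commutes, Algebra.algebraMap_eq_smul_one, Matrix.smul_mulVec, Matrix.one_mulVec]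
      exact U.smul_mem c hu
    · rw [hu i]; exact U.neg_mem hu
    · rw [map_add, Matrix.add_mulVec]; exact U.add_mem (hx u hu) (hy u hu)
    · rw [map_mul, ← Matrix.mulVec_mulVec]; exact hx _ (hy u hu)
  have hmem : ∀ v, (L.rep (signSum m (heckeT m))).mulVec v ∈ U := fun v i => by
    rw [Matrix.mulVec_mulVec, ← map_mul, heckeT_mul_signSum, map_neg, Matrix.neg_mulVec]
  rcases L.irreducible U hU with h1 | h1
  · refine absurd (Matrix.ext_of_mulVec_single fun j => ?_) h
    have h2 := hmem (Pi.single j 1)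
    rw [h1, Submodule.mem_bot] at h2
    rw [h2, Matrix.zero_mulVec]
  · refine Matrix.ext_of_mulVec_single fun j => ?_
    have h2 : Pi.single j 1 ∈ U := by rw [h1]; trivial
    rw [h2 i, Matrix.neg_mulVec, Matrix.one_mulVec]

theorem exists_wordProd_eq (g : DihedralGroup m) : ∃ l, wordProd m l = g := by
  rcases g with k | k
  · exact ⟨altWord false (2 * k.val), by rw [wordProd_false, ZMod.natCast_zmod_val]⟩
  · refine ⟨false :: altWord false (2 * k.val), ?_⟩
    rw [wordProd_cons, wordProd_false, ZMod.natCast_zmod_val]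
    simp [simpleRefl]

theorem eq_sgn_of_rep_signSum_ne_zero {χ : Irr m} (L : HeckeLift m χ.1)
    (h : L.rep (signSum m (heckeT m)) ≠ 0) : χ = irrSgn m := by
  have h1 := L.rep_signSum h
  have h2 : ∀ l : List Bool, L.rep (heckeWord m l) = (-1 : F) ^ l.length • 1 := fun l => by
    rw [map_heckeWord]
    have : (fun i => L.rep (heckeT m i)) = fun _ => -1 := funext h1
    rw [this, List.map_const', List.prod_replicate]
    rcases Nat.even_or_odd l.length with h | h <;> simp [h.neg_one_pow]
  have h3 : ∀ g, χ.1 g = L.n * sgn m g := fun g => by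
    obtain ⟨l, rfl⟩ := exists_wordProd_eq g
    have h4 := L.specializes l
    rw [h2, Matrix.trace_smul, Matrix.trace_one, Fintype.card_fin, smul_eq_mul,
      show ((-1 : F) ^ l.length * (L.n : F)) = algebraMap (Polynomial ℂ) F ((-1) ^ l.length * (L.n : Polynomial ℂ))
        by simp] at h4
    have h5 := evalOne_algebraMap ((-1) ^ l.length * (L.n : Polynomial ℂ))
    rw [evalOne, h4] at h5
    rw [sgn_wordProd]
    refine h5.trans ?_
    simp [mul_comm]
  by_contra hne
  have h4 := sum_mul_inv_eq_zero χ.2 (irrSgn m).2 fun h => hne (Subtype.ext h)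
  have h5 : ∀ g : DihedralGroup m, χ.1 g * (irrSgn m).1 g⁻¹ = L.n := fun g => by
    rw [h3, show (irrSgn m).1 = sgn m from rfl, mul_assoc, ← sgn_mul, mul_inv_cancel, DihedralGroup.one_def]
    simp [sgn]
  simp only [h5, Finset.sum_const, Finset.card_univ, nsmul_eq_mul, mul_eq_zero, Nat.cast_eq_zero] at h4
  rcases h4 with h4 | h4
  · exact Fintype.card_ne_zero h4
  · exact L.pos.ne' h4

theorem rep_signSum_sgn (L : HeckeLift m (sgn m)) :
    L.rep (signSum m (heckeT m)) = algebraMap F _ (signScalar m) := by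
  have hn : L.n = 1 := by
    have h1 := L.n_eq
    rw [DihedralGroup.one_def, sgn] at h1
    exact_mod_cast h1
  have hT : ∀ i, L.rep (heckeT m i) = -1 := fun i => by
    rw [(L.rep_of_n_eq_one hn i).1, linEig, sgn_simpleRefl, if_neg (by norm_num), map_neg, map_one]
  have h1 : L.rep (signSum m (heckeT m)) = signSum m (fun i => L.rep (heckeT m i)) := by
    simp only [signSum, map_add, map_sum, map_smul, map_list_prod, List.map_map]
    rfl
  have h2 := signSum_smul (m := m) (fun i => L.rep (heckeT m i)) (1 : Matrix (Fin L.n) (Fin L.n) F)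
    fun i => by rw [hT, smul_eq_mul, mul_one]
  rw [h1, Algebra.algebraMap_eq_smul_one, ← h2, smul_eq_mul, mul_one]

theorem algebraMap_mem_heckeOrder {x : F} (hx : x ∈ rouquierRing m) :
    algebraMap F (Hecke m) x ∈ heckeOrder m :=
  Subring.subset_closure (Or.inl ⟨x, hx, rfl⟩)

theorem heckeT_mem_heckeOrder (i : Bool) : heckeT m i ∈ heckeOrder m :=
  Subring.subset_closure (Or.inr ⟨i, rfl⟩)

theorem q_mem_rouquierRing : q ∈ rouquierRing m := Subring.subset_closure (Or.inl (Or.inr (Or.inl rfl)))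

theorem q_inv_mem_rouquierRing : q⁻¹ ∈ rouquierRing m :=
  Subring.subset_closure (Or.inl (Or.inr (Or.inr rfl)))

theorem signSum_mem_heckeOrder : signSum m (heckeT m) ∈ heckeOrder m := by
  have h1 : ∀ (n : ℕ) (l : List Bool), (-q⁻¹) ^ n • (l.map (heckeT m)).prod ∈ heckeOrder m := fun n l => by
    rw [Algebra.smul_def]
    refine mul_mem (algebraMap_mem_heckeOrder (pow_mem (neg_mem q_inv_mem_rouquierRing) n))
      (list_prod_mem fun x hx => ?_)
    obtain ⟨i, -, rfl⟩ := List.mem_map.1 hx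
    exact heckeT_mem_heckeOrder i
  exact add_mem (sum_mem fun n _ => h1 _ _) (sum_mem fun n _ => h1 _ _)

/-- The inverse is `q ^ m (q - 1) ^ 2 / ((q ^ 2 - 1) (q ^ m - 1))`, and the Rouquier ring inverts
precisely factors like those in the denominator. -/
theorem signScalar_inv_mem : (signScalar m)⁻¹ ∈ rouquierRing m := by
  have hm := NeZero.ne m
  have hP := poincare_ne_zero (m := m)
  have hS := signScalar_ne_zero (m := m)
  have h2 := q_pow_sub_one_ne_zero two_ne_zero
  have h3 := q_pow_sub_one_ne_zero hm
  have h1 : (signScalar m)⁻¹ = q ^ m * ((q - 1) ^ 2 * ((q ^ 2 - 1)⁻¹ * (q ^ m - 1)⁻¹)) := by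
    rw [← mul_inv, ← poincare_eq, ← signScalar_mul]
    have := q_sub_one_ne_zero
    have := q_ne_zero
    field_simp
  have hinv : ∀ n : ℕ, 1 ≤ n → (q ^ n - 1)⁻¹ ∈ rouquierRing m := fun n hn =>
    Subring.subset_closure (Or.inr ⟨n, hn, rfl⟩)
  rw [h1]
  exact mul_mem (pow_mem q_mem_rouquierRing m) (mul_mem (pow_mem (sub_mem q_mem_rouquierRing (one_mem _)) 2)
    (mul_mem (hinv 2 one_le_two) (hinv m (Nat.one_le_iff_ne_zero.2 hm))))

/-- The sign character is alone in its family. -/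
theorem eq_of_sameFamily_sgn {χ : Irr m} (h : SameFamily m (irrSgn m) χ) : χ = irrSgn m := by
  obtain ⟨L, L', h⟩ := h
  have hS := signScalar_ne_zero (m := m)
  -- The central idempotent of the sign representation. It lies in the order over the Rouquier ring
  -- and is nonzero only in lifts of `ε`.
  set e : Hecke m := algebraMap F _ (signScalar m)⁻¹ * signSum m (heckeT m) with he
  have hsq : signSum m (heckeT m) * signSum m (heckeT m) =
      algebraMap F _ (signScalar m) * signSum m (heckeT m) := by
    have := signSum_smul (m := m) (heckeT m) (signSum m (heckeT m))
      fun i => by rw [smul_eq_mul, heckeT_mul_signSum]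
    rwa [smul_eq_mul, Algebra.smul_def] at this
  have hee : e * e = e := by
    have h1 := Algebra.commutes (signScalar m)⁻¹ (signSum m (heckeT m))
    have h2 : e * e = algebraMap F _ (signScalar m)⁻¹ * algebraMap F _ (signScalar m)⁻¹ *
        (signSum m (heckeT m) * signSum m (heckeT m)) := by
      rw [he, mul_assoc, ← mul_assoc (signSum m (heckeT m)), ← h1]
      simp only [mul_assoc]
    rw [h2, hsq, ← mul_assoc, ← map_mul, ← map_mul, mul_assoc, inv_mul_cancel₀ hS, mul_one]
  have h1 := h e (mul_mem (algebraMap_mem_heckeOrder signScalar_inv_mem) signSum_mem_heckeOrder) hee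
    fun x _ => ((Algebra.commute_algebraMap_left _ x).mul_left (commute_signSum x)).eq
  have hL : L.rep e ≠ 0 := by
    have : NeZero L.n := ⟨L.pos.ne'⟩
    rw [he, map_mul, AlgHom.commutes, rep_signSum_sgn L, ← map_mul, inv_mul_cancel₀ hS, map_one]
    exact one_ne_zero
  refine eq_sgn_of_rep_signSum_ne_zero L' fun h2 => hL (h1.2 ?_)
  rw [he, map_mul, h2, mul_zero]

end

section

variable {m : ℕ} [NeZero m]

/-! ## Fractions with monic denominator -/

/-- The inclusion of the polynomials with algebraic integer coefficients. -/
def intPolyHom : Polynomial (integralClosure ℤ ℂ) →+* F :=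
  (algebraMap (Polynomial ℂ) F).comp (Polynomial.mapRingHom (algebraMap (integralClosure ℤ ℂ) ℂ))

theorem intPolyHom_X : intPolyHom Polynomial.X = q := by simp [intPolyHom]

theorem intPolyHom_C (z : integralClosure ℤ ℂ) : intPolyHom (Polynomial.C z) = RatFunc.C (z : ℂ) := by
  simp [intPolyHom]

/-- Quotients of polynomials with algebraic integer coefficients, with monic denominator. -/
def monicRing : Subring F where
  carrier := {x | ∃ g P : Polynomial (integralClosure ℤ ℂ), g.Monic ∧ x * intPolyHom g = intPolyHom P}
  mul_mem' := by
    rintro x y ⟨g, P, hg, h⟩ ⟨g', P', hg', h'⟩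
    refine ⟨g * g', P * P', hg.mul hg', ?_⟩
    rw [map_mul, map_mul, ← h, ← h']; ring
  one_mem' := ⟨1, 1, Polynomial.monic_one, one_mul _⟩
  add_mem' := by
    rintro x y ⟨g, P, hg, h⟩ ⟨g', P', hg', h'⟩
    refine ⟨g * g', P * g' + P' * g, hg.mul hg', ?_⟩
    rw [map_mul, map_add, map_mul, map_mul, ← h, ← h']; ring
  zero_mem' := ⟨1, 0, Polynomial.monic_one, by rw [zero_mul, map_zero]⟩
  neg_mem' := by
    rintro x ⟨g, P, hg, h⟩
    exact ⟨g, -P, hg, by rw [map_neg, ← h, neg_mul]⟩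

theorem C_mem_monicRing {z : ℂ} (hz : IsIntegral ℤ z) : RatFunc.C z ∈ monicRing :=
  ⟨1, Polynomial.C ⟨z, hz⟩, Polynomial.monic_one, by rw [map_one, mul_one, intPolyHom_C]⟩

theorem q_mem_monicRing : q ∈ monicRing :=
  ⟨1, Polynomial.X, Polynomial.monic_one, by rw [map_one, mul_one, intPolyHom_X]⟩

/-- All generators have monic denominators, powers of `q` or `q ^ n - 1`. Inverting them introduces
no new constants besides algebraic integers, so congruences modulo algebraic integers keep their
meaning. -/
theorem rouquierRing_le : rouquierRing m ≤ monicRing := by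
  refine Subring.closure_le.2 ?_
  rintro x ((⟨z, hz, -, rfl⟩ | (rfl | rfl)) | ⟨n, hn, rfl⟩)
  · exact C_mem_monicRing hz
  · exact q_mem_monicRing
  · exact ⟨Polynomial.X, 1, Polynomial.monic_X, by rw [intPolyHom_X, map_one, inv_mul_cancel₀ q_ne_zero]⟩
  · refine ⟨Polynomial.X ^ n - 1, 1, ?_, ?_⟩
    · simpa using Polynomial.monic_X_pow_sub_C (1 : integralClosure ℤ ℂ) (by omega : n ≠ 0)
    · rw [map_sub, map_pow, intPolyHom_X, map_one,
        inv_mul_cancel₀ (q_pow_sub_one_ne_zero (by omega))]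

/-- Compare the leading coefficient of the monic denominator `g`, multiplied by `t`, with the
coefficient of the same degree in the numerator. -/
theorem isIntegral_of_C_mem {t : ℂ} (h : RatFunc.C t ∈ monicRing) : IsIntegral ℤ t := by
  obtain ⟨g, P, hg, h⟩ := h
  set ι := algebraMap (integralClosure ℤ ℂ) ℂ
  have h1 : Polynomial.C t * g.map ι = P.map ι := by
    refine RatFunc.algebraMap_injective ℂ ?_
    rw [map_mul, RatFunc.algebraMap_C]
    exact h
  have h2 := congrArg (fun p => p.coeff g.natDegree) h1
  simp only [Polynomial.coeff_C_mul, Polynomial.coeff_map] at h2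
  rw [show g.coeff g.natDegree = 1 from hg, map_one, mul_one] at h2
  rw [h2]
  exact (P.coeff g.natDegree).2

/-! ## Roots of unity of prime power order -/

/-- For `u = ω - 1`, expanding `(u + 1) ^ p ^ a = 1` shows that `u ^ p ^ a` is divisible by `p` in
the algebraic integers. If `u` were a unit, so would be `p`, and `1 / p` is not an algebraic
integer. -/
theorem not_isIntegral_inv_sub_one {ω : ℂ} {p a : ℕ} (hp : p.Prime) (hω : ω ^ p ^ a = 1) (h1 : ω ≠ 1) :
    ¬ IsIntegral ℤ (ω - 1)⁻¹ := by
  intro h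
  have hint : IsIntegral ℤ ω := IsIntegral.of_pow (pow_pos hp.pos a) (hω ▸ isIntegral_one)
  have hne : ω - 1 ≠ 0 := sub_ne_zero.2 h1
  let u : integralClosure ℤ ℂ := ⟨ω - 1, hint.sub isIntegral_one⟩
  let t : integralClosure ℤ ℂ := ⟨(ω - 1)⁻¹, h⟩
  have htu : u * t = 1 := Subtype.ext (mul_inv_cancel₀ hne)
  obtain ⟨r, hr⟩ := exists_add_pow_prime_pow_eq hp u 1 a
  have hu : (u + 1) ^ p ^ a = 1 := Subtype.ext (by
    change (ω - 1 + 1) ^ p ^ a = 1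
    rw [sub_add_cancel, hω])
  rw [hu, one_pow, mul_one] at hr
  have hpa : p ^ a = p ^ a - 1 + 1 := (Nat.succ_pred_eq_of_pos (pow_pos hp.pos a)).symm
  have hut : u ^ p ^ a * t ^ p ^ a = 1 := by rw [← mul_pow, htu, one_pow]
  have h2 : (p : integralClosure ℤ ℂ) * (-(t ^ (p ^ a - 1) * r)) = 1 := by
    have h3 : t ^ p ^ a = t ^ (p ^ a - 1) * t := by rw [← pow_succ, ← hpa]
    rw [h3] at hut
    linear_combination (t ^ (p ^ a - 1) * t) * hr + hut + (p : integralClosure ℤ ℂ) * t ^ (p ^ a - 1) * r * htu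
  have h3 : (p : ℂ) * ((-(t ^ (p ^ a - 1) * r) : integralClosure ℤ ℂ) : ℂ) = 1 := by
    have := congrArg Subtype.val h2
    simpa using this
  have hp0 : (p : ℂ) ≠ 0 := Nat.cast_ne_zero.2 hp.ne_zero
  have h4 : IsIntegral ℤ (algebraMap ℚ ℂ (p : ℚ)⁻¹) := by
    have h5 : algebraMap ℚ ℂ (p : ℚ)⁻¹ = ((-(t ^ (p ^ a - 1) * r) : integralClosure ℤ ℂ) : ℂ) := by
      rw [map_inv₀, map_natCast]
      exact inv_eq_of_mul_eq_one_right h3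
    rw [h5]
    exact Subtype.prop _
  rw [isIntegral_algebraMap_iff (algebraMap ℚ ℂ).injective] at h4
  obtain ⟨k, hk⟩ := IsIntegrallyClosed.isIntegral_iff.1 h4
  have h6 : (p : ℤ) * k = 1 := by
    have hpQ : (p : ℚ) ≠ 0 := Nat.cast_ne_zero.2 hp.ne_zero
    have h7 : (p : ℚ) * (k : ℚ) = 1 := by
      rw [show (k : ℚ) = (p : ℚ)⁻¹ from hk, mul_inv_cancel₀ hpQ]
    exact_mod_cast h7
  have h8 := Int.isUnit_iff.1 (IsUnit.of_mul_eq_one k h6)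
  have := hp.two_le
  omega

/-! ## Congruences between representations -/

/-- The multiples of `δ` in `monicRing`. -/
def multiples (δ : F) : Submodule monicRing F := Submodule.span monicRing {δ}

theorem mem_multiples {δ x : F} : x ∈ multiples δ ↔ ∃ y ∈ monicRing, y * δ = x := by
  rw [multiples, Submodule.mem_span_singleton]
  exact ⟨fun ⟨a, h⟩ => ⟨a.1, a.2, h⟩, fun ⟨y, hy, h⟩ => ⟨⟨y, hy⟩, h⟩⟩

theorem mul_mem_multiples {δ x y : F} (hx : x ∈ monicRing) (hy : y ∈ multiples δ) :
    x * y ∈ multiples δ := (multiples δ).smul_mem ⟨x, hx⟩ hy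

theorem mul_mem_multiples' {δ x y : F} (hx : x ∈ monicRing) (hy : y ∈ multiples δ) :
    y * x ∈ multiples δ := mul_comm x y ▸ mul_mem_multiples hx hy

theorem isIntegral_inv_of_mem {d : ℂ} {ε : F} (hε : ε = 1 ∨ ε = -1)
    (h : ε ∈ multiples (RatFunc.C d)) : IsIntegral ℤ d⁻¹ := by
  have h1 : (1 : F) ∈ multiples (RatFunc.C d) := by
    rcases hε with rfl | rfl
    · exact h
    · simpa using (multiples (RatFunc.C d)).neg_mem h
  obtain ⟨y, hy, h2⟩ := mem_multiples.1 h1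
  refine isIntegral_of_C_mem ?_
  rw [map_inv₀, ← eq_inv_of_mul_eq_one_left h2]
  exact hy

theorem heckeOrder_induction {p : Hecke m → Prop} (hC : ∀ c ∈ rouquierRing m, p (algebraMap F _ c))
    (hT : ∀ i, p (heckeT m i)) (hadd : ∀ x y, p x → p y → p (x + y)) (hneg : ∀ x, p x → p (-x))
    (hmul : ∀ x y, p x → p y → p (x * y)) {x : Hecke m} (hx : x ∈ heckeOrder m) : p x := by
  induction hx using Subring.closure_induction with
  | mem x hx =>
    rcases hx with ⟨c, hc, rfl⟩ | ⟨i, rfl⟩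
    · exact hC c hc
    · exact hT i
  | zero =>
    have := hC 0 (zero_mem _)
    rwa [map_zero] at this
  | one =>
    have := hC 1 (one_mem _)
    rwa [map_one] at this
  | add x y _ _ hx hy => exact hadd x y hx hy
  | neg x _ hx => exact hneg x hx
  | mul x y _ _ hx hy => exact hmul x y hx hy

/-- A congruence of matrices over `monicRing` passes from the generators to the whole order, as the
scalars of the order lie in `monicRing`. -/
theorem sub_mem_multiples {n : ℕ} {δ : F} (f g : Hecke m →ₐ[F] Matrix (Fin n) (Fin n) F)
    (hf : ∀ i a b, f (heckeT m i) a b ∈ monicRing) (hg : ∀ i a b, g (heckeT m i) a b ∈ monicRing)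
    (hfg : ∀ i a b, f (heckeT m i) a b - g (heckeT m i) a b ∈ multiples δ)
    {x : Hecke m} (hx : x ∈ heckeOrder m) (a b : Fin n) : f x a b - g x a b ∈ multiples δ := by
  suffices h : ∀ a b, f x a b ∈ monicRing ∧ g x a b ∈ monicRing ∧ f x a b - g x a b ∈ multiples δ from
    (h a b).2.2
  refine heckeOrder_induction (p := fun x => ∀ a b, f x a b ∈ monicRing ∧ g x a b ∈ monicRing ∧
    f x a b - g x a b ∈ multiples δ) (fun c hc a b => ?_) (fun i a b => ⟨hf i a b, hg i a b, hfg i a b⟩)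
    (fun x y hx hy a b => ?_) (fun x hx a b => ?_) (fun x y hx hy a b => ?_) hx
  · rw [AlgHom.commutes, AlgHom.commutes, sub_self, Matrix.algebraMap_eq_diagonal]
    have h1 : Matrix.diagonal (algebraMap F (Fin n → F) c) a b ∈ monicRing := by
      rw [Matrix.diagonal_apply]
      split_ifs
      · exact rouquierRing_le hc
      · exact zero_mem _
    exact ⟨h1, h1, zero_mem _⟩
  · rw [map_add, map_add, Matrix.add_apply, Matrix.add_apply, add_sub_add_comm]
    exact ⟨add_mem (hx a b).1 (hy a b).1, add_mem (hx a b).2.1 (hy a b).2.1,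
      add_mem (hx a b).2.2 (hy a b).2.2⟩
  · rw [map_neg, map_neg, Matrix.neg_apply, Matrix.neg_apply, neg_sub_neg, ← neg_sub]
    exact ⟨neg_mem (hx a b).1, neg_mem (hx a b).2.1, neg_mem (hx a b).2.2⟩
  · rw [map_mul, map_mul, Matrix.mul_apply, Matrix.mul_apply, ← Finset.sum_sub_distrib]
    refine ⟨sum_mem fun k _ => mul_mem (hx a k).1 (hy k b).1,
      sum_mem fun k _ => mul_mem (hx a k).2.1 (hy k b).2.1, sum_mem fun k _ => ?_⟩
    rw [show f x a k * f y k b - g x a k * g y k b =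
      (f x a k - g x a k) * f y k b + g x a k * (f y k b - g y k b) by ring]
    exact add_mem (mul_mem_multiples' (hy k b).1 (hx a k).2.2) (mul_mem_multiples (hx a k).2.1 (hy k b).2.2)

/-- A two-dimensional representation that is triangular modulo `δ` has the one-dimensional
constituents given by its diagonal. -/
theorem diag_sub_mem_multiples {δ : F} (f : Hecke m →ₐ[F] Matrix (Fin 2) (Fin 2) F)
    (g : Hecke m →ₐ[F] Matrix (Fin 1) (Fin 1) F) (k : Fin 2)
    (hf : ∀ i a b, f (heckeT m i) a b ∈ monicRing) (hg : ∀ i, g (heckeT m i) 0 0 ∈ monicRing)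
    (hf0 : ∀ i, f (heckeT m i) 1 0 ∈ multiples δ)
    (hfg : ∀ i, f (heckeT m i) k k = g (heckeT m i) 0 0)
    {x : Hecke m} (hx : x ∈ heckeOrder m) : f x k k - g x 0 0 ∈ multiples δ := by
  suffices h : (∀ a b, f x a b ∈ monicRing) ∧ g x 0 0 ∈ monicRing ∧ f x 1 0 ∈ multiples δ ∧
      f x k k - g x 0 0 ∈ multiples δ from h.2.2.2
  refine heckeOrder_induction (p := fun x => (∀ a b, f x a b ∈ monicRing) ∧ g x 0 0 ∈ monicRing ∧
    f x 1 0 ∈ multiples δ ∧ f x k k - g x 0 0 ∈ multiples δ) (fun c hc => ?_)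
    (fun i => ⟨hf i, hg i, hf0 i, by rw [hfg, sub_self]; exact zero_mem _⟩)
    (fun x y hx hy => ?_) (fun x hx => ?_) (fun x y hx hy => ?_) hx
  · rw [AlgHom.commutes, AlgHom.commutes, Matrix.algebraMap_eq_diagonal, Matrix.algebraMap_eq_diagonal]
    refine ⟨fun a b => ?_, ?_, ?_, ?_⟩
    · rw [Matrix.diagonal_apply]
      split_ifs
      · exact rouquierRing_le hc
      · exact zero_mem _
    · rw [Matrix.diagonal_apply_eq]
      exact rouquierRing_le hc
    · rw [Matrix.diagonal_apply_ne _ (by decide)]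
      exact zero_mem _
    · rw [Matrix.diagonal_apply_eq, Matrix.diagonal_apply_eq]
      simp
  · rw [map_add, map_add]
    simp only [Matrix.add_apply]
    rw [add_sub_add_comm]
    exact ⟨fun a b => add_mem (hx.1 a b) (hy.1 a b), add_mem hx.2.1 hy.2.1,
      add_mem hx.2.2.1 hy.2.2.1, add_mem hx.2.2.2 hy.2.2.2⟩
  · rw [map_neg, map_neg]
    simp only [Matrix.neg_apply]
    rw [neg_sub_neg, ← neg_sub]
    exact ⟨fun a b => neg_mem (hx.1 a b), neg_mem hx.2.1, neg_mem hx.2.2.1, neg_mem hx.2.2.2⟩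
  · rw [map_mul, map_mul]
    have hsplit : f x k k * f y k k - g x 0 0 * g y 0 0 ∈ multiples δ := by
      rw [show f x k k * f y k k - g x 0 0 * g y 0 0 =
        (f x k k - g x 0 0) * f y k k + g x 0 0 * (f y k k - g y 0 0) by ring]
      exact add_mem (mul_mem_multiples' (hy.1 k k) hx.2.2.2) (mul_mem_multiples hx.2.1 hy.2.2.2)
    simp only [Matrix.mul_apply, Fin.sum_univ_two, Finset.univ_unique, Fin.default_eq_zero,
      Finset.sum_singleton]
    refine ⟨fun a b => add_mem (mul_mem (hx.1 _ _) (hy.1 _ _)) (mul_mem (hx.1 _ _) (hy.1 _ _)),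
      mul_mem hx.2.1 hy.2.1, add_mem (mul_mem_multiples' (hy.1 _ _) hx.2.2.1)
        (mul_mem_multiples (hx.1 _ _) hy.2.2.1), ?_⟩
    obtain rfl | rfl : k = 0 ∨ k = 1 := by fin_cases k <;> simp
    · rw [add_sub_right_comm]
      exact add_mem hsplit (mul_mem_multiples (hx.1 _ _) hy.2.2.1)
    · rw [add_sub_assoc]
      exact add_mem (mul_mem_multiples' (hy.1 _ _) hx.2.2.1) hsplit

/-! ## The block of the reflection character -/

theorem exists_twoRep (hm : 2 ≤ m) {z : ℂ} (hz : z ^ m = 1) (hz2 : z * z ≠ 1) :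
    ∃ f : Hecke m →ₐ[F] Matrix (Fin 2) (Fin 2) F,
      ∀ i, f (heckeT m i) = twoMat q (RatFunc.C (z + z⁻¹)) i := by
  have hz0 : z ≠ 0 := by
    rintro rfl
    rw [zero_pow (by omega)] at hz
    exact zero_ne_one hz
  refine ⟨heckeHom m (twoMat q (RatFunc.C (z + z⁻¹))) (fun i => twoMat_quadratic _ _ _) ?_,
    fun i => heckeHom_T i⟩
  rw [map_add]
  refine twoMat_prod_eq hm ?_ (fun h => hz2 ?_) ?_
  · rw [← map_mul, mul_inv_cancel₀ hz0, map_one]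
  · have := C_inj.1 h
    nth_rewrite 2 [this]
    exact mul_inv_cancel₀ hz0
  · rw [← map_pow, hz, map_one]

theorem eq_zero_or_one_of_commute_twoMat {K : Type*} [Field K] {x c : K} (hx : x * (2 + c) ≠ 0)
    {M : Matrix (Fin 2) (Fin 2) K} (hM : ∀ i, M * twoMat x c i = twoMat x c i * M) (hMM : M * M = M) : M = 0 ∨ M = 1 := by
  have e := fun i a b => congrFun (congrFun (hM i) a) b
  have e1 := e true 0 0
  have e2 := e true 0 1
  have e3 := e false 0 0
  have e4 := congrFun (congrFun hMM 0) 0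
  simp [twoMat, Matrix.mul_apply, Fin.sum_univ_two] at e1 e2 e3 e4
  have h10 : M 1 0 = 0 := by linear_combination -e1
  have h01 : M 0 1 = 0 :=
    e3.resolve_right fun h => hx (mul_eq_zero.2 h)
  have h11 : M 1 1 = M 0 0 := by
    rw [h01] at e2
    linear_combination -e2
  rw [h01, zero_mul, add_zero] at e4
  have h00 : M 0 0 = 0 ∨ M 0 0 = 1 := by
    rcases eq_or_ne (M 0 0) 0 with h | h
    · exact Or.inl h
    · exact Or.inr (mul_left_cancel₀ h (by rw [e4, mul_one]))
  rcases h00 with h | h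
  · left
    ext a b
    fin_cases a <;> fin_cases b <;> simp [h10, h01, h11, h]
  · right
    ext a b
    fin_cases a <;> fin_cases b <;> simp [h10, h01, h11, h]

theorem isIntegral_of_pow_eq_one {z : ℂ} (hz : z ^ m = 1) : IsIntegral ℤ z :=
  IsIntegral.of_pow (Nat.pos_of_neZero m) (hz ▸ isIntegral_one)

theorem twoMat_mem_monicRing {z : ℂ} (hz : z ^ m = 1) (i : Bool) (a b : Fin 2) :
    twoMat q (RatFunc.C (z + z⁻¹)) i a b ∈ monicRing := by
  have h1 := isIntegral_of_pow_eq_one hz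
  have h2 : IsIntegral ℤ z⁻¹ := isIntegral_of_pow_eq_one (m := m) (by rw [inv_pow, hz, inv_one])
  have h3 := C_mem_monicRing (h1.add h2)
  have h4 := mul_mem q_mem_monicRing (add_mem (add_mem (one_mem monicRing) (one_mem _)) h3)
  rw [one_add_one_eq_two] at h4
  cases i <;> fin_cases a <;> fin_cases b <;> simp only [twoMat] <;>
    first
    | exact h4
    | exact q_mem_monicRing
    | exact one_mem _
    | exact zero_mem _
    | exact neg_mem (one_mem _)

/-- The representations attached to roots of unity that are congruent modulo a prime lie in the
same block. -/
theorem twoRep_zero_iff {f g : Hecke m →ₐ[F] Matrix (Fin 2) (Fin 2) F} {z z' : ℂ} (hz : z ^ m = 1)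
    (hz' : z' ^ m = 1) (hf : ∀ i, f (heckeT m i) = twoMat q (RatFunc.C (z + z⁻¹)) i)
    (hg : ∀ i, g (heckeT m i) = twoMat q (RatFunc.C (z' + z'⁻¹)) i) {p a : ℕ} (hp : p.Prime)
    (hω : (z / z') ^ p ^ a = 1) {e : Hecke m} (he : e ∈ heckeOrder m) (hfe : f e = 0 ∨ f e = 1)
    (hge : g e = 0 ∨ g e = 1) : f e = 0 ↔ g e = 0 := by
  have hne : ∀ {z : ℂ}, z ^ m = 1 → z ≠ 0 := by
    rintro z hz rfl
    rw [zero_pow (NeZero.ne m)] at hz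
    exact zero_ne_one hz
  have hz0 := hne hz
  have hz0' := hne hz'
  set d : ℂ := z + z⁻¹ - (z' + z'⁻¹) with hd
  have key : (f e) 0 0 - (g e) 0 0 ∈ multiples (RatFunc.C d) := by
    refine sub_mem_multiples f g (fun i a b => ?_) (fun i a b => ?_) (fun i a b => ?_) he 0 0
    · rw [hf]; exact twoMat_mem_monicRing hz i a b
    · rw [hg]; exact twoMat_mem_monicRing hz' i a b
    · rw [hf, hg, mem_multiples]
      by_cases h10 : i = false ∧ a = 1 ∧ b = 0
      · obtain ⟨rfl, rfl, rfl⟩ := h10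
        exact ⟨q, q_mem_monicRing, by simp [twoMat, hd]; ring⟩
      · refine ⟨0, zero_mem _, ?_⟩
        cases i <;> fin_cases a <;> fin_cases b <;> simp [twoMat] at h10 ⊢
  -- If `e` acted by `0` in one representation and by `1` in the other, `d` would be a unit in the
  -- algebraic integers. It factors as `(z - z') (1 - z⁻¹ z'⁻¹)`, so `z / z' - 1` would be a unit as
  -- well, against its prime power order.
  have hcontra : ∀ ε : F, (ε = 1 ∨ ε = -1) → ε ∈ multiples (RatFunc.C d) → z = z' := by
    intro ε hε h
    by_contra hzz
    have h1 := isIntegral_inv_of_mem hε h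
    refine not_isIntegral_inv_sub_one hp hω (fun h2 => hzz ?_) ?_
    · rwa [div_eq_one_iff_eq hz0'] at h2
    · have hint : IsIntegral ℤ (z' * (1 - z⁻¹ * z'⁻¹)) :=
        (isIntegral_of_pow_eq_one hz').mul (isIntegral_one.sub
          (isIntegral_of_pow_eq_one (m := m) (by rw [mul_pow, inv_pow, inv_pow, hz, hz']; simp)))
      have hzz' : z - z' ≠ 0 := sub_ne_zero.2 hzz
      by_cases hd0 : 1 - z⁻¹ * z'⁻¹ = 0
      · have hdz : d = 0 := by
          rw [hd]
          field_simp at hd0 ⊢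
          linear_combination (z - z') * hd0
        rw [hdz, map_zero] at h
        obtain ⟨y, -, hy⟩ := mem_multiples.1 h
        rw [mul_zero] at hy
        rcases hε with rfl | rfl <;> simp at hy
      · have hdd : d = (z - z') * (1 - z⁻¹ * z'⁻¹) := by rw [hd]; field_simp; ring
        have h3 : (z / z' - 1)⁻¹ = z' * (1 - z⁻¹ * z'⁻¹) * d⁻¹ := by
          have h4 : z / z' - 1 = (z - z') / z' := by field_simp
          rw [h4, hdd]
          generalize 1 - z⁻¹ * z'⁻¹ = w at hd0
          field_simp
        rw [h3]
        exact hint.mul h1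
  by_cases hzz : z = z'
  · have : f e = g e := by
      refine hecke_induction (p := fun x => f x = g x) (fun c => by rw [AlgHom.commutes, AlgHom.commutes])
        (fun i => by rw [hf, hg, hzz]) (fun x y hx hy => by rw [map_add, map_add, hx, hy])
        (fun x y hx hy => by rw [map_mul, map_mul, hx, hy]) e
    rw [this]
  · rcases hfe with h1 | h1 <;> rcases hge with h2 | h2 <;> rw [h1, h2] at key ⊢
    · exact absurd (hcontra _ (Or.inr (by simp)) key) hzz
    · exact absurd (hcontra _ (Or.inl (by simp)) key) hzz

end

/-! ### Reduction to one-dimensional representations: the family of the reflection character for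
even `m` -/

section

variable {m : ℕ} [NeZero m]

theorem ne_zero_of_pow_eq_one {y : ℂ} (hy : y ^ m = 1) : y ≠ 0 := by
  rintro rfl
  rw [zero_pow (NeZero.ne m)] at hy
  exact zero_ne_one hy

theorem two_add_neg_add_inv {y : ℂ} (hy : y ≠ 0) : 2 + (-y + (-y)⁻¹) = -((y - 1) ^ 2 * y⁻¹) := by
  rw [inv_neg]
  field_simp
  ring

/-- The lower left entries of the generators are `0` and `q (2 + c)`, and `2 + c = -(y - 1) ^ 2 /
y`. Modulo this number, which is not a unit as `y` has prime power order, the representation is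
triangular, and its diagonal consists of the two mixed one-dimensional representations. -/
theorem oneRep_zero_iff {f : Hecke m →ₐ[F] Matrix (Fin 2) (Fin 2) F}
    {g : Hecke m →ₐ[F] Matrix (Fin 1) (Fin 1) F} {k : Fin 2} {y : ℂ} (hy : y ^ m = 1) (hm : Even m)
    (hf : ∀ i, f (heckeT m i) = twoMat q (RatFunc.C (-y + (-y)⁻¹)) i)
    (hg : ∀ i, g (heckeT m i) 0 0 = f (heckeT m i) k k) {p a : ℕ} (hp : p.Prime)
    (hω : y ^ p ^ a = 1) (hy1 : y ≠ 1) {e : Hecke m} (he : e ∈ heckeOrder m) (hfe : f e = 0 ∨ f e = 1)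
    (hge : g e * g e = g e) : f e = 0 ↔ g e = 0 := by
  have hy0 := ne_zero_of_pow_eq_one hy
  have hny : (-y) ^ m = 1 := by rw [hm.neg_pow, hy]
  set d : ℂ := 2 + (-y + (-y)⁻¹) with hd
  have key : f e k k - g e 0 0 ∈ multiples (RatFunc.C d) := by
    refine diag_sub_mem_multiples f g k (fun i a b => ?_) (fun i => ?_) (fun i => ?_)
      (fun i => (hg i).symm) he
    · rw [hf]; exact twoMat_mem_monicRing hny i a b
    · rw [hg, hf]; exact twoMat_mem_monicRing hny i k k
    · rw [hf, mem_multiples]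
      cases i
      · exact ⟨q, q_mem_monicRing, by simp [twoMat, hd, map_ofNat RatFunc.C 2]⟩
      · exact ⟨0, zero_mem _, by simp [twoMat]⟩
  have hge' : g e = 0 ∨ g e = 1 := by
    have h1 := congrFun (congrFun hge 0) 0
    simp only [Matrix.mul_apply, Finset.univ_unique, Fin.default_eq_zero, Finset.sum_singleton] at h1
    rcases eq_or_ne (g e 0 0) 0 with h | h
    · left
      ext a b
      fin_cases a; fin_cases b
      exact h
    · right
      ext a b
      fin_cases a; fin_cases b
      exact mul_left_cancel₀ h (h1.trans (mul_one _).symm)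
  have hcontra : ∀ ε : F, (ε = 1 ∨ ε = -1) → ε ∉ multiples (RatFunc.C d) := by
    intro ε hε h
    have h1 := isIntegral_inv_of_mem hε h
    refine not_isIntegral_inv_sub_one hp hω hy1 ?_
    have h2 : (y - 1)⁻¹ = -((y - 1) * y⁻¹ * d⁻¹) := by
      have := sub_ne_zero.2 hy1
      rw [hd, two_add_neg_add_inv hy0]
      field_simp
    rw [h2]
    exact ((((isIntegral_of_pow_eq_one hy).sub isIntegral_one).mul
      (isIntegral_of_pow_eq_one (m := m) (by rw [inv_pow, hy, inv_one]))).mul h1).neg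
  rcases hfe with h1 | h1 <;> rcases hge' with h2 | h2 <;> rw [h1, h2] at key ⊢
  · simp
  · exact absurd key (hcontra _ (Or.inr (by simp)))
  · exact absurd key (hcontra _ (Or.inl (by simp)))
  · simp

theorem twoRep_zero_or_one {f : Hecke m →ₐ[F] Matrix (Fin 2) (Fin 2) F} {y : ℂ} (hy : y ^ m = 1)
    (hy1 : y ≠ 1) (hf : ∀ i, f (heckeT m i) = twoMat q (RatFunc.C (-y + (-y)⁻¹)) i) {e : Hecke m}
    (hee : e * e = e) (hc : ∀ x ∈ heckeOrder m, e * x = x * e) : f e = 0 ∨ f e = 1 := by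
  have hy0 := ne_zero_of_pow_eq_one hy
  refine eq_zero_or_one_of_commute_twoMat (x := q) (c := RatFunc.C (-y + (-y)⁻¹)) ?_ (fun i => ?_) ?_
  · refine mul_ne_zero q_ne_zero fun h => ?_
    have h1 : 2 + (-y + (-y)⁻¹) = 0 := by
      refine C_inj.1 ?_
      rw [map_add, map_ofNat, h, map_zero]
    rw [two_add_neg_add_inv hy0, neg_eq_zero, mul_eq_zero] at h1
    exact hy1 (sub_eq_zero.1 (pow_eq_zero_iff two_ne_zero |>.1
      (h1.resolve_right (inv_ne_zero hy0))))
  · rw [← hf, ← map_mul, ← map_mul, hc _ (heckeT_mem_heckeOrder i)]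
  · rw [← map_mul, hee]

/-- All representations attached to roots of unity lie in the blocks of the two mixed
one-dimensional representations. -/
theorem twoRep_zero_iff_oneRep (hm2 : 2 ≤ m) (hm : Even m)
    {g : Hecke m →ₐ[F] Matrix (Fin 1) (Fin 1) F} {k : Fin 2}
    (hg : ∀ i, g (heckeT m i) 0 0 = twoMat q 0 i k k) {e : Hecke m} (he : e ∈ heckeOrder m)
    (hee : e * e = e) (hc : ∀ x ∈ heckeOrder m, e * x = x * e) (y : ℂ) (hy : y ^ m = 1)
    (hy2 : y * y ≠ 1) (f : Hecke m →ₐ[F] Matrix (Fin 2) (Fin 2) F)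
    (hf : ∀ i, f (heckeT m i) = twoMat q (RatFunc.C (-y + (-y)⁻¹)) i) : f e = 0 ↔ g e = 0 := by
  -- The parameter is `-y` so that the reducible case is `y = 1`. Each step removes the part of `y`
  -- of `p`-power order for one prime `p`, until nothing is left.
  induction hN : orderOf y using Nat.strong_induction_on generalizing y f with
  | _ N ih =>
    have hy1 : y ≠ 1 := by rintro rfl; exact hy2 (mul_one _)
    have hy0 := ne_zero_of_pow_eq_one hy
    have hNpos : 0 < N := hN ▸ orderOf_pos_iff.2 (isOfFinOrder_iff_pow_eq_one.2 ⟨m, Nat.pos_of_neZero m, hy⟩)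
    have hN1 : N ≠ 1 := fun h => hy1 (orderOf_eq_one_iff.1 (hN.trans h))
    have hp := Nat.minFac_prime hN1
    set p := N.minFac with hp_def
    obtain ⟨a, M, hpM, hNM⟩ := Nat.exists_eq_pow_mul_and_not_dvd hNpos.ne' p hp.ne_one
    have hMpos : 0 < M := Nat.pos_of_ne_zero fun h => hpM (h ▸ dvd_zero p)
    have hlt : M < N := by
      have ha : a ≠ 0 := by
        rintro rfl
        rw [pow_zero, one_mul] at hNM
        exact hpM (hNM ▸ N.minFac_dvd)
      rw [hNM]
      exact lt_mul_of_one_lt_left hMpos (Nat.one_lt_pow ha hp.one_lt)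
    have hMdvd : M ∣ N := ⟨p ^ a, by rw [hNM, mul_comm]⟩
    -- Choosing the smallest prime factor first removes the prime `2` first. So the remaining part
    -- `w` has odd order and is never `-1`, which would be excluded from the induction hypothesis.
    have hModd : Odd M := by
      rw [← Nat.not_even_iff_odd]
      intro h
      have h2 : 2 ∣ N := (even_iff_two_dvd.1 h).trans hMdvd
      have h3 : p = 2 := (Nat.minFac_eq_two_iff N).2 h2
      exact hpM (h3 ▸ even_iff_two_dvd.1 h)
    have hcop : IsCoprime ((p ^ a : ℕ) : ℤ) (M : ℤ) :=
      Nat.isCoprime_iff_coprime.2 (Nat.Coprime.pow_left a ((Nat.Prime.coprime_iff_not_dvd hp).2 hpM))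
    obtain ⟨u, v, huv⟩ := hcop
    have hyN : y ^ (N : ℤ) = 1 := by rw [zpow_natCast, ← hN, pow_orderOf_eq_one]
    have hNz : (N : ℤ) = ((p ^ a : ℕ) : ℤ) * M := by rw [hNM]; push_cast; ring
    -- Bézout splits `y` into a part `w` of order prime to `p` and a part `ω` of `p`-power order.
    -- The representations for `y` and `w` are congruent, as the quotient of their parameters is
    -- `ω`.
    set w := y ^ (u * ((p ^ a : ℕ) : ℤ)) with hw
    set ω := y ^ (v * (M : ℤ)) with hωdef
    have hyw : y = w * ω := by rw [hw, hωdef, ← zpow_add₀ hy0, huv, zpow_one]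
    have hwM : w ^ M = 1 := by
      rw [hw, ← zpow_natCast, ← zpow_mul, show u * ((p ^ a : ℕ) : ℤ) * (M : ℤ) = (N : ℤ) * u by
        rw [hNz]; ring, zpow_mul, hyN, one_zpow]
    have hωp : ω ^ p ^ a = 1 := by
      rw [hωdef, ← zpow_natCast, ← zpow_mul, show v * (M : ℤ) * ((p ^ a : ℕ) : ℤ) = (N : ℤ) * v by
        rw [hNz]; ring, zpow_mul, hyN, one_zpow]
    have hfe := twoRep_zero_or_one hy hy1 hf hee hc
    by_cases hw1 : w = 1
    · rw [hw1, one_mul] at hyw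
      refine oneRep_zero_iff (k := k) hy hm hf (fun i => ?_) hp (hyw ▸ hωp) hy1 he hfe
        (by rw [← map_mul, hee])
      rw [hg, hf]
      cases i <;> fin_cases k <;> simp [twoMat]
    · have hwm : w ^ m = 1 := by
        obtain ⟨b, hb⟩ : N ∣ m := hN ▸ orderOf_dvd_of_pow_eq_one hy
        obtain ⟨b', hb'⟩ := hMdvd
        rw [hb, hb', pow_mul, pow_mul, hwM, one_pow, one_pow]
      have hw0 := ne_zero_of_pow_eq_one hwm
      have hww : w * w ≠ 1 := by
        intro h
        rcases mul_self_eq_one_iff.1 h with h | h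
        · exact hw1 h
        · rw [h, hModd.neg_one_pow] at hwM
          norm_num at hwM
      have hnw : (-w) ^ m = 1 := by rw [hm.neg_pow, hwm]
      have hny : (-y) ^ m = 1 := by rw [hm.neg_pow, hy]
      obtain ⟨f', hf'⟩ := exists_twoRep hm2 hnw (by rwa [neg_mul_neg])
      have hlt' : orderOf w < N :=
        (Nat.le_of_dvd hMpos (orderOf_dvd_of_pow_eq_one hwM)).trans_lt hlt
      rw [← ih _ hlt' w hwm hww f' hf' rfl]
      refine twoRep_zero_iff hny hnw hf hf' hp (a := a) ?_ he hfe
        (twoRep_zero_or_one hwm hw1 hf' hee hc)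
      rw [neg_div_neg_eq, hyw, mul_div_cancel_left₀ _ hw0, hωp]

/-- If `m` is even, then the characters `χ_r`, `χ_r'` lie in the family of the reflection
character. -/
theorem sameFamily_half (hm : 3 ≤ m) (he : Even m) (s : ℤˣ) :
    SameFamily m (irrChi m s 1) (irrChi m s (m / 2)) := by
  have h2 : 2 * (m / 2) = m := Nat.two_mul_div_two_of_even he
  have hv1 : (irrChi m s 1).1 = chi m s 1 := irrChi_val (by omega)
  have hv2 : (irrChi m s (m / 2)).1 = chiHom s h2 := irrChi_val h2.le
  have h12 : 2 * 1 < m := by omega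
  have hne : ec m ((1 : ℕ) : ZMod m) ≠ ec m (-((1 : ℕ) : ZMod m)) := fun h =>
    natCast_ne_neg one_ne_zero h12 (ZMod.injective_stdAddChar h)
  rw [SameFamily, hv1, hv2]
  refine ⟨twoLift (by omega) ((1 : ℕ) : ZMod m) hne fun g => ?_,
    halfLift (by omega) s h2, ?_⟩
  · rcases g with k | k
    · rw [(chi_two one_ne_zero h12.ne).1, rho_r, Matrix.trace_fin_two_of]
    · rw [(chi_two one_ne_zero h12.ne).2, rho_sr, Matrix.trace_fin_two_of, add_zero]
  intro e heo hee hc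
  set z := ec m ((1 : ℕ) : ZMod m) with hz
  have hzinv : ec m (-((1 : ℕ) : ZMod m)) = z⁻¹ := ec_neg _
  have hzm : z ^ m = 1 := ec_pow_m _
  have hz0 : z ≠ 0 := ec_ne_zero _
  -- The sign `s` decides which diagonal position of the two-dimensional matrices carries `χ_r`.
  refine twoRep_zero_iff_oneRep (k := if s = 1 then 1 else 0) (by omega) he (fun i => ?_) heo hee hc (-z)
    (by rw [he.neg_pow, hzm]) (fun h => hne ?_) _ fun i => ?_
  · refine (congrArg (fun M : Matrix (Fin 1) (Fin 1) F => M 0 0) (halfLift_rep (by omega) s h2 i)).trans ?_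
    have hne' : (-1 : ℤˣ) ≠ 1 := by decide
    rcases Int.units_eq_one_or s with rfl | rfl <;> cases i <;>
      simp [twoMat, linVal, hne', hne'.symm]
  · rw [hzinv]
    rw [neg_mul_neg] at h
    exact eq_inv_of_mul_eq_one_left h
  · refine (twoLift_rep i).trans ?_
    rw [neg_neg, hzinv]

end

end

end LusztigShoji

/-! ### Proof of the theorem -/

open LusztigShoji in
theorem theorem3p1 (m : ℕ) [NeZero m] (hm : 3 ≤ m) (s : ℤˣ)
    (S : Set (DihedralGroup m → ℂ)) (hS : S ⊆ irrChars m)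
    (h_zero : chi m s 0 ∈ S) (h_one : chi m s 1 ∈ S) (h_sgn : sgn m ∈ S)
    (h_label : Even m → chi m s (m / 2) ∈ S → chi' m s ∈ S)
    (N : ℕ) (d : ℕ → ℕ) (hd : StrictMonoOn d (Set.Iic N))
    (hd_image : d '' Set.Iic N = {i | 2 * i < m ∧ chi m s i ∈ S}) :
    (∃ D : Datum m, IsSpringerFor m S D) ∧
    (∀ D : Datum m, IsSpringerFor m S D →
      ∃ f : ℕ → ℕ, AntitoneOn f (Set.Icc 1 N) ∧ HasForm m s S N d f D ∧
        (¬ (Even m ∧ chi m s (m / 2) ∉ S ∧ chi' m s ∈ S) →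
          ∀ k ∈ Set.Icc 1 N, f k = (m - 1) / 2) ∧
        (Even m ∧ chi m s (m / 2) ∉ S ∧ chi' m s ∈ S → f 1 = m / 2 ∧ d N ≤ f N)) ∧
    (¬ (Even m ∧ chi m s (m / 2) ∉ S ∧ chi' m s ∈ S) →
      (∀ D D' : Datum m, IsSpringerFor m S D → IsSpringerFor m S D' →
        D.X = D'.X ∧
        (∀ C (h : C ∈ D.X) (h' : C ∈ D'.X), D.a ⟨C, h⟩ = D'.a ⟨C, h'⟩) ∧
        (∀ C₁ C₂ (h₁ : C₁ ∈ D.X) (h₂ : C₂ ∈ D.X) (h₁' : C₁ ∈ D'.X) (h₂' : C₂ ∈ D'.X),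
          ({Subtype.val '' C₁, Subtype.val '' C₂} : Set (Set (DihedralGroup m → ℂ))) ≠
              {{chi m s (m / 2)}, {chi' m s}} →
            (D.lt ⟨C₁, h₁⟩ ⟨C₂, h₂⟩ ↔ D'.lt ⟨C₁, h₁'⟩ ⟨C₂, h₂'⟩))) ∧
      (¬ (Even m ∧ chi m s (m / 2) ∈ S) → ∃! D : Datum m, IsSpringerFor m S D)) ∧
    (Even m ∧ chi m s (m / 2) ∉ S ∧ chi' m s ∈ S →
      ∀ f : ℕ → ℕ, f 1 = m / 2 → AntitoneOn f (Set.Icc 1 N) → d N ≤ f N →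
        ((∀ k, 1 ≤ k → k < N → (f k : ℤ) - f (k + 1) ≤ d (k + 1) - d k) →
          ∃ D : Datum m, IsSpringerFor m S D ∧ HasForm m s S N d f D) ∧
        ((∃ D : Datum m, IsSpringerFor m S D ∧ HasForm m s S N d f D) ↔
          ∀ k l, 1 ≤ k → k < l → l ≤ N → (l = N ∨ f (l + 1) < f l) →
            (f k : ℤ) - f l ≤ d l - d k)) := by
  have hL : IsLabelled m s S N d := ⟨hm, hS, h_zero, h_one, h_sgn, h_label, hd, hd_image⟩
  have hex : ∀ f, IsTail m s S N d f → IsSpringerFor m S (levDatum hL f) := fun f hT =>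
    isSpringerFor_levDatum hL hT (isSpecial_iff hm s) fun _ => eq_of_sameFamily_sgn
  obtain ⟨f₀, hf₀⟩ := exists_isTail hL
  refine ⟨⟨_, hex f₀ hf₀⟩, fun D h => ?_, fun hne => ⟨fun D D' h h' => ⟨h.X_eq hL h' hne,
    fun _ => h.a_unique hL h' hne, fun _ _ h₁ h₂ h₁' h₂' hC => h.lt_unique hL h' hne h₁ h₂ h₁' h₂'
      fun _ _ => hC⟩, fun hr => ⟨_, hex f₀ hf₀, fun D h =>
        h.eq_of_half_notMem hL (hex f₀ hf₀) hne hr⟩⟩, fun he f hf1 hf hfN => ?_⟩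
  · by_cases he : Even m ∧ chi m s (m / 2) ∉ S ∧ chi' m s ∈ S
    · have h2 : 2 * (m / 2) = m := Nat.two_mul_div_two_of_even he.1
      -- As `χ_r` is nonspecial and in the family of the special `χ_1`, the family condition bounds
      -- its class by that of `χ_1`; this is the hypothesis that yields `f 1 = m / 2`.
      have hns : ¬ IsSpecial m (irrChi m s (m / 2)) := by
        rw [isSpecial_iff hm s]
        rintro (h1 | h1 | h1)
        · have := irrChi_inj h2.le (by omega) h1
          omega
        · have := irrChi_inj h2.le (by omega) h1
          omega
        · exact irrChi_ne_irrSgn s h2.le h1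
      obtain ⟨f, hf, hF, hf1, hfN⟩ := h.exists_hasForm hL he
        (le_iff_eq_or_lt.2 (h.1.family _ _ ((isSpecial_iff hm s _).2 (Or.inr (Or.inl rfl))) hns
          (sameFamily_half hm he.1 s) _ _ (D.mem_supp _) (D.mem_supp _)))
      exact ⟨f, hf, hF, fun hne => absurd he hne, fun _ => ⟨hf1, hfN⟩⟩
    · exact ⟨_, fun _ _ _ _ _ => le_rfl, h.hasForm_const hL he, fun _ _ _ => rfl,
        fun h => absurd h he⟩
  -- The step condition on neighbouring terms implies this one by telescoping, so both existence
  -- statements come from the same construction.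
  · have hexists : (∀ k l, 1 ≤ k → k < l → l ≤ N → (l = N ∨ f (l + 1) < f l) →
        (f k : ℤ) - f l ≤ d l - d k) → ∃ D : Datum m, IsSpringerFor m S D ∧
          HasForm m s S N d f D := fun hcond =>
      have hT : IsTail m s S N d f := ⟨hf, hfN, Or.inl ⟨he, hf1⟩, hcond⟩
      ⟨_, hex f hT, hasForm_levDatum hL hT (hex f hT) he hf1⟩
    exact ⟨fun hstep => hexists fun k l hk hkl hl _ => cond_of_step hstep hk hkl.le hl,
      fun ⟨D, h, hF⟩ k l hk hkl hl hfl => h.sub_le_sub hL he hf hf1 hfN hF hk hkl hl hfl, hexists⟩
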